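/- Let $p,q\ge 2$ and $\ell\ge 1$ be integers with $\ell\mid p$ and $\ell\mid q-1$, and let $\eta$ be a primitive $\ell$-th root of unity. Let $L$ be the abelian group generated by $\vec x,\vec y$ modulo the relation $\frac p\ell\vec x=\frac{q-1}\ell\vec y$, and put $\vec c=p\vec x+\vec y=q\vec y$. Let $S=\mathbb C[x,y]$ be $L$-graded by $|x|=\vec x$, $|y|=\vec y$, write $S(l)_m=S_{l+m}$, and let $\mathbf w=x^py+y^q=y\,w_1\cdots w_\ell$ with $w_r=x^{p/\ell}-e^{\pi i/\ell}\eta^r y^{(q-1)/\ell}$; $\mathbf w$ is homogeneous of degree $\vec c$. An $L$-graded matrix factorisation of $\mathbf w$ is a sequence $\cdots\to K^i\to K^{i+1}\to\cdots$ of degree-preserving maps of graded free $S$-modules of finite rank with $K^{i+2}=K^i(\vec c)$, two-periodic, consecutive maps composing to $\mathbf w$. $\operatorname{Hom}^n(K,K')$ consists of the two-periodic families of degree-preserving maps $f^i:K^i\to K'^{\,i+n}$, with $\partial f=d'f-(-1)^nfd$; this defines a $\mathbb Z$-graded dg category $\mathrm{mf}(\mathbb C^2,\Gamma,\mathbf w)$.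 Consider the following objects, for $1\le i\le p-1$, $q-\frac{q-1}\ell\le j\le q-1$, $1\le r\le\ell$. * $K_y^{\,j}=K_y((j+1-q)\vec y)$, where $K_y=(\cdots\to S(-\vec c)\xrightarrow{w_1\cdots w_\ell}S(-\vec y)\xrightarrow{\ y\ }S\to\cdots)$ and $S$ is in cohomological degree $0$. * $K_{w_r}=(\cdots\to S(-\vec c)\xrightarrow{\mathbf w/w_r}S(-\frac p\ell\vec x)\xrightarrow{w_r}S\to\cdots)$, with $S$ in cohomological degree $0$. * $K_0^{i,j}$ of rank $k+2$, $k=\lfloor (i-1)\ell/p\rfloor$, with $$K^{-2}=S(\vec c-\tfrac{q-1}\ell\vec y)^{\oplus(k+1)}\oplus S(i\vec x+(j+1)\vec y-\vec c),\quad K^{-1}=S((j+1)\vec y)\oplus S(\vec c)^{\oplus k}\oplus S(\vec c+i\vec x-(k+1)\tfrac{q-1}\ell\vec y),\quad K^0=K^{-2}(\vec c).$$ The map $d_0:K^{-2}\to K^{-1}$ has diagonal entries $y^{\,j-(\ell-1)\frac{q-1}\ell},\,y^{\frac{q-1}\ell}$ ($k$ times), $y^{\,q-j+(\ell-k-1)\frac{q-1}\ell}$;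 entries immediately below the diagonal $-x^{p/\ell}$ ($k$ times), $-x^{\,i-kp/\ell}$; upper right entry $x^{p-i}y$; and all other entries $0$. The map $d_1:K^{-1}\to K^0$ is the adjugate matrix of $d_0$. Let $\mathcal B$ be the full subcategory of $\mathrm{mf}(\mathbb C^2,\Gamma,\mathbf w)$ on the $\frac{p(q-1)}\ell+\ell$ objects $K_0^{i,j}$, $K_y^{\,j}[3]$, $K_{w_r}[3]$, with $i,j,r$ as above. Let $Q$ be the quiver whose vertices are these objects and whose arrows are: * $x:K_0^{i,j}\to K_0^{i+1,j}$ for $i+1\le p-1$; * $y:K_0^{i,j}\to K_0^{i,j+1}$ for $j+1\le q-1$, and $y:K_0^{i,q-1}\to K_0^{\,i+\frac p\ell,\ q-\frac{q-1}\ell}$ for $i+\frac p\ell\le p-1$; * $a:K_0^{p-1,j}\to K_y^{\,j}[3]$; * $c_r:K_0^{p-1,q-1}\to K_{w_r}[3]$ for $1\le r\le\ell$. The relations are $xy=yx$, $ay=0$ and $c_r\bigl(x^{p/\ell}-e^{\pi i/\ell}\eta^ry^{(q-1)/\ell}\bigr)=0$, wherever the paths exist (products are compositions, the rightmost arrow being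 applied first). **Theorem.** The cohomology of all morphism complexes of $\mathcal B$ is concentrated in degree $0$. The cohomology-level total endomorphism algebra of the objects of $\mathcal B$ is isomorphic to the path algebra of $Q$ modulo the two-sided ideal generated by the relations, by an isomorphism that matches the trivial path at each vertex with the identity of the corresponding object. Consequently $\mathcal B$ is intrinsically formal: every $\mathbb Z$-graded $A_\infty$-category over $\mathbb C$ on the same set of objects whose graded cohomology category is isomorphic (identically on objects) to that of $\mathcal B$ is formal, i.e. quasi-isomorphic to an $A_\infty$-category whose only non-zero operation is $\mu^2$. In particular $\mathcal B$ itself is formal. -/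

import Mathlib

open MvPolynomial DirectSum
universe u v

/-! ## A∞-categories -/

/-- Given a sequence `v`, replace the block of `s` consecutive entries `v r, …, v (r + s - 1)`
by the single entry `a`. -/
def graft {A : Type*} (v : ℕ → A) (r s : ℕ) (a : A) : ℕ → A :=
  fun i => if i < r then v i else if i = r then a else v (i + s - 1)

open Classical in
/-- A (small, `ℤ`-graded, uncurved, not necessarily strictly unital) `A∞`-category over `ℂ` with set
of objects `V`.  It is written through its total morphism space `carrier = ⨁ hom^n(X, Y)`, where
`gr X Y n` is the summand of the morphisms `X ⟶ Y` of degree `n`.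

`μ n v` is the operation usually written `μ^n(v (n-1), …, v 1, v 0)`, where `v 0` is the morphism
that is applied first.  Signs are in the usual reduced-degree convention: with `‖a‖ = |a| - 1`,
`∑ (-1)^(‖v 0‖ + ⋯ + ‖v (r-1)‖) μ^(n-s+1)(v (n-1), …, μ^s(v (r+s-1), …, v r), v (r-1), …, v 0) = 0`. -/
structure AInfCat (V : Type) where
  carrier : Type u
  [addCommGroup : AddCommGroup carrier]
  [module : Module ℂ carrier]
  gr : V → V → ℤ → Submodule ℂ carrier
  isInternal : DirectSum.IsInternal (fun t : V × V × ℤ => gr t.1 t.2.1 t.2.2)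
  μ : (n : ℕ) → MultilinearMap ℂ (fun _ : Fin n => carrier) carrier
  μ_zero : μ 0 = 0
  μ_mem : ∀ (n : ℕ), 1 ≤ n → ∀ (X : ℕ → V) (deg : ℕ → ℤ) (v : ℕ → carrier),
    (∀ i < n, v i ∈ gr (X i) (X (i + 1)) (deg i)) →
      μ n (fun i => v i) ∈ gr (X 0) (X n) ((∑ i ∈ Finset.range n, deg i) + 2 - n)
  μ_eq_zero : ∀ (n : ℕ) (X Y : ℕ → V) (deg : ℕ → ℤ) (v : ℕ → carrier),
    (∀ i < n, v i ∈ gr (X i) (Y i) (deg i)) → (∃ i, i + 1 < n ∧ Y i ≠ X (i + 1)) →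
      μ n (fun i => v i) = 0
  relation : ∀ (n : ℕ) (X : ℕ → V) (deg : ℕ → ℤ) (v : ℕ → carrier),
    (∀ i < n, v i ∈ gr (X i) (X (i + 1)) (deg i)) →
      ∑ s ∈ Finset.Icc 1 n, ∑ r ∈ Finset.range (n - s + 1),
        ((-1 : ℂ) ^ (∑ i ∈ Finset.range r, (deg i - 1))) •
          μ (n - s + 1) (fun i => graft v r s (μ s (fun j => v (r + j))) i) = 0

attribute [instance] AInfCat.addCommGroup AInfCat.module

namespace AInfCat

variable {V : Type}

/-- The operation `μ¹` as a linear map. -/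
def μ₁ (A : AInfCat.{u} V) : A.carrier →ₗ[ℂ] A.carrier where
  toFun a := A.μ 1 (fun _ => a)
  map_add' a b := by
    have h := (A.μ 1).map_update_add (fun _ => a) 0 a b
    have e : ∀ x : A.carrier, Function.update (fun _ : Fin 1 => a) 0 x = fun _ => x := by
      intro x; funext i; rw [Subsingleton.elim i 0]; simp
    simpa only [e] using h
  map_smul' c a := by
    have h := (A.μ 1).map_update_smul (fun _ => a) 0 c a
    have e : ∀ x : A.carrier, Function.update (fun _ : Fin 1 => a) 0 x = fun _ => x := by
      intro x; funext i; rw [Subsingleton.elim i 0]; simp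
    simpa only [e, RingHom.id_apply] using h

/-- The operation `μ²(b, a)` (first `a`, then `b`) as a bilinear map in `a` and `b`. -/
def μ₂ (A : AInfCat.{u} V) : A.carrier →ₗ[ℂ] A.carrier →ₗ[ℂ] A.carrier :=
  LinearMap.mk₂ ℂ (fun a b => A.μ 2 ![a, b])
    (fun a a' b => by
      have h := (A.μ 2).map_update_add ![a, b] 0 a a'
      have e : ∀ x, Function.update ![a, b] 0 x = ![x, b] := by
        intro x; funext i; fin_cases i <;> simp
      simpa only [e] using h)
    (fun c a b => by
      have h := (A.μ 2).map_update_smul ![a, b] 0 c a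
      have e : ∀ x, Function.update ![a, b] 0 x = ![x, b] := by
        intro x; funext i; fin_cases i <;> simp
      simpa only [e] using h)
    (fun a b b' => by
      have h := (A.μ 2).map_update_add ![a, b] 1 b b'
      have e : ∀ x, Function.update ![a, b] 1 x = ![a, x] := by
        intro x; funext i; fin_cases i <;> simp
      simpa only [e] using h)
    (fun c a b => by
      have h := (A.μ 2).map_update_smul ![a, b] 1 c b
      have e : ∀ x, Function.update ![a, b] 1 x = ![a, x] := by
        intro x; funext i; fin_cases i <;> simp
      simpa only [e] using h)

theorem μ₁_mem (A : AInfCat.{u} V) {X Y : V} {n : ℤ} {a : A.carrier} (ha : a ∈ A.gr X Y n) :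
    A.μ₁ a ∈ A.gr X Y (n + 1) := by
  have h := A.μ_mem 1 le_rfl (fun i => if i = 0 then X else Y) (fun _ => n) (fun _ => a)
    (by intro i hi; obtain rfl : i = 0 := by omega
        simpa using ha)
  have e : (∑ i ∈ Finset.range 1, n) + 2 - ((1 : ℕ) : ℤ) = n + 1 := by simp; ring
  rw [e] at h
  simpa [μ₁] using h

theorem μ₂_mem (A : AInfCat.{u} V) {X Y Z : V} {m n : ℤ} {a b : A.carrier}
    (ha : a ∈ A.gr X Y m) (hb : b ∈ A.gr Y Z n) : A.μ₂ a b ∈ A.gr X Z (m + n) := by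
  have h := A.μ_mem 2 (by norm_num) (fun i => if i = 0 then X else if i = 1 then Y else Z)
    (fun i => if i = 0 then m else n) (fun i => if i = 0 then a else b)
    (by intro i hi
        interval_cases i
        · simpa using ha
        · simpa using hb)
  have e : (∑ i ∈ Finset.range 2, (fun i => if i = 0 then m else n) i) + 2 - ((2 : ℕ) : ℤ)
      = m + n := by simp [Finset.sum_range_succ]
  rw [e] at h
  have e2 : (fun i : Fin 2 => (fun i : ℕ => if i = 0 then a else b) (i : ℕ)) = ![a, b] := by
    funext i; fin_cases i <;> simp
  rw [e2] at h
  simpa [μ₂] using h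

theorem μ₁_μ₁ (A : AInfCat.{u} V) {X Y : V} {n : ℤ} {a : A.carrier} (ha : a ∈ A.gr X Y n) :
    A.μ₁ (A.μ₁ a) = 0 := by
  have h := A.relation 1 (fun i => if i = 0 then X else Y) (fun _ => n) (fun _ => a)
    (by intro i hi; obtain rfl : i = 0 := by omega
        simpa using ha)
  simpa [graft, μ₁] using h

theorem leibniz (A : AInfCat.{u} V) {X Y Z : V} {m n : ℤ} {a b : A.carrier}
    (ha : a ∈ A.gr X Y m) (hb : b ∈ A.gr Y Z n) :
    A.μ₂ (A.μ₁ a) b + (-1 : ℂ) ^ (m - 1) • A.μ₂ a (A.μ₁ b) + A.μ₁ (A.μ₂ a b) = 0 := by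
  have h := A.relation 2 (fun i => if i = 0 then X else if i = 1 then Y else Z)
    (fun i => if i = 0 then m else n) (fun i => if i = 0 then a else b)
    (by intro i hi
        interval_cases i
        · simpa using ha
        · simpa using hb)
  rw [Finset.sum_Icc_succ_top (by norm_num), Finset.Icc_self, Finset.sum_singleton] at h
  simp only [Nat.add_one_sub_one, Nat.reduceAdd, Finset.sum_range_succ, Finset.range_zero,
    Finset.sum_empty, Nat.sub_self, zero_add, zpow_zero, one_smul, Nat.reduceSub] at h
  have e1 : (fun i : Fin 2 => graft (fun i : ℕ => if i = 0 then a else b) 0 1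
      (A.μ 1 fun _ => a) (i : ℕ)) = ![A.μ₁ a, b] := by
    funext i; fin_cases i <;> simp [graft, μ₁]
  have e2 : (fun i : Fin 2 => graft (fun i : ℕ => if i = 0 then a else b) 1 1
      (A.μ 1 fun _ => b) (i : ℕ)) = ![a, A.μ₁ b] := by
    funext i; fin_cases i <;> simp [graft, μ₁]
  have e3 : ∀ x : A.carrier, (fun i : Fin 1 => graft (fun i : ℕ => if i = 0 then a else b) 0 2
      x (i : ℕ)) = fun _ => x := by
    intro x; funext i; fin_cases i; simp [graft]
  have f1 : (fun j : Fin 1 => if (j : ℕ) = 0 then a else b) = fun _ => a := by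
    funext i; fin_cases i; simp
  have f2 : (fun j : Fin 1 => if 1 + (j : ℕ) = 0 then a else b) = fun _ => b := by
    funext i; fin_cases i; simp
  have f3 : (fun j : Fin 2 => if (j : ℕ) = 0 then a else b) = ![a, b] := by
    funext i; fin_cases i <;> simp
  rw [f1, f2, f3, e1, e2, e3] at h
  simpa [μ₁, μ₂] using h

/-- The closed morphisms `X ⟶ Y` of degree `n`. -/
def cocycles (A : AInfCat.{u} V) (X Y : V) (n : ℤ) : Submodule ℂ A.carrier :=
  A.gr X Y n ⊓ LinearMap.ker A.μ₁

/-- The exact morphisms `X ⟶ Y` of degree `n`. -/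
def coboundaries (A : AInfCat.{u} V) (X Y : V) (n : ℤ) : Submodule ℂ A.carrier :=
  (A.gr X Y (n - 1)).map A.μ₁

/-- The degree `n` part `H^n(hom(X, Y))` of the morphism space of the cohomology category. -/
abbrev Coh (A : AInfCat.{u} V) (X Y : V) (n : ℤ) : Type u :=
  A.cocycles X Y n ⧸ (A.coboundaries X Y n).submoduleOf (A.cocycles X Y n)

theorem μ₂_cocycle (A : AInfCat.{u} V) {X Y Z : V} {m n : ℤ} {a b : A.carrier}
    (ha : a ∈ A.cocycles X Y m) (hb : b ∈ A.cocycles Y Z n) :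
    A.μ₂ a b ∈ A.cocycles X Z (m + n) := by
  refine ⟨A.μ₂_mem ha.1 hb.1, ?_⟩
  have h := A.leibniz ha.1 hb.1
  have h1 : A.μ₁ a = 0 := ha.2
  have h2 : A.μ₁ b = 0 := hb.2
  simpa [h1, h2] using h

theorem μ₂_left_coboundary (A : AInfCat.{u} V) {X Y Z : V} {m n : ℤ} {a b : A.carrier}
    (ha : a ∈ A.coboundaries X Y m) (hb : b ∈ A.cocycles Y Z n) :
    A.μ₂ a b ∈ A.coboundaries X Z (m + n) := by
  obtain ⟨c, hc, rfl⟩ := ha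
  have h := A.leibniz hc hb.1
  have h2 : A.μ₁ b = 0 := hb.2
  refine ⟨-A.μ₂ c b, ?_, ?_⟩
  · have h3 := A.μ₂_mem hc hb.1
    rw [show m - 1 + n = m + n - 1 by ring] at h3
    exact neg_mem h3
  · rw [h2, map_zero, smul_zero, add_zero] at h
    rw [map_neg]
    exact (eq_neg_of_add_eq_zero_left h).symm

theorem μ₂_right_coboundary (A : AInfCat.{u} V) {X Y Z : V} {m n : ℤ} {a b : A.carrier}
    (ha : a ∈ A.cocycles X Y m) (hb : b ∈ A.coboundaries Y Z n) :
    A.μ₂ a b ∈ A.coboundaries X Z (m + n) := by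
  obtain ⟨c, hc, rfl⟩ := hb
  have h := A.leibniz ha.1 hc
  have h2 : A.μ₁ a = 0 := ha.2
  have h3 := A.μ₂_mem ha.1 hc
  rw [show m + (n - 1) = m + n - 1 by ring] at h3
  have hs : ((-1 : ℂ) ^ (m - 1)) ≠ 0 := zpow_ne_zero _ (by norm_num)
  refine ⟨-(((-1 : ℂ) ^ (m - 1))⁻¹ • A.μ₂ a c), neg_mem (Submodule.smul_mem _ _ h3), ?_⟩
  rw [h2, map_zero, LinearMap.zero_apply, zero_add] at h
  rw [map_neg, map_smul, ← smul_neg, ← eq_neg_of_add_eq_zero_left h, smul_smul,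
    inv_mul_cancel₀ hs, one_smul]

/-- Composition of cohomology classes on the level of cocycles:
`[b] ∘ [a] = (-1)^|a| [μ²(b, a)]`. -/
noncomputable def compAux (A : AInfCat.{u} V) {X Y Z : V} {m n k : ℤ} (h : m + n = k) :
    A.cocycles X Y m →ₗ[ℂ] A.cocycles Y Z n →ₗ[ℂ] A.Coh X Z k :=
  LinearMap.mk₂ ℂ
    (fun a b => Submodule.Quotient.mk
      ((-1 : ℂ) ^ m • (⟨A.μ₂ a b, h ▸ A.μ₂_cocycle a.2 b.2⟩ : A.cocycles X Z k)))
    (fun a a' b => by rw [← Submodule.Quotient.mk_add, ← smul_add]; congr 2; ext; simp)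
    (fun c a b => by rw [← Submodule.Quotient.mk_smul, smul_comm]; congr 2; ext; simp)
    (fun a b b' => by rw [← Submodule.Quotient.mk_add, ← smul_add]; congr 2; ext; simp)
    (fun c a b => by rw [← Submodule.Quotient.mk_smul, smul_comm]; congr 2; ext; simp)

/-- Composition `(f, g) ↦ g ∘ f` in the cohomology category. -/
noncomputable def comp (A : AInfCat.{u} V) {X Y Z : V} {m n k : ℤ} (h : m + n = k) :
    A.Coh X Y m →ₗ[ℂ] A.Coh Y Z n →ₗ[ℂ] A.Coh X Z k :=
  Submodule.liftQ _
    (LinearMap.flip (Submodule.liftQ _ (A.compAux h).flip (by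
      intro b hb
      ext a
      refine (Submodule.Quotient.mk_eq_zero _).2 (Submodule.smul_mem _ _ ?_)
      exact h ▸ A.μ₂_right_coboundary a.2 hb)))
    (by
      intro a ha
      ext b
      refine (Submodule.Quotient.mk_eq_zero _).2 (Submodule.smul_mem _ _ ?_)
      exact h ▸ A.μ₂_left_coboundary ha b.2)

end AInfCat

/-- An isomorphism, identical on objects, between the graded cohomology categories of two
`A∞`-categories with the same set of objects. -/
structure CohomologyIso {V : Type} (A : AInfCat.{u} V) (B : AInfCat.{v} V) where
  equiv : ∀ (X Y : V) (n : ℤ), A.Coh X Y n ≃ₗ[ℂ] B.Coh X Y n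
  map_comp : ∀ (X Y Z : V) (m n k : ℤ) (h : m + n = k) (f : A.Coh X Y m) (g : A.Coh Y Z n),
    equiv X Z k (A.comp h f g) = B.comp h (equiv X Y m f) (equiv Y Z n g)

/-- An `A∞`-functor, identical on objects.  `F n v` is `F^n(v (n-1), …, v 0)`; the equation is
`∑ μ^r(F^(s_r)(…), …, F^(s_1)(…)) =
∑ (-1)^(‖v 0‖ + ⋯ + ‖v (r-1)‖) F^(n-s+1)(…, μ^s(v (r+s-1), …, v r), v (r-1), …, v 0)`,
where the left sum runs over all compositions `s_1 + ⋯ + s_r = n`. -/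
structure AInfFunctor {V : Type} (A : AInfCat.{u} V) (B : AInfCat.{v} V) where
  F : (n : ℕ) → MultilinearMap ℂ (fun _ : Fin n => A.carrier) B.carrier
  F_zero : F 0 = 0
  F_mem : ∀ (n : ℕ), 1 ≤ n → ∀ (X : ℕ → V) (deg : ℕ → ℤ) (v : ℕ → A.carrier),
    (∀ i < n, v i ∈ A.gr (X i) (X (i + 1)) (deg i)) →
      F n (fun i => v i) ∈ B.gr (X 0) (X n) ((∑ i ∈ Finset.range n, deg i) + 1 - n)
  F_eq_zero : ∀ (n : ℕ) (X Y : ℕ → V) (deg : ℕ → ℤ) (v : ℕ → A.carrier),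
    (∀ i < n, v i ∈ A.gr (X i) (Y i) (deg i)) → (∃ i, i + 1 < n ∧ Y i ≠ X (i + 1)) →
      F n (fun i => v i) = 0
  relation : ∀ (n : ℕ) (X : ℕ → V) (deg : ℕ → ℤ) (v : ℕ → A.carrier),
    (∀ i < n, v i ∈ A.gr (X i) (X (i + 1)) (deg i)) →
      ∑ c : Composition n,
          B.μ c.length (fun b => F (c.blocksFun b) (fun i => v (c.sizeUpTo b + i))) =
        ∑ s ∈ Finset.Icc 1 n, ∑ r ∈ Finset.range (n - s + 1),
          ((-1 : ℂ) ^ (∑ i ∈ Finset.range r, (deg i - 1))) •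
            F (n - s + 1) (fun i => graft v r s (A.μ s (fun j => v (r + j))) i)

/-- The functor induces bijections on cohomology. -/
def AInfFunctor.IsQuasiIso {V : Type} {A : AInfCat.{u} V} {B : AInfCat.{v} V}
    (F : AInfFunctor A B) : Prop :=
  ∀ (X Y : V) (n : ℤ),
    (∀ a ∈ A.cocycles X Y n,
      F.F 1 (fun _ => a) ∈ B.coboundaries X Y n → a ∈ A.coboundaries X Y n) ∧
    (∀ b ∈ B.cocycles X Y n, ∃ a ∈ A.cocycles X Y n,
      F.F 1 (fun _ => a) - b ∈ B.coboundaries X Y n)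

/-- The equivalence relation generated by `A∞`-quasi-isomorphisms. -/
def QuasiIsomorphic {V : Type} (A B : AInfCat.{u} V) : Prop :=
  Relation.EqvGen (fun A B : AInfCat.{u} V => ∃ F : AInfFunctor A B, F.IsQuasiIso) A B

/-- An `A∞`-category is formal if it is quasi-isomorphic to one in which only `μ²` is non-zero
(which is then its cohomology category). -/
def IsFormal {V : Type} (A : AInfCat.{u} V) : Prop :=
  ∃ M : AInfCat.{u} V, (∀ n, n ≠ 2 → M.μ n = 0) ∧ QuasiIsomorphic A M

/-- An `A∞`-category `B` is intrinsically formal if every `A∞`-category whose graded cohomology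
category is isomorphic to that of `B` is formal. -/
def IntrinsicallyFormal {V : Type} (B : AInfCat.{v} V) : Prop :=
  ∀ A : AInfCat.{u} V, Nonempty (CohomologyIso A B) → IsFormal A

/-! ## Graded matrix factorisations -/

/-- The polynomial ring `S = ℂ[x, y]`, with `x = X 0` and `y = X 1`. -/
abbrev PolyXY : Type := MvPolynomial (Fin 2) ℂ

/-- An `L`-graded matrix factorisation of `W`, an element of degree `c` of `S`, where `x` and `y`
have degrees `deg 0` and `deg 1`: a sequence `⋯ → K^i → K^(i+1) → ⋯` of graded free modules
`K^i = ⨁_a S(s i a)` and degree-preserving `S`-linear maps with `K^(i+2) = K^i(c)` and with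
consecutive maps composing to `W`.  Here `S(l)_m = S_(l+m)`, so that a degree-preserving map
`S(l) → S(l')` is multiplication by a homogeneous element of degree `l' - l`. -/
structure GradedMF {L : Type} [AddCommGroup L] (deg : Fin 2 → L) (W : PolyXY) (c : L) where
  rank : ℕ
  s : ℤ → Fin rank → L
  d : ℤ → Matrix (Fin rank) (Fin rank) PolyXY
  s_add_two : ∀ i a, s (i + 2) a = s i a + c
  d_add_two : ∀ i, d (i + 2) = d i
  d_homogeneous : ∀ i b a, IsWeightedHomogeneous deg (d i b a) (s (i + 1) b - s i a)
  d_mul_d : ∀ i, d (i + 1) * d i = W • (1 : Matrix (Fin rank) (Fin rank) PolyXY)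

namespace GradedMF

section

variable {L : Type} [AddCommGroup L] {deg : Fin 2 → L} {W : PolyXY} {c : L}

/-- The matrix factorisation with `K^(-2) = ⨁ S(s₀ a)`, `K^(-1) = ⨁ S(s₁ a)`,
`K^0 = ⨁ S(s₀ a + c)`, and with maps `d₀ : K^(-2) → K^(-1)` and `d₁ : K^(-1) → K^0`. -/
def ofPair (r : ℕ) (s₀ s₁ : Fin r → L) (d₀ d₁ : Matrix (Fin r) (Fin r) PolyXY)
    (h₀ : ∀ b a, IsWeightedHomogeneous deg (d₀ b a) (s₁ b - s₀ a))
    (h₁ : ∀ b a, IsWeightedHomogeneous deg (d₁ b a) (s₀ b + c - s₁ a))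
    (h₁₀ : d₁ * d₀ = W • (1 : Matrix (Fin r) (Fin r) PolyXY))
    (h₀₁ : d₀ * d₁ = W • (1 : Matrix (Fin r) (Fin r) PolyXY)) : GradedMF deg W c where
  rank := r
  s i a := if Even i then s₀ a + (i / 2 + 1) • c else s₁ a + ((i + 1) / 2) • c
  d i := if Even i then d₀ else d₁
  s_add_two i a := by
    have h : Even (i + 2) ↔ Even i := by simp
    simp only [h]
    split_ifs
    · rw [show (i + 2) / 2 + 1 = (i / 2 + 1) + 1 by omega, add_smul _ (1 : ℤ), one_smul, add_assoc]
    · rw [show (i + 2 + 1) / 2 = (i + 1) / 2 + 1 by omega, add_smul _ (1 : ℤ), one_smul, add_assoc]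
  d_add_two i := by
    have h : Even (i + 2) ↔ Even i := by simp
    simp only [h]
  d_homogeneous i b a := by
    have h : Even (i + 1) ↔ ¬ Even i := Int.even_add_one
    by_cases hi : Even i
    · simp only [h, hi, not_true, if_true, if_false]
      rw [show (i + 1 + 1) / 2 = i / 2 + 1 by omega, add_sub_add_right_eq_sub]
      exact h₀ b a
    · simp only [h, hi, not_false_iff, if_true, if_false]
      rw [add_smul _ (1 : ℤ), one_smul, add_comm _ c, ← add_assoc, add_sub_add_right_eq_sub]
      exact h₁ b a
  d_mul_d i := by
    have h : Even (i + 1) ↔ ¬ Even i := Int.even_add_one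
    by_cases hi : Even i
    · simp only [h, hi, not_true, if_true, if_false, h₁₀]
    · simp only [h, hi, not_false_iff, if_true, if_false, h₀₁]

/-- The grading twist `K(l)`. -/
def twist (K : GradedMF deg W c) (l : L) : GradedMF deg W c where
  rank := K.rank
  s i a := K.s i a + l
  d := K.d
  s_add_two i a := by rw [K.s_add_two]; abel
  d_add_two := K.d_add_two
  d_homogeneous i b a := by
    rw [add_sub_add_right_eq_sub]; exact K.d_homogeneous i b a
  d_mul_d := K.d_mul_d

/-- The cohomological shift `K[m]`, with `K[m]^i = K^(i+m)` and differential `(-1)^m d`. -/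
noncomputable def shift (K : GradedMF deg W c) (m : ℤ) : GradedMF deg W c where
  rank := K.rank
  s i := K.s (i + m)
  d i := ((-1 : ℂ) ^ m) • K.d (i + m)
  s_add_two i a := by rw [add_right_comm, K.s_add_two]
  d_add_two i := by rw [add_right_comm, K.d_add_two]
  d_homogeneous i b a := by
    rw [add_right_comm]
    exact Submodule.smul_mem (weightedHomogeneousSubmodule ℂ deg _) _ (K.d_homogeneous (i + m) b a)
  d_mul_d i := by
    rw [add_right_comm, Matrix.smul_mul, Matrix.mul_smul, smul_smul, K.d_mul_d,
      ← mul_zpow, neg_one_mul, neg_neg, one_zpow, one_smul]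

/-- The space `Hom^n(K, K')` of degree `n` morphisms: families of degree-preserving `S`-linear maps
`f^i : K^i → K'^(i+n)`, compatible with the two-periodicity. -/
def Hom (K K' : GradedMF deg W c) (n : ℤ) :
    Submodule ℂ (ℤ → Matrix (Fin K'.rank) (Fin K.rank) PolyXY) where
  carrier := {f | (∀ i, f (i + 2) = f i) ∧
    ∀ i b a, IsWeightedHomogeneous deg (f i b a) (K'.s (i + n) b - K.s i a)}
  zero_mem' := ⟨fun _ => rfl, fun i b a => isWeightedHomogeneous_zero ℂ deg _⟩
  add_mem' {f g} hf hg := ⟨fun i => by simp [hf.1 i, hg.1 i],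
    fun i b a => (hf.2 i b a).add (hg.2 i b a)⟩
  smul_mem' r f hf := ⟨fun i => by simp [hf.1 i], fun i b a =>
    Submodule.smul_mem (weightedHomogeneousSubmodule ℂ deg _) r (hf.2 i b a)⟩

theorem mul_homogeneous {l m n : ℕ} {A : Matrix (Fin l) (Fin m) PolyXY}
    {B : Matrix (Fin m) (Fin n) PolyXY} {u : Fin l → L} {v : Fin m → L} {w : Fin n → L}
    (hA : ∀ b a, IsWeightedHomogeneous deg (A b a) (u b - v a))
    (hB : ∀ b a, IsWeightedHomogeneous deg (B b a) (v b - w a)) (b : Fin l) (a : Fin n) :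
    IsWeightedHomogeneous deg ((A * B) b a) (u b - w a) := by
  rw [Matrix.mul_apply]
  refine IsWeightedHomogeneous.sum _ _ _ (fun k _ => ?_)
  have h := (hA b k).mul (hB k a)
  rwa [sub_add_sub_cancel] at h

/-- The differential of the morphism complex, `∂f = d f - (-1)^n f d`. -/
noncomputable def diff (K K' : GradedMF deg W c) (n : ℤ) :
    K.Hom K' n →ₗ[ℂ] K.Hom K' (n + 1) where
  toFun f := ⟨fun i => K'.d (i + n) * f.1 i - ((-1 : ℂ) ^ n) • (f.1 (i + 1) * K.d i), by
    constructor
    · intro i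
      dsimp only
      rw [f.2.1, K.d_add_two, add_right_comm i 2 n, add_right_comm i 2 1, K'.d_add_two, f.2.1]
    · intro i b a
      refine IsWeightedHomogeneous.sub ?_ (Submodule.smul_mem
        (weightedHomogeneousSubmodule ℂ deg _) _ ?_)
      · refine mul_homogeneous (u := fun b => K'.s (i + (n + 1)) b) (w := K.s i)
          (v := K'.s (i + n)) ?_ ?_ b a
        · intro b a
          have h := K'.d_homogeneous (i + n) b a
          rwa [add_assoc] at h
        · exact f.2.2 i
      · refine mul_homogeneous (u := fun b => K'.s (i + (n + 1)) b) (w := K.s i)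
          (v := K.s (i + 1)) ?_ ?_ b a
        · intro b a
          have h := f.2.2 (i + 1) b a
          rwa [add_assoc, add_comm 1 n] at h
        · exact K.d_homogeneous i⟩
  map_add' f g := by
    ext1; funext i
    simp only [Submodule.coe_add, Pi.add_apply, Matrix.mul_add, Matrix.add_mul, smul_add]
    abel
  map_smul' r f := by
    ext1; funext i
    simp only [SetLike.val_smul, Pi.smul_apply, Matrix.mul_smul, Matrix.smul_mul, smul_sub,
      RingHom.id_apply]
    rw [smul_comm r]

/-- Composition of morphisms, `(f, g) ↦ g f`. -/
noncomputable def comp (K K' K'' : GradedMF deg W c) (m n : ℤ) :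
    K.Hom K' m →ₗ[ℂ] K'.Hom K'' n →ₗ[ℂ] K.Hom K'' (m + n) :=
  LinearMap.mk₂ ℂ
    (fun f g => ⟨fun i => g.1 (i + m) * f.1 i, by
      constructor
      · intro i
        dsimp only
        rw [f.2.1, add_right_comm, g.2.1]
      · intro i b a
        refine mul_homogeneous (u := fun b => K''.s (i + (m + n)) b) (w := K.s i)
          (v := K'.s (i + m)) ?_ (f.2.2 i) b a
        intro b a
        have h := g.2.2 (i + m) b a
        rwa [add_assoc] at h⟩)
    (fun f f' g => by ext1; funext i; simp [Matrix.mul_add])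
    (fun r f g => by ext1; funext i; simp)
    (fun f g g' => by ext1; funext i; simp [Matrix.add_mul])
    (fun r f g => by ext1; funext i; simp)

end

end GradedMF

/-! ## The `A∞`-category of a family of graded matrix factorisations -/

namespace MFCat

open Classical

variable {L : Type} [AddCommGroup L] {deg : Fin 2 → L} {W : PolyXY} {c : L} {V : Type}

/-- The total morphism space `⨁ Hom^n(K X, K Y)`. -/
abbrev Total (K : V → GradedMF deg W c) : Type :=
  ⨁ t : V × V × ℤ, (K t.1).Hom (K t.2.1) t.2.2

/-- The inclusion of `Hom^n(K X, K Y)` into the total morphism space. -/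
noncomputable def incl (K : V → GradedMF deg W c) (X Y : V) (n : ℤ) :
    (K X).Hom (K Y) n →ₗ[ℂ] Total K :=
  DirectSum.lof ℂ (V × V × ℤ) (fun t => (K t.1).Hom (K t.2.1) t.2.2) (X, Y, n)

/-- The operation `μ¹(a) = (-1)^|a| ∂a`. -/
noncomputable def op₁ (K : V → GradedMF deg W c) : Total K →ₗ[ℂ] Total K :=
  DirectSum.toModule ℂ _ _ fun t =>
    ((-1 : ℂ) ^ t.2.2) • (incl K t.1 t.2.1 (t.2.2 + 1)).comp ((K t.1).diff (K t.2.1) t.2.2)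

/-- The restriction of `μ²` to two summands of the total morphism space. -/
noncomputable def op₂Aux (K : V → GradedMF deg W c) (X Y Y' Z : V) (m n : ℤ) :
    (K X).Hom (K Y) m →ₗ[ℂ] (K Y').Hom (K Z) n →ₗ[ℂ] Total K :=
  if h : Y = Y' then by
    subst h
    exact ((-1 : ℂ) ^ m) • ((K X).comp (K Y) (K Z) m n).compr₂ (incl K X Z (m + n))
  else 0

/-- The operation `μ²(b, a) = (-1)^|a| b ∘ a`, zero if `b` and `a` are not composable. -/
noncomputable def op₂ (K : V → GradedMF deg W c) : Total K →ₗ[ℂ] Total K →ₗ[ℂ] Total K :=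
  DirectSum.toModule ℂ _ _ fun s => LinearMap.flip <|
    DirectSum.toModule ℂ _ _ fun t => (op₂Aux K s.1 s.2.1 t.1 t.2.1 s.2.2 t.2.2).flip

theorem op₁_incl (K : V → GradedMF deg W c) (X Y : V) (n : ℤ) (f : (K X).Hom (K Y) n) :
    op₁ K (incl K X Y n f) =
      ((-1 : ℂ) ^ n) • incl K X Y (n + 1) ((K X).diff (K Y) n f) := by
  simp [op₁, incl, DirectSum.toModule_lof]

theorem op₂_incl (K : V → GradedMF deg W c) (X Y Z : V) (m n : ℤ) (f : (K X).Hom (K Y) m)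
    (g : (K Y).Hom (K Z) n) :
    op₂ K (incl K X Y m f) (incl K Y Z n g) =
      ((-1 : ℂ) ^ m) • incl K X Z (m + n) ((K X).comp (K Y) (K Z) m n f g) := by
  simp [op₂, op₂Aux, incl, DirectSum.toModule_lof]

theorem op₂_incl_of_ne (K : V → GradedMF deg W c) (X Y Y' Z : V) (m n : ℤ) (h : Y ≠ Y')
    (f : (K X).Hom (K Y) m) (g : (K Y').Hom (K Z) n) :
    op₂ K (incl K X Y m f) (incl K Y' Z n g) = 0 := by
  simp [op₂, op₂Aux, incl, DirectSum.toModule_lof, h]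

theorem incl_congr (K : V → GradedMF deg W c) (X Y : V) {n n' : ℤ} (h : n = n')
    (f : (K X).Hom (K Y) n) (f' : (K X).Hom (K Y) n') (hf : f.1 = f'.1) :
    incl K X Y n f = incl K X Y n' f' := by
  subst h
  rw [Subtype.ext hf]

/-- The operations `μ^n`: only `μ¹` and `μ²` are non-zero. -/
noncomputable def op (K : V → GradedMF deg W c) :
    (n : ℕ) → MultilinearMap ℂ (fun _ : Fin n => Total K) (Total K)
  | 1 => MultilinearMap.mk' (fun v => op₁ K (v 0))
      (fun v i x y => by
        obtain rfl : i = 0 := Subsingleton.elim _ _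
        simp)
      (fun v i r x => by
        obtain rfl : i = 0 := Subsingleton.elim _ _
        simp)
  | 2 => MultilinearMap.mk' (fun v => op₂ K (v 0) (v 1))
      (fun v i x y => by fin_cases i <;> simp)
      (fun v i r x => by fin_cases i <;> simp)
  | _ => 0

theorem op_one (K : V → GradedMF deg W c) (v : Fin 1 → Total K) : op K 1 v = op₁ K (v 0) := rfl

theorem op_two (K : V → GradedMF deg W c) (v : Fin 2 → Total K) :
    op K 2 v = op₂ K (v 0) (v 1) := rfl

theorem op_of_ge (K : V → GradedMF deg W c) {n : ℕ} (h : 3 ≤ n) : op K n = 0 := by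
  match n, h with
  | n + 3, _ => rfl

theorem isInternal_range_incl (K : V → GradedMF deg W c) :
    DirectSum.IsInternal
      (fun t : V × V × ℤ => LinearMap.range (incl K t.1 t.2.1 t.2.2)) := by
  have hinj : ∀ t : V × V × ℤ, Function.Injective (incl K t.1 t.2.1 t.2.2) := fun t => by
    intro f g h
    exact DFinsupp.single_injective (β := fun t : V × V × ℤ => (K t.1).Hom (K t.2.1) t.2.2) h
  let e : (⨁ t : V × V × ℤ, (K t.1).Hom (K t.2.1) t.2.2) ≃ₗ[ℂ]
      ⨁ t : V × V × ℤ, LinearMap.range (incl K t.1 t.2.1 t.2.2) :=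
    DFinsupp.mapRange.linearEquiv (fun t => LinearEquiv.ofInjective _ (hinj t))
  have h : (DirectSum.coeLinearMap
      (fun t : V × V × ℤ => LinearMap.range (incl K t.1 t.2.1 t.2.2))).comp e.toLinearMap
      = LinearMap.id := by
    refine DirectSum.linearMap_ext ℂ (fun t => ?_)
    ext1 f
    have h1 : e (DirectSum.lof ℂ _ _ t f) =
        DirectSum.lof ℂ _ _ t (LinearEquiv.ofInjective _ (hinj t) f) := by
      exact DFinsupp.mapRange_single (hf := fun _ => map_zero _)
    simp only [LinearMap.comp_apply, LinearEquiv.coe_coe, h1, DirectSum.coeLinearMap_lof,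
      LinearMap.id_apply]
    rfl
  have hb : Function.Bijective (DirectSum.coeLinearMap
      (fun t : V × V × ℤ => LinearMap.range (incl K t.1 t.2.1 t.2.2))) := by
    have h2 : Function.Bijective ((DirectSum.coeLinearMap
      (fun t : V × V × ℤ => LinearMap.range (incl K t.1 t.2.1 t.2.2))) ∘ e) := by
      have : ((DirectSum.coeLinearMap
        (fun t : V × V × ℤ => LinearMap.range (incl K t.1 t.2.1 t.2.2))) ∘ e) = id :=
        funext fun x => LinearMap.congr_fun h x
      rw [this]; exact Function.bijective_id
    exact (Function.Bijective.of_comp_iff _ e.bijective).1 h2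
  exact hb

theorem sq (K : V → GradedMF deg W c) (X Y : V) (n : ℤ) (f : (K X).Hom (K Y) n) :
    op₁ K (op₁ K (incl K X Y n f)) = 0 := by
  rw [op₁_incl, map_smul, op₁_incl]
  have h : (K X).diff (K Y) (n + 1) ((K X).diff (K Y) n f) = 0 := by
    ext1; funext i
    have hs : ((-1 : ℂ) ^ (n + 1)) = - (-1 : ℂ) ^ n := by rw [zpow_add_one₀ (by norm_num)]; ring
    have e1 : (K Y).d (i + (n + 1)) * ((K Y).d (i + n) * f.1 i) = W • f.1 i := by
      rw [← Matrix.mul_assoc, ← add_assoc, GradedMF.d_mul_d, Matrix.smul_mul, Matrix.one_mul]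
    have e2 : (f.1 (i + 1 + 1) * (K X).d (i + 1)) * (K X).d i = W • f.1 i := by
      rw [Matrix.mul_assoc, GradedMF.d_mul_d, Matrix.mul_smul, Matrix.mul_one, add_assoc]
      exact congrArg _ (f.2.1 i)
    have e3 : i + (n + 1) = i + 1 + n := by ring
    simp only [GradedMF.diff, LinearMap.coe_mk, AddHom.coe_mk, Matrix.mul_sub, Matrix.sub_mul,
      Matrix.mul_smul, Matrix.smul_mul, hs, e1, e2]
    rw [e3, Matrix.mul_assoc, smul_sub, smul_smul]
    simp only [ZeroMemClass.coe_zero, Pi.zero_apply, neg_smul]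
    rw [neg_mul, ← mul_zpow]
    simp only [mul_neg, mul_one, neg_neg, one_zpow, neg_smul, one_smul]
    abel
  rw [h]; simp

theorem leibniz (K : V → GradedMF deg W c) (X Y Z : V) (m n : ℤ) (f : (K X).Hom (K Y) m)
    (g : (K Y).Hom (K Z) n) :
    op₂ K (op₁ K (incl K X Y m f)) (incl K Y Z n g)
      + ((-1 : ℂ) ^ (m - 1)) • op₂ K (incl K X Y m f) (op₁ K (incl K Y Z n g))
      + op₁ K (op₂ K (incl K X Y m f) (incl K Y Z n g)) = 0 := by
  have hs : ((-1 : ℂ) ^ (m - 1)) = - (-1 : ℂ) ^ m := by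
    rw [zpow_sub_one₀ (by norm_num)]; norm_num
  have hs1 : ((-1 : ℂ) ^ (m + 1)) = - (-1 : ℂ) ^ m := by
    rw [zpow_add_one₀ (by norm_num)]; norm_num
  have hs2 : ((-1 : ℂ) ^ m) * (-1 : ℂ) ^ m = 1 := by
    rw [← mul_zpow]; norm_num
  have e1 : incl K X Z (m + 1 + n) ((K X).comp (K Y) (K Z) (m + 1) n
      ((K X).diff (K Y) m f) g) = incl K X Z (m + n + 1)
        ⟨fun i => g.1 (i + (m + 1)) * ((K X).diff (K Y) m f).1 i, by
          have h : (fun i => g.1 (i + (m + 1)) * ((K X).diff (K Y) m f).1 i) ∈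
              (K X).Hom (K Z) (m + 1 + n) :=
            ((K X).comp (K Y) (K Z) (m + 1) n ((K X).diff (K Y) m f) g).2
          rwa [add_right_comm m 1 n] at h⟩ := incl_congr K X Z (add_right_comm _ _ _) _ _ rfl
  have e2 : incl K X Z (m + (n + 1)) ((K X).comp (K Y) (K Z) m (n + 1) f
      ((K Y).diff (K Z) n g)) = incl K X Z (m + n + 1)
        ⟨fun i => ((K Y).diff (K Z) n g).1 (i + m) * f.1 i, by
          have h : (fun i => ((K Y).diff (K Z) n g).1 (i + m) * f.1 i) ∈
              (K X).Hom (K Z) (m + (n + 1)) :=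
            ((K X).comp (K Y) (K Z) m (n + 1) f ((K Y).diff (K Z) n g)).2
          rwa [← add_assoc m n 1] at h⟩ := incl_congr K X Z (add_assoc _ _ _).symm _ _ rfl
  simp only [op₂_incl, op₁_incl, map_smul, LinearMap.smul_apply, smul_smul, hs, hs1, e1, e2]
  simp only [← map_smul, ← map_add]
  refine (congrArg _ ?_).trans (map_zero (incl K X Z (m + n + 1)))
  ext1; funext i
  simp only [Submodule.coe_add, SetLike.val_smul, Pi.add_apply, Pi.smul_apply, GradedMF.diff,
    GradedMF.comp, LinearMap.coe_mk, AddHom.coe_mk, LinearMap.mk₂_apply, ZeroMemClass.coe_zero,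
    Pi.zero_apply, Matrix.mul_sub, Matrix.sub_mul, Matrix.mul_smul, Matrix.smul_mul, smul_sub,
    smul_smul, Matrix.mul_assoc]
  have hs3 : ((-1 : ℂ) ^ (m + n)) = (-1 : ℂ) ^ m * (-1 : ℂ) ^ n := zpow_add₀ (by norm_num) _ _
  have hs4 : ((-1 : ℂ) ^ n) * (-1 : ℂ) ^ n = 1 := by
    rw [← mul_zpow]; norm_num
  rw [← add_assoc i m 1, ← add_assoc i m n, add_right_comm i 1 m, hs3]
  generalize (-1 : ℂ) ^ m = u at *
  generalize (-1 : ℂ) ^ n = w at *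
  have c1 : u * -u = -1 := by linear_combination -hs2
  have c2 : u * -u * u = -u := by linear_combination -u * hs2
  have c3 : -u * (w * u) = -w := by linear_combination -w * hs2
  have c4 : -u * (w * u) * w = -1 := by linear_combination -(w * w) * hs2 - hs4
  have c5 : u * (u * w) = w := by linear_combination w * hs2
  have c6 : u * w * (u * (u * w)) = u := by linear_combination u * w * w * hs2 + u * hs4
  rw [c6, c2, c4, c1, c3, c5]
  simp only [neg_smul, one_smul]
  abel

theorem assoc (K : V → GradedMF deg W c) (X Y Z T : V) (l m n : ℤ) (f : (K X).Hom (K Y) l)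
    (g : (K Y).Hom (K Z) m) (h : (K Z).Hom (K T) n) :
    op₂ K (op₂ K (incl K X Y l f) (incl K Y Z m g)) (incl K Z T n h)
      + ((-1 : ℂ) ^ (l - 1)) •
        op₂ K (incl K X Y l f) (op₂ K (incl K Y Z m g) (incl K Z T n h)) = 0 := by
  have hs : ((-1 : ℂ) ^ (l - 1)) = - (-1 : ℂ) ^ l := by
    rw [zpow_sub_one₀ (by norm_num)]; norm_num
  have hs2 : ((-1 : ℂ) ^ l) * (-1 : ℂ) ^ l = 1 := by
    rw [← mul_zpow]; norm_num
  have e : incl K X T (l + m + n) ((K X).comp (K Z) (K T) (l + m) n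
        ((K X).comp (K Y) (K Z) l m f g) h) =
      incl K X T (l + (m + n)) ((K X).comp (K Y) (K T) l (m + n) f
        ((K Y).comp (K Z) (K T) m n g h)) := by
    refine incl_congr K X T (add_assoc _ _ _) _ _ ?_
    funext i
    simp only [GradedMF.comp, LinearMap.mk₂_apply]
    rw [← Matrix.mul_assoc, add_assoc]
  simp only [op₂_incl, map_smul, LinearMap.smul_apply, smul_smul, e, hs]
  rw [← add_smul]
  convert zero_smul ℂ _
  rw [zpow_add₀ (by norm_num)]
  ring

end MFCat

open Classical in
/-- The full subcategory of the differential graded category of `L`-graded matrix factorisations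
on a family of objects, as an `A∞`-category. -/
noncomputable def mfCat {L : Type} [AddCommGroup L] {deg : Fin 2 → L} {W : PolyXY} {c : L}
    {V : Type} (K : V → GradedMF deg W c) : AInfCat.{0} V where
  carrier := MFCat.Total K
  addCommGroup := inferInstance
  module := inferInstance
  gr X Y n := LinearMap.range (MFCat.incl K X Y n)
  isInternal := MFCat.isInternal_range_incl K
  μ := MFCat.op K
  μ_zero := rfl
  μ_mem := by
    intro n hn X deg v hv
    match n, hn with
    | 1, _ =>
      obtain ⟨f, hf⟩ := hv 0 (by norm_num)
      rw [MFCat.op_one]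
      simp only [Fin.val_zero, ← hf, MFCat.op₁_incl]
      have e : (∑ i ∈ Finset.range 1, deg i) + 2 - ((1 : ℕ) : ℤ) = deg 0 + 1 := by simp; ring
      rw [e]
      exact Submodule.smul_mem _ _ ⟨_, rfl⟩
    | 2, _ =>
      obtain ⟨f, hf⟩ := hv 0 (by norm_num)
      obtain ⟨g, hg⟩ := hv 1 (by norm_num)
      rw [MFCat.op_two]
      simp only [Fin.val_zero, Fin.val_one, ← hf, ← hg, MFCat.op₂_incl]
      have e : (∑ i ∈ Finset.range 2, deg i) + 2 - ((2 : ℕ) : ℤ) = deg 0 + deg 1 := by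
        simp [Finset.sum_range_succ]
      rw [e]
      exact Submodule.smul_mem _ _ ⟨_, rfl⟩
    | n + 3, _ =>
      rw [MFCat.op_of_ge K (by omega)]
      exact zero_mem _
  μ_eq_zero := by
    intro n X Y deg v hv hne
    obtain ⟨i, hi, hne⟩ := hne
    match n, hi with
    | 2, hi =>
      obtain rfl : i = 0 := by omega
      obtain ⟨f, hf⟩ := hv 0 (by norm_num)
      obtain ⟨g, hg⟩ := hv 1 (by norm_num)
      rw [MFCat.op_two]
      simp only [Fin.val_zero, Fin.val_one, ← hf, ← hg]
      exact MFCat.op₂_incl_of_ne K _ _ _ _ _ _ hne _ _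
    | n + 3, _ =>
      rw [MFCat.op_of_ge K (by omega)]
      rfl
  relation := by
    intro n X deg v hv
    match n with
    | 0 => simp
    | 1 =>
      obtain ⟨f, hf⟩ := hv 0 (by norm_num)
      have h := MFCat.sq K _ _ _ f
      rw [hf] at h
      simpa [graft, MFCat.op_one] using h
    | 2 =>
      obtain ⟨f, hf⟩ := hv 0 (by norm_num)
      obtain ⟨g, hg⟩ := hv 1 (by norm_num)
      have h := MFCat.leibniz K _ _ _ _ _ f g
      rw [hf, hg] at h
      rw [Finset.sum_Icc_succ_top (by norm_num), Finset.Icc_self, Finset.sum_singleton]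
      simpa [Finset.sum_range_succ, graft, MFCat.op_one, MFCat.op_two] using h
    | 3 =>
      obtain ⟨f, hf⟩ := hv 0 (by norm_num)
      obtain ⟨g, hg⟩ := hv 1 (by norm_num)
      obtain ⟨h', hh⟩ := hv 2 (by norm_num)
      have h := MFCat.assoc K _ _ _ _ _ _ _ f g h'
      rw [hf, hg, hh] at h
      have h3 : MFCat.op K 3 = 0 := rfl
      rw [Finset.sum_Icc_succ_top (by norm_num), Finset.sum_Icc_succ_top (by norm_num),
        Finset.Icc_self, Finset.sum_singleton]
      simpa [Finset.sum_range_succ, graft, MFCat.op_one, MFCat.op_two, h3] using h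
    | n + 4 =>
      refine Finset.sum_eq_zero fun s hs => Finset.sum_eq_zero fun r hr => ?_
      rw [Finset.mem_Icc] at hs
      rw [Finset.mem_range] at hr
      by_cases h : 3 ≤ n + 4 - s + 1
      · rw [MFCat.op_of_ge K h]; simp
      · rw [MFCat.op_of_ge K (show 3 ≤ s by omega)]
        rw [MultilinearMap.map_coord_zero _ (⟨r, hr⟩ : Fin (n + 4 - s + 1)) (by simp [graft])]
        simp

/-! ## Chain polynomials and their basic matrix factorisations -/

/-- The parameters of a chain polynomial `x^p y + y^q` together with an admissible grading group of
index `ℓ` in the maximal one, and a primitive `ℓ`-th root of unity `η`. -/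
structure ChainData where
  p : ℕ
  q : ℕ
  ℓ : ℕ
  η : ℂ
  two_le_p : 2 ≤ p
  two_le_q : 2 ≤ q
  dvd_p : ℓ ∣ p
  dvd_q : ℓ ∣ q - 1
  isPrimitiveRoot : IsPrimitiveRoot η ℓ

namespace ChainData

/-- The integer `p / ℓ`. -/
def pl (D : ChainData) : ℕ := D.p / D.ℓ

/-- The integer `(q - 1) / ℓ`. -/
def ql (D : ChainData) : ℕ := (D.q - 1) / D.ℓ

theorem ℓ_pos (D : ChainData) : 0 < D.ℓ := by
  have h := D.dvd_p
  have h2 := D.two_le_p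
  rcases Nat.eq_zero_or_pos D.ℓ with h0 | h0
  · rw [h0, zero_dvd_iff] at h; omega
  · exact h0

theorem p_eq (D : ChainData) : D.p = D.ℓ * D.pl := (Nat.mul_div_cancel' D.dvd_p).symm

theorem q_eq (D : ChainData) : D.q = D.ℓ * D.ql + 1 := by
  have h : D.ℓ * D.ql = D.q - 1 := Nat.mul_div_cancel' D.dvd_q
  have := D.two_le_q
  omega

theorem pl_pos (D : ChainData) : 0 < D.pl :=
  Nat.div_pos (Nat.le_of_dvd (by have := D.two_le_p; omega) D.dvd_p) D.ℓ_pos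

theorem ql_pos (D : ChainData) : 0 < D.ql :=
  Nat.div_pos (Nat.le_of_dvd (by have := D.two_le_q; omega) D.dvd_q) D.ℓ_pos

/-- The grading group `L`, generated by `x⃗` and `y⃗` modulo `(p/ℓ) x⃗ = ((q-1)/ℓ) y⃗`. -/
abbrev L (D : ChainData) : Type :=
  (ℤ × ℤ) ⧸ AddSubgroup.zmultiples ((D.pl : ℤ), -(D.ql : ℤ))

/-- The element `m x⃗ + n y⃗` of `L`. -/
def vec (D : ChainData) (m n : ℤ) : D.L := QuotientAddGroup.mk (m, n)

/-- The degrees of the variables. -/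
def deg (D : ChainData) : Fin 2 → D.L := ![D.vec 1 0, D.vec 0 1]

/-- The degree of the chain polynomial, `c⃗ = p x⃗ + y⃗`. -/
def c (D : ChainData) : D.L := D.vec D.p 1

/-- The chain polynomial `𝐰 = x^p y + y^q`. -/
noncomputable def poly (D : ChainData) : PolyXY := X 0 ^ D.p * X 1 + X 1 ^ D.q

/-- The scalar `e^(πi/ℓ) η^r`. -/
noncomputable def ζ (D : ChainData) (r : ℕ) : ℂ :=
  Complex.exp (Real.pi * Complex.I / D.ℓ) * D.η ^ r

/-- The factor `w_r = x^(p/ℓ) - e^(πi/ℓ) η^r y^((q-1)/ℓ)`. -/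
noncomputable def wFactor (D : ChainData) (r : ℕ) : PolyXY :=
  X 0 ^ D.pl - C (D.ζ r) * X 1 ^ D.ql

/-- The product `w_1 ⋯ w_ℓ`. -/
noncomputable def wProd (D : ChainData) : PolyXY := ∏ r ∈ Finset.Icc 1 D.ℓ, D.wFactor r

/-- The polynomial `𝐰 / w_r`, that is, `y` times the product of the `w_t` with `t ≠ r`. -/
noncomputable def wCofactor (D : ChainData) (r : ℕ) : PolyXY :=
  X 1 * ∏ t ∈ (Finset.Icc 1 D.ℓ).erase r, D.wFactor t

theorem vec_eq (D : ChainData) {m n m' n' : ℤ} (t : ℤ) (hm : m = m' + t * D.pl)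
    (hn : n = n' - t * D.ql) : D.vec m n = D.vec m' n' := by
  unfold vec
  rw [QuotientAddGroup.eq, AddSubgroup.mem_zmultiples_iff]
  exact ⟨-t, by ext <;> simp [hm, hn]⟩

theorem vec_add (D : ChainData) (m n m' n' : ℤ) :
    D.vec m n + D.vec m' n' = D.vec (m + m') (n + n') := rfl

theorem vec_sub (D : ChainData) (m n m' n' : ℤ) :
    D.vec m n - D.vec m' n' = D.vec (m - m') (n - n') := rfl

theorem c_eq (D : ChainData) : D.c = D.vec 0 D.q := by
  refine D.vec_eq D.ℓ ?_ ?_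
  · rw [D.p_eq]; push_cast; ring
  · rw [D.q_eq]; push_cast; ring

theorem nsmul_vec (D : ChainData) (k : ℕ) (m n : ℤ) :
    k • D.vec m n = D.vec (k * m) (k * n) := by
  have : k • ((m, n) : ℤ × ℤ) = (k * m, k * n) := by ext <;> simp
  unfold vec
  rw [← this]; rfl

theorem mono_homogeneous (D : ChainData) (m n : ℕ) (l : D.L) (h : D.vec m n = l) :
    IsWeightedHomogeneous D.deg (X 0 ^ m * X 1 ^ n : PolyXY) l := by
  have h1 := ((isWeightedHomogeneous_X ℂ D.deg 0).pow m).mul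
    ((isWeightedHomogeneous_X ℂ D.deg 1).pow n)
  have h2 : m • D.deg 0 + n • D.deg 1 = D.vec m n := by
    simp [deg, nsmul_vec, vec_add]
  rw [h2, h] at h1
  exact h1

theorem y_homogeneous (D : ChainData) (n : ℕ) (l : D.L) (h : D.vec 0 n = l) :
    IsWeightedHomogeneous D.deg (X 1 ^ n : PolyXY) l := by
  have := D.mono_homogeneous 0 n l (by simpa using h)
  simpa using this

theorem x_homogeneous (D : ChainData) (m : ℕ) (l : D.L) (h : D.vec m 0 = l) :
    IsWeightedHomogeneous D.deg (X 0 ^ m : PolyXY) l := by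
  have := D.mono_homogeneous m 0 l (by simpa using h)
  simpa using this

theorem poly_homogeneous (D : ChainData) : IsWeightedHomogeneous D.deg D.poly D.c := by
  refine IsWeightedHomogeneous.add ?_ (D.y_homogeneous _ _ D.c_eq.symm)
  have := D.mono_homogeneous D.p 1 D.c rfl
  simpa using this

theorem wFactor_homogeneous (D : ChainData) (r : ℕ) :
    IsWeightedHomogeneous D.deg (D.wFactor r) (D.vec D.pl 0) :=
  (D.x_homogeneous _ _ rfl).sub
    ((D.y_homogeneous _ _ (D.vec_eq (-1) (by ring) (by ring))).C_mul _)

theorem wProd_homogeneous (D : ChainData) :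
    IsWeightedHomogeneous D.deg D.wProd (D.vec D.p 0) := by
  have h := IsWeightedHomogeneous.prod (Finset.Icc 1 D.ℓ) D.wFactor (w := D.deg)
    (fun _ => D.vec D.pl 0) (fun r _ => D.wFactor_homogeneous r)
  rw [Finset.sum_const, nsmul_vec, Nat.card_Icc, Nat.add_sub_cancel] at h
  rw [D.p_eq]
  push_cast
  simpa [wProd] using h

theorem wCofactor_homogeneous (D : ChainData) (r : ℕ) (hr : r ∈ Finset.Icc 1 D.ℓ) :
    IsWeightedHomogeneous D.deg (D.wCofactor r) (D.c - D.vec D.pl 0) := by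
  have h := (isWeightedHomogeneous_X ℂ D.deg 1).mul
    (IsWeightedHomogeneous.prod ((Finset.Icc 1 D.ℓ).erase r) D.wFactor (w := D.deg)
      (fun _ => D.vec D.pl 0) (fun r _ => D.wFactor_homogeneous r))
  rw [Finset.sum_const, nsmul_vec, Finset.card_erase_of_mem hr, Nat.card_Icc,
    Nat.add_sub_cancel] at h
  have hl := D.ℓ_pos
  have e : D.deg 1 + D.vec (↑(D.ℓ - 1) * ↑D.pl) (↑(D.ℓ - 1) * 0) = D.c - D.vec D.pl 0 := by
    have h1 : D.deg 1 = D.vec 0 1 := rfl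
    rw [h1, vec_add, c, vec_sub, D.p_eq]
    congr 1
    rw [Nat.cast_sub (by omega)]; push_cast; ring
  rw [e] at h
  exact h

theorem ζ_pow (D : ChainData) (r : ℕ) : D.ζ r ^ D.ℓ = -1 := by
  have h : (D.ℓ : ℂ) ≠ 0 := by exact_mod_cast D.ℓ_pos.ne'
  rw [ζ, mul_pow, ← Complex.exp_nat_mul, mul_div_cancel₀ _ h, Complex.exp_pi_mul_I, ← pow_mul,
    mul_comm r, pow_mul, D.isPrimitiveRoot.pow_eq_one, one_pow, mul_one]

theorem wProd_eq (D : ChainData) : D.wProd = X 0 ^ D.p + X 1 ^ (D.q - 1) := by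
  have hl := D.ℓ_pos
  have hη : IsPrimitiveRoot (C D.η : PolyXY) D.ℓ :=
    D.isPrimitiveRoot.map_of_injective (C_injective (Fin 2) ℂ)
  have h := hη.pow_sub_pow_eq_prod_sub_mul (X 0 ^ D.pl)
    (C (Complex.exp (Real.pi * Complex.I / D.ℓ)) * X 1 ^ D.ql) hl
  have hz : Complex.exp (Real.pi * Complex.I / D.ℓ) ^ D.ℓ = -1 := by
    simpa [ζ] using D.ζ_pow 0
  have hq : D.q - 1 = D.ql * D.ℓ := by rw [D.q_eq, Nat.add_sub_cancel, mul_comm]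
  rw [← pow_mul, mul_pow, ← map_pow, hz, ← pow_mul, ← hq, mul_comm D.pl, ← D.p_eq, map_neg,
    map_one, neg_one_mul, sub_neg_eq_add] at h
  rw [h, wProd]
  refine Finset.prod_nbij (fun r => (C D.η : PolyXY) ^ r) ?_ ?_ ?_ ?_
  · intro r _
    rw [Polynomial.mem_nthRootsFinset hl, ← pow_mul, mul_comm, pow_mul, hη.pow_eq_one, one_pow]
  · intro r hr t ht hrt
    simp only [Finset.coe_Icc, Set.mem_Icc] at hr ht
    obtain ⟨r, rfl⟩ : ∃ r', r = r' + 1 := ⟨r - 1, by omega⟩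
    obtain ⟨t, rfl⟩ : ∃ t', t = t' + 1 := ⟨t - 1, by omega⟩
    have h0 : (C D.η : PolyXY) ≠ 0 := hη.ne_zero hl.ne'
    simp only [pow_succ] at hrt
    have := hη.pow_inj (by omega) (by omega) (mul_right_cancel₀ h0 hrt)
    omega
  · intro x hx
    rw [Finset.mem_coe, Polynomial.mem_nthRootsFinset hl] at hx
    have : NeZero D.ℓ := ⟨hl.ne'⟩
    obtain ⟨i, hi, rfl⟩ := hη.eq_pow_of_pow_eq_one hx
    rcases Nat.eq_zero_or_pos i with rfl | h0
    · exact ⟨D.ℓ, by simp; omega, by simp [hη.pow_eq_one]⟩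
    · exact ⟨i, by simp; omega, rfl⟩
  · intro r _
    rw [wFactor, ζ, map_mul, map_pow]
    ring

theorem X_mul_wProd (D : ChainData) : X 1 * D.wProd = D.poly := by
  rw [wProd_eq, poly, mul_add, ← pow_succ', mul_comm]
  have := D.two_le_q
  rw [show D.q - 1 + 1 = D.q by omega]

theorem wCofactor_mul (D : ChainData) (r : ℕ) (hr : r ∈ Finset.Icc 1 D.ℓ) :
    D.wCofactor r * D.wFactor r = D.poly := by
  rw [wCofactor, mul_assoc, Finset.prod_erase_mul _ _ hr]
  exact D.X_mul_wProd

/-- The matrix factorisation `K_y`, `⋯ → S(-c⃗) → S(-y⃗) → S → ⋯` with maps `w = w_1 ⋯ w_ℓ` and `y`, the last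
`S` being in cohomological degree `0`. -/
noncomputable def Ky (D : ChainData) : GradedMF D.deg D.poly D.c :=
  GradedMF.ofPair 1 (fun _ => -D.c) (fun _ => D.vec 0 (-1))
    (Matrix.of fun _ _ => D.wProd) (Matrix.of fun _ _ => X 1)
    (fun _ _ => by
      have h : D.vec 0 (-1) - -D.c = D.vec D.p 0 := by
        rw [sub_neg_eq_add, c, vec_add]; congr 1; ring
      rw [h]; exact D.wProd_homogeneous)
    (fun _ _ => by
      have h : -D.c + D.c - D.vec 0 (-1) = D.deg 1 := by
        rw [neg_add_cancel, show (0 : D.L) = D.vec 0 0 from rfl, vec_sub]; rfl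
      rw [h]; exact isWeightedHomogeneous_X ℂ D.deg 1)
    (by ext i j : 2; simp [Matrix.mul_apply, Subsingleton.elim i j, X_mul_wProd])
    (by ext i j : 2; simp [Matrix.mul_apply, Subsingleton.elim i j, mul_comm, ← X_mul_wProd])

/-- The matrix factorisation `K_{w_r}`,
`⋯ → S(-c⃗) → S(-(p/ℓ) x⃗) → S → ⋯` with maps `𝐰 / w_r` and `w_r`, the last `S` being in
cohomological degree `0`. -/
noncomputable def Kw (D : ChainData) (r : ℕ) (hr : r ∈ Finset.Icc 1 D.ℓ) :
    GradedMF D.deg D.poly D.c :=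
  GradedMF.ofPair 1 (fun _ => -D.c) (fun _ => D.vec (-D.pl) 0)
    (Matrix.of fun _ _ => D.wCofactor r) (Matrix.of fun _ _ => D.wFactor r)
    (fun _ _ => by
      have h : D.vec (-D.pl) 0 - -D.c = D.c - D.vec D.pl 0 := by
        rw [sub_neg_eq_add, c, vec_add, vec_sub]; congr 1; ring
      rw [h]; exact D.wCofactor_homogeneous r hr)
    (fun _ _ => by
      have h : -D.c + D.c - D.vec (-D.pl) 0 = D.vec D.pl 0 := by
        rw [neg_add_cancel, show (0 : D.L) = D.vec 0 0 from rfl, vec_sub]; congr 1; ring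
      rw [h]; exact D.wFactor_homogeneous r)
    (by ext i j : 2; simp [Matrix.mul_apply, Subsingleton.elim i j, mul_comm, ← D.wCofactor_mul r hr])
    (by ext i j : 2; simp [Matrix.mul_apply, Subsingleton.elim i j, D.wCofactor_mul r hr])

/-- A square matrix with entries `f` on the diagonal, `g` immediately below it, and `h` in the upper
right corner. -/
def cyclicMatrix {R : Type} [Zero R] (n : ℕ) (f g : ℕ → R) (h : R) :
    Matrix (Fin (n + 2)) (Fin (n + 2)) R :=
  Matrix.of fun b a =>
    if (b : ℕ) = a then f a
    else if (b : ℕ) = a + 1 then g a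
    else if (b : ℕ) = 0 ∧ (a : ℕ) = n + 1 then h
    else 0

theorem det_cyclicMatrix {R : Type} [CommRing R] (n : ℕ) (f g : ℕ → R) (h : R) :
    (cyclicMatrix n f g h).det = ∏ t ∈ Finset.range (n + 2), f t
      + (-1) ^ (n + 1) * h * ∏ t ∈ Finset.range (n + 1), g t := by
  rw [Matrix.det_succ_row_zero, Fin.sum_univ_succ, Fin.sum_univ_castSucc]
  have h0 : ∀ i : Fin n, cyclicMatrix n f g h 0 i.castSucc.succ = 0 := by
    intro i
    simp [cyclicMatrix]
    omega
  have h1 : cyclicMatrix n f g h 0 (Fin.last n).succ = h := by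
    simp [cyclicMatrix]
  have h2 : cyclicMatrix n f g h 0 0 = f 0 := by simp [cyclicMatrix]
  have h3 : ((cyclicMatrix n f g h).submatrix Fin.succ (Fin.succAbove 0)).det
      = ∏ t ∈ Finset.range (n + 1), f (t + 1) := by
    rw [Matrix.det_of_isLowerTriangular, ← Fin.prod_univ_eq_prod_range (fun t => f (t + 1))]
    · simp [cyclicMatrix]
    · intro b a hab
      have hab' : (b : ℕ) < a := hab
      have i1 : ¬ ((b : ℕ) = a) := by omega
      have i2 : ¬ ((b : ℕ) = a + 1) := by omega
      simp [cyclicMatrix, i1, i2]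
  have h4 : ((cyclicMatrix n f g h).submatrix Fin.succ (Fin.succAbove (Fin.last n).succ)).det
      = ∏ t ∈ Finset.range (n + 1), g t := by
    rw [Matrix.det_of_isUpperTriangular, ← Fin.prod_univ_eq_prod_range g]
    · simp [cyclicMatrix]
    · intro b a hab
      have hab' : (a : ℕ) < b := hab
      have i1 : ¬ ((b : ℕ) + 1 = a) := by omega
      have i2 : ¬ ((b : ℕ) = a) := by omega
      simp [cyclicMatrix, i1, i2]
  rw [h1, h2, h3, h4, Finset.prod_range_succ' f (n + 1)]
  simp [h0]
  ring

theorem det_homogeneous {L : Type} [AddCommGroup L] {deg : Fin 2 → L} {n : ℕ}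
    (A : Matrix (Fin n) (Fin n) PolyXY) (u v : Fin n → L)
    (h : ∀ b a, IsWeightedHomogeneous deg (A b a) (u b - v a)) :
    IsWeightedHomogeneous deg A.det (∑ b, u b - ∑ a, v a) := by
  rw [Matrix.det_apply]
  refine IsWeightedHomogeneous.sum _ _ _ (fun σ _ => ?_)
  have h1 := IsWeightedHomogeneous.prod Finset.univ (fun i => A (σ i) i) (w := deg)
    (fun i => u (σ i) - v i) (fun i _ => h _ _)
  rw [Finset.sum_sub_distrib, Equiv.sum_comp σ u] at h1
  rcases Int.units_eq_one_or (Equiv.Perm.sign σ) with hs | hs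
  · rw [hs, one_smul]; exact h1
  · rw [hs, Units.neg_smul, one_smul]; exact h1.neg

theorem adjugate_homogeneous {L : Type} [AddCommGroup L] {deg : Fin 2 → L} {n : ℕ}
    (A : Matrix (Fin n) (Fin n) PolyXY) (u v : Fin n → L) (c : L)
    (h : ∀ b a, IsWeightedHomogeneous deg (A b a) (u b - v a))
    (hc : ∑ b, u b - ∑ a, v a = c) (b a : Fin n) :
    IsWeightedHomogeneous deg (A.adjugate b a) (v b + c - u a) := by
  rw [Matrix.adjugate_apply]
  have h1 := det_homogeneous (A.updateRow a (Pi.single b 1)) (Function.update u a (v b)) v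
    (deg := deg) (by
      intro i j
      by_cases hi : i = a
      · subst hi
        rw [Matrix.updateRow_self, Function.update_self]
        by_cases hj : j = b
        · subst hj
          rw [Pi.single_eq_same, sub_self]
          exact isWeightedHomogeneous_one ℂ deg
        · rw [Pi.single_eq_of_ne hj]
          exact isWeightedHomogeneous_zero ℂ deg _
      · rw [Matrix.updateRow_ne hi, Function.update_of_ne hi]
        exact h i j)
  rw [Finset.sum_update_of_mem (Finset.mem_univ a)] at h1
  convert h1 using 1
  have h2 := Finset.sum_erase_eq_sub (s := Finset.univ) (f := u) (Finset.mem_univ a)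
  rw [← hc, Finset.sdiff_singleton_eq_erase, h2]
  abel

/-- The integer `k = ⌊(i - 1) ℓ / p⌋`. -/
def k (D : ChainData) (i : ℕ) : ℕ := (i - 1) * D.ℓ / D.p

/-- The matrix `d₀` of the matrix factorisation `K_0^{i,j}`. -/
noncomputable def d₀ (D : ChainData) (i j : ℕ) :
    Matrix (Fin (D.k i + 2)) (Fin (D.k i + 2)) PolyXY :=
  cyclicMatrix (D.k i)
    (fun t => if t = 0 then X 1 ^ (j - (D.ℓ - 1) * D.ql)
      else if t = D.k i + 1 then X 1 ^ (D.q - j + (D.ℓ - D.k i - 1) * D.ql)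
      else X 1 ^ D.ql)
    (fun t => if t = D.k i then -X 0 ^ (i - D.k i * D.pl) else -X 0 ^ D.pl)
    (X 0 ^ (D.p - i) * X 1)

/-- The grading shifts in `K^(-2)` for `K = K_0^{i,j}`:
`S(c⃗ - ((q-1)/ℓ) y⃗)^(k+1) ⊕ S(i x⃗ + (j+1) y⃗ - c⃗)`. -/
def shift₀ (D : ChainData) (i j : ℕ) (t : Fin (D.k i + 2)) : D.L :=
  if (t : ℕ) = D.k i + 1 then D.vec i (j + 1) - D.c else D.c - D.vec 0 D.ql

/-- The grading shifts in `K^(-1)` for `K = K_0^{i,j}`: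
`S((j+1) y⃗) ⊕ S(c⃗)^k ⊕ S(c⃗ + i x⃗ - (k+1) ((q-1)/ℓ) y⃗)`. -/
def shift₁ (D : ChainData) (i j : ℕ) (t : Fin (D.k i + 2)) : D.L :=
  if (t : ℕ) = 0 then D.vec 0 (j + 1)
  else if (t : ℕ) = D.k i + 1 then D.c + D.vec i (-((D.k i + 1) * D.ql))
  else D.c

theorem k_bounds (D : ChainData) {i : ℕ} (hi : 1 ≤ i ∧ i ≤ D.p - 1) :
    D.k i + 1 ≤ D.ℓ ∧ D.k i * D.pl ≤ i - 1 ∧ i ≤ (D.k i + 1) * D.pl := by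
  have hp := D.two_le_p
  have hl := D.ℓ_pos
  have hk : D.k i = (i - 1) / D.pl := by
    rw [k, D.p_eq, mul_comm, Nat.mul_div_mul_left _ _ hl]
  have h1 : D.k i * D.pl ≤ i - 1 := by rw [hk]; exact Nat.div_mul_le_self _ _
  have h2 : i - 1 < (D.k i + 1) * D.pl := by
    rw [hk, mul_comm]; exact Nat.lt_mul_div_succ _ D.pl_pos
  have h3 : D.k i * D.pl < D.ℓ * D.pl := by rw [← D.p_eq]; omega
  have h4 := Nat.lt_of_mul_lt_mul_right h3
  omega

theorem j_bounds (D : ChainData) {j : ℕ} (hj : D.q - D.ql ≤ j ∧ j ≤ D.q - 1) :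
    (D.ℓ - 1) * D.ql + 1 ≤ j ∧ j ≤ D.ℓ * D.ql := by
  have hq := D.q_eq
  have hl := D.ℓ_pos
  have h : (D.ℓ - 1) * D.ql = D.ℓ * D.ql - D.ql := Nat.sub_one_mul _ _
  have h2 : D.ql ≤ D.ℓ * D.ql := Nat.le_mul_of_pos_left _ hl
  omega

theorem d₀_homogeneous (D : ChainData) {i j : ℕ} (hi : 1 ≤ i ∧ i ≤ D.p - 1)
    (hj : D.q - D.ql ≤ j ∧ j ≤ D.q - 1) (b a : Fin (D.k i + 2)) :
    IsWeightedHomogeneous D.deg (D.d₀ i j b a) (D.shift₁ i j b - D.shift₀ i j a) := by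
  obtain ⟨k1, k2, k3⟩ := D.k_bounds hi
  obtain ⟨j1, j2⟩ := D.j_bounds hj
  have hp := D.two_le_p
  have hl := D.ℓ_pos
  have hq := D.q_eq
  have hp' := D.p_eq
  have hj' : j ≤ D.q := by omega
  have ha := a.2
  have hb := b.2
  have key : (D.k i : ℤ) * D.pl ≤ i - 1 := by
    have : D.k i * D.pl + 1 ≤ i := by omega
    have : ((D.k i * D.pl + 1 : ℕ) : ℤ) ≤ i := by exact_mod_cast this
    push_cast at this; linarith
  simp only [d₀, cyclicMatrix, Matrix.of_apply, shift₀, shift₁, D.c_eq, vec_sub, vec_add]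
  by_cases h1 : (b : ℕ) = a
  · rw [if_pos h1]
    by_cases h2 : (a : ℕ) = 0
    · rw [if_pos h2, if_pos (h1.trans h2), if_neg (by omega)]
      refine D.y_homogeneous _ _ (D.vec_eq 0 (by ring) ?_)
      rw [Nat.cast_sub (by omega), hq]
      push_cast [Nat.cast_sub hl]
      ring
    · rw [if_neg h2, if_neg (show ¬ (b : ℕ) = 0 by omega)]
      by_cases h3 : (a : ℕ) = D.k i + 1
      · rw [if_pos h3, if_pos (h1.trans h3), if_pos h3]
        refine D.y_homogeneous _ _ (D.vec_eq 0 (by ring) ?_)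
        rw [show D.ℓ - D.k i - 1 = D.ℓ - (D.k i + 1) by omega]
        push_cast [Nat.cast_sub hj', Nat.cast_sub k1]
        rw [hq]
        push_cast
        ring
      · rw [if_neg h3, if_neg (by omega), if_neg h3]
        exact D.y_homogeneous _ _ (D.vec_eq 0 (by ring) (by ring))
  · rw [if_neg h1]
    by_cases h2 : (b : ℕ) = a + 1
    · rw [if_pos h2, if_neg (show ¬ (b : ℕ) = 0 by omega), if_neg (show ¬ (a : ℕ) = D.k i + 1 by omega)]
      by_cases h3 : (a : ℕ) = D.k i
      · rw [if_pos h3, if_pos (by omega)]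
        refine (D.x_homogeneous _ _ (D.vec_eq (-(D.k i : ℤ)) ?_ ?_)).neg
        · rw [Nat.cast_sub (by omega)]; push_cast; ring
        · ring
      · rw [if_neg h3, if_neg (by omega)]
        exact (D.x_homogeneous _ _ (D.vec_eq 1 (by ring) (by ring))).neg
    · rw [if_neg h2]
      by_cases h3 : (b : ℕ) = 0 ∧ (a : ℕ) = D.k i + 1
      · rw [if_pos h3, if_pos h3.1, if_pos h3.2]
        have := D.mono_homogeneous (D.p - i) 1 (D.vec (0 - (i - 0)) (j + 1 - (j + 1 - D.q)))
          (D.vec_eq D.ℓ (by rw [Nat.cast_sub (by omega), hp']; push_cast; ring)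
            (by rw [hq]; push_cast; ring))
        rw [pow_one] at this
        exact this
      · rw [if_neg h3]
        exact isWeightedHomogeneous_zero ℂ _ _

theorem sum_shift (D : ChainData) (i j : ℕ) :
    ∑ t, D.shift₁ i j t - ∑ t, D.shift₀ i j t = D.c := by
  have h1 : ∑ t, D.shift₁ i j t = D.vec 0 (j + 1) + (D.k i • D.c +
      (D.c + D.vec i (-((D.k i + 1) * D.ql)))) := by
    rw [Fin.sum_univ_succ, Fin.sum_univ_castSucc]
    congr 2
    · rw [Finset.sum_congr rfl (g := fun _ => D.c)]
      · simp
      · intro t _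
        have := t.2
        simp [shift₁]
        omega
    · simp [shift₁]
  have h0 : ∑ t, D.shift₀ i j t = (D.k i + 1) • (D.c - D.vec 0 D.ql) +
      (D.vec i (j + 1) - D.c) := by
    rw [Fin.sum_univ_castSucc]
    congr 1
    · rw [Finset.sum_congr rfl (g := fun _ => D.c - D.vec 0 D.ql)]
      · rw [Finset.sum_const, Finset.card_univ, Fintype.card_fin]
      · intro t _
        have := t.2
        simp [shift₀]
        omega
    · simp [shift₀]
  rw [h0, h1, D.c_eq, vec_sub, vec_sub, nsmul_vec, nsmul_vec]
  simp only [vec_add, vec_sub]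
  refine D.vec_eq 0 ?_ ?_ <;> push_cast <;> ring

theorem det_cyclicMatrix_pow {R : Type} [CommRing R] (x y : R) (n A A' A'' E E' F : ℕ) :
    (cyclicMatrix n (fun t => if t = 0 then y ^ A else if t = n + 1 then y ^ A'' else y ^ A')
      (fun t => if t = n then -x ^ E' else -x ^ E) (x ^ F * y)).det =
      x ^ (F + (E * n + E')) * y + y ^ (A' * n + A + A'') := by
  rw [det_cyclicMatrix, Finset.prod_range_succ, Finset.prod_range_succ', Finset.prod_range_succ]
  have e1 : ∀ t ∈ Finset.range n, (if t + 1 = 0 then y ^ A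
        else if t + 1 = n + 1 then y ^ A'' else y ^ A') = y ^ A' := by
    intro t ht
    rw [Finset.mem_range] at ht
    rw [if_neg (by omega), if_neg (by omega)]
  have e2 : ∀ t ∈ Finset.range n, (if t = n then -x ^ E' else -x ^ E) = -x ^ E := by
    intro t ht
    rw [Finset.mem_range] at ht
    rw [if_neg (by omega)]
  rw [Finset.prod_congr rfl e1, Finset.prod_congr rfl e2]
  simp only [Finset.prod_const, Finset.card_range, if_true, Nat.add_one_ne_zero, if_false]
  have s1 : ((-1 : R) ^ n) * (-1) ^ n = 1 := by
    rw [← mul_pow]; simp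
  rw [neg_pow (x ^ E)]
  simp only [pow_add, pow_mul, pow_one]
  linear_combination (x ^ F * y * (x ^ E) ^ n * x ^ E') * s1

theorem det_d₀ (D : ChainData) {i j : ℕ} (hi : 1 ≤ i ∧ i ≤ D.p - 1)
    (hj : D.q - D.ql ≤ j ∧ j ≤ D.q - 1) : (D.d₀ i j).det = D.poly := by
  obtain ⟨k1, k2, k3⟩ := D.k_bounds hi
  obtain ⟨j1, j2⟩ := D.j_bounds hj
  have hp := D.two_le_p
  have hq := D.q_eq
  have m1 : D.ql * D.k i + (j - (D.ℓ - 1) * D.ql) + (D.q - j + (D.ℓ - D.k i - 1) * D.ql)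
      = D.q := by
    obtain ⟨r, hr⟩ := Nat.exists_eq_add_of_le k1
    have hr1 : D.ℓ - D.k i - 1 = r := by omega
    have hr2 : D.ℓ - 1 = D.k i + r := by omega
    have hr3 : D.ql * D.k i + r * D.ql = (D.ℓ - 1) * D.ql := by rw [hr2]; ring
    rw [hr1]
    omega
  have m2 : D.p - i + (D.pl * D.k i + (i - D.k i * D.pl)) = D.p := by
    rw [mul_comm D.pl]; omega
  rw [d₀, det_cyclicMatrix_pow, m1, m2, poly]

/-- The matrix factorisation `K_0^{i,j}` of rank `k + 2`, with `d₁` the adjugate of `d₀`: the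
stabilisation of the module `R(i x⃗ + (j+1) y⃗) / I_{i,j}`. -/
noncomputable def K₀ (D : ChainData) (i j : ℕ) (hi : 1 ≤ i ∧ i ≤ D.p - 1)
    (hj : D.q - D.ql ≤ j ∧ j ≤ D.q - 1) : GradedMF D.deg D.poly D.c :=
  GradedMF.ofPair (D.k i + 2) (D.shift₀ i j) (D.shift₁ i j) (D.d₀ i j) (D.d₀ i j).adjugate
    (D.d₀_homogeneous hi hj)
    (adjugate_homogeneous _ _ _ _ (D.d₀_homogeneous hi hj) (D.sum_shift i j))
    (by rw [Matrix.adjugate_mul, D.det_d₀ hi hj])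
    (by rw [Matrix.mul_adjugate, D.det_d₀ hi hj])

/-- The vertices of the quiver, indexing the objects of `ℬ`. -/
inductive Vertex (D : ChainData) : Type
  | zero (i j : ℕ) (hi : 1 ≤ i ∧ i ≤ D.p - 1) (hj : D.q - D.ql ≤ j ∧ j ≤ D.q - 1)
  | y (j : ℕ) (hj : D.q - D.ql ≤ j ∧ j ≤ D.q - 1)
  | w (r : ℕ) (hr : r ∈ Finset.Icc 1 D.ℓ)

/-- The objects `K_0^{i,j}`, `K_y^j[3]` with `K_y^j = K_y((j+1-q) y⃗)`, and `K_{w_r}[3]`. -/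
noncomputable def obj (D : ChainData) : D.Vertex → GradedMF D.deg D.poly D.c
  | .zero i j hi hj => D.K₀ i j hi hj
  | .y j _ => (D.Ky.twist (D.vec 0 (j + 1 - D.q))).shift 3
  | .w r hr => (D.Kw r hr).shift 3

/-- The full subcategory `ℬ` of the category of `L`-graded matrix factorisations. -/
noncomputable def B (D : ChainData) : AInfCat.{0} D.Vertex := mfCat D.obj

/-! ## The quiver with relations -/

/-- The labels of the arrows. -/
inductive Label : Type
  | x | y | a | c

/-- `D.IsArrow t u v` says that the quiver has an arrow `u ⟶ v` labelled `t`. The arrows labelled `y`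
are the vertical ones inside a block and the diagonal ones, from the top row of a block
to the bottom row of the next block. -/
def IsArrow (D : ChainData) : Label → D.Vertex → D.Vertex → Prop
  | .x, .zero i j _ _, .zero i' j' _ _ => i' = i + 1 ∧ j' = j
  | .y, .zero i j _ _, .zero i' j' _ _ =>
      (i' = i ∧ j' = j + 1) ∨ (i' = i + D.pl ∧ j = D.q - 1 ∧ j' = D.q - D.ql)
  | .a, .zero i j _ _, .y j' _ => i = D.p - 1 ∧ j' = j
  | .c, .zero i j _ _, .w _ _ => i = D.p - 1 ∧ j = D.q - 1
  | _, _, _ => False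

instance (D : ChainData) : Quiver D.Vertex where
  Hom u v := {t : Label // D.IsArrow t u v}

/-- The list of labels along a path, in the order in which the arrows are traversed. -/
def labels (D : ChainData) {u : D.Vertex} : {v : D.Vertex} → Quiver.Path u v → List Label
  | _, .nil => []
  | _, .cons P e => D.labels P ++ [e.1]

/-- The relations `xy = yx`, `ay = 0` and `c_r (x^(p/ℓ) - e^(πi/ℓ) η^r y^((q-1)/ℓ)) = 0`, as linear
combinations of parallel paths (`ay` means first `y`, then `a`). -/
inductive Relation (D : ChainData) : (u v : D.Vertex) → (Quiver.Path u v →₀ ℂ) → Prop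
  | comm (u v : D.Vertex) (P Q : Quiver.Path u v) (hP : D.labels P = [.x, .y])
      (hQ : D.labels Q = [.y, .x]) :
      Relation D u v (Finsupp.single P 1 - Finsupp.single Q 1)
  | ay (u v : D.Vertex) (P : Quiver.Path u v) (hP : D.labels P = [.y, .a]) :
      Relation D u v (Finsupp.single P 1)
  | cr (u : D.Vertex) (r : ℕ) (hr : r ∈ Finset.Icc 1 D.ℓ) (P Q : Quiver.Path u (.w r hr))
      (hP : D.labels P = List.replicate D.pl .x ++ [.c])
      (hQ : D.labels Q = List.replicate D.ql .y ++ [.c]) :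
      Relation D u (.w r hr) (Finsupp.single P 1 - D.ζ r • Finsupp.single Q 1)

/-- The paths from `u` to `v` component of the two-sided ideal of the path algebra generated by the
relations. -/
noncomputable def relIdeal (D : ChainData) (u v : D.Vertex) : Submodule ℂ (Quiver.Path u v →₀ ℂ) :=
  Submodule.span ℂ {f | ∃ (u' v' : D.Vertex) (P : Quiver.Path u u') (ρ : Quiver.Path u' v' →₀ ℂ)
    (Q : Quiver.Path v' v), D.Relation u' v' ρ ∧
      f = Finsupp.mapDomain (fun Z => (P.comp Z).comp Q) ρ}

/-- The component, spanned by the classes of paths from `u` to `v`, of the algebra of the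
quiver with relations. -/
abbrev QuiverAlg (D : ChainData) (u v : D.Vertex) : Type :=
  (Quiver.Path u v →₀ ℂ) ⧸ D.relIdeal u v

/-- The class of a path in the algebra of the quiver with relations. The product of the
classes of composable paths is the class of the concatenated path. -/
noncomputable def pathClass (D : ChainData) {u v : D.Vertex} (P : Quiver.Path u v) :
    D.QuiverAlg u v := Submodule.Quotient.mk (Finsupp.single P 1)

end ChainData

/-! ## Formality of `A∞`-categories with cohomology in degree zero -/

/-! Up to shifts and twists every object is the 2-periodic stabilisation of a cyclic module S/I: I
is a monomial ideal for `K₀`, the ideal (y) for `Ky`, and (w_r) for `Kw`. If K' resolves S/I in the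
sense of `Resolves`, then Hom(K, K') has the cohomology of Hom(K, S/I). Closed morphisms and
homotopies are thus controlled by a single row of their matrices, modulo I. The work is done by
`exists_primitive`, which reconstructs a homotopy from its row; it is used through
`isCoboundary_of_imageMem` (exactness) and `GradedMF.exists_cocycle` (existence). What remains is to
decide which elements of S of a given degree in L lie in I.

Targets `K₀`. The columns of d₀ except the last are the Hilbert–Burch syzygies between neighbouring
generators of the monomial ideal, and the last row of the adjugate consists of these generators
(`adjugate_last`, `mono_exact`). The ideal contains every monomial whose degree exceeds ix + (j+1)y
- c by the degree of a monomial (`exists_generator`). By a comparison of degrees (`K₀_neg`,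
`KyObj_neg`, `KwObj_neg`) only one summand of the source can contribute, and only if the source is
itself some `K₀`. Hence Hom(K_0^{i,j}, K_0^{i',j'}) is S in degree (i'-i)x + (j'-j)y, placed in
cohomological degree 0, and nothing maps from `Ky` or `Kw` to `K₀`.

Targets `Ky` and `Kw`, the sinks. Here I = (f) with f = y or f = w_r, and f is coprime to x. A
closed row (e_t) on `K₀` satisfies x^i e_t ≡ m_t e_0 modulo f, where the m_t are the generators of
the monomial ideal, so it is determined by e_0 (`dvd_mul_sub_mono_mul`). In cohomological degree 0
the entry e_0 is, modulo f, zero or a multiple of y^(J-j), where J is the row of the vertex with an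
arrow into the sink; in the other degrees it is divisible by x^i modulo f, which makes the morphism
exact. Between two sinks a morphism is killed either by coprimality of the factors of the potential
or by an explicit homotopy; only the scalar endomorphisms survive.

The quiver. The relation xy = yx brings a path between vertices `K₀` into the form "x first, then
y", so such paths modulo relations are the monomials of the appropriate degree. A path into a sink
ends with its unique incoming arrow, and the other relations amount to computing modulo f. With
`modulus` equal to 0, y or w_r, a combination of paths from a vertex `K₀` lies in the ideal of
relations if and only if its polynomial is divisible by the modulus, and if and only if the
associated closed morphism is exact (`mem_relIdeal_iff`).

Formality. For an A∞-category with cohomology in degree 0 the truncation in degrees ≤ 0 is an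
A∞-subcategory for reasons of degree. Its inclusion and its projection to the cohomology category
are both strict quasi-isomorphisms. The hypothesis concerns cohomology only, so it passes to every
A∞-category with isomorphic cohomology. -/

theorem lof_injective {ι : Type*} [DecidableEq ι] (M : ι → Type*)
    [∀ i, AddCommGroup (M i)] [∀ i, Module ℂ (M i)] (i : ι) :
    Function.Injective (DirectSum.lof ℂ ι M i) :=
  DFinsupp.single_injective (β := M)

theorem isInternal_range_lof {ι : Type*} [DecidableEq ι] (M : ι → Type*)
    [∀ i, AddCommGroup (M i)] [∀ i, Module ℂ (M i)] :
    DirectSum.IsInternal (fun i => LinearMap.range (DirectSum.lof ℂ ι M i)) := by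
  have hinj := lof_injective M
  let e : (⨁ i, M i) ≃ₗ[ℂ] ⨁ i, LinearMap.range (DirectSum.lof ℂ ι M i) :=
    DFinsupp.mapRange.linearEquiv (fun i => LinearEquiv.ofInjective _ (hinj i))
  have h : (DirectSum.coeLinearMap (fun i => LinearMap.range (DirectSum.lof ℂ ι M i))).comp
      e.toLinearMap = LinearMap.id := by
    refine DirectSum.linearMap_ext ℂ (fun i => ?_)
    ext1 f
    have h1 : e (DirectSum.lof ℂ _ _ i f) =
        DirectSum.lof ℂ _ _ i (LinearEquiv.ofInjective _ (hinj i) f) :=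
      DFinsupp.mapRange_single (hf := fun _ => map_zero _)
    simp only [LinearMap.comp_apply, LinearEquiv.coe_coe, h1, DirectSum.coeLinearMap_lof,
      LinearMap.id_apply]
    rfl
  have h2 : Function.Bijective ((DirectSum.coeLinearMap
      (fun i => LinearMap.range (DirectSum.lof ℂ ι M i))) ∘ e) := by
    have : ((DirectSum.coeLinearMap
        (fun i => LinearMap.range (DirectSum.lof ℂ ι M i))) ∘ e) = id :=
      funext fun x => LinearMap.congr_fun h x
    rw [this]; exact Function.bijective_id
  exact (Function.Bijective.of_comp_iff _ e.bijective).1 h2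

/-! ### Composition of cohomology classes. -/

namespace AInfCat

variable {V : Type}

theorem μ_congr (A : AInfCat.{u} V) {m n : ℕ} (h : m = n) (w : ℕ → A.carrier) :
    A.μ m (fun i => w i) = A.μ n (fun i => w i) := by
  subst h; rfl

theorem μ_eq_zero_of_entry (A : AInfCat.{u} V) {n : ℕ} (v : ℕ → A.carrier) {i : ℕ} (hi : i < n)
    (h : v i = 0) : A.μ n (fun i => v i) = 0 :=
  MultilinearMap.map_coord_zero _ (⟨i, hi⟩ : Fin n) h

theorem μ_one_apply (A : AInfCat.{u} V) (v : ℕ → A.carrier) :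
    A.μ 1 (fun i => v i) = A.μ₁ (v 0) := by
  show A.μ 1 _ = A.μ 1 _
  congr 1; funext i; rw [Subsingleton.elim i 0]; rfl

theorem μ_two_apply (A : AInfCat.{u} V) (v : ℕ → A.carrier) :
    A.μ 2 (fun i => v i) = A.μ₂ (v 0) (v 1) := by
  show A.μ 2 _ = A.μ 2 _
  congr 1; funext i; fin_cases i <;> rfl

theorem comp_mk (A : AInfCat.{u} V) {X Y Z : V} {m n k : ℤ} (h : m + n = k)
    (a : A.cocycles X Y m) (b : A.cocycles Y Z n) :
    A.comp h (Submodule.Quotient.mk a) (Submodule.Quotient.mk b) = Submodule.Quotient.mk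
      ((-1 : ℂ) ^ m • (⟨A.μ₂ a b, h ▸ A.μ₂_cocycle a.2 b.2⟩ : A.cocycles X Z k)) := rfl

theorem coh_mk_eq_zero (A : AInfCat.{u} V) {X Y : V} {n : ℤ} (a : A.cocycles X Y n) :
    (Submodule.Quotient.mk a : A.Coh X Y n) = 0 ↔ (a : A.carrier) ∈ A.coboundaries X Y n := by
  rw [Submodule.Quotient.mk_eq_zero]; rfl

/-- In the A∞-relation with three inputs the terms in which μ³ is applied to some μ¹ vanish on
cocycles. What is left says that the associator of μ² is -μ¹ of μ³. -/
theorem assoc_mem_coboundaries (A : AInfCat.{u} V) {X Y Z T : V} {l m n k : ℤ}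
    (hk : l + m + n = k) {a b c : A.carrier}
    (ha : a ∈ A.cocycles X Y l) (hb : b ∈ A.cocycles Y Z m) (hc : c ∈ A.cocycles Z T n) :
    A.μ₂ (A.μ₂ a b) c + (-1 : ℂ) ^ (l - 1) • A.μ₂ a (A.μ₂ b c) ∈ A.coboundaries X T k := by
  let O : ℕ → V := fun i => if i = 0 then X else if i = 1 then Y else if i = 2 then Z else T
  let g : ℕ → ℤ := fun i => if i = 0 then l else if i = 1 then m else n
  let w : ℕ → A.carrier := fun i => if i = 0 then a else if i = 1 then b else c
  have hw : ∀ i < 3, w i ∈ A.gr (O i) (O (i + 1)) (g i) := by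
    intro i hi
    interval_cases i
    · exact ha.1
    · exact hb.1
    · exact hc.1
  have ha0 : A.μ₁ a = 0 := ha.2
  have hb0 : A.μ₁ b = 0 := hb.2
  have hc0 : A.μ₁ c = 0 := hc.2
  have h := A.relation 3 O g w hw
  have hm := A.μ_mem 3 (by norm_num) O g w hw
  rw [Finset.sum_Icc_succ_top (by norm_num), Finset.sum_Icc_succ_top (by norm_num),
    Finset.Icc_self, Finset.sum_singleton] at h
  have z : ∀ r < 3, A.μ 3 (fun i => graft w r 1 (A.μ 1 (fun j => w (r + j))) i) = 0 := by
    intro r hr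
    refine A.μ_eq_zero_of_entry (i := r) _ hr ?_
    have e := A.μ_one_apply (fun j => w (r + j))
    simp only [add_zero] at e
    rw [e]
    interval_cases r <;> simp [graft, w, ha0, hb0, hc0]
  have z0 := z 0 (by norm_num)
  simp only [zero_add] at z0
  simp only [Nat.reduceAdd, Nat.reduceSub, Finset.sum_range_succ, Finset.range_zero,
    Finset.sum_empty, z0, z 1 (by norm_num), z 2 (by norm_num), smul_zero,
    zero_add, zpow_zero, one_smul] at h
  rw [A.μ_two_apply (graft w 0 2 _), A.μ_two_apply (graft w 1 2 _), A.μ_one_apply (graft w 0 3 _),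
    A.μ_two_apply w, A.μ_two_apply (fun j => w (1 + j))] at h
  have h' : A.μ₂ (A.μ₂ a b) c + (-1 : ℂ) ^ (l - 1) • A.μ₂ a (A.μ₂ b c)
      + A.μ₁ (A.μ 3 (fun i => w i)) = 0 := by
    simpa [graft, w, g] using h
  refine ⟨-A.μ 3 (fun i => w i), neg_mem ?_, ?_⟩
  · have e : (∑ i ∈ Finset.range 3, g i) + 2 - ((3 : ℕ) : ℤ) = k - 1 := by
      simp [Finset.sum_range_succ, g, ← hk]; ring
    rw [e] at hm
    exact hm
  · rw [map_neg, eq_neg_of_add_eq_zero_left h']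

theorem comp_assoc (A : AInfCat.{u} V) {X Y Z T : V} {l m n lm mn k : ℤ} (h1 : l + m = lm)
    (h2 : m + n = mn) (h3 : lm + n = k) (h4 : l + mn = k) (a : A.Coh X Y l) (b : A.Coh Y Z m)
    (c : A.Coh Z T n) :
    A.comp h3 (A.comp h1 a b) c = A.comp h4 a (A.comp h2 b c) := by
  obtain ⟨a, rfl⟩ := Submodule.Quotient.mk_surjective _ a
  obtain ⟨b, rfl⟩ := Submodule.Quotient.mk_surjective _ b
  obtain ⟨c, rfl⟩ := Submodule.Quotient.mk_surjective _ c
  simp only [comp_mk]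
  rw [← sub_eq_zero, ← Submodule.Quotient.mk_sub, coh_mk_eq_zero]
  have h := A.assoc_mem_coboundaries (k := k) (by omega) a.2 b.2 c.2
  have hs : ((-1 : ℂ) ^ (l - 1)) = - (-1 : ℂ) ^ l := by
    rw [zpow_sub_one₀ (by norm_num)]; norm_num
  have hl : ((-1 : ℂ) ^ l) * (-1 : ℂ) ^ l = 1 := by rw [← mul_zpow]; norm_num
  have hlm : ((-1 : ℂ) ^ lm) = (-1 : ℂ) ^ l * (-1 : ℂ) ^ m := by
    rw [← h1]; exact zpow_add₀ (by norm_num) _ _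
  -- The signs in `comp` give (-1)^m for the left bracketing and (-1)^(l+m) for the right one; the
  -- common factor (-1)^m leaves exactly the signed associator.
  convert Submodule.smul_mem _ ((-1 : ℂ) ^ m) h using 1
  simp only [Submodule.coe_sub, SetLike.val_smul, map_smul, LinearMap.smul_apply, smul_add,
    smul_smul, hs, hlm]
  generalize (-1 : ℂ) ^ l = u at *
  generalize (-1 : ℂ) ^ m = w at *
  rw [show u * w * u = w by linear_combination w * hl, mul_neg, neg_smul, mul_comm w u]
  abel

/-! ### The cohomology category as an A∞-category with only μ². -/

section Cohomology

open Classical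

/-- The inclusion of a summand into the total space of the cohomology category. -/
noncomputable def cohIncl (A : AInfCat.{u} V) (X Y : V) (n : ℤ) :
    A.Coh X Y n →ₗ[ℂ] ⨁ t : V × V × ℤ, A.Coh t.1 t.2.1 t.2.2 :=
  DirectSum.lof ℂ (V × V × ℤ) (fun t => A.Coh t.1 t.2.1 t.2.2) (X, Y, n)

/-- The sign is the one already present in `comp`, so the two cancel and this operation is induced
by μ² itself. -/
noncomputable def cohOpAux (A : AInfCat.{u} V) (X Y Y' Z : V) (m n : ℤ) :
    A.Coh X Y m →ₗ[ℂ] A.Coh Y' Z n →ₗ[ℂ] ⨁ t : V × V × ℤ, A.Coh t.1 t.2.1 t.2.2 :=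
  if h : Y = Y' then by
    subst h
    exact ((-1 : ℂ) ^ m) • (A.comp (X := X) (Y := Y) (Z := Z) (rfl : m + n = m + n)).compr₂
      (A.cohIncl X Z (m + n))
  else 0

/-- The operation `μ²(b, a) = (-1)^|a| b ∘ a` on cohomology. -/
noncomputable def cohOp (A : AInfCat.{u} V) :
    (⨁ t : V × V × ℤ, A.Coh t.1 t.2.1 t.2.2) →ₗ[ℂ]
      (⨁ t : V × V × ℤ, A.Coh t.1 t.2.1 t.2.2) →ₗ[ℂ]
        ⨁ t : V × V × ℤ, A.Coh t.1 t.2.1 t.2.2 :=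
  DirectSum.toModule ℂ _ _ fun s => LinearMap.flip <|
    DirectSum.toModule ℂ _ _ fun t => (A.cohOpAux s.1 s.2.1 t.1 t.2.1 s.2.2 t.2.2).flip

theorem cohOp_incl (A : AInfCat.{u} V) (X Y Z : V) {m n k : ℤ} (h : m + n = k)
    (a : A.Coh X Y m) (b : A.Coh Y Z n) :
    A.cohOp (A.cohIncl X Y m a) (A.cohIncl Y Z n b) =
      ((-1 : ℂ) ^ m) • A.cohIncl X Z k (A.comp h a b) := by
  subst h
  simp [cohOp, cohOpAux, cohIncl, DirectSum.toModule_lof]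

theorem cohOp_incl_of_ne (A : AInfCat.{u} V) (X Y Y' Z : V) (m n : ℤ) (h : Y ≠ Y')
    (a : A.Coh X Y m) (b : A.Coh Y' Z n) :
    A.cohOp (A.cohIncl X Y m a) (A.cohIncl Y' Z n b) = 0 := by
  simp [cohOp, cohOpAux, cohIncl, DirectSum.toModule_lof, h]

noncomputable def cohμ (A : AInfCat.{u} V) : (n : ℕ) →
    MultilinearMap ℂ (fun _ : Fin n => ⨁ t : V × V × ℤ, A.Coh t.1 t.2.1 t.2.2)
      (⨁ t : V × V × ℤ, A.Coh t.1 t.2.1 t.2.2)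
  | 2 => MultilinearMap.mk' (fun v => A.cohOp (v 0) (v 1))
      (fun v i x y => by fin_cases i <;> simp)
      (fun v i r x => by fin_cases i <;> simp)
  | _ => 0

theorem cohμ_two (A : AInfCat.{u} V) (v) : A.cohμ 2 v = A.cohOp (v 0) (v 1) := rfl

theorem cohμ_ne_two (A : AInfCat.{u} V) {n : ℕ} (h : n ≠ 2) : A.cohμ n = 0 := by
  match n, h with
  | 0, _ => rfl
  | 1, _ => rfl
  | n + 3, _ => rfl

/-- The cohomology category, as an `A∞`-category whose only operation is `μ²`. -/
noncomputable def cohCat (A : AInfCat.{u} V) : AInfCat.{u} V where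
  carrier := ⨁ t : V × V × ℤ, A.Coh t.1 t.2.1 t.2.2
  addCommGroup := inferInstance
  module := inferInstance
  gr X Y n := LinearMap.range (A.cohIncl X Y n)
  isInternal := isInternal_range_lof (fun t : V × V × ℤ => A.Coh t.1 t.2.1 t.2.2)
  μ := A.cohμ
  μ_zero := rfl
  μ_mem := by
    intro n hn X deg v hv
    by_cases h2 : n = 2
    · subst h2
      obtain ⟨f, hf⟩ := hv 0 (by norm_num)
      obtain ⟨g, hg⟩ := hv 1 (by norm_num)
      rw [cohμ_two]
      simp only [Fin.val_zero, Fin.val_one, ← hf, ← hg]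
      rw [A.cohOp_incl _ _ _ (k := (∑ i ∈ Finset.range 2, deg i) + 2 - ((2 : ℕ) : ℤ))
        (by simp [Finset.sum_range_succ])]
      exact Submodule.smul_mem _ _ ⟨_, rfl⟩
    · rw [cohμ_ne_two A h2]
      exact zero_mem _
  μ_eq_zero := by
    intro n X Y deg v hv hne
    obtain ⟨i, hi, hne⟩ := hne
    by_cases h2 : n = 2
    · subst h2
      obtain rfl : i = 0 := by omega
      obtain ⟨f, hf⟩ := hv 0 (by norm_num)
      obtain ⟨g, hg⟩ := hv 1 (by norm_num)
      rw [cohμ_two]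
      simp only [Fin.val_zero, Fin.val_one, ← hf, ← hg]
      exact A.cohOp_incl_of_ne _ _ _ _ _ _ hne _ _
    · rw [cohμ_ne_two A h2]
      rfl
  relation := by
    intro n X deg v hv
    by_cases h3 : n = 3
    · subst h3
      obtain ⟨a, ha⟩ := hv 0 (by norm_num)
      obtain ⟨b, hb⟩ := hv 1 (by norm_num)
      obtain ⟨c, hc⟩ := hv 2 (by norm_num)
      have h : A.cohOp (A.cohOp (v 0) (v 1)) (v 2) +
          ((-1 : ℂ) ^ (deg 0 - 1)) • A.cohOp (v 0) (A.cohOp (v 1) (v 2)) = 0 := by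
        rw [← ha, ← hb, ← hc, A.cohOp_incl _ _ _ rfl, A.cohOp_incl _ _ _ rfl]
        simp only [map_smul, LinearMap.smul_apply]
        rw [A.cohOp_incl _ _ _ (add_assoc (deg 0) (deg 1) (deg 2)), A.cohOp_incl _ _ _ rfl,
          A.comp_assoc rfl rfl _ rfl, smul_smul, smul_smul, smul_smul, ← add_smul]
        convert zero_smul ℂ _
        rw [zpow_add₀ (by norm_num), zpow_sub_one₀ (by norm_num)]
        have hl : ((-1 : ℂ) ^ deg 0) * (-1 : ℂ) ^ deg 0 = 1 := by rw [← mul_zpow]; norm_num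
        have hi : ((-1 : ℂ))⁻¹ = -1 := by norm_num
        rw [hi]
        ring
      have z1 : A.cohμ 1 = 0 := rfl
      have z3 : A.cohμ 3 = 0 := rfl
      rw [Finset.sum_Icc_succ_top (by norm_num), Finset.sum_Icc_succ_top (by norm_num),
        Finset.Icc_self, Finset.sum_singleton]
      simpa [Finset.sum_range_succ, graft, cohμ_two, z1, z3] using h
    · refine Finset.sum_eq_zero fun s hs => Finset.sum_eq_zero fun r hr => ?_
      rw [Finset.mem_Icc] at hs
      rw [Finset.mem_range] at hr
      by_cases h : n - s + 1 = 2
      · rw [cohμ_ne_two A (show s ≠ 2 by omega)]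
        rw [MultilinearMap.map_coord_zero _ (⟨r, hr⟩ : Fin (n - s + 1)) (by simp [graft])]
        simp
      · rw [cohμ_ne_two A h]; simp

end Cohomology

end AInfCat

/-! ### Strict functors -/

/-- For a strict functor all higher components vanish, so on the left of the functor equation only
the composition of n into ones survives. -/
theorem sum_composition_ones {M : Type*} [AddCommMonoid M] (n : ℕ) (F : Composition n → M)
    (h : ∀ c, (∃ b, c.blocksFun b ≠ 1) → F c = 0) : ∑ c, F c = F (Composition.ones n) := by
  refine Finset.sum_eq_single _ (fun c _ hc => h c ?_) (fun h => absurd (Finset.mem_univ _) h)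
  by_contra hb
  push Not at hb
  refine hc (Composition.eq_ones_iff.2 fun i hi => ?_)
  rw [← c.ofFn_blocksFun, List.mem_ofFn] at hi
  obtain ⟨b, rfl⟩ := hi
  exact hb b

namespace AInfCat

variable {V : Type}

def strictF {A : AInfCat.{u} V} {B : AInfCat.{v} V} (f : A.carrier →ₗ[ℂ] B.carrier) :
    (n : ℕ) → MultilinearMap ℂ (fun _ : Fin n => A.carrier) B.carrier
  | 1 => MultilinearMap.mk' (fun v => f (v 0))
      (fun v i x y => by
        obtain rfl : i = 0 := Subsingleton.elim _ _
        simp)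
      (fun v i r x => by
        obtain rfl : i = 0 := Subsingleton.elim _ _
        simp)
  | _ => 0

theorem strictF_one {A : AInfCat.{u} V} {B : AInfCat.{v} V} (f : A.carrier →ₗ[ℂ] B.carrier)
    {n : ℕ} (hn : n = 1) (w : ℕ → A.carrier) : strictF f n (fun i => w i) = f (w 0) := by
  subst hn; rfl

theorem strictF_ne_one {A : AInfCat.{u} V} {B : AInfCat.{v} V} (f : A.carrier →ₗ[ℂ] B.carrier)
    {n : ℕ} (hn : n ≠ 1) : strictF f n = 0 := by
  match n, hn with
  | 0, _ => rfl
  | n + 2, _ => rfl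

/-- The strict `A∞`-functor given by a linear map that commutes with all operations on composable
homogeneous elements. -/
def strictFunctor {A : AInfCat.{u} V} {B : AInfCat.{v} V} (f : A.carrier →ₗ[ℂ] B.carrier)
    (hmem : ∀ X Y n, ∀ a ∈ A.gr X Y n, f a ∈ B.gr X Y n)
    (hμ : ∀ (n : ℕ), 1 ≤ n → ∀ (X : ℕ → V) (deg : ℕ → ℤ) (v : ℕ → A.carrier),
      (∀ i < n, v i ∈ A.gr (X i) (X (i + 1)) (deg i)) →
        f (A.μ n (fun i => v i)) = B.μ n (fun i => f (v i))) : AInfFunctor A B where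
  F := strictF f
  F_zero := rfl
  F_mem n hn X deg v hv := by
    by_cases h : n = 1
    · subst h
      rw [strictF_one f rfl]
      have e : (∑ i ∈ Finset.range 1, deg i) + 1 - ((1 : ℕ) : ℤ) = deg 0 := by simp
      rw [e]
      exact hmem _ _ _ _ (hv 0 one_pos)
    · rw [strictF_ne_one f h]; exact zero_mem _
  F_eq_zero n X Y deg v hv hne := by
    obtain ⟨i, hi, -⟩ := hne
    rw [strictF_ne_one f (by omega)]; rfl
  relation n X deg v hv := by
    have hL := sum_composition_ones n (fun c => B.μ c.length
        (fun b => strictF f (c.blocksFun b) (fun i => v (c.sizeUpTo b + i)))) (by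
      rintro c ⟨b, hb⟩
      refine MultilinearMap.map_coord_zero _ b ?_
      rw [strictF_ne_one f hb]; rfl)
    rw [hL]
    have hL2 : (fun b : Fin (Composition.ones n).length => strictF f
        ((Composition.ones n).blocksFun b)
          (fun i => v ((Composition.ones n).sizeUpTo b + i))) = fun b : Fin _ => f (v b) := by
      funext b
      rw [strictF_one f (Composition.ones_blocksFun n b) (fun i => v (_ + i)),
        Composition.ones_sizeUpTo, min_eq_left]
      · rfl
      · exact b.2.le.trans (Composition.ones_length n).le
    rw [hL2]
    refine (μ_congr B (Composition.ones_length n) (fun b : ℕ => f (v b))).trans ?_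
    rcases Nat.eq_zero_or_pos n with rfl | hn
    · rw [B.μ_zero]; simp
    rw [Finset.sum_eq_single n]
    · rw [Nat.sub_self, zero_add, Finset.sum_range_one, Finset.sum_range_zero, zpow_zero,
        one_smul, strictF_one f rfl, ← hμ n hn X deg v hv]
      simp [graft]
    · intro s hs hsn
      rw [Finset.mem_Icc] at hs
      refine Finset.sum_eq_zero fun r _ => ?_
      rw [strictF_ne_one f (by omega)]; simp
    · intro h
      exact absurd (Finset.mem_Icc.2 ⟨hn, le_rfl⟩) h

/-! ### Truncation -/

/-- The summands of the canonical truncation in non-positive degrees. -/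
def lowGr (A : AInfCat.{u} V) (X Y : V) (n : ℤ) : Submodule ℂ A.carrier :=
  if n < 0 then A.gr X Y n else if n = 0 then A.cocycles X Y n else ⊥

theorem lowGr_neg (A : AInfCat.{u} V) (X Y : V) {n : ℤ} (h : n < 0) :
    A.lowGr X Y n = A.gr X Y n := if_pos h

theorem lowGr_zero (A : AInfCat.{u} V) (X Y : V) : A.lowGr X Y 0 = A.cocycles X Y 0 := by
  simp [lowGr]

theorem lowGr_pos (A : AInfCat.{u} V) (X Y : V) {n : ℤ} (h : 0 < n) : A.lowGr X Y n = ⊥ := by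
  rw [lowGr, if_neg (by omega), if_neg (by omega)]

theorem lowGr_le (A : AInfCat.{u} V) (X Y : V) (n : ℤ) : A.lowGr X Y n ≤ A.gr X Y n := by
  rcases lt_trichotomy n 0 with h | h | h
  · rw [A.lowGr_neg X Y h]
  · subst h; rw [lowGr_zero]; exact inf_le_left
  · rw [A.lowGr_pos X Y h]; exact bot_le

theorem cocycles_le_lowGr (A : AInfCat.{u} V) (X Y : V) {n : ℤ} (h : n ≤ 0) :
    A.cocycles X Y n ≤ A.lowGr X Y n := by
  rcases h.lt_or_eq with h | h
  · rw [A.lowGr_neg X Y h]; exact inf_le_left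
  · subst h; rw [lowGr_zero]

/-- On inputs of degree ≤ 0 the output of μ^n has degree at most 2 - n, so n ≥ 3 gives negative
degree and nothing has to be checked. For n = 2 degree 0 arises only from two cocycles of degree 0,
whose product is closed. For n = 1 the value is closed because μ¹ squares to zero. -/
theorem μ_mem_lowGr (A : AInfCat.{u} V) (n : ℕ) (hn : 1 ≤ n) (X : ℕ → V) (deg : ℕ → ℤ)
    (v : ℕ → A.carrier) (hv : ∀ i < n, v i ∈ A.lowGr (X i) (X (i + 1)) (deg i)) :
    A.μ n (fun i => v i) ∈ A.lowGr (X 0) (X n) ((∑ i ∈ Finset.range n, deg i) + 2 - n) := by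
  by_cases hp : ∃ i < n, 0 < deg i
  · obtain ⟨i, hi, hd⟩ := hp
    have h := hv i hi
    rw [A.lowGr_pos _ _ hd, Submodule.mem_bot] at h
    rw [A.μ_eq_zero_of_entry v hi h]
    exact zero_mem _
  push Not at hp
  have hs : ∑ i ∈ Finset.range n, deg i ≤ 0 :=
    Finset.sum_nonpos fun i hi => hp i (Finset.mem_range.1 hi)
  have hm := A.μ_mem n hn X deg v fun i hi => A.lowGr_le _ _ _ (hv i hi)
  by_cases h1 : n = 1
  · subst h1
    have h0 := hv 0 one_pos
    have hd := hp 0 one_pos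
    rw [A.μ_one_apply] at hm ⊢
    have e : (∑ i ∈ Finset.range 1, deg i) + 2 - ((1 : ℕ) : ℤ) = deg 0 + 1 := by simp; ring
    rw [e] at hm ⊢
    rcases hd.lt_or_eq with hd | hd
    · exact A.cocycles_le_lowGr _ _ (by omega)
        ⟨hm, A.μ₁_μ₁ (A.lowGr_le _ _ _ h0)⟩
    · rw [hd, lowGr_zero] at h0
      rw [show A.μ₁ (v 0) = 0 from h0.2]
      exact zero_mem _
  by_cases hd : (∑ i ∈ Finset.range n, deg i) + 2 - (n : ℤ) < 0
  · rw [A.lowGr_neg _ _ hd]; exact hm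
  obtain rfl : n = 2 := by omega
  have h0 := hv 0 (by norm_num)
  have h1 := hv 1 (by norm_num)
  have p0 := hp 0 (by norm_num)
  have p1 := hp 1 (by norm_num)
  simp only [Finset.sum_range_succ, Finset.sum_range_zero, zero_add] at hd
  have d0 : deg 0 = 0 := by omega
  have d1 : deg 1 = 0 := by omega
  rw [d0, lowGr_zero] at h0
  rw [d1, lowGr_zero] at h1
  have e : (∑ i ∈ Finset.range 2, deg i) + 2 - ((2 : ℕ) : ℤ) = 0 := by
    simp [Finset.sum_range_succ, d0, d1]
  rw [e, A.μ_two_apply, lowGr_zero]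
  exact A.μ₂_cocycle h0 h1

section Truncation

open Classical

abbrev LowCarrier (A : AInfCat.{u} V) : Type u :=
  ⨁ t : V × V × ℤ, A.lowGr t.1 t.2.1 t.2.2

noncomputable def lowIncl (A : AInfCat.{u} V) (X Y : V) (n : ℤ) :
    A.lowGr X Y n →ₗ[ℂ] A.LowCarrier :=
  DirectSum.lof ℂ (V × V × ℤ) (fun t => A.lowGr t.1 t.2.1 t.2.2) (X, Y, n)

noncomputable def lowι (A : AInfCat.{u} V) : A.LowCarrier →ₗ[ℂ] A.carrier :=
  DirectSum.coeLinearMap (fun t : V × V × ℤ => A.lowGr t.1 t.2.1 t.2.2)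

theorem lowι_incl (A : AInfCat.{u} V) (X Y : V) (n : ℤ) (a : A.lowGr X Y n) :
    A.lowι (A.lowIncl X Y n a) = a :=
  DirectSum.coeLinearMap_lof (fun t : V × V × ℤ => A.lowGr t.1 t.2.1 t.2.2) (X, Y, n) a

theorem lowι_injective (A : AInfCat.{u} V) : Function.Injective A.lowι := by
  have h := (A.isInternal.submodule_iSupIndep).mono
    (fun t : V × V × ℤ => A.lowGr_le t.1 t.2.1 t.2.2)
  exact h.dfinsupp_lsum_injective

/-- The operations must be defined on all elements of the total space, so an arbitrary linear
retraction is chosen; on composable homogeneous inputs the values of `A.μ` already lie in the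
truncation and the choice does not matter. -/
noncomputable def lowπ (A : AInfCat.{u} V) : A.carrier →ₗ[ℂ] A.LowCarrier :=
  (A.lowι.exists_leftInverse_of_injective (LinearMap.ker_eq_bot.2 A.lowι_injective)).choose

theorem lowπ_ι (A : AInfCat.{u} V) (x : A.LowCarrier) : A.lowπ (A.lowι x) = x :=
  LinearMap.congr_fun
    (A.lowι.exists_leftInverse_of_injective (LinearMap.ker_eq_bot.2 A.lowι_injective)).choose_spec x

theorem lowπ_of_mem (A : AInfCat.{u} V) {X Y : V} {n : ℤ} {a : A.carrier} (h : a ∈ A.lowGr X Y n) :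
    A.lowπ a = A.lowIncl X Y n ⟨a, h⟩ := by
  rw [← A.lowπ_ι (A.lowIncl X Y n ⟨a, h⟩), lowι_incl]

noncomputable def lowμ (A : AInfCat.{u} V) (n : ℕ) :
    MultilinearMap ℂ (fun _ : Fin n => A.LowCarrier) A.LowCarrier :=
  A.lowπ.compMultilinearMap ((A.μ n).compLinearMap fun _ => A.lowι)

theorem lowμ_apply (A : AInfCat.{u} V) (n : ℕ) (v : ℕ → A.LowCarrier) :
    A.lowμ n (fun i => v i) = A.lowπ (A.μ n (fun i => A.lowι (v i))) := rfl

theorem lowι_mem (A : AInfCat.{u} V) {X Y : V} {n : ℤ} {a : A.LowCarrier}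
    (h : a ∈ LinearMap.range (A.lowIncl X Y n)) : A.lowι a ∈ A.lowGr X Y n := by
  obtain ⟨b, rfl⟩ := h
  rw [lowι_incl]; exact b.2

/-- Composable inputs are covered by `μ_mem_lowGr`; for non-composable ones both sides are zero.
Homogeneity is demanded at every index, also beyond n, so that objects and degrees can be chosen for
the whole sequence. -/
theorem ι_lowμ (A : AInfCat.{u} V) {n : ℕ} (hn : 1 ≤ n) (v : ℕ → A.LowCarrier)
    (hv : ∀ i, ∃ X Y d, v i ∈ LinearMap.range (A.lowIncl X Y d)) :
    A.lowι (A.lowμ n (fun i => v i)) = A.μ n (fun i => A.lowι (v i)) := by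
  rw [lowμ_apply]
  choose X Y d h using hv
  by_cases hc : ∃ i, i + 1 < n ∧ Y i ≠ X (i + 1)
  · rw [A.μ_eq_zero n X Y d (fun i => A.lowι (v i))
      (fun i _ => A.lowGr_le _ _ _ (A.lowι_mem (h i))) hc]
    simp
  · push Not at hc
    have hm := A.μ_mem_lowGr n hn (fun i => if i = 0 then X 0 else Y (i - 1)) d
      (fun i => A.lowι (v i)) (by
        intro i hi
        have h1 := A.lowι_mem (h i)
        rcases Nat.eq_zero_or_pos i with rfl | h0
        · simpa using h1
        · have := hc (i - 1) (by omega)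
          rw [Nat.sub_add_cancel h0] at this
          simpa [h0.ne', this] using h1)
    rw [A.lowπ_of_mem hm, lowι_incl]

/-- The canonical truncation of an `A∞`-category in non-positive degrees. -/
noncomputable def lowCat (A : AInfCat.{u} V) : AInfCat.{u} V where
  carrier := A.LowCarrier
  addCommGroup := inferInstance
  module := inferInstance
  gr X Y n := LinearMap.range (A.lowIncl X Y n)
  isInternal := isInternal_range_lof (fun t : V × V × ℤ => A.lowGr t.1 t.2.1 t.2.2)
  μ := A.lowμ
  μ_zero := by
    refine MultilinearMap.ext fun v => ?_
    show A.lowπ (A.μ 0 _) = 0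
    rw [A.μ_zero, _root_.zero_apply, map_zero]
  μ_mem := by
    intro n hn X deg v hv
    rw [lowμ_apply, A.lowπ_of_mem (A.μ_mem_lowGr n hn X deg (fun i => A.lowι (v i))
      fun i hi => A.lowι_mem (hv i hi))]
    exact ⟨_, rfl⟩
  μ_eq_zero := by
    intro n X Y deg v hv hne
    rw [lowμ_apply, A.μ_eq_zero n X Y deg (fun i => A.lowι (v i))
      (fun i hi => A.lowGr_le _ _ _ (A.lowι_mem (hv i hi))) hne, map_zero]
  relation := by
    intro n X deg v hv
    apply A.lowι_injective
    rw [map_zero, ← A.relation n X deg (fun i => A.lowι (v i))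
      fun i hi => A.lowGr_le _ _ _ (A.lowι_mem (hv i hi)), map_sum]
    refine Finset.sum_congr rfl fun s hs => ?_
    rw [map_sum]
    refine Finset.sum_congr rfl fun r hr => ?_
    rw [Finset.mem_Icc] at hs
    rw [Finset.mem_range] at hr
    -- Only the first n entries of v are known to be homogeneous. Setting the later ones to 0 gives
    -- a sequence to which `ι_lowμ` applies without changing any operation involved.
    have h1 : ∀ i, ∃ w : A.LowCarrier, (∃ X Y d, w ∈ LinearMap.range (A.lowIncl X Y d)) ∧
        (i < n → w = v i) := by
      intro i
      by_cases hi : i < n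
      · exact ⟨v i, ⟨_, _, _, hv i hi⟩, fun _ => rfl⟩
      · exact ⟨0, ⟨X 0, X 0, 0, zero_mem _⟩, fun h => absurd h hi⟩
    choose w hw hwv using h1
    have e1 : A.lowμ s (fun j => v (r + j)) = A.lowμ s (fun j => w (r + j)) := by
      congr 1; funext j; rw [hwv]; omega
    have e2 : A.μ s (fun j => A.lowι (v (r + j))) = A.μ s (fun j => A.lowι (w (r + j))) := by
      congr 1; funext j; rw [hwv]; omega
    have h3 := A.ι_lowμ hs.1 (fun j => w (r + j)) (fun i => hw _)
    have h4 : ∃ X Y d, A.lowμ s (fun j => w (r + j)) ∈ LinearMap.range (A.lowIncl X Y d) := by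
      rw [← e1, A.lowμ_apply s (fun j => v (r + j)),
        A.lowπ_of_mem (A.μ_mem_lowGr s hs.1 (fun i => X (r + i)) (fun i => deg (r + i))
        (fun i => A.lowι (v (r + i))) fun i hi => A.lowι_mem (hv (r + i) (by omega)))]
      exact ⟨_, _, _, ⟨_, rfl⟩⟩
    have h5 := A.ι_lowμ (n := n - s + 1) (by omega)
      (graft w r s (A.lowμ s (fun j => w (r + j)))) (by
        intro i
        unfold graft
        split_ifs
        · exact hw _
        · exact h4
        · exact hw _)
    have e3 : (fun i : Fin (n - s + 1) => graft v r s (A.lowμ s (fun j => w (r + j))) i) =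
        fun i : Fin (n - s + 1) => graft w r s (A.lowμ s (fun j => w (r + j))) i := by
      funext i
      have := i.2
      unfold graft
      split_ifs
      · rw [hwv]; omega
      · rfl
      · rw [hwv]; omega
    rw [map_smul, e1, e3, h5, e2]
    congr 2
    funext i
    have := i.2
    unfold graft
    split_ifs
    · rw [hwv]; omega
    · exact h3
    · rw [hwv]; omega

/-- The inclusion of a summand into the total space of the truncation. -/
noncomputable def lowCatIncl (A : AInfCat.{u} V) (X Y : V) (n : ℤ) :
    A.lowGr X Y n →ₗ[ℂ] A.lowCat.carrier := A.lowIncl X Y n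

noncomputable def lowCatι (A : AInfCat.{u} V) : A.lowCat.carrier →ₗ[ℂ] A.carrier := A.lowι

noncomputable def cohCatIncl (A : AInfCat.{u} V) (X Y : V) (n : ℤ) :
    A.Coh X Y n →ₗ[ℂ] A.cohCat.carrier := A.cohIncl X Y n

theorem mem_lowCat_gr (A : AInfCat.{u} V) {X Y : V} {n : ℤ} {a : A.lowCat.carrier} :
    a ∈ A.lowCat.gr X Y n ↔ ∃ b, A.lowCatIncl X Y n b = a := Iff.rfl

theorem mem_cohCat_gr (A : AInfCat.{u} V) {X Y : V} {n : ℤ} {a : A.cohCat.carrier} :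
    a ∈ A.cohCat.gr X Y n ↔ ∃ b, A.cohCatIncl X Y n b = a := Iff.rfl

theorem lowCatι_incl (A : AInfCat.{u} V) (X Y : V) (n : ℤ) (a : A.lowGr X Y n) :
    A.lowCatι (A.lowCatIncl X Y n a) = a := A.lowι_incl X Y n a

theorem lowCatι_injective (A : AInfCat.{u} V) : Function.Injective A.lowCatι := A.lowι_injective

theorem lowCatι_mem (A : AInfCat.{u} V) {X Y : V} {n : ℤ} {a : A.lowCat.carrier}
    (h : a ∈ A.lowCat.gr X Y n) : A.lowCatι a ∈ A.lowGr X Y n := A.lowι_mem h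

theorem cohCat_μ₂ (A : AInfCat.{u} V) (X Y Z : V) {m n k : ℤ} (h : m + n = k)
    (a : A.Coh X Y m) (b : A.Coh Y Z n) :
    A.cohCat.μ₂ (A.cohCatIncl X Y m a) (A.cohCatIncl Y Z n b) =
      ((-1 : ℂ) ^ m) • A.cohCatIncl X Z k (A.comp h a b) := A.cohOp_incl X Y Z h a b

theorem lowCatι_μ (A : AInfCat.{u} V) (n : ℕ) (hn : 1 ≤ n) (X : ℕ → V) (deg : ℕ → ℤ)
    (v : ℕ → A.lowCat.carrier) (hv : ∀ i < n, v i ∈ A.lowCat.gr (X i) (X (i + 1)) (deg i)) :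
    A.lowCatι (A.lowCat.μ n (fun i => v i)) = A.μ n (fun i => A.lowCatι (v i)) := by
  show A.lowι (A.lowπ (A.μ n fun i => A.lowι (v i))) = _
  rw [A.lowπ_of_mem (A.μ_mem_lowGr n hn X deg (fun i => A.lowι (v i))
      fun i hi => A.lowι_mem (hv i hi)), lowι_incl]
  rfl

theorem lowCatι_μ₁ (A : AInfCat.{u} V) {X Y : V} {n : ℤ} {a : A.lowCat.carrier}
    (ha : a ∈ A.lowCat.gr X Y n) : A.lowCatι (A.lowCat.μ₁ a) = A.μ₁ (A.lowCatι a) := by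
  have h := A.lowCatι_μ 1 le_rfl (fun i => if i = 0 then X else Y) (fun _ => n) (fun _ => a)
    (by intro i hi; obtain rfl : i = 0 := by omega
        simpa using ha)
  exact h

theorem mem_lowCat_cocycles (A : AInfCat.{u} V) {X Y : V} {n : ℤ} {a : A.lowCat.carrier} :
    a ∈ A.lowCat.cocycles X Y n ↔
      a ∈ A.lowCat.gr X Y n ∧ A.lowCatι a ∈ A.cocycles X Y n := by
  refine ⟨fun h => ⟨h.1, A.lowGr_le _ _ _ (A.lowCatι_mem h.1), ?_⟩, fun h => ⟨h.1, ?_⟩⟩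
  · show A.μ₁ _ = 0
    rw [← A.lowCatι_μ₁ h.1, show A.lowCat.μ₁ a = 0 from h.2, map_zero]
  · refine A.lowCatι_injective ?_
    rw [A.lowCatι_μ₁ h.1, map_zero]
    exact h.2.2

/-- A primitive lives in degree n - 1 < 0, where the truncation removes nothing. -/
theorem mem_lowCat_coboundaries (A : AInfCat.{u} V) {X Y : V} {n : ℤ} (hn : n ≤ 0)
    {a : A.lowCat.carrier} (h : A.lowCatι a ∈ A.coboundaries X Y n) :
    a ∈ A.lowCat.coboundaries X Y n := by
  obtain ⟨b, hb, hba⟩ := h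
  have hb' : b ∈ A.lowGr X Y (n - 1) := by
    rw [A.lowGr_neg _ _ (by omega)]; exact hb
  refine ⟨A.lowCatIncl X Y (n - 1) ⟨b, hb'⟩, ⟨_, rfl⟩, A.lowCatι_injective ?_⟩
  rw [A.lowCatι_μ₁ (A.mem_lowCat_gr.2 ⟨⟨b, hb'⟩, rfl⟩), lowCatι_incl, ← hba]

/-- The inclusion of the truncation. -/
noncomputable def lowFunctor (A : AInfCat.{u} V) : AInfFunctor A.lowCat A :=
  strictFunctor (A := A.lowCat) A.lowCatι (fun _ _ _ _ ha => A.lowGr_le _ _ _ (A.lowCatι_mem ha)) A.lowCatι_μ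

/-- In degrees ≤ 0 the truncation has the same cocycles and coboundaries as A. In positive degrees
it is zero, and so is the cohomology of A by hypothesis. -/
theorem lowFunctor_isQuasiIso (A : AInfCat.{u} V)
    (h : ∀ X Y n, 0 < n → Subsingleton (A.Coh X Y n)) : A.lowFunctor.IsQuasiIso := by
  intro X Y n
  have e : ∀ a : A.lowCat.carrier, A.lowFunctor.F 1 (fun _ => a) = A.lowCatι a := fun _ => rfl
  refine ⟨fun a ha hb => ?_, fun b hb => ?_⟩
  · rw [e] at hb
    rcases le_or_gt n 0 with hn | hn
    · exact A.mem_lowCat_coboundaries hn hb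
    · have h0 := A.lowCatι_mem ha.1
      rw [A.lowGr_pos _ _ hn, Submodule.mem_bot] at h0
      rw [A.lowCatι_injective (h0.trans (map_zero _).symm)]
      exact zero_mem _
  · rcases le_or_gt n 0 with hn | hn
    · have hb' := A.cocycles_le_lowGr _ _ hn hb
      refine ⟨A.lowCatIncl X Y n ⟨b, hb'⟩, A.mem_lowCat_cocycles.2 ⟨⟨_, rfl⟩, ?_⟩, ?_⟩
      · rw [lowCatι_incl]; exact hb
      · rw [e, lowCatι_incl, sub_self]; exact zero_mem _
    · refine ⟨0, zero_mem _, ?_⟩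
      have := h X Y n hn
      have h0 := (A.coh_mk_eq_zero ⟨b, hb⟩).1 (Subsingleton.elim _ _)
      rw [e, map_zero, zero_sub]
      exact neg_mem h0

/-! ### Projection of the truncation to cohomology -/

noncomputable def lowToCohAux (A : AInfCat.{u} V) (X Y : V) (n : ℤ) :
    A.lowGr X Y n →ₗ[ℂ] A.Coh X Y n :=
  if h : n = 0 then
    (Submodule.mkQ _).comp (Submodule.inclusion (by subst h; rw [lowGr_zero]))
  else 0

noncomputable def lowToCoh (A : AInfCat.{u} V) :
    A.lowCat.carrier →ₗ[ℂ] A.cohCat.carrier :=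
  DirectSum.toModule ℂ (V × V × ℤ) A.cohCat.carrier fun t => (A.cohCatIncl t.1 t.2.1 t.2.2).comp (A.lowToCohAux t.1 t.2.1 t.2.2)

theorem lowToCoh_incl (A : AInfCat.{u} V) (X Y : V) (n : ℤ) (a : A.lowGr X Y n) :
    A.lowToCoh (A.lowCatIncl X Y n a) = A.cohCatIncl X Y n (A.lowToCohAux X Y n a) :=
  DirectSum.toModule_lof ℂ (N := A.cohCat.carrier)
    (φ := fun t : V × V × ℤ => (A.cohCatIncl t.1 t.2.1 t.2.2).comp
      (A.lowToCohAux t.1 t.2.1 t.2.2)) (X, Y, n) a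

theorem lowToCoh_zero (A : AInfCat.{u} V) {X Y : V} {a : A.lowCat.carrier}
    (ha : a ∈ A.lowCat.gr X Y 0) (h : A.lowCatι a ∈ A.cocycles X Y 0) :
    A.lowToCoh a = A.cohCatIncl X Y 0 (Submodule.Quotient.mk ⟨A.lowCatι a, h⟩) := by
  obtain ⟨b, rfl⟩ := A.mem_lowCat_gr.1 ha
  rw [lowToCoh_incl, lowToCohAux, dif_pos rfl]
  simp only [lowCatι_incl]
  rfl

theorem cohCat_gr_eq_bot (A : AInfCat.{u} V) (X Y : V) (n : ℤ) [Subsingleton (A.Coh X Y n)] :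
    A.cohCat.gr X Y n = ⊥ := by
  refine (Submodule.eq_bot_iff _).2 ?_
  rintro _ ⟨a, rfl⟩
  rw [Subsingleton.elim a 0]
  exact map_zero _

theorem lowToCoh_mem (A : AInfCat.{u} V) {X Y : V} {n : ℤ} {a : A.lowCat.carrier}
    (ha : a ∈ A.lowCat.gr X Y n) : A.lowToCoh a ∈ A.cohCat.gr X Y n := by
  obtain ⟨b, rfl⟩ := A.mem_lowCat_gr.1 ha
  rw [lowToCoh_incl]
  exact ⟨_, rfl⟩

/-- If the output degree is not 0, both sides lie in a zero space. With inputs of degree ≤ 0, output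
degree 0 leaves two cases: μ¹ of an element of degree -1, which is exact and maps to 0, and μ² of
two cocycles of degree 0, where the projection is multiplicative by the definition of `comp`. -/
theorem lowToCoh_μ (A : AInfCat.{u} V) (h : ∀ X Y n, n ≠ 0 → Subsingleton (A.Coh X Y n))
    (n : ℕ) (hn : 1 ≤ n) (X : ℕ → V) (deg : ℕ → ℤ)
    (v : ℕ → A.lowCat.carrier) (hv : ∀ i < n, v i ∈ A.lowCat.gr (X i) (X (i + 1)) (deg i)) :
    A.lowToCoh (A.lowCat.μ n (fun i => v i)) = A.cohCat.μ n (fun i => A.lowToCoh (v i)) := by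
  have m1 := A.lowToCoh_mem (A.lowCat.μ_mem n hn X deg v hv)
  have m2 := A.cohCat.μ_mem n hn X deg (fun i => A.lowToCoh (v i))
    fun i hi => A.lowToCoh_mem (hv i hi)
  by_cases hd : (∑ i ∈ Finset.range n, deg i) + 2 - (n : ℤ) = 0
  swap
  · have := h (X 0) (X n) _ hd
    rw [cohCat_gr_eq_bot, Submodule.mem_bot] at m1 m2
    rw [m1, m2]
  by_cases hp : ∃ i < n, 0 < deg i
  · obtain ⟨i, hi, hd⟩ := hp
    have h0 := A.lowCatι_mem (hv i hi)
    rw [A.lowGr_pos _ _ hd, Submodule.mem_bot] at h0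
    have h1 : v i = 0 := A.lowCatι_injective (h0.trans (map_zero _).symm)
    rw [A.lowCat.μ_eq_zero_of_entry v hi h1, map_zero,
      A.cohCat.μ_eq_zero_of_entry (fun i => A.lowToCoh (v i)) hi (by rw [h1, map_zero])]
  push Not at hp
  have hs : ∑ i ∈ Finset.range n, deg i ≤ 0 :=
    Finset.sum_nonpos fun i hi => hp i (Finset.mem_range.1 hi)
  by_cases h1 : n = 1
  · subst h1
    simp only [Finset.sum_range_one, Nat.cast_one] at hd
    have hg := hv 0 one_pos
    have hc := A.lowCat.μ₁_mem hg
    rw [show deg 0 + 1 = 0 by omega] at hc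
    have hb : A.lowCatι (A.lowCat.μ₁ (v 0)) ∈ A.coboundaries (X 0) (X 1) 0 := by
      rw [A.lowCatι_μ₁ hg]
      refine ⟨_, ?_, rfl⟩
      have := A.lowGr_le _ _ _ (A.lowCatι_mem hg)
      rwa [show deg 0 = 0 - 1 by omega] at this
    have hz : A.lowCatι (A.lowCat.μ₁ (v 0)) ∈ A.cocycles (X 0) (X 1) 0 := by
      have := A.lowCatι_mem hc
      rwa [lowGr_zero] at this
    rw [A.lowCat.μ_one_apply, A.lowToCoh_zero hc hz, (A.coh_mk_eq_zero _).2 hb, map_zero]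
    rfl
  obtain rfl : n = 2 := by omega
  have g0 := hv 0 (by norm_num)
  have g1 := hv 1 (by norm_num)
  have p0 := hp 0 (by norm_num)
  have p1 := hp 1 (by norm_num)
  simp only [Finset.sum_range_succ, Finset.sum_range_zero, zero_add] at hd
  rw [show deg 0 = 0 by push_cast at hd; omega] at g0
  rw [show deg 1 = 0 by push_cast at hd; omega] at g1
  have c0 := A.lowCatι_mem g0
  have c1 := A.lowCatι_mem g1
  rw [lowGr_zero] at c0 c1
  have hmu : A.lowCatι (A.lowCat.μ₂ (v 0) (v 1)) = A.μ₂ (A.lowCatι (v 0)) (A.lowCatι (v 1)) := by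
    rw [← A.lowCat.μ_two_apply, A.lowCatι_μ 2 (by norm_num) X deg v hv,
      A.μ_two_apply (fun i => A.lowCatι (v i))]
  have g2 := A.lowCat.μ₂_mem g0 g1
  have c2 := A.μ₂_cocycle c0 c1
  rw [← hmu, add_zero] at c2
  rw [A.lowCat.μ_two_apply, A.lowToCoh_zero g2 c2]
  rw [A.cohCat.μ_two_apply (fun i => A.lowToCoh (v i)), A.lowToCoh_zero g0 c0,
    A.lowToCoh_zero g1 c1, A.cohCat_μ₂ _ _ _ (add_zero 0), comp_mk]
  simp only [zpow_zero, one_smul, hmu]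

noncomputable def lowToCohFunctor (A : AInfCat.{u} V)
    (h : ∀ X Y n, n ≠ 0 → Subsingleton (A.Coh X Y n)) : AInfFunctor A.lowCat A.cohCat :=
  strictFunctor A.lowToCoh (fun _ _ _ _ ha => A.lowToCoh_mem ha)
    (A.lowToCoh_μ h)

theorem cohCatIncl_injective (A : AInfCat.{u} V) (X Y : V) (n : ℤ) :
    Function.Injective (A.cohCatIncl X Y n) :=
  lof_injective (fun t : V × V × ℤ => A.Coh t.1 t.2.1 t.2.2) (X, Y, n)

/-- In degree 0 this is the quotient map from cocycles to classes; in negative degrees every cocycle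
of A is exact and stays so in the truncation; in positive degrees the truncation is zero. -/
theorem lowToCohFunctor_isQuasiIso (A : AInfCat.{u} V)
    (h : ∀ X Y n, n ≠ 0 → Subsingleton (A.Coh X Y n)) : (A.lowToCohFunctor h).IsQuasiIso := by
  intro X Y n
  have e : ∀ a : A.lowCat.carrier, (A.lowToCohFunctor h).F 1 (fun _ => a) = A.lowToCoh a := fun _ => rfl
  have hcob : A.cohCat.coboundaries X Y n = ⊥ := by
    refine (Submodule.eq_bot_iff _).2 ?_
    rintro _ ⟨a, -, rfl⟩
    rfl
  have hcoc : ∀ b, b ∈ A.cohCat.cocycles X Y n ↔ b ∈ A.cohCat.gr X Y n :=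
    fun b => ⟨fun hb => hb.1, fun hb => ⟨hb, rfl⟩⟩
  rw [hcob]
  by_cases hn : n = 0
  · subst hn
    refine ⟨fun a ha hb => ?_, fun b hb => ?_⟩
    · have ha' := A.mem_lowCat_cocycles.1 ha
      rw [Submodule.mem_bot, e, A.lowToCoh_zero ha'.1 ha'.2] at hb
      have h0 := A.cohCatIncl_injective _ _ _ (hb.trans (map_zero _).symm)
      exact A.mem_lowCat_coboundaries le_rfl ((A.coh_mk_eq_zero _).1 h0)
    · obtain ⟨b, rfl⟩ := A.mem_cohCat_gr.1 ((hcoc b).1 hb)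
      obtain ⟨b, rfl⟩ := Submodule.Quotient.mk_surjective _ b
      have hb' := A.cocycles_le_lowGr _ _ le_rfl b.2
      have hc : A.lowCatι (A.lowCatIncl X Y 0 ⟨b, hb'⟩) ∈ A.cocycles X Y 0 := by
        rw [lowCatι_incl]; exact b.2
      refine ⟨A.lowCatIncl X Y 0 ⟨b, hb'⟩, A.mem_lowCat_cocycles.2 ⟨⟨_, rfl⟩, hc⟩, ?_⟩
      rw [Submodule.mem_bot, sub_eq_zero, e, A.lowToCoh_zero (A.mem_lowCat_gr.2 ⟨_, rfl⟩) hc]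
      simp only [lowCatι_incl]
  · have := h X Y n hn
    refine ⟨fun a ha _ => ?_, fun b hb => ?_⟩
    · have ha' := A.mem_lowCat_cocycles.1 ha
      rcases lt_or_gt_of_ne hn with hn | hn
      · exact A.mem_lowCat_coboundaries hn.le
          ((A.coh_mk_eq_zero ⟨_, ha'.2⟩).1 (Subsingleton.elim _ _))
      · have h0 := A.lowCatι_mem ha.1
        rw [A.lowGr_pos _ _ hn, Submodule.mem_bot] at h0
        rw [A.lowCatι_injective (h0.trans (map_zero _).symm)]
        exact zero_mem _
    · have hb := (hcoc b).1 hb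
      rw [cohCat_gr_eq_bot, Submodule.mem_bot] at hb
      refine ⟨0, zero_mem _, ?_⟩
      rw [e, map_zero, hb, sub_self]
      exact zero_mem _

end Truncation

/-- An `A∞`-category with cohomology concentrated in degree zero is formal. -/
theorem isFormal_of_subsingleton (A : AInfCat.{u} V)
    (h : ∀ X Y n, n ≠ 0 → Subsingleton (A.Coh X Y n)) : IsFormal A :=
  ⟨A.cohCat, fun _ hn => A.cohμ_ne_two hn,
    .trans _ A.lowCat _
      (.symm _ _ (.rel _ _ ⟨A.lowFunctor,
        A.lowFunctor_isQuasiIso fun X Y n hn => h X Y n hn.ne'⟩))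
      (.rel _ _ ⟨A.lowToCohFunctor h, A.lowToCohFunctor_isQuasiIso h⟩)⟩

/-- Concentration in degree 0 is a property of the cohomology spaces alone, so it is inherited by
any A with isomorphic cohomology. -/
theorem intrinsicallyFormal_of_subsingleton (B : AInfCat.{v} V)
    (h : ∀ X Y n, n ≠ 0 → Subsingleton (B.Coh X Y n)) : IntrinsicallyFormal.{u, v} B := by
  rintro A ⟨e⟩
  refine A.isFormal_of_subsingleton fun X Y n hn => ?_
  have := h X Y n hn
  exact (e.equiv X Y n).toEquiv.subsingleton

end AInfCat

/-! ## Morphism complexes into resolved factorisations -/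

namespace GradedMF

variable {L : Type} [AddCommGroup L] {deg : Fin 2 → L} {W : PolyXY} {c : L}

/-- The differential `∂f = d f - (-1)^n f d` on families of matrices. -/
noncomputable def dRaw (K K' : GradedMF deg W c) (n : ℤ)
    (f : ℤ → Matrix (Fin K'.rank) (Fin K.rank) PolyXY) :
    ℤ → Matrix (Fin K'.rank) (Fin K.rank) PolyXY :=
  fun i => K'.d (i + n) * f i - ((-1 : ℂ) ^ n) • (f (i + 1) * K.d i)

/-- A closed morphism of degree `n`. -/
def IsCocycle (K K' : GradedMF deg W c) (n : ℤ)
    (f : ℤ → Matrix (Fin K'.rank) (Fin K.rank) PolyXY) : Prop :=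
  f ∈ K.Hom K' n ∧ dRaw K K' n f = 0

/-- An exact morphism of degree `n`. -/
def IsCoboundary (K K' : GradedMF deg W c) (n : ℤ)
    (f : ℤ → Matrix (Fin K'.rank) (Fin K.rank) PolyXY) : Prop :=
  ∃ g ∈ K.Hom K' (n - 1), dRaw K K' (n - 1) g = f

theorem eq_of_add_two {α : Type*} {f : ℤ → α} (h : ∀ i, f (i + 2) = f i) (i m : ℤ) :
    f (i + 2 * m) = f i := by
  induction m using Int.induction_on with
  | zero => simp
  | succ m ih => rw [← ih, ← h (i + 2 * m)]; congr 1; ring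
  | pred m ih => rw [← ih, ← h (i + 2 * (-m - 1))]; congr 1; ring

theorem s_add_two_mul (K : GradedMF deg W c) (i m : ℤ) (a : Fin K.rank) :
    K.s (i + 2 * m) a = K.s i a + m • c := by
  induction m using Int.induction_on with
  | zero => simp
  | succ m ih =>
    rw [show i + 2 * ((m : ℤ) + 1) = i + 2 * m + 2 by ring, K.s_add_two, ih, add_smul, one_smul,
      add_assoc]
  | pred m ih =>
    have h := K.s_add_two (i + 2 * (-m - 1)) a
    rw [show i + 2 * (-(m : ℤ) - 1) + 2 = i + 2 * (-m) by ring, ih] at h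
    rw [eq_sub_of_add_eq h.symm, sub_smul, one_smul, add_sub_assoc]

theorem s_sub_s (K K' : GradedMF deg W c) {i j i' j' : ℤ} (m : ℤ) (hi : i' = i + 2 * m)
    (hj : j' = j + 2 * m) (b : Fin K'.rank) (a : Fin K.rank) :
    K'.s i' b - K.s j' a = K'.s i b - K.s j a := by
  rw [hi, hj, s_add_two_mul, s_add_two_mul, add_sub_add_right_eq_sub]

/-- The complex `K'` around the position `z` resolves the cokernel of the row `κ` of the
differential into position `z`. -/
structure Resolves (K' : GradedMF deg W c) (z : ℤ) (κ : Fin K'.rank) : Prop where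
  -- By periodicity d (z - 1) = d (z + 1), so its row κ may be applied to elements in position z +
  -- 1. The requirement b κ = 0 says that the columns of d z other than κ already generate the
  -- syzygies of that row.
  exact : ∀ (σ : L) (r : Fin K'.rank → PolyXY),
    (∀ t, IsWeightedHomogeneous deg (r t) (K'.s (z + 1) t - σ)) →
    ∑ t, K'.d (z - 1) κ t * r t = 0 →
    ∃ b : Fin K'.rank → PolyXY, b κ = 0 ∧
      (∀ s, IsWeightedHomogeneous deg (b s) (K'.s z s - σ)) ∧ (K'.d z).mulVec b = r

/-- `p` lies in the ideal generated by the row `κ` of the differential into position `z`, with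
homogeneous coefficients. -/
def ImageMem (K' : GradedMF deg W c) (z : ℤ) (κ : Fin K'.rank) (σ : L) (p : PolyXY) : Prop :=
  ∃ O : Fin K'.rank → PolyXY,
    (∀ t, IsWeightedHomogeneous deg (O t) (K'.s (z - 1) t - σ)) ∧
    ∑ t, K'.d (z - 1) κ t * O t = p

theorem ImageMem.zero (K' : GradedMF deg W c) (z : ℤ) (κ : Fin K'.rank) (σ : L) :
    ImageMem K' z κ σ 0 :=
  ⟨0, fun _ => isWeightedHomogeneous_zero ℂ deg _, by simp⟩

theorem ImageMem.add {K' : GradedMF deg W c} {z : ℤ} {κ : Fin K'.rank} {σ : L} {p q : PolyXY}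
    (hp : ImageMem K' z κ σ p) (hq : ImageMem K' z κ σ q) : ImageMem K' z κ σ (p + q) := by
  obtain ⟨O, hO, rfl⟩ := hp
  obtain ⟨P, hP, rfl⟩ := hq
  exact ⟨O + P, fun t => (hO t).add (hP t), by simp [mul_add, Finset.sum_add_distrib]⟩

theorem smul_homogeneous {p : PolyXY} {l : L} (r : ℂ) (h : IsWeightedHomogeneous deg p l) :
    IsWeightedHomogeneous deg (r • p) l :=
  Submodule.smul_mem (weightedHomogeneousSubmodule ℂ deg l) r h

theorem ImageMem.smul {K' : GradedMF deg W c} {z : ℤ} {κ : Fin K'.rank} {σ : L} {p : PolyXY}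
    (r : ℂ) (hp : ImageMem K' z κ σ p) : ImageMem K' z κ σ (r • p) := by
  obtain ⟨O, hO, rfl⟩ := hp
  exact ⟨r • O, fun t => smul_homogeneous r (hO t), by simp [Finset.smul_sum]⟩

theorem neg_one_zpow_mul_self (n : ℤ) : ((-1 : ℂ) ^ n) * (-1 : ℂ) ^ n = 1 := by
  rw [← mul_zpow]; norm_num

theorem neg_one_zpow_succ (n : ℤ) : ((-1 : ℂ) ^ (n + 1)) = -(-1 : ℂ) ^ n := by
  rw [zpow_add_one₀ (by norm_num)]; ring

/-- A morphism of degree `n` is given by its components in two consecutive positions. -/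
theorem exists_mem_Hom (K K' : GradedMF deg W c) (n i₀ : ℤ)
    (E O : Matrix (Fin K'.rank) (Fin K.rank) PolyXY)
    (hE : ∀ b a, IsWeightedHomogeneous deg (E b a) (K'.s (i₀ + n) b - K.s i₀ a))
    (hO : ∀ b a, IsWeightedHomogeneous deg (O b a) (K'.s (i₀ - 1 + n) b - K.s (i₀ - 1) a)) :
    ∃ f ∈ K.Hom K' n, f i₀ = E ∧ f (i₀ - 1) = O := by
  refine ⟨fun i => if Even (i - i₀) then E else O, ⟨fun i => ?_, fun i b a => ?_⟩, ?_, ?_⟩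
  · have : Even (i + 2 - i₀) ↔ Even (i - i₀) := by
      rw [show i + 2 - i₀ = i - i₀ + 2 by ring]; simp
    simp only [this]
  · by_cases h : Even (i - i₀)
    · simp only [h, if_true]
      obtain ⟨m, hm⟩ := h
      rw [s_sub_s K K' (i := i₀ + n) (j := i₀) m (by omega) (by omega)]
      exact hE b a
    · simp only [h, if_false]
      obtain ⟨m, hm⟩ := Int.not_even_iff_odd.1 h
      rw [s_sub_s K K' (i := i₀ - 1 + n) (j := i₀ - 1) (m + 1) (by omega) (by omega)]
      exact hO b a
  · simp
  · have : ¬ Even (i₀ - 1 - i₀) := by rw [show i₀ - 1 - i₀ = -1 by ring]; decide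
    simp only [this, if_false]

theorem dRaw_periodic (K K' : GradedMF deg W c) (n : ℤ)
    {f : ℤ → Matrix (Fin K'.rank) (Fin K.rank) PolyXY} (hf : ∀ i, f (i + 2) = f i) (i : ℤ) :
    dRaw K K' n f (i + 2) = dRaw K K' n f i := by
  unfold dRaw
  rw [hf, K.d_add_two, add_right_comm i 2 n, add_right_comm i 2 1, K'.d_add_two, hf]

theorem eq_of_two {α : Type*} {f g : ℤ → α} (hf : ∀ i, f (i + 2) = f i)
    (hg : ∀ i, g (i + 2) = g i) (i₀ : ℤ) (h0 : f i₀ = g i₀) (h1 : f (i₀ - 1) = g (i₀ - 1)) :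
    f = g := by
  funext i
  rcases Int.even_or_odd (i - i₀) with ⟨m, hm⟩ | ⟨m, hm⟩
  · rw [show i = i₀ + 2 * m by omega, eq_of_add_two hf, eq_of_add_two hg, h0]
  · rw [show i = i₀ - 1 + 2 * (m + 1) by omega, eq_of_add_two hf, eq_of_add_two hg, h1]

/-- Multiplying by the next differential turns d A = 0 into W A = 0. -/
theorem d_mul_cancel (K : GradedMF deg W c) (hW : W ≠ 0) (i : ℤ) {n : ℕ}
    {A : Matrix (Fin K.rank) (Fin n) PolyXY} (h : K.d i * A = 0) : A = 0 := by
  have h1 : K.d (i + 1) * (K.d i * A) = 0 := by rw [h, Matrix.mul_zero]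
  rw [← Matrix.mul_assoc, K.d_mul_d, Matrix.smul_mul, Matrix.one_mul] at h1
  ext1 b a
  have h2 := congrFun (congrFun h1 b) a
  simp only [Matrix.smul_apply, Matrix.zero_apply, smul_eq_mul] at h2
  exact (mul_eq_zero.1 h2).resolve_left hW

theorem d_pred (K : GradedMF deg W c) (i : ℤ) : K.d (i - 1) = K.d (i + 1) := by
  rw [← K.d_add_two (i - 1)]; congr 1; ring

theorem s_succ (K : GradedMF deg W c) (i : ℤ) (a : Fin K.rank) :
    K.s (i + 1) a = K.s (i - 1) a + c := by
  rw [← K.s_add_two (i - 1)]; congr 1; ring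

/-- A closed morphism `f` is the differential of a morphism `η` whose component `κ` at the
position `z` of the target is a prescribed row `g`, as soon as this is so up to elements of the
ideal resolved by the target. -/
theorem exists_primitive (hW : W ≠ 0) {K K' : GradedMF deg W c} {z : ℤ} {κ : Fin K'.rank}
    (hR : K'.Resolves z κ) {n i₀ : ℤ} (hi : i₀ + n = z)
    {f : ℤ → Matrix (Fin K'.rank) (Fin K.rank) PolyXY} (hf : K.IsCocycle K' (n + 1) f)
    (g : Fin K.rank → PolyXY)
    (hg : ∀ a, IsWeightedHomogeneous deg (g a) (K'.s z κ - K.s i₀ a))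
    (hI : ∀ a, K'.ImageMem z κ (K.s (i₀ - 1) a)
      (f (i₀ - 1) κ a + ((-1 : ℂ) ^ n) • Matrix.vecMul g (K.d (i₀ - 1)) a)) :
    ∃ η ∈ K.Hom K' n, dRaw K K' n η = f ∧ ∀ a, η i₀ κ a = g a := by
  obtain ⟨⟨hp, hh⟩, hc⟩ := hf
  have hε := neg_one_zpow_mul_self n
  have c0 := congrFun hc (i₀ - 1)
  have c1 := congrFun hc i₀
  have hf1 : f (i₀ + 1) = f (i₀ - 1) := by rw [← hp (i₀ - 1)]; congr 1; ring
  have hh0 := hh (i₀ - 1)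
  have hh1 := hh i₀
  simp only [dRaw, neg_one_zpow_succ, neg_smul, sub_neg_eq_add, Pi.zero_apply, sub_add_cancel,
    hf1, ← K'.d_pred, show i₀ - 1 + (n + 1) = z by omega,
    show i₀ + (n + 1) = z + 1 by omega] at c0 c1 hh0 hh1
  have q0 : K.d i₀ * K.d (i₀ - 1) = W • (1 : Matrix _ _ PolyXY) := by
    rw [← K.d_mul_d (i₀ - 1)]; congr 2; ring
  have q1 : K.d (i₀ - 1) * K.d i₀ = W • (1 : Matrix _ _ PolyXY) := by
    rw [d_pred, K.d_mul_d]
  have q2 : K'.d z * K'.d (z - 1) = W • (1 : Matrix _ _ PolyXY) := by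
    rw [← K'.d_mul_d (z - 1)]; congr 2; ring
  have q3 : K'.d (z - 1) * K'.d z = W • (1 : Matrix _ _ PolyXY) := by
    rw [d_pred, K'.d_mul_d]
  have hd1 := K.d_homogeneous i₀
  generalize hεdef : (-1 : ℂ) ^ n = ε at *
  -- O will be the component of η in position i₀ - 1: it lifts the row prescribed by f and g through
  -- row κ of the differential.
  choose O' hO hOsum using hI
  set O : Matrix (Fin K'.rank) (Fin K.rank) PolyXY := Matrix.of fun t a => O' a t with hOdef
  have hrow : (K'.d (z - 1) * O) κ = f (i₀ - 1) κ + ε • Matrix.vecMul g (K.d (i₀ - 1)) := by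
    funext a
    rw [Matrix.mul_apply]
    exact hOsum a
  -- The equation dη = f in position i₀ reads d z * E = R for the unknown component E = η i₀.
  set R := f i₀ + ε • (O * K.d i₀) with hRdef
  have hO1 : ∀ t a, IsWeightedHomogeneous deg ((O * K.d i₀) t a) (K'.s (z + 1) t - K.s i₀ a) := by
    intro t a
    refine mul_homogeneous (u := fun t => K'.s (z + 1) t) (v := fun b => K.s (i₀ + 1) b)
      (w := K.s i₀) ?_ hd1 t a
    intro b a
    rw [s_succ, s_succ, add_sub_add_right_eq_sub]
    exact hO a b
  have hRh : ∀ t a, IsWeightedHomogeneous deg (R t a) (K'.s (z + 1) t - K.s i₀ a) :=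
    fun t a => (hh1 t a).add (smul_homogeneous ε (hO1 t a))
  have hRow : (K'.d (z - 1) * R) κ = W • g := by
    rw [hRdef, Matrix.mul_add, Matrix.mul_smul, ← Matrix.mul_assoc]
    have h1 : K'.d (z - 1) * f i₀ = -(ε • (f (i₀ - 1) * K.d i₀)) := eq_neg_of_add_eq_zero_left c1
    have h2 : (K'.d (z - 1) * O * K.d i₀) κ = (f (i₀ - 1) * K.d i₀) κ + ε • (W • g) := by
      rw [Matrix.mul_apply_eq_vecMul, hrow, Matrix.add_vecMul, Matrix.smul_vecMul,
        Matrix.vecMul_vecMul, q1, Matrix.vecMul_smul, Matrix.vecMul_one,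
        ← Matrix.mul_apply_eq_vecMul]
    have h3 : (K'.d (z - 1) * f i₀ + ε • (K'.d (z - 1) * O * K.d i₀)) κ =
        (K'.d (z - 1) * f i₀) κ + ε • (K'.d (z - 1) * O * K.d i₀) κ := rfl
    have h4 : (-(ε • (f (i₀ - 1) * K.d i₀))) κ = -(ε • (f (i₀ - 1) * K.d i₀) κ) := rfl
    rw [h3, h1, h2, h4, smul_add, smul_smul, hε, one_smul]
    abel
  -- Row κ of d (z - 1) maps R to W g, and by (d d)_κκ = W it maps column κ of d z times g to the
  -- same value. The difference is therefore a syzygy and comes from some b with b κ = 0; inserting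
  -- g in place κ gives E.
  have hb := fun a => hR.exact (K.s i₀ a) (fun t => R t a - K'.d z t κ * g a)
    (fun t => by
      refine (hRh t a).sub ?_
      have := (K'.d_homogeneous z t κ).mul (hg a)
      rwa [sub_add_sub_cancel] at this)
    (by
      have h1 := congrFun hRow a
      rw [Matrix.mul_apply] at h1
      have h2 := congrFun (congrFun q3 κ) κ
      rw [Matrix.mul_apply] at h2
      simp only [Matrix.smul_apply, Matrix.one_apply_eq, smul_eq_mul, mul_one] at h2
      simp only [mul_sub, Finset.sum_sub_distrib, h1, ← mul_assoc, ← Finset.sum_mul, h2,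
        Pi.smul_apply, smul_eq_mul, sub_self])
  choose b hbκ hbh hbe using hb
  set E : Matrix (Fin K'.rank) (Fin K.rank) PolyXY :=
    Matrix.of fun s a => if s = κ then g a else b a s with hEdef
  have hE : K'.d z * E = R := by
    ext1 t a
    have h1 := congrFun (hbe a) t
    rw [Matrix.mulVec, dotProduct] at h1
    rw [Matrix.mul_apply, ← sub_add_cancel (R t a) (K'.d z t κ * g a), ← h1,
      ← Finset.add_sum_erase _ _ (Finset.mem_univ κ),
      ← Finset.add_sum_erase _ (fun s => K'.d z t s * b a s) (Finset.mem_univ κ), hbκ, mul_zero,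
      zero_add, add_comm]
    congr 1
    · refine Finset.sum_congr rfl fun s hs => ?_
      simp [hEdef, Finset.ne_of_mem_erase hs]
    · simp [hEdef]
  obtain ⟨η, hη, hη0, hη1⟩ := exists_mem_Hom K K' n i₀ E O (by
      intro s a
      rw [hi]
      by_cases hs : s = κ
      · subst hs; simpa [hEdef] using hg a
      · simpa [hEdef, hs] using hbh a s) (by
      intro t a
      rw [show i₀ - 1 + n = z - 1 by omega]
      exact hO a t)
  refine ⟨η, hη, ?_, fun a => by rw [hη0]; simp [hEdef]⟩
  have hη2 : η (i₀ + 1) = O := by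
    rw [← hη1, ← hη.1 (i₀ - 1)]; congr 1; ring
  refine eq_of_two (dRaw_periodic K K' n hη.1) hp i₀ ?_ ?_
  · simp only [dRaw, hi, hη0, hη2, hE, hRdef, hεdef]
    abel
  · simp only [dRaw, show i₀ - 1 + n = z - 1 by omega, sub_add_cancel, hη0, hη1, hεdef]
    rw [← sub_eq_zero]
    -- The remaining equation, in position i₀ - 1, holds after multiplication by d z, which is
    -- injective.
    refine K'.d_mul_cancel hW z ?_
    rw [Matrix.mul_sub, Matrix.mul_sub, ← Matrix.mul_assoc, q2, Matrix.mul_smul, ← Matrix.mul_assoc,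
      hE, hRdef, Matrix.add_mul, Matrix.smul_mul, Matrix.one_mul, Matrix.smul_mul, Matrix.mul_assoc O,
      q0, smul_add, smul_smul, hε, one_smul, Matrix.mul_smul, Matrix.mul_one,
      eq_neg_of_add_eq_zero_left c0]
    abel

/-- A sufficient condition for a closed morphism to be exact. -/
theorem isCoboundary_of_imageMem (hW : W ≠ 0) {K K' : GradedMF deg W c} {z : ℤ}
    {κ : Fin K'.rank} (hR : K'.Resolves z κ) {n i₀ : ℤ} (hi : i₀ + n = z)
    {f : ℤ → Matrix (Fin K'.rank) (Fin K.rank) PolyXY} (hf : K.IsCocycle K' n f)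
    (g : Fin K.rank → PolyXY)
    (hg : ∀ a, IsWeightedHomogeneous deg (g a) (K'.s z κ - K.s (i₀ + 1) a))
    (hI : ∀ a, K'.ImageMem z κ (K.s i₀ a) (f i₀ κ a + Matrix.vecMul g (K.d i₀) a)) :
    K.IsCoboundary K' n f := by
  have hε := neg_one_zpow_mul_self (n - 1)
  obtain ⟨η, h1, h2, -⟩ := exists_primitive hW hR (n := n - 1) (i₀ := i₀ + 1) (by omega)
    (f := f) (by rwa [sub_add_cancel]) (((-1 : ℂ) ^ (n - 1)) • g)
    (fun a => smul_homogeneous _ (hg a)) (by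
      intro a
      rw [add_sub_cancel_right, Matrix.smul_vecMul, Pi.smul_apply, smul_smul, hε, one_smul]
      exact hI a)
  exact ⟨η, h1, h2⟩

/-- Existence of closed morphisms with a prescribed row. -/
theorem exists_cocycle (hW : W ≠ 0) {K K' : GradedMF deg W c} {z : ℤ}
    {κ : Fin K'.rank} (hR : K'.Resolves z κ) {n i₀ : ℤ} (hi : i₀ + n = z)
    (g : Fin K.rank → PolyXY)
    (hg : ∀ a, IsWeightedHomogeneous deg (g a) (K'.s z κ - K.s i₀ a))
    (hI : ∀ a, K'.ImageMem z κ (K.s (i₀ - 1) a) (Matrix.vecMul g (K.d (i₀ - 1)) a)) :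
    ∃ η, K.IsCocycle K' n η ∧ ∀ a, η i₀ κ a = g a := by
  have h0 : K.IsCocycle K' (n + 1) 0 :=
    ⟨zero_mem _, by funext i; simp [dRaw]⟩
  obtain ⟨η, h1, h2, h3⟩ := exists_primitive hW hR hi h0 g hg (by
    intro a
    rw [Pi.zero_apply, Matrix.zero_apply, zero_add]
    exact (hI a).smul _)
  exact ⟨η, ⟨h1, h2⟩, h3⟩

/-- The row of a closed morphism is closed modulo the ideal resolved by the target. -/
theorem IsCocycle.vecMul_mem {K K' : GradedMF deg W c} {n : ℤ}
    {f : ℤ → Matrix (Fin K'.rank) (Fin K.rank) PolyXY} (hf : K.IsCocycle K' n f) {z i₀ : ℤ}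
    (hi : i₀ + n = z) (κ : Fin K'.rank) (a : Fin K.rank) :
    Matrix.vecMul (f i₀ κ) (K.d (i₀ - 1)) a =
      ((-1 : ℂ) ^ n) • ∑ t, K'.d (z - 1) κ t * f (i₀ - 1) t a := by
  have h := congrFun (congrFun (congrFun hf.2 (i₀ - 1)) κ) a
  simp only [dRaw, sub_add_cancel, show i₀ - 1 + n = z - 1 by omega] at h
  rw [Matrix.sub_apply, Matrix.smul_apply, Pi.zero_apply, Matrix.zero_apply, sub_eq_zero,
    Matrix.mul_apply, Matrix.mul_apply_eq_vecMul] at h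
  rw [h, smul_smul, neg_one_zpow_mul_self, one_smul]

theorem IsCocycle.comp {K K' K'' : GradedMF deg W c}
    {f : ℤ → Matrix (Fin K'.rank) (Fin K.rank) PolyXY}
    {g : ℤ → Matrix (Fin K''.rank) (Fin K'.rank) PolyXY} (hf : K.IsCocycle K' 0 f)
    (hg : K'.IsCocycle K'' 0 g) : K.IsCocycle K'' 0 (fun i => g i * f i) := by
  refine ⟨⟨fun i => by simp only [hf.1.1 i, hg.1.1 i], fun i b a => ?_⟩, ?_⟩
  · refine mul_homogeneous (u := fun b => K''.s (i + 0) b) (w := K.s i) (v := K'.s (i + 0)) ?_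
      (hf.1.2 i) b a
    have := hg.1.2 i
    simp only [add_zero] at this ⊢
    exact this
  · funext i
    have h1 := congrFun hf.2 i
    have h2 := congrFun hg.2 i
    simp only [dRaw, add_zero, zpow_zero, one_smul, Pi.zero_apply, sub_eq_zero] at h1 h2 ⊢
    rw [← Matrix.mul_assoc, h2, Matrix.mul_assoc, h1, Matrix.mul_assoc]

theorem IsCocycle.sub {K K' : GradedMF deg W c} {n : ℤ}
    {f g : ℤ → Matrix (Fin K'.rank) (Fin K.rank) PolyXY} (hf : K.IsCocycle K' n f)
    (hg : K.IsCocycle K' n g) : K.IsCocycle K' n (f - g) := by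
  refine ⟨sub_mem hf.1 hg.1, ?_⟩
  have h1 := hf.2
  have h2 := hg.2
  funext i
  have h1 := congrFun h1 i
  have h2 := congrFun h2 i
  simp only [dRaw, Pi.sub_apply, Pi.zero_apply, Matrix.mul_sub, Matrix.sub_mul, smul_sub] at *
  rw [sub_sub_sub_comm, h1, h2, sub_zero]

theorem IsCocycle.smul {K K' : GradedMF deg W c} {n : ℤ} (r : ℂ)
    {f : ℤ → Matrix (Fin K'.rank) (Fin K.rank) PolyXY} (hf : K.IsCocycle K' n f) :
    K.IsCocycle K' n (r • f) := by
  refine ⟨Submodule.smul_mem _ r hf.1, ?_⟩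
  funext i
  have h1 := congrFun hf.2 i
  simp only [dRaw, Pi.smul_apply, Pi.zero_apply, Matrix.mul_smul, Matrix.smul_mul] at *
  rw [smul_comm, ← smul_sub, h1, smul_zero]

theorem isCocycle_id (K : GradedMF deg W c) : K.IsCocycle K 0 (fun _ => 1) := by
  refine ⟨⟨fun _ => rfl, fun i b a => ?_⟩, ?_⟩
  · dsimp only
    by_cases h : b = a
    · subst h
      rw [Matrix.one_apply_eq, add_zero, sub_self]
      exact isWeightedHomogeneous_one ℂ deg
    · rw [Matrix.one_apply_ne h]
      exact isWeightedHomogeneous_zero ℂ deg _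
  · funext i
    simp [dRaw]

end GradedMF

/-! ## The cohomology of the category of matrix factorisations -/

namespace MFCat

variable {L : Type} [AddCommGroup L] {deg : Fin 2 → L} {W : PolyXY} {c : L} {V : Type}

theorem incl_injective (K : V → GradedMF deg W c) (X Y : V) (n : ℤ) :
    Function.Injective (incl K X Y n) := by
  classical
  exact lof_injective (fun t : V × V × ℤ => (K t.1).Hom (K t.2.1) t.2.2) (X, Y, n)

theorem μ₁_incl (K : V → GradedMF deg W c) (X Y : V) (n : ℤ) (f : (K X).Hom (K Y) n) :
    (mfCat K).μ₁ (incl K X Y n f) =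
      ((-1 : ℂ) ^ n) • incl K X Y (n + 1) ((K X).diff (K Y) n f) := op₁_incl K X Y n f

theorem μ₂_incl (K : V → GradedMF deg W c) (X Y Z : V) (m n : ℤ) (f : (K X).Hom (K Y) m)
    (g : (K Y).Hom (K Z) n) :
    (mfCat K).μ₂ (incl K X Y m f) (incl K Y Z n g) =
      ((-1 : ℂ) ^ m) • incl K X Z (m + n) ((K X).comp (K Y) (K Z) m n f g) :=
  op₂_incl K X Y Z m n f g

theorem incl_mem_cocycles_iff (K : V → GradedMF deg W c) {X Y : V} {n : ℤ}
    (f : (K X).Hom (K Y) n) :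
    incl K X Y n f ∈ (mfCat K).cocycles X Y n ↔ (K X).IsCocycle (K Y) n f.1 := by
  have h0 : ((-1 : ℂ) ^ n) ≠ 0 := zpow_ne_zero _ (by norm_num)
  have h1 : (mfCat K).μ₁ (incl K X Y n f) = 0 ↔ GradedMF.dRaw (K X) (K Y) n f.1 = 0 := by
    rw [μ₁_incl]
    refine (smul_eq_zero_iff_right h0).trans ?_
    refine ((incl_injective K X Y (n + 1)).eq_iff' (map_zero _)).trans ?_
    exact Subtype.ext_iff
  exact ⟨fun h => ⟨f.2, h1.1 h.2⟩, fun h => ⟨⟨f, rfl⟩, h1.2 h.2⟩⟩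

theorem incl_mem_coboundaries_iff (K : V → GradedMF deg W c) {X Y : V} {n : ℤ}
    (f : (K X).Hom (K Y) n) :
    incl K X Y n f ∈ (mfCat K).coboundaries X Y n ↔ (K X).IsCoboundary (K Y) n f.1 := by
  have hε := GradedMF.neg_one_zpow_mul_self (n - 1)
  constructor
  · rintro ⟨_, ⟨g, rfl⟩, hg⟩
    rw [μ₁_incl] at hg
    have h1 : incl K X Y (n - 1 + 1) ((K X).diff (K Y) (n - 1) (((-1 : ℂ) ^ (n - 1)) • g)) =
        incl K X Y n f := by rw [map_smul, map_smul]; exact hg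
    refine ⟨(((-1 : ℂ) ^ (n - 1)) • g).1, (((-1 : ℂ) ^ (n - 1)) • g).2, ?_⟩
    have h2 : incl K X Y n f = incl K X Y (n - 1 + 1) ⟨f.1, by rw [sub_add_cancel]; exact f.2⟩ :=
      incl_congr K X Y (by ring) _ _ rfl
    rw [h2] at h1
    exact congrArg Subtype.val (incl_injective K X Y _ h1)
  · rintro ⟨g, hg, h⟩
    refine ⟨incl K X Y (n - 1) (((-1 : ℂ) ^ (n - 1)) • ⟨g, hg⟩), ⟨_, rfl⟩, ?_⟩
    rw [μ₁_incl, map_smul, map_smul, smul_smul, hε, one_smul]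
    exact incl_congr K X Y (by ring) _ _ h

theorem coh_subsingleton (K : V → GradedMF deg W c) {X Y : V} {n : ℤ}
    (h : ∀ f, (K X).IsCocycle (K Y) n f → (K X).IsCoboundary (K Y) n f) :
    Subsingleton ((mfCat K).Coh X Y n) := by
  refine subsingleton_of_forall_eq 0 fun x => ?_
  obtain ⟨⟨_, ⟨f, rfl⟩, hx⟩, rfl⟩ := Submodule.Quotient.mk_surjective _ x
  rw [AInfCat.coh_mk_eq_zero]
  exact (incl_mem_coboundaries_iff K f).2 (h _ ((incl_mem_cocycles_iff K f).1 ⟨⟨f, rfl⟩, hx⟩))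

/-- The space of closed morphisms of degree zero. -/
def closed (K K' : GradedMF deg W c) :
    Submodule ℂ (ℤ → Matrix (Fin K'.rank) (Fin K.rank) PolyXY) where
  carrier := {f | K.IsCocycle K' 0 f}
  zero_mem' := ⟨zero_mem _, by funext i; simp [GradedMF.dRaw]⟩
  add_mem' {f g} hf hg := by
    have h := GradedMF.IsCocycle.sub hf (hg.smul (-1))
    rwa [neg_one_smul, sub_neg_eq_add] at h
  smul_mem' r f hf := GradedMF.IsCocycle.smul r hf

theorem closed_le_Hom (K K' : GradedMF deg W c) : closed K K' ≤ K.Hom K' 0 := fun _ h => h.1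

/-- The cohomology class of a closed morphism of degree zero. -/
noncomputable def cls (K : V → GradedMF deg W c) (X Y : V) :
    closed (K X) (K Y) →ₗ[ℂ] (mfCat K).Coh X Y 0 :=
  (Submodule.mkQ _).comp
    (((incl K X Y 0).comp (Submodule.inclusion (closed_le_Hom _ _))).codRestrict
      ((mfCat K).cocycles X Y 0) fun f => (incl_mem_cocycles_iff K _).2 f.2)

theorem cls_surjective (K : V → GradedMF deg W c) (X Y : V) : Function.Surjective (cls K X Y) := by
  intro x
  obtain ⟨⟨_, ⟨f, rfl⟩, hx⟩, rfl⟩ := Submodule.Quotient.mk_surjective _ x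
  exact ⟨⟨f.1, (incl_mem_cocycles_iff K f).1 ⟨⟨f, rfl⟩, hx⟩⟩, rfl⟩

theorem cls_eq_zero_iff (K : V → GradedMF deg W c) {X Y : V} (f : closed (K X) (K Y)) :
    cls K X Y f = 0 ↔ (K X).IsCoboundary (K Y) 0 f.1 :=
  (AInfCat.coh_mk_eq_zero (mfCat K) _).trans (incl_mem_coboundaries_iff K ⟨f.1, f.2.1⟩)

theorem comp_cls (K : V → GradedMF deg W c) {X Y Z : V} (f : closed (K X) (K Y))
    (g : closed (K Y) (K Z)) :
    (mfCat K).comp (add_zero (0 : ℤ)) (cls K X Y f) (cls K Y Z g) =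
      cls K X Z ⟨fun i => g.1 i * f.1 i, GradedMF.IsCocycle.comp f.2 g.2⟩ := by
  refine (AInfCat.comp_mk _ _ _ _).trans (congrArg Submodule.Quotient.mk (Subtype.ext ?_))
  rw [zpow_zero, one_smul]
  refine (μ₂_incl K X Y Z 0 0 _ _).trans ?_
  rw [zpow_zero, one_smul]
  refine incl_congr K X Z (add_zero 0) _ _ ?_
  funext i
  show g.1 (i + 0) * f.1 i = _
  rw [add_zero]
  rfl

end MFCat

/-! ## Degrees -/

/-- A factor of a homogeneous polynomial whose cofactor is homogeneous is homogeneous. -/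
theorem isWeightedHomogeneous_of_mul {L : Type} [AddCommGroup L] {deg : Fin 2 → L}
    {p b : PolyXY} {l l' : L} (hp0 : p ≠ 0) (hp : IsWeightedHomogeneous deg p l)
    (h : IsWeightedHomogeneous deg (p * b) (l + l')) : IsWeightedHomogeneous deg b l' := by
  classical
  let _ := weightedGradedAlgebra ℂ deg
  -- The component of p b in degree l + l' is p times the component of b in degree l'. As p b is
  -- homogeneous, cancelling p shows that b equals its own component.
  have h1 := DirectSum.coe_decompose_mul_add_of_left_mem (weightedHomogeneousSubmodule ℂ deg)
    (b := b) (j := l') hp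
  rw [DirectSum.decompose_of_mem_same _ h] at h1
  have h2 := mul_left_cancel₀ hp0 h1
  rw [h2]
  exact (DirectSum.decompose (weightedHomogeneousSubmodule ℂ deg) b l').2

namespace ChainData

theorem vec_eq_iff (D : ChainData) {m n m' n' : ℤ} :
    D.vec m n = D.vec m' n' ↔ ∃ t : ℤ, m = m' + t * D.pl ∧ n = n' - t * D.ql := by
  refine ⟨fun h => ?_, fun ⟨t, hm, hn⟩ => D.vec_eq t hm hn⟩
  unfold vec at h
  rw [QuotientAddGroup.eq, AddSubgroup.mem_zmultiples_iff] at h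
  obtain ⟨t, ht⟩ := h
  have h1 := congrArg Prod.fst ht
  have h2 := congrArg Prod.snd ht
  simp at h1 h2
  exact ⟨-t, by linarith, by linarith⟩

theorem zsmul_vec (D : ChainData) (k m n : ℤ) : k • D.vec m n = D.vec (k * m) (k * n) := by
  have : k • ((m, n) : ℤ × ℤ) = (k * m, k * n) := by ext <;> simp
  unfold vec
  rw [← this]; rfl

theorem zsmul_c (D : ChainData) (k : ℤ) : k • D.c = D.vec 0 (k * D.q) := by
  rw [D.c_eq, zsmul_vec, mul_zero]

theorem neg_vec (D : ChainData) (m n : ℤ) : -D.vec m n = D.vec (-m) (-n) := rfl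

theorem zero_eq_vec (D : ChainData) : (0 : D.L) = D.vec 0 0 := rfl

/-- The degrees in which `ℂ[x, y]` is non-zero. -/
def Pos (D : ChainData) (l : D.L) : Prop := ∃ m n : ℕ, D.vec m n = l

theorem pos_vec (D : ChainData) {m n : ℤ} (t : ℤ) (hm : 0 ≤ m + t * D.pl)
    (hn : 0 ≤ n - t * D.ql) : D.Pos (D.vec m n) := by
  refine ⟨(m + t * D.pl).toNat, (n - t * D.ql).toNat, D.vec_eq t ?_ ?_⟩
  · rw [Int.toNat_of_nonneg hm]
  · rw [Int.toNat_of_nonneg hn]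

/-- The representatives of the degree are (m + s pl, n - s ql). The two inequalities make the first
coordinate negative for s ≤ t and the second one negative for s ≥ t + 1, so a single t excludes all
of them. -/
theorem not_pos_vec (D : ChainData) {m n : ℤ} (t : ℤ) (hm : m + t * D.pl < 0)
    (hn : n - t * D.ql < D.ql) : ¬ D.Pos (D.vec m n) := by
  rintro ⟨a, b, h⟩
  obtain ⟨s, h1, h2⟩ := D.vec_eq_iff.1 h
  have hp : (0 : ℤ) < D.pl := by exact_mod_cast D.pl_pos
  have hq : (0 : ℤ) < D.ql := by exact_mod_cast D.ql_pos
  rcases lt_or_ge t s with hts | hts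
  · have : (t + 1) * (D.ql : ℤ) ≤ s * D.ql := by nlinarith
    have hb : (0 : ℤ) ≤ b := b.cast_nonneg
    linarith
  · have : s * (D.pl : ℤ) ≤ t * D.pl := by nlinarith
    have ha : (0 : ℤ) ≤ a := a.cast_nonneg
    linarith

/-- Induction over monomials for homogeneous polynomials. -/
theorem homogeneous_induction (D : ChainData) {l : D.L} {P : PolyXY → Prop} (h0 : P 0)
    (hadd : ∀ p q, P p → P q → P (p + q))
    (hmono : ∀ (a b : ℕ) (r : ℂ), D.vec a b = l → P (r • (X 0 ^ a * X 1 ^ b)))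
    {p : PolyXY} (hp : IsWeightedHomogeneous D.deg p l) : P p := by
  refine IsWeightedHomogeneous.induction_on (motive := fun p _ => P p) h0
    (fun p q _ _ => hadd p q) (fun d r hd => ?_) hp
  have h1 : Finsupp.weight D.deg d = D.vec (d 0) (d 1) := by
    rw [Finsupp.weight_apply, Finsupp.sum_fintype _ _ (fun i => zero_smul ℕ (D.deg i)), Fin.sum_univ_two]
    simp [deg, nsmul_vec, vec_add]
  have h2 : (monomial d r : PolyXY) = r • (X 0 ^ d 0 * X 1 ^ d 1) := by
    rw [monomial_eq, Finsupp.prod_fintype _ _ (fun i => pow_zero _), Fin.prod_univ_two,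
      smul_eq_C_mul]
  rw [h2]
  exact hmono _ _ _ (h1.symm.trans hd)

theorem eq_zero_of_not_pos (D : ChainData) {l : D.L} {p : PolyXY}
    (hp : IsWeightedHomogeneous D.deg p l) (hl : ¬ D.Pos l) : p = 0 :=
  D.homogeneous_induction (P := fun p => p = 0) rfl (fun p q hp hq => by rw [hp, hq, add_zero])
    (fun a b _ h => absurd ⟨a, b, h⟩ hl) hp

theorem poly_ne_zero (D : ChainData) : D.poly ≠ 0 := by
  intro h
  have h1 := congrArg (eval (![0, 1] : Fin 2 → ℂ)) h
  have hp := D.two_le_p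
  simp [poly, show D.p ≠ 0 by omega] at h1

end ChainData

/-- Constructor for `Resolves` that takes care of homogeneity. -/
theorem GradedMF.Resolves.of_exact {D : ChainData} {K : GradedMF D.deg D.poly D.c} {z : ℤ}
    {κ : Fin K.rank} (h : ∀ r : Fin K.rank → PolyXY, ∑ t, K.d (z - 1) κ t * r t = 0 →
      ∃ b : Fin K.rank → PolyXY, b κ = 0 ∧ (K.d z).mulVec b = r) : K.Resolves z κ := by
  refine ⟨fun σ r hr h0 => ?_⟩
  obtain ⟨b, hb, hbr⟩ := h r h0
  refine ⟨b, hb, fun s => ?_, hbr⟩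
  -- From r = d b follows d r = W b, so b is a factor of a homogeneous element and needs no separate
  -- degree bookkeeping.
  have h1 : (K.d (z - 1)).mulVec r s = D.poly * b s := by
    rw [← hbr, Matrix.mulVec_mulVec, K.d_pred, K.d_mul_d, Matrix.smul_mulVec, Matrix.one_mulVec]
    rfl
  refine isWeightedHomogeneous_of_mul D.poly_ne_zero D.poly_homogeneous (l' := K.s z s - σ) ?_
  rw [← h1, Matrix.mulVec, dotProduct]
  refine IsWeightedHomogeneous.sum _ _ _ fun t _ => ?_
  have h2 := (K.d_homogeneous (z - 1) s t).mul (hr t)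
  rw [sub_add_cancel, K.s_succ] at h2
  convert h2 using 1
  abel

/-! ## The factorisations `K_0^{i,j}` -/

section Cyclic

variable {R : Type} [CommRing R]

theorem sum_mul_cyclicMatrix (n : ℕ) (f g M : ℕ → R) (h : R) (a : Fin (n + 2)) :
    ∑ t : Fin (n + 2), M t * ChainData.cyclicMatrix n f g h t a =
      if (a : ℕ) = n + 1 then M (n + 1) * f (n + 1) + M 0 * h
      else M a * f a + M (a + 1) * g a := by
  have ha := a.2
  split_ifs with h1
  · have hne : Fin.last (n + 1) ≠ 0 := by simp [Fin.ext_iff]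
    rw [Finset.sum_eq_add (Fin.last (n + 1)) 0 hne]
    · obtain rfl : a = Fin.last (n + 1) := Fin.ext h1
      simp [ChainData.cyclicMatrix]
    · intro t _ ht
      have h2 : (t : ℕ) ≠ a := fun h => ht.1 (Fin.ext (h.trans h1))
      have h3 : (t : ℕ) ≠ 0 := fun h => ht.2 (Fin.ext h)
      have h4 : (t : ℕ) ≠ a + 1 := by have := t.2; omega
      simp only [ChainData.cyclicMatrix, Matrix.of_apply, h2, h3, h4, false_and, if_false, mul_zero]
    · simp
    · simp
  · have h5 : (a : ℕ) + 1 < n + 2 := by omega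
    have hne : a ≠ ⟨a + 1, h5⟩ := by simp [Fin.ext_iff]
    rw [Finset.sum_eq_add a ⟨a + 1, h5⟩ hne]
    · simp [ChainData.cyclicMatrix]
    · intro t _ ht
      have h2 : (t : ℕ) ≠ a := fun h => ht.1 (Fin.ext h)
      have h4 : (t : ℕ) ≠ a + 1 := fun h => ht.2 (Fin.ext h)
      simp [ChainData.cyclicMatrix, h2, h1, h4]
    · simp
    · simp

theorem cyclicMatrix_mulVec (n : ℕ) (f g v : ℕ → R) (h : R) (b : Fin (n + 2)) :
    (ChainData.cyclicMatrix n f g h).mulVec (fun a => v a) b =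
      if (b : ℕ) = 0 then f 0 * v 0 + h * v (n + 1)
      else f b * v b + g (b - 1) * v (b - 1) := by
  have hb := b.2
  rw [Matrix.mulVec, dotProduct]
  split_ifs with h1
  · have hne : Fin.last (n + 1) ≠ 0 := by simp [Fin.ext_iff]
    obtain rfl : b = 0 := Fin.ext h1
    rw [Finset.sum_eq_add 0 (Fin.last (n + 1)) hne.symm]
    · simp [ChainData.cyclicMatrix]
    · intro t _ ht
      have h2 : (0 : ℕ) ≠ t := fun h => ht.1 (Fin.ext h.symm)
      have h3 : (t : ℕ) ≠ n + 1 := fun h => ht.2 (Fin.ext h)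
      simp [ChainData.cyclicMatrix, h2, h3]
    · simp
    · simp
  · have h5 : (b : ℕ) - 1 < n + 2 := by omega
    have hne : b ≠ ⟨b - 1, h5⟩ := by simp [Fin.ext_iff]; omega
    rw [Finset.sum_eq_add b ⟨b - 1, h5⟩ hne]
    · have h6 : (b : ℕ) ≠ b - 1 := by omega
      have h7 : (b : ℕ) = b - 1 + 1 := by omega
      simp [ChainData.cyclicMatrix, h6, ← h7]
    · intro t _ ht
      have h2 : (b : ℕ) ≠ t := fun h => ht.1 (Fin.ext h.symm)
      have h4 : (b : ℕ) ≠ t + 1 := fun h => ht.2 (Fin.ext (by simp; omega))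
      simp only [ChainData.cyclicMatrix, Matrix.of_apply, h2, h1, h4, false_and, if_false, zero_mul]
    · simp
    · simp

end Cyclic

theorem X_not_dvd_X_pow {i j : Fin 2} (h : i ≠ j) (n : ℕ) : ¬ (X i : PolyXY) ∣ X j ^ n := by
  intro hd
  have h1 := X_prime.dvd_of_dvd_pow hd
  rw [X_dvd_X] at h1
  exact h (by simpa using h1)

theorem X_pow_mul_X_pow_dvd {a b : ℕ} {p : PolyXY} (h0 : (X 0 : PolyXY) ^ a ∣ p)
    (h1 : (X 1 : PolyXY) ^ b ∣ p) : (X 0 : PolyXY) ^ a * X 1 ^ b ∣ p := by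
  obtain ⟨c, rfl⟩ := h0
  exact mul_dvd_mul_left _
    (X_prime.pow_dvd_of_dvd_mul_left b (X_not_dvd_X_pow (by decide) a) h1)

/-! ### The monomial ideal of `K₀` and its Hilbert–Burch resolution. -/

namespace ChainData

/-- The `t`-th generator of the monomial ideal `I_{i,j}`. -/
noncomputable def mono (D : ChainData) (i j t : ℕ) : PolyXY :=
  X 0 ^ (i - t * D.pl) * X 1 ^ (j - (D.ℓ - t) * D.ql)

section

variable (D : ChainData) {i j : ℕ}

/-- For t = 0 the subtraction j - ℓ ql truncates to 0 because j ≤ ℓ ql. The first step of the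
y-exponent is therefore shorter than the others, which accounts for the special first entry of d₀.
-/
theorem diag_exponent (hj : D.q - D.ql ≤ j ∧ j ≤ D.q - 1) {t : ℕ} (ht : t ≤ D.k i) (hk : D.k i + 1 ≤ D.ℓ) :
    j - (D.ℓ - (t + 1)) * D.ql = j - (D.ℓ - t) * D.ql +
      (if t = 0 then j - (D.ℓ - 1) * D.ql else D.ql) := by
  obtain ⟨j1, j2⟩ := D.j_bounds hj
  split_ifs with h0
  · subst h0
    rw [Nat.sub_zero, zero_add]
    omega
  · obtain ⟨r, hr⟩ := Nat.exists_eq_add_of_le (show t + 1 ≤ D.ℓ by omega)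
    have e1 : D.ℓ - (t + 1) = r := by omega
    have e2 : D.ℓ - t = r + 1 := by omega
    have e3 : (r + 1) * D.ql ≤ (D.ℓ - 1) * D.ql := Nat.mul_le_mul_right _ (by omega)
    rw [e1, e2, add_mul, one_mul] at *
    omega

theorem last_diag_exponent (hj : D.q - D.ql ≤ j ∧ j ≤ D.q - 1) (hk : D.k i + 1 ≤ D.ℓ) :
    j - (D.ℓ - (D.k i + 1)) * D.ql + (D.q - j + (D.ℓ - D.k i - 1) * D.ql) = D.q := by
  obtain ⟨j1, j2⟩ := D.j_bounds hj
  have hq := D.q_eq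
  have e3 : (D.ℓ - (D.k i + 1)) * D.ql ≤ (D.ℓ - 1) * D.ql := Nat.mul_le_mul_right _ (by omega)
  rw [Nat.sub_sub]
  omega

/-- For t = k the subtraction i - (k + 1) pl truncates to 0, so the last step of the x-exponent is i
- k pl instead of pl. -/
theorem subdiag_exponent (hi : 1 ≤ i ∧ i ≤ D.p - 1) {t : ℕ} (ht : t ≤ D.k i) :
    i - t * D.pl = i - (t + 1) * D.pl + (if t = D.k i then i - D.k i * D.pl else D.pl) := by
  obtain ⟨k1, k2, k3⟩ := D.k_bounds hi
  split_ifs with h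
  · subst h
    omega
  · have e3 : (t + 1) * D.pl ≤ D.k i * D.pl := Nat.mul_le_mul_right _ (by omega)
    rw [add_mul, one_mul] at *
    omega

/-- The diagonal entries of `d₀`. -/
noncomputable def diag (i j t : ℕ) : PolyXY :=
  if t = 0 then X 1 ^ (j - (D.ℓ - 1) * D.ql)
      else if t = D.k i + 1 then X 1 ^ (D.q - j + (D.ℓ - D.k i - 1) * D.ql)
      else X 1 ^ D.ql

/-- The entries of `d₀` below the diagonal, up to sign. -/
noncomputable def subdiag (i t : ℕ) : PolyXY :=
  if t = D.k i then X 0 ^ (i - D.k i * D.pl) else X 0 ^ D.pl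

theorem d₀_eq : D.d₀ i j = cyclicMatrix (D.k i) (D.diag i j) (fun t => -D.subdiag i t)
    (X 0 ^ (D.p - i) * X 1) := by
  unfold d₀ diag subdiag
  congr 1
  funext t
  split_ifs <;> rfl

/-- The right side is the least common multiple of the generators t and t + 1;
`mono_succ_mul_subdiag` reaches it from the other generator, and together they form the syzygy in
column t of d₀. -/
theorem mono_mul_diag (hi : 1 ≤ i ∧ i ≤ D.p - 1)
    (hj : D.q - D.ql ≤ j ∧ j ≤ D.q - 1)
    {t : ℕ} (ht : t ≤ D.k i) :
    D.mono i j t * D.diag i j t = X 0 ^ (i - t * D.pl) * X 1 ^ (j - (D.ℓ - (t + 1)) * D.ql) := by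
  rw [D.diag_exponent hj ht (D.k_bounds hi).1, mono, diag, pow_add, if_neg (show t ≠ D.k i + 1 by omega)]
  split_ifs <;> ring

theorem mono_succ_mul_subdiag (hi : 1 ≤ i ∧ i ≤ D.p - 1) {t : ℕ} (ht : t ≤ D.k i) :
    D.mono i j (t + 1) * D.subdiag i t =
      X 0 ^ (i - t * D.pl) * X 1 ^ (j - (D.ℓ - (t + 1)) * D.ql) := by
  rw [D.subdiag_exponent hi ht, mono, subdiag, pow_add]
  split_ifs <;> ring

theorem mono_zero (hj : D.q - D.ql ≤ j ∧ j ≤ D.q - 1) : D.mono i j 0 = X 0 ^ i := by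
  obtain ⟨j1, j2⟩ := D.j_bounds hj
  rw [mono, Nat.sub_zero, Nat.sub_eq_zero_of_le j2]
  simp

theorem mono_last (hi : 1 ≤ i ∧ i ≤ D.p - 1) : D.mono i j (D.k i + 1) = X 1 ^ (j - (D.ℓ - (D.k i + 1)) * D.ql) := by
  rw [mono, Nat.sub_eq_zero_of_le (D.k_bounds hi).2.2, pow_zero, one_mul]

/-- All columns but the last are syzygies of neighbouring generators. The last one pairs x^i with
x^(p-i) y and the pure power of y with its complement to y^q, giving the two terms of the potential.
-/
theorem sum_mono_mul_d₀ (hi : 1 ≤ i ∧ i ≤ D.p - 1)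
    (hj : D.q - D.ql ≤ j ∧ j ≤ D.q - 1)
    (a : Fin (D.k i + 2)) :
    ∑ t : Fin (D.k i + 2), D.mono i j t * D.d₀ i j t a =
      if (a : ℕ) = D.k i + 1 then D.poly else 0 := by
  rw [d₀_eq, sum_mul_cyclicMatrix]
  have hp := D.two_le_p
  split_ifs with h
  · rw [D.mono_zero hj, D.mono_last hi, diag, if_neg (by omega), if_pos rfl, ← pow_add,
      D.last_diag_exponent hj (D.k_bounds hi).1, ← mul_assoc, ← pow_add,
      Nat.add_sub_of_le (by omega), poly, add_comm]
  · have ha := a.2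
    rw [D.mono_mul_diag hi hj (by omega), mul_neg, D.mono_succ_mul_subdiag hi (by omega),
      add_neg_cancel]

/-- The generators satisfy m d₀ = W e_last. Multiplying by the adjugate and using det d₀ = W gives W
m = W times the last row, and W can be cancelled. -/
theorem adjugate_last (hi : 1 ≤ i ∧ i ≤ D.p - 1)
    (hj : D.q - D.ql ≤ j ∧ j ≤ D.q - 1)
    (t : Fin (D.k i + 2)) :
    (D.d₀ i j).adjugate (Fin.last _) t = D.mono i j t := by
  have h1 : Matrix.vecMul (fun t : Fin (D.k i + 2) => D.mono i j t) (D.d₀ i j) =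
      D.poly • Pi.single (Fin.last _) 1 := by
    funext a
    rw [Matrix.vecMul, dotProduct, D.sum_mono_mul_d₀ hi hj, Pi.smul_apply, smul_eq_mul,
      Pi.single_apply, mul_ite, mul_one, mul_zero]
    simp only [Fin.ext_iff, Fin.val_last]
  have h2 := congrArg (fun v => Matrix.vecMul v (D.d₀ i j).adjugate t) h1
  simp only [Matrix.vecMul_vecMul, Matrix.mul_adjugate, D.det_d₀ hi hj, Matrix.vecMul_smul,
    Matrix.vecMul_one, Matrix.smul_vecMul, Matrix.single_one_vecMul, Pi.smul_apply,
    smul_eq_mul] at h2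
  exact (mul_left_cancel₀ D.poly_ne_zero h2).symm

/-- The partial sum of a relation up to t is divisible by the x-power of generator t and, being
minus the complementary sum, by the y-power of generator t + 1. It is therefore a multiple of their
least common multiple. The quotients are the coefficients of the relation in terms of the syzygies,
by telescoping. -/
theorem mono_exact (hi : 1 ≤ i ∧ i ≤ D.p - 1)
    (hj : D.q - D.ql ≤ j ∧ j ≤ D.q - 1)
    (r : Fin (D.k i + 2) → PolyXY)
    (h : ∑ t : Fin (D.k i + 2), D.mono i j t * r t = 0) :
    ∃ b : Fin (D.k i + 2) → PolyXY, b (Fin.last _) = 0 ∧ (D.d₀ i j).mulVec b = r := by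
  set r' : ℕ → PolyXY := fun t => if h : t < D.k i + 2 then r ⟨t, h⟩ else 0 with hr'
  have hr : ∀ t : Fin (D.k i + 2), r t = r' t := fun t => by simp [hr']
  set P : ℕ → PolyXY := fun t => ∑ s ∈ Finset.range (t + 1), D.mono i j s * r' s with hP
  have hlast : P (D.k i + 1) = 0 := by
    rw [hP, ← h]
    dsimp only
    rw [← Fin.sum_univ_eq_sum_range (fun s => D.mono i j s * r' s)]
    exact Finset.sum_congr rfl fun t _ => by rw [hr]
  have hb : ∀ t, ∃ b, t ≤ D.k i →
      P t = X 0 ^ (i - t * D.pl) * X 1 ^ (j - (D.ℓ - (t + 1)) * D.ql) * b := by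
    intro t
    by_cases ht : t ≤ D.k i
    · have h0 : (X 0 : PolyXY) ^ (i - t * D.pl) ∣ P t := by
        refine Finset.dvd_sum fun s hs => Dvd.dvd.mul_right (Dvd.dvd.mul_right ?_ _) _
        refine pow_dvd_pow _ (Nat.sub_le_sub_left (Nat.mul_le_mul_right _ ?_) _)
        exact Nat.lt_succ_iff.1 (Finset.mem_range.1 hs)
      -- The total sum vanishes, so the partial sum is minus the tail, whose generators all have a
      -- large y-exponent.
      have h1 : (X 1 : PolyXY) ^ (j - (D.ℓ - (t + 1)) * D.ql) ∣ P t := by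
        have h2 : P t = -∑ s ∈ Finset.Ico (t + 1) (D.k i + 2), D.mono i j s * r' s := by
          rw [eq_neg_iff_add_eq_zero, hP]
          dsimp only
          rw [Finset.sum_range_add_sum_Ico _ (by omega)]
          exact hlast
        rw [h2, dvd_neg]
        refine Finset.dvd_sum fun s hs => Dvd.dvd.mul_right (Dvd.dvd.mul_left ?_ _) _
        have := (Finset.mem_Ico.1 hs).1
        exact pow_dvd_pow _ (Nat.sub_le_sub_left (Nat.mul_le_mul_right _ (by omega)) _)
      obtain ⟨b, hb⟩ := X_pow_mul_X_pow_dvd h0 h1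
      exact ⟨b, fun _ => hb⟩
    · exact ⟨0, fun h => absurd h ht⟩
  choose b hb using hb
  -- The last column of d₀ is not a syzygy, so its coefficient is set to 0; this agrees with the
  -- vanishing of the full sum.
  set b' : ℕ → PolyXY := fun t => if t = D.k i + 1 then 0 else b t with hb'
  have hmono : ∀ t, D.mono i j t ≠ 0 := fun t =>
    mul_ne_zero (pow_ne_zero _ (X_ne_zero 0)) (pow_ne_zero _ (X_ne_zero 1))
  have hPb : ∀ t, t ≤ D.k i + 1 → P t = D.mono i j t * (D.diag i j t * b' t) := by
    intro t ht
    by_cases h : t = D.k i + 1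
    · rw [h, hlast, hb']; simp
    · rw [← mul_assoc, D.mono_mul_diag hi hj (by omega), hb t (by omega)]
      simp only [hb', if_neg h]
  have hPb' : ∀ t, t ≤ D.k i → P t = D.mono i j (t + 1) * (D.subdiag i t * b' t) := by
    intro t ht
    rw [← mul_assoc, D.mono_succ_mul_subdiag hi ht, hb t ht]
    simp only [hb', if_neg (show t ≠ D.k i + 1 by omega)]
  refine ⟨fun t => b' t, by simp [hb'], ?_⟩
  funext t
  have ht := t.2
  rw [d₀_eq, cyclicMatrix_mulVec, hr]
  split_ifs with h0
  · have h1 := hPb 0 (by omega)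
    rw [hP] at h1
    simp only [zero_add, Finset.sum_range_one] at h1
    rw [h0, mul_left_cancel₀ (hmono 0) h1, hb']
    simp
  · obtain ⟨s, hs⟩ : ∃ s, (t : ℕ) = s + 1 := ⟨t - 1, by omega⟩
    rw [hs, Nat.add_sub_cancel]
    refine mul_left_cancel₀ (hmono (s + 1)) ?_
    have h1 : P (s + 1) = P s + D.mono i j (s + 1) * r' (s + 1) := Finset.sum_range_succ _ _
    have h2 := hPb (s + 1) (by omega)
    have h3 := hPb' s (by omega)
    linear_combination h1 - h2 + h3
end

end ChainData

/-! ### Positions of a factorisation given by two matrices. -/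

namespace GradedMF

variable {L : Type} [AddCommGroup L] {deg : Fin 2 → L} {W : PolyXY} {c : L}
  {r : ℕ} {s₀ s₁ : Fin r → L} {d₀ d₁ : Matrix (Fin r) (Fin r) PolyXY} {h₀ h₁ h₁₀ h₀₁}

theorem ofPair_s_even (m : ℤ) (a : Fin r) :
    (ofPair (deg := deg) (W := W) (c := c) r s₀ s₁ d₀ d₁ h₀ h₁ h₁₀ h₀₁).s (2 * m) a =
      s₀ a + (m + 1) • c := by
  show (if Even (2 * m) then s₀ a + (2 * m / 2 + 1) • c else s₁ a + ((2 * m + 1) / 2) • c) = _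
  rw [if_pos (even_two_mul m), show 2 * m / 2 = m by omega]

theorem ofPair_s_odd (m : ℤ) (a : Fin r) :
    (ofPair (deg := deg) (W := W) (c := c) r s₀ s₁ d₀ d₁ h₀ h₁ h₁₀ h₀₁).s (2 * m + 1) a =
      s₁ a + (m + 1) • c := by
  show (if Even (2 * m + 1) then s₀ a + ((2 * m + 1) / 2 + 1) • c
    else s₁ a + ((2 * m + 1 + 1) / 2) • c) = _
  rw [if_neg (by simp), show (2 * m + 1 + 1) / 2 = m + 1 by omega]

theorem ofPair_d_even (m : ℤ) :
    (ofPair (deg := deg) (W := W) (c := c) r s₀ s₁ d₀ d₁ h₀ h₁ h₁₀ h₀₁).d (2 * m) = d₀ :=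
  if_pos (even_two_mul m)

theorem ofPair_d_odd (m : ℤ) :
    (ofPair (deg := deg) (W := W) (c := c) r s₀ s₁ d₀ d₁ h₀ h₁ h₁₀ h₀₁).d (2 * m + 1) = d₁ :=
  if_neg (by simp)

end GradedMF

/-! ### Degrees and differentials of `K₀`, and membership in its ideal. -/

namespace ChainData

section

variable (D : ChainData) {i j : ℕ} (hi : 1 ≤ i ∧ i ≤ D.p - 1) (hj : D.q - D.ql ≤ j ∧ j ≤ D.q - 1)

/-- The index of the last summand in even positions. -/
def lastIdx : Fin (D.K₀ i j hi hj).rank := Fin.last (D.k i + 1)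

/-- The index of the first summand in odd positions. -/
def firstIdx : Fin (D.K₀ i j hi hj).rank := (0 : Fin (D.k i + 2))

theorem K₀_s_even_last (m : ℤ) :
    (D.K₀ i j hi hj).s (2 * m) (D.lastIdx hi hj) = D.vec i (j + 1 + m * D.q) := by
  refine (GradedMF.ofPair_s_even m _).trans ?_
  rw [show D.shift₀ i j (D.lastIdx hi hj) = D.vec i (j + 1) - D.c from if_pos (by simp [lastIdx]),
    zsmul_c, c_eq, vec_sub, vec_add]
  exact D.vec_eq 0 (by ring) (by ring)

theorem K₀_s_even_of_ne (m : ℤ) {a : Fin (D.K₀ i j hi hj).rank} (ha : a ≠ D.lastIdx hi hj) :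
    (D.K₀ i j hi hj).s (2 * m) a = D.vec 0 (2 * D.q - D.ql + m * D.q) := by
  refine (GradedMF.ofPair_s_even m _).trans ?_
  rw [show D.shift₀ i j a = D.c - D.vec 0 D.ql from if_neg (fun h => ha (Fin.ext h)),
    zsmul_c, c_eq, vec_sub, vec_add]
  exact D.vec_eq 0 (by ring) (by ring)

theorem K₀_s_odd_first (m : ℤ) :
    (D.K₀ i j hi hj).s (2 * m + 1) (D.firstIdx hi hj) = D.vec 0 (j + 1 + (m + 1) * D.q) := by
  refine (GradedMF.ofPair_s_odd m _).trans ?_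
  rw [show D.shift₁ i j (D.firstIdx hi hj) = D.vec 0 (j + 1) from if_pos (by simp [firstIdx]),
    zsmul_c, vec_add]
  exact D.vec_eq 0 (by ring) (by ring)

theorem K₀_s_odd_last (m : ℤ) :
    (D.K₀ i j hi hj).s (2 * m + 1) (D.lastIdx hi hj) =
      D.vec i ((m + 2) * D.q - (D.k i + 1) * D.ql) := by
  refine (GradedMF.ofPair_s_odd m _).trans ?_
  rw [show D.shift₁ i j (D.lastIdx hi hj) = D.c + D.vec i (-((D.k i + 1) * D.ql)) from
    (if_neg (by simp [lastIdx])).trans (if_pos (by simp [lastIdx])), zsmul_c, c_eq, vec_add,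
    vec_add]
  exact D.vec_eq 0 (by ring) (by ring)

theorem K₀_s_odd_of_ne (m : ℤ) {a : Fin (D.K₀ i j hi hj).rank} (ha : a ≠ D.lastIdx hi hj)
    (ha' : a ≠ D.firstIdx hi hj) :
    (D.K₀ i j hi hj).s (2 * m + 1) a = D.vec 0 ((m + 2) * D.q) := by
  refine (GradedMF.ofPair_s_odd m _).trans ?_
  rw [show D.shift₁ i j a = D.c from (if_neg fun h => ha' (Fin.ext h)).trans
    (if_neg fun h => ha (Fin.ext h)), zsmul_c, c_eq, vec_add]
  exact D.vec_eq 0 (by ring) (by ring)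

theorem K₀_d_even (m : ℤ) : (D.K₀ i j hi hj).d (2 * m) = D.d₀ i j := GradedMF.ofPair_d_even m

theorem K₀_d_odd (m : ℤ) : (D.K₀ i j hi hj).d (2 * m + 1) = (D.d₀ i j).adjugate :=
  GradedMF.ofPair_d_odd m

theorem K₀_d_odd_last (m : ℤ) (t : Fin (D.K₀ i j hi hj).rank) :
    (D.K₀ i j hi hj).d (2 * m + 1) (D.lastIdx hi hj) t = D.mono i j (t : ℕ) := by
  rw [K₀_d_odd]
  exact D.adjugate_last hi hj t

theorem K₀_resolves : (D.K₀ i j hi hj).Resolves 0 (D.lastIdx hi hj) := by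
  refine .of_exact fun r hr => ?_
  have h0 : (D.K₀ i j hi hj).d 0 = D.d₀ i j := D.K₀_d_even hi hj 0
  simp only [show (0 : ℤ) - 1 = 2 * (-1) + 1 by norm_num, D.K₀_d_odd_last hi hj] at hr
  rw [h0]
  exact D.mono_exact hi hj r hr

/-- A representative (a', b') with parameter t gives a ≥ i - t pl and b ≥ j - (ℓ - t) ql, which is
divisibility by generator t whenever 0 ≤ t ≤ k + 1. Beyond this range the extreme generators serve:
for t ≤ 0 the power x^i, and for t > k + 1 the pure power of y. -/
theorem exists_generator (hi : 1 ≤ i ∧ i ≤ D.p - 1) (hj : D.q - D.ql ≤ j ∧ j ≤ D.q - 1)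
    {a b : ℕ} (h : D.Pos (D.vec a b - D.vec i (j + 1 - D.q))) :
    ∃ t ≤ D.k i + 1, i - t * D.pl ≤ a ∧ j - (D.ℓ - t) * D.ql ≤ b := by
  obtain ⟨a', b', h⟩ := h
  rw [vec_sub, vec_eq_iff] at h
  obtain ⟨t, h1, h2⟩ := h
  obtain ⟨k1, k2, k3⟩ := D.k_bounds hi
  obtain ⟨j1, j2⟩ := D.j_bounds hj
  have hq : (D.q : ℤ) = D.ℓ * D.ql + 1 := by exact_mod_cast D.q_eq
  have ha' : (0 : ℤ) ≤ a' := a'.cast_nonneg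
  have hb' : (0 : ℤ) ≤ b' := b'.cast_nonneg
  have hql : (0 : ℤ) ≤ D.ql := by positivity
  have hpl : (0 : ℤ) ≤ D.pl := by positivity
  rcases le_or_gt t 0 with ht | ht
  · refine ⟨0, by omega, ?_, by rw [Nat.sub_zero]; omega⟩
    have : t * (D.pl : ℤ) ≤ 0 := mul_nonpos_of_nonpos_of_nonneg ht hpl
    rw [zero_mul, Nat.sub_zero]
    zify
    linarith
  rcases le_or_gt t (D.k i + 1) with htk | htk
  · lift t to ℕ using ht.le
    refine ⟨t, by exact_mod_cast htk, ?_, ?_⟩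
    · rw [Nat.sub_le_iff_le_add]
      zify
      linarith
    · rw [Nat.sub_le_iff_le_add]
      zify [show t ≤ D.ℓ by omega]
      rw [hq] at h2
      linarith
  · refine ⟨D.k i + 1, le_rfl, by omega, ?_⟩
    rw [Nat.sub_le_iff_le_add]
    have h3 : ((D.k i : ℤ) + 1) * D.ql ≤ t * D.ql := mul_le_mul_of_nonneg_right htk.le hql
    zify [k1]
    rw [hq] at h2
    linarith

/-- In the relevant degrees, homogeneous polynomials lie in the ideal `I_{i,j}` as soon as the
degree is large. -/
theorem K₀_imageMem {σ : D.L} {p : PolyXY}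
    (hp : IsWeightedHomogeneous D.deg p (D.vec i (j + 1) - σ))
    (h : D.Pos (D.vec 0 D.q - σ) ∨ ¬ D.Pos (D.vec i (j + 1) - σ)) :
    (D.K₀ i j hi hj).ImageMem 0 (D.lastIdx hi hj) σ p := by
  rcases h with h | h
  swap
  · rw [D.eq_zero_of_not_pos hp h]
    exact .zero _ _ _ _
  refine D.homogeneous_induction (.zero _ _ _ _) (fun _ _ => .add) (fun a b r hab => ?_) hp
  refine .smul r ?_
  obtain ⟨t, ht, h1, h2⟩ := D.exists_generator hi hj (a := a) (b := b) (by
    rw [hab, sub_right_comm, vec_sub]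
    convert h using 2
    exact D.vec_eq 0 (by ring) (by ring))
  let t' : Fin (D.K₀ i j hi hj).rank := (⟨t, by omega⟩ : Fin (D.k i + 2))
  have hmono : (D.K₀ i j hi hj).d (0 - 1) (D.lastIdx hi hj) t' = D.mono i j t := by
    rw [show (0 : ℤ) - 1 = 2 * (-1) + 1 by norm_num]
    exact D.K₀_d_odd_last hi hj (-1) t'
  have hm0 : D.mono i j t ≠ 0 :=
    mul_ne_zero (pow_ne_zero _ (X_ne_zero 0)) (pow_ne_zero _ (X_ne_zero 1))
  have hmul : D.mono i j t * (X 0 ^ (a - (i - t * D.pl)) * X 1 ^ (b - (j - (D.ℓ - t) * D.ql))) =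
      X 0 ^ a * X 1 ^ b := by
    rw [mono, mul_mul_mul_comm, ← pow_add, ← pow_add, Nat.add_sub_of_le h1, Nat.add_sub_of_le h2]
  have hmh := (D.K₀ i j hi hj).d_homogeneous (0 - 1) (D.lastIdx hi hj) t'
  rw [hmono, sub_add_cancel] at hmh
  -- The monomial is a multiple of generator t', so the quotient in place t' expresses it through
  -- the row of generators.
  refine ⟨Pi.single t' (X 0 ^ (a - (i - t * D.pl)) * X 1 ^ (b - (j - (D.ℓ - t) * D.ql))), ?_, ?_⟩
  · intro s
    by_cases hs : s = t'
    · subst hs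
      rw [Pi.single_eq_same]
      refine isWeightedHomogeneous_of_mul hm0 hmh ?_
      rw [hmul, sub_add_sub_cancel, show (0 : ℤ) = 2 * 0 by norm_num, K₀_s_even_last]
      refine D.mono_homogeneous a b _ (hab.trans ?_)
      congr 1
      exact D.vec_eq 0 (by ring) (by ring)
    · rw [Pi.single_eq_of_ne hs]
      exact isWeightedHomogeneous_zero ℂ _ _
  · rw [Finset.sum_eq_single t']
    · rw [Pi.single_eq_same, hmono, hmul]
    · intro s _ hs
      rw [Pi.single_eq_of_ne hs, mul_zero]
    · simp

end

/-! ### Degree estimates: summands that do not contribute to morphisms into `K₀`. -/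

theorem mul_q_le (D : ChainData) {m n : ℤ} (h : m ≤ n) : m * (D.q : ℤ) ≤ n * D.q :=
  mul_le_mul_of_nonneg_right h (by positivity)

/-- The degree condition under which a component of a morphism into `K_0^{i,j}` is irrelevant. -/
def Neg (D : ChainData) (i j : ℕ) (σ : D.L) : Prop :=
  D.Pos (D.vec 0 D.q - σ) ∨ ¬ D.Pos (D.vec i (j + 1) - σ)

theorem cast_bounds (D : ChainData) {i j : ℕ} (hi : 1 ≤ i ∧ i ≤ D.p - 1)
    (hj : D.q - D.ql ≤ j ∧ j ≤ D.q - 1) :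
    (1 : ℤ) ≤ i ∧ (i : ℤ) + 1 ≤ D.p ∧ (D.q : ℤ) ≤ j + D.ql ∧ (j : ℤ) + 1 ≤ D.q := by
  have := D.two_le_p
  have := D.two_le_q
  omega

theorem cast_eqs (D : ChainData) : (D.ℓ : ℤ) * D.pl = D.p ∧ (D.ℓ : ℤ) * D.ql = D.q - 1 ∧
    (1 : ℤ) ≤ D.ℓ ∧ (1 : ℤ) ≤ D.pl ∧ (1 : ℤ) ≤ D.ql := by
  refine ⟨by exact_mod_cast D.p_eq.symm, ?_, by exact_mod_cast D.ℓ_pos, by exact_mod_cast D.pl_pos,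
    by exact_mod_cast D.ql_pos⟩
  have : (D.q : ℤ) = D.ℓ * D.ql + 1 := by exact_mod_cast D.q_eq
  linarith

theorem cast_k_bounds (D : ChainData) {i : ℕ} (hi : 1 ≤ i ∧ i ≤ D.p - 1) :
    (D.k i : ℤ) + 1 ≤ D.ℓ ∧ (D.k i : ℤ) * D.pl + 1 ≤ i ∧ (i : ℤ) ≤ (D.k i + 1) * D.pl := by
  obtain ⟨k1, k2, k3⟩ := D.k_bounds hi
  refine ⟨by exact_mod_cast k1, ?_, by exact_mod_cast k3⟩
  have : D.k i * D.pl + 1 ≤ i := by omega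
  exact_mod_cast this

/-- In each case either σ is far enough below c that everything in the component lies in the ideal,
or σ is so large that the component vanishes. The sign of m separates the two alternatives, and the
extra arguments of `pos_vec` and `not_pos_vec` select the representative in L that shows it. The
only excluded summand is the one carrying the morphisms of degree 0. -/
theorem K₀_neg (D : ChainData) {i j i' j' : ℕ} (hi : 1 ≤ i ∧ i ≤ D.p - 1)
    (hj : D.q - D.ql ≤ j ∧ j ≤ D.q - 1) (hi' : 1 ≤ i' ∧ i' ≤ D.p - 1)
    (hj' : D.q - D.ql ≤ j' ∧ j' ≤ D.q - 1) (z : ℤ) (a : Fin (D.K₀ i j hi hj).rank)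
    (h : z ≠ 0 ∨ a ≠ D.lastIdx hi hj) : D.Neg i' j' ((D.K₀ i j hi hj).s z a) := by
  obtain ⟨b1, b2, b3, b4⟩ := D.cast_bounds hi hj
  obtain ⟨b1', b2', b3', b4'⟩ := D.cast_bounds hi' hj'
  obtain ⟨e1, e2, e3, e4, e5⟩ := D.cast_eqs
  obtain ⟨k1, k2, k3⟩ := D.cast_k_bounds hi
  have k4 : (D.k i : ℤ) * D.ql + D.ql ≤ D.ℓ * D.ql := by nlinarith
  unfold Neg
  rcases Int.even_or_odd' z with ⟨m, rfl | rfl⟩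
  · by_cases ha : a = D.lastIdx hi hj
    · subst ha
      have hm : m ≠ 0 := by rintro rfl; simp at h
      rw [K₀_s_even_last]
      rcases lt_or_gt_of_ne hm with hm | hm
      · have := D.mul_q_le (show m ≤ -1 by omega)
        exact .inl (D.pos_vec D.ℓ (by linarith) (by linarith))
      · have := D.mul_q_le (show 1 ≤ m by omega)
        exact .inr (D.not_pos_vec (-D.ℓ) (by linarith) (by linarith))
    · rw [K₀_s_even_of_ne _ _ _ _ ha]
      rcases lt_or_ge m 0 with hm | hm
      · have := D.mul_q_le (show m ≤ -1 by omega)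
        exact .inl (D.pos_vec 0 (by linarith) (by linarith))
      · have := D.mul_q_le hm
        exact .inr (D.not_pos_vec (-D.ℓ) (by linarith) (by linarith))
  · by_cases ha : a = D.lastIdx hi hj
    · subst ha
      rw [K₀_s_odd_last]
      rcases lt_or_ge m 0 with hm | hm
      · have := D.mul_q_le (show m ≤ -1 by omega)
        exact .inl (D.pos_vec (D.k i + 1) (by linarith) (by linarith))
      · have := D.mul_q_le hm
        exact .inr (D.not_pos_vec (D.k i - D.ℓ) (by linarith) (by linarith))
    by_cases ha' : a = D.firstIdx hi hj
    · subst ha'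
      rw [K₀_s_odd_first]
      rcases lt_or_ge m 0 with hm | hm
      · have := D.mul_q_le (show m ≤ -1 by omega)
        exact .inl (D.pos_vec 0 (by linarith) (by linarith))
      · have := D.mul_q_le hm
        exact .inr (D.not_pos_vec (-D.ℓ) (by linarith) (by linarith))
    · rw [K₀_s_odd_of_ne _ _ _ _ ha ha']
      rcases lt_or_ge m 0 with hm | hm
      · have := D.mul_q_le (show m ≤ -1 by omega)
        exact .inl (D.pos_vec 0 (by linarith) (by linarith))
      · have := D.mul_q_le hm
        exact .inr (D.not_pos_vec (-D.ℓ) (by linarith) (by linarith))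

/-- The matrix factorisation `K_y^j[3]`. -/
noncomputable abbrev KyObj (D : ChainData) (j : ℕ) : GradedMF D.deg D.poly D.c :=
  (D.Ky.twist (D.vec 0 (j + 1 - D.q))).shift 3

/-- The matrix factorisation `K_{w_r}[3]`. -/
noncomputable abbrev KwObj (D : ChainData) (r : ℕ) (hr : r ∈ Finset.Icc 1 D.ℓ) :
    GradedMF D.deg D.poly D.c :=
  (D.Kw r hr).shift 3

theorem KyObj_s_odd (D : ChainData) (j : ℕ) (m : ℤ) (a : Fin (D.KyObj j).rank) :
    (D.KyObj j).s (2 * m + 1) a = D.vec 0 ((m + 1) * D.q + j + 1) := by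
  have h : D.Ky.s (2 * (m + 2)) a = -D.c + (m + 2 + 1) • D.c := GradedMF.ofPair_s_even (m + 2) a
  show D.Ky.s (2 * m + 1 + 3) a + D.vec 0 (j + 1 - D.q) = _
  rw [show 2 * m + 1 + 3 = 2 * (m + 2) by ring, h, zsmul_c, c_eq, neg_vec, vec_add, vec_add]
  exact D.vec_eq 0 (by ring) (by ring)

theorem KyObj_s_even (D : ChainData) (j : ℕ) (m : ℤ) (a : Fin (D.KyObj j).rank) :
    (D.KyObj j).s (2 * m) a = D.vec 0 ((m + 1) * D.q + j) := by
  have h : D.Ky.s (2 * (m + 1) + 1) a = D.vec 0 (-1) + (m + 1 + 1) • D.c :=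
    GradedMF.ofPair_s_odd (m + 1) a
  show D.Ky.s (2 * m + 3) a + D.vec 0 (j + 1 - D.q) = _
  rw [show 2 * m + 3 = 2 * (m + 1) + 1 by ring, h, zsmul_c, vec_add, vec_add]
  exact D.vec_eq 0 (by ring) (by ring)

theorem KwObj_s_odd (D : ChainData) (r : ℕ) (hr : r ∈ Finset.Icc 1 D.ℓ) (m : ℤ)
    (a : Fin (D.KwObj r hr).rank) :
    (D.KwObj r hr).s (2 * m + 1) a = D.vec 0 ((m + 2) * D.q) := by
  show (D.Kw r hr).s (2 * m + 1 + 3) a = _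
  rw [show 2 * m + 1 + 3 = 2 * (m + 2) by ring]
  refine (GradedMF.ofPair_s_even (m + 2) a).trans ?_
  rw [zsmul_c, c_eq, neg_vec, vec_add]
  exact D.vec_eq 0 (by ring) (by ring)

theorem KwObj_s_even (D : ChainData) (r : ℕ) (hr : r ∈ Finset.Icc 1 D.ℓ) (m : ℤ)
    (a : Fin (D.KwObj r hr).rank) :
    (D.KwObj r hr).s (2 * m) a = D.vec (-D.pl) ((m + 2) * D.q) := by
  show (D.Kw r hr).s (2 * m + 3) a = _
  rw [show 2 * m + 3 = 2 * (m + 1) + 1 by ring]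
  refine (GradedMF.ofPair_s_odd (m + 1) a).trans ?_
  rw [zsmul_c, vec_add]
  exact D.vec_eq 0 (by ring) (by ring)

/-- No summand is excluded here, and likewise for `KwObj_neg`: this is why there are no morphisms
from a sink to `K₀` in any cohomological degree. -/
theorem KyObj_neg (D : ChainData) {j i' j' : ℕ}
    (hj : D.q - D.ql ≤ j ∧ j ≤ D.q - 1) (hi' : 1 ≤ i' ∧ i' ≤ D.p - 1)
    (hj' : D.q - D.ql ≤ j' ∧ j' ≤ D.q - 1) (z : ℤ) (a : Fin (D.KyObj j).rank) :
    D.Neg i' j' ((D.KyObj j).s z a) := by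
  obtain ⟨b1, b2, b3, b4⟩ := D.cast_bounds hi' hj
  obtain ⟨b1', b2', b3', b4'⟩ := D.cast_bounds hi' hj'
  obtain ⟨e1, e2, e3, e4, e5⟩ := D.cast_eqs
  unfold Neg
  rcases Int.even_or_odd' z with ⟨m, rfl | rfl⟩
  · rw [KyObj_s_even]
    rcases lt_or_ge m 0 with hm | hm
    · have := D.mul_q_le (show m ≤ -1 by omega)
      exact .inl (D.pos_vec 0 (by linarith) (by linarith))
    · have := D.mul_q_le hm
      exact .inr (D.not_pos_vec (-D.ℓ) (by linarith) (by linarith))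
  · rw [KyObj_s_odd]
    rcases lt_or_ge m 0 with hm | hm
    · have := D.mul_q_le (show m ≤ -1 by omega)
      exact .inl (D.pos_vec 0 (by linarith) (by linarith))
    · have := D.mul_q_le hm
      exact .inr (D.not_pos_vec (-D.ℓ) (by linarith) (by linarith))

theorem KwObj_neg (D : ChainData) {r i' j' : ℕ} (hr : r ∈ Finset.Icc 1 D.ℓ)
    (hi' : 1 ≤ i' ∧ i' ≤ D.p - 1) (hj' : D.q - D.ql ≤ j' ∧ j' ≤ D.q - 1) (z : ℤ)
    (a : Fin (D.KwObj r hr).rank) : D.Neg i' j' ((D.KwObj r hr).s z a) := by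
  obtain ⟨b1', b2', b3', b4'⟩ := D.cast_bounds hi' hj'
  obtain ⟨e1, e2, e3, e4, e5⟩ := D.cast_eqs
  unfold Neg
  rcases Int.even_or_odd' z with ⟨m, rfl | rfl⟩
  · rw [KwObj_s_even]
    rcases lt_or_ge m 0 with hm | hm
    · have := D.mul_q_le (show m ≤ -1 by omega)
      exact .inl (D.pos_vec 0 (by linarith) (by linarith))
    · have := D.mul_q_le hm
      exact .inr (D.not_pos_vec (-D.ℓ - 1) (by linarith) (by linarith))
  · rw [KwObj_s_odd]
    rcases lt_or_ge m 0 with hm | hm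
    · have := D.mul_q_le (show m ≤ -1 by omega)
      exact .inl (D.pos_vec 0 (by linarith) (by linarith))
    · have := D.mul_q_le hm
      exact .inr (D.not_pos_vec (-D.ℓ) (by linarith) (by linarith))

end ChainData

namespace GradedMF

variable {L : Type} [AddCommGroup L] {deg : Fin 2 → L} {W : PolyXY} {c : L}

theorem vecMul_d_homogeneous (K : GradedMF deg W c) (i : ℤ) {l : L} {g : Fin K.rank → PolyXY}
    (hg : ∀ a, IsWeightedHomogeneous deg (g a) (l - K.s (i + 1) a)) (a : Fin K.rank) :
    IsWeightedHomogeneous deg (Matrix.vecMul g (K.d i) a) (l - K.s i a) := by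
  rw [Matrix.vecMul, dotProduct]
  refine IsWeightedHomogeneous.sum _ _ _ fun s _ => ?_
  have h := (hg s).mul (K.d_homogeneous i s a)
  rwa [sub_add_sub_cancel] at h

theorem Hom.homogeneous {K K' : GradedMF deg W c} {n i₀ z : ℤ}
    {f : ℤ → Matrix (Fin K'.rank) (Fin K.rank) PolyXY} (hf : f ∈ K.Hom K' n) (hi : i₀ + n = z)
    (b : Fin K'.rank) (a : Fin K.rank) :
    IsWeightedHomogeneous deg (f i₀ b a) (K'.s z b - K.s i₀ a) := by
  rw [← hi]
  exact hf.2 i₀ b a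

end GradedMF

namespace ChainData

/-! ## Morphisms into `K_0^{i,j}` -/

section

variable (D : ChainData) {i j i' j' : ℕ} (hi : 1 ≤ i ∧ i ≤ D.p - 1)
  (hj : D.q - D.ql ≤ j ∧ j ≤ D.q - 1) (hi' : 1 ≤ i' ∧ i' ≤ D.p - 1)
  (hj' : D.q - D.ql ≤ j' ∧ j' ≤ D.q - 1)

theorem K₀_s_zero_last : (D.K₀ i j hi hj).s 0 (D.lastIdx hi hj) = D.vec i (j + 1) := by
  have h := D.K₀_s_even_last hi hj 0
  rwa [mul_zero, zero_mul, add_zero] at h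

/-- With zero correction the row itself has to lie in the ideal, and this holds entry by entry for
degree reasons. -/
theorem isCoboundary_of_neg {K : GradedMF D.deg D.poly D.c} {n : ℤ}
    {f : ℤ → Matrix (Fin (D.K₀ i' j' hi' hj').rank) (Fin K.rank) PolyXY}
    (hf : K.IsCocycle (D.K₀ i' j' hi' hj') n f)
    (h : ∀ a, f (-n) (D.lastIdx hi' hj') a = 0 ∨ D.Neg i' j' (K.s (-n) a)) :
    K.IsCoboundary (D.K₀ i' j' hi' hj') n f := by
  refine GradedMF.isCoboundary_of_imageMem D.poly_ne_zero (D.K₀_resolves hi' hj')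
    (neg_add_cancel n) hf 0 (fun _ => isWeightedHomogeneous_zero ℂ _ _) fun a => ?_
  rw [Matrix.zero_vecMul, Pi.zero_apply, add_zero]
  rcases h a with h | h
  · rw [h]
    exact .zero _ _ _ _
  · refine D.K₀_imageMem hi' hj' ?_ h
    have h1 := GradedMF.Hom.homogeneous hf.1 (neg_add_cancel n) (D.lastIdx hi' hj') a
    rwa [K₀_s_zero_last] at h1

/-- The other summands in position 0 have degree 2c - ql y, too large to map to degree ix + (j+1)y.
Hence a morphism of degree 0 has a single entry in its critical row, and composition multiplies
these entries. -/
theorem K₀_row_eq_zero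
    {f : ℤ → Matrix (Fin (D.K₀ i' j' hi' hj').rank) (Fin (D.K₀ i j hi hj).rank) PolyXY}
    (hf : f ∈ (D.K₀ i j hi hj).Hom (D.K₀ i' j' hi' hj') 0) {a : Fin (D.K₀ i j hi hj).rank}
    (ha : a ≠ D.lastIdx hi hj) : f 0 (D.lastIdx hi' hj') a = 0 := by
  have h1 := GradedMF.Hom.homogeneous hf (zero_add 0) (D.lastIdx hi' hj') a
  obtain ⟨b1', b2', b3', b4'⟩ := D.cast_bounds hi' hj'
  obtain ⟨e1, e2, e3, e4, e5⟩ := D.cast_eqs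
  have h2 := D.K₀_s_even_of_ne hi hj 0 ha
  rw [mul_zero, zero_mul, add_zero] at h2
  rw [K₀_s_zero_last, h2, vec_sub] at h1
  exact D.eq_zero_of_not_pos h1 (D.not_pos_vec (-D.ℓ) (by linarith) (by linarith))

theorem K₀_isCoboundary
    {f : ℤ → Matrix (Fin (D.K₀ i' j' hi' hj').rank) (Fin (D.K₀ i j hi hj).rank) PolyXY} {n : ℤ}
    (hf : (D.K₀ i j hi hj).IsCocycle (D.K₀ i' j' hi' hj') n f)
    (h : n ≠ 0 ∨ f 0 (D.lastIdx hi' hj') (D.lastIdx hi hj) = 0) :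
    (D.K₀ i j hi hj).IsCoboundary (D.K₀ i' j' hi' hj') n f := by
  refine D.isCoboundary_of_neg hi' hj' hf fun a => ?_
  by_cases hn : n = 0
  · subst hn
    refine .inl ?_
    by_cases ha : a = D.lastIdx hi hj
    · subst ha
      simpa using h
    · exact D.K₀_row_eq_zero hi hj hi' hj' hf.1 ha
  · exact .inr (D.K₀_neg hi hj hi' hj' _ a (.inl (neg_ne_zero.2 hn)))

/-- Exact morphisms `K_0 ⟶ K_0` of degree zero have no component at the last summands. -/
theorem K₀_eq_zero_of_isCoboundary
    {f : ℤ → Matrix (Fin (D.K₀ i' j' hi' hj').rank) (Fin (D.K₀ i j hi hj).rank) PolyXY}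
    (hf : (D.K₀ i j hi hj).IsCoboundary (D.K₀ i' j' hi' hj') 0 f) :
    f 0 (D.lastIdx hi' hj') (D.lastIdx hi hj) = 0 := by
  obtain ⟨g, hg, rfl⟩ := hf
  obtain ⟨b1, b2, b3, b4⟩ := D.cast_bounds hi hj
  obtain ⟨b1', b2', b3', b4'⟩ := D.cast_bounds hi' hj'
  obtain ⟨e1, e2, e3, e4, e5⟩ := D.cast_eqs
  obtain ⟨k1, k2, k3⟩ := D.cast_k_bounds hi
  obtain ⟨k1', k2', k3'⟩ := D.cast_k_bounds hi'
  -- By degree, a homotopy has no components out of the last summand of the source in position 0,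
  -- nor (as `h2` shows) into the last summand of the target there, so it cannot alter the critical
  -- entry.
  have h1 : ∀ s, g 0 s (D.lastIdx hi hj) = 0 := by
    intro s
    have h := GradedMF.Hom.homogeneous hg (show (0 : ℤ) + (0 - 1) = 2 * (-1) + 1 by norm_num) s
      (D.lastIdx hi hj)
    refine D.eq_zero_of_not_pos h ?_
    rw [K₀_s_zero_last]
    by_cases hs : s = D.lastIdx hi' hj'
    · rw [hs, K₀_s_odd_last, vec_sub]
      exact D.not_pos_vec (-(D.k i' + 1)) (by linarith) (by linarith)
    by_cases hs' : s = D.firstIdx hi' hj'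
    · rw [hs', K₀_s_odd_first, vec_sub]
      exact D.not_pos_vec 0 (by linarith) (by linarith)
    · rw [K₀_s_odd_of_ne _ _ _ _ hs hs', vec_sub]
      exact D.not_pos_vec 0 (by linarith) (by linarith)
  have h2 : ∀ s, g 1 (D.lastIdx hi' hj') s = 0 := by
    intro s
    have h := GradedMF.Hom.homogeneous hg (show (1 : ℤ) + (0 - 1) = 0 by norm_num)
      (D.lastIdx hi' hj') s
    refine D.eq_zero_of_not_pos h ?_
    rw [K₀_s_zero_last, show (1 : ℤ) = 2 * 0 + 1 by norm_num]
    by_cases hs : s = D.lastIdx hi hj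
    · rw [hs, K₀_s_odd_last, vec_sub]
      exact D.not_pos_vec (D.k i - D.ℓ) (by linarith) (by linarith)
    by_cases hs' : s = D.firstIdx hi hj
    · rw [hs', K₀_s_odd_first, vec_sub]
      exact D.not_pos_vec (-D.ℓ) (by linarith) (by linarith)
    · rw [K₀_s_odd_of_ne _ _ _ _ hs hs', vec_sub]
      exact D.not_pos_vec (-D.ℓ) (by linarith) (by linarith)
  show ((D.K₀ i' j' hi' hj').d (0 + (0 - 1)) * g 0 - ((-1 : ℂ) ^ ((0 : ℤ) - 1)) •
    (g (0 + 1) * (D.K₀ i j hi hj).d 0)) (D.lastIdx hi' hj') (D.lastIdx hi hj) = 0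
  rw [Matrix.sub_apply, Matrix.smul_apply, Matrix.mul_apply, Matrix.mul_apply, zero_add (1 : ℤ)]
  simp only [h1, h2, mul_zero, zero_mul, Finset.sum_const_zero, smul_zero, sub_zero]

/-- The row with the single entry h is closed modulo the ideal for free, since all summands of the
source in position -1 are negligible by `K₀_neg`. -/
theorem K₀_exists_cocycle {h : PolyXY}
    (hh : IsWeightedHomogeneous D.deg h (D.vec (i' - i) (j' - j))) :
    ∃ f, (D.K₀ i j hi hj).IsCocycle (D.K₀ i' j' hi' hj') 0 f ∧
      f 0 (D.lastIdx hi' hj') (D.lastIdx hi hj) = h := by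
  have hg : ∀ a, IsWeightedHomogeneous D.deg
      ((Pi.single (D.lastIdx hi hj) h : Fin (D.K₀ i j hi hj).rank → PolyXY) a)
      ((D.K₀ i' j' hi' hj').s 0 (D.lastIdx hi' hj') - (D.K₀ i j hi hj).s 0 a) := by
    intro a
    by_cases ha : a = D.lastIdx hi hj
    · subst ha
      rw [Pi.single_eq_same, K₀_s_zero_last, K₀_s_zero_last, vec_sub, add_sub_add_right_eq_sub]
      exact hh
    · rw [Pi.single_eq_of_ne ha]
      exact isWeightedHomogeneous_zero ℂ _ _
  obtain ⟨f, hf, hr⟩ := GradedMF.exists_cocycle D.poly_ne_zero (D.K₀_resolves hi' hj')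
    (K := D.K₀ i j hi hj) (zero_add 0) (Pi.single (D.lastIdx hi hj) h) hg fun a => by
      refine D.K₀_imageMem hi' hj' ?_ (D.K₀_neg hi hj hi' hj' (0 - 1) a (.inl (by norm_num)))
      have h1 := GradedMF.vecMul_d_homogeneous (D.K₀ i j hi hj) (0 - 1)
        (l := (D.K₀ i' j' hi' hj').s 0 (D.lastIdx hi' hj'))
        (g := Pi.single (D.lastIdx hi hj) h) (by rw [sub_add_cancel]; exact hg) a
      rwa [K₀_s_zero_last] at h1
  exact ⟨f, hf, by rw [hr, Pi.single_eq_same]⟩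

theorem K₀_comp_last {K : GradedMF D.deg D.poly D.c}
    {f : ℤ → Matrix (Fin (D.K₀ i' j' hi' hj').rank) (Fin (D.K₀ i j hi hj).rank) PolyXY}
    (hf : f ∈ (D.K₀ i j hi hj).Hom (D.K₀ i' j' hi' hj') 0)
    (g : Matrix (Fin (D.K₀ i j hi hj).rank) (Fin K.rank) PolyXY) (a : Fin K.rank) :
    (f 0 * g) (D.lastIdx hi' hj') a =
      f 0 (D.lastIdx hi' hj') (D.lastIdx hi hj) * g (D.lastIdx hi hj) a := by
  rw [Matrix.mul_apply, Finset.sum_eq_single (D.lastIdx hi hj)]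
  · intro s _ hs
    rw [D.K₀_row_eq_zero hi hj hi' hj' hf hs, zero_mul]
  · simp

end

end ChainData

namespace ChainData

/-! ## The factorisations `K_y` and `K_{w_r}` -/

theorem neg_one_zpow_three_smul (f : PolyXY) : ((-1 : ℂ) ^ (3 : ℤ)) • f = -f := by
  rw [show ((-1 : ℂ) ^ (3 : ℤ)) = -1 by norm_num, neg_one_smul]

/-- The index of the only summand of `K_y`. -/
def KyIdx (D : ChainData) (j : ℕ) : Fin (D.KyObj j).rank := (0 : Fin 1)

/-- The index of the only summand of `K_{w_r}`. -/
def KwIdx (D : ChainData) (r : ℕ) (hr : r ∈ Finset.Icc 1 D.ℓ) : Fin (D.KwObj r hr).rank :=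
  (0 : Fin 1)

theorem KyObj_d_even (D : ChainData) (j : ℕ) (m : ℤ) (a b : Fin (D.KyObj j).rank) :
    (D.KyObj j).d (2 * m) a b = -X 1 := by
  have h : D.Ky.d (2 * (m + 1) + 1) a b = X 1 :=
    congrFun (congrFun (GradedMF.ofPair_d_odd (m + 1)) a) b
  show ((-1 : ℂ) ^ (3 : ℤ)) • D.Ky.d (2 * m + 3) a b = _
  rw [show 2 * m + 3 = 2 * (m + 1) + 1 by ring, h, neg_one_zpow_three_smul]

theorem KyObj_d_odd (D : ChainData) (j : ℕ) (m : ℤ) (a b : Fin (D.KyObj j).rank) :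
    (D.KyObj j).d (2 * m + 1) a b = -D.wProd := by
  have h : D.Ky.d (2 * (m + 2)) a b = D.wProd :=
    congrFun (congrFun (GradedMF.ofPair_d_even (m + 2)) a) b
  show ((-1 : ℂ) ^ (3 : ℤ)) • D.Ky.d (2 * m + 1 + 3) a b = _
  rw [show 2 * m + 1 + 3 = 2 * (m + 2) by ring, h, neg_one_zpow_three_smul]

theorem KwObj_d_even (D : ChainData) (r : ℕ) (hr : r ∈ Finset.Icc 1 D.ℓ) (m : ℤ)
    (a b : Fin (D.KwObj r hr).rank) : (D.KwObj r hr).d (2 * m) a b = -D.wFactor r := by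
  have h : (D.Kw r hr).d (2 * (m + 1) + 1) a b = D.wFactor r :=
    congrFun (congrFun (GradedMF.ofPair_d_odd (m + 1)) a) b
  show ((-1 : ℂ) ^ (3 : ℤ)) • (D.Kw r hr).d (2 * m + 3) a b = _
  rw [show 2 * m + 3 = 2 * (m + 1) + 1 by ring, h, neg_one_zpow_three_smul]

theorem KwObj_d_odd (D : ChainData) (r : ℕ) (hr : r ∈ Finset.Icc 1 D.ℓ) (m : ℤ)
    (a b : Fin (D.KwObj r hr).rank) : (D.KwObj r hr).d (2 * m + 1) a b = -D.wCofactor r := by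
  have h : (D.Kw r hr).d (2 * (m + 2)) a b = D.wCofactor r :=
    congrFun (congrFun (GradedMF.ofPair_d_even (m + 2)) a) b
  show ((-1 : ℂ) ^ (3 : ℤ)) • (D.Kw r hr).d (2 * m + 1 + 3) a b = _
  rw [show 2 * m + 1 + 3 = 2 * (m + 2) by ring, h, neg_one_zpow_three_smul]

theorem wFactor_dvd_pow_sub (D : ChainData) (r s : ℕ) :
    D.wFactor r ∣ X 0 ^ (s * D.pl) - C (D.ζ r ^ s) * X 1 ^ (s * D.ql) := by
  have h := sub_dvd_pow_sub_pow (X 0 ^ D.pl : PolyXY) (C (D.ζ r) * X 1 ^ D.ql) s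
  rwa [mul_pow, ← pow_mul, ← pow_mul, ← map_pow, mul_comm D.pl, mul_comm D.ql] at h

theorem ζ_ne_zero (D : ChainData) (r : ℕ) : D.ζ r ≠ 0 := by
  intro h
  have h1 := D.ζ_pow r
  rw [h, zero_pow D.ℓ_pos.ne'] at h1
  norm_num at h1

/-- Modulo `w_r`, every homogeneous component of `S` is spanned by any of its monomials. -/
theorem wFactor_dvd_sub (D : ChainData) (r : ℕ) {a b : ℕ} {l : D.L} (hl : D.vec a b = l)
    {p : PolyXY} (hp : IsWeightedHomogeneous D.deg p l) :
    ∃ κ : ℂ, D.wFactor r ∣ p - C κ * (X 0 ^ a * X 1 ^ b) := by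
  refine D.homogeneous_induction (P := fun p => ∃ κ : ℂ, D.wFactor r ∣
    p - C κ * (X 0 ^ a * X 1 ^ b)) ⟨0, by simp⟩ ?_ ?_ hp
  · rintro p q ⟨κ, h⟩ ⟨κ', h'⟩
    refine ⟨κ + κ', ?_⟩
    convert h.add h' using 1
    rw [map_add]
    ring
  · intro a' b' s h
    rw [← hl, vec_eq_iff] at h
    obtain ⟨t, h1, h2⟩ := h
    -- Two monomials of equal degree differ by exchanging x^pl for y^ql a certain number t of times.
    -- Modulo w_r each exchange costs a factor ζ, inverted if t is negative.
    rcases le_total 0 t with ht | ht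
    · lift t to ℕ using ht
      have e1 : a' = a + t * D.pl := by exact_mod_cast h1
      have e2 : b = b' + t * D.ql := by
        have : (b : ℤ) = b' + t * D.ql := by linarith
        exact_mod_cast this
      refine ⟨s * D.ζ r ^ t, ?_⟩
      convert (D.wFactor_dvd_pow_sub r t).mul_left (C s * (X 0 ^ a * X 1 ^ b')) using 1
      rw [e1, e2, smul_eq_C_mul, map_mul, pow_add, pow_add]
      ring
    · obtain ⟨t, rfl⟩ : ∃ t' : ℕ, t = -t' := ⟨t.natAbs, by omega⟩
      have e1 : a = a' + t * D.pl := by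
        have : (a : ℤ) = a' + t * D.pl := by linarith
        exact_mod_cast this
      have e2 : b' = b + t * D.ql := by
        have : (b' : ℤ) = b + t * D.ql := by linarith
        exact_mod_cast this
      refine ⟨s * (D.ζ r ^ t)⁻¹, ?_⟩
      have h0 : C ((D.ζ r ^ t)⁻¹) * C (D.ζ r ^ t) = (1 : PolyXY) := by
        rw [← map_mul, inv_mul_cancel₀ (pow_ne_zero _ (D.ζ_ne_zero r)), map_one]
      convert (D.wFactor_dvd_pow_sub r t).mul_left
        (-C s * C ((D.ζ r ^ t)⁻¹) * (X 0 ^ a' * X 1 ^ b)) using 1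
      rw [e1, e2, smul_eq_C_mul, map_mul, pow_add, pow_add]
      linear_combination (-C s * X 0 ^ a' * X 1 ^ b * X 1 ^ (t * D.ql)) * h0

/-- Modulo `y`, every homogeneous component of `S` is spanned by a power of `x`. -/
theorem X_dvd_sub (D : ChainData) {l : D.L} {p : PolyXY} (hp : IsWeightedHomogeneous D.deg p l) :
    X 1 ∣ p ∨ ∃ (a : ℕ) (κ : ℂ), D.vec a 0 = l ∧ X 1 ∣ p - C κ * X 0 ^ a := by
  refine D.homogeneous_induction (P := fun p => X 1 ∣ p ∨ ∃ (a : ℕ) (κ : ℂ), D.vec a 0 = l ∧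
    X 1 ∣ p - C κ * X 0 ^ a) (.inl (dvd_zero _)) ?_ ?_ hp
  · rintro p q (h | ⟨a, κ, ha, h⟩) (h' | ⟨a', κ', ha', h'⟩)
    · exact .inl (h.add h')
    · exact .inr ⟨a', κ', ha', by rw [add_sub_assoc]; exact h.add h'⟩
    · exact .inr ⟨a, κ, ha, by rw [add_sub_right_comm]; exact h.add h'⟩
    · refine .inr ⟨a, κ + κ', ha, ?_⟩
      -- Different powers of x have different degrees in L, because the y-coordinate forces t ql =
      -- 0; so the two exponents agree.
      obtain ⟨t, h1, h2⟩ := D.vec_eq_iff.1 (ha'.trans ha.symm)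
      have ht : t * (D.ql : ℤ) = 0 := by linarith
      have ht0 : t = 0 := (mul_eq_zero.1 ht).resolve_right (by exact_mod_cast D.ql_pos.ne')
      obtain rfl : a' = a := by
        rw [ht0, zero_mul, add_zero] at h1
        exact_mod_cast h1
      convert h.add h' using 1
      rw [map_add]
      ring
  · intro a b s h
    rcases Nat.eq_zero_or_pos b with rfl | hb
    · refine .inr ⟨a, s, h, ?_⟩
      rw [pow_zero, mul_one, smul_eq_C_mul, sub_self]
      exact dvd_zero _
    · refine .inl ?_
      rw [smul_eq_C_mul]
      exact ((dvd_pow_self _ hb.ne').mul_left _).mul_left _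

/-! ### The common features of `Ky` and `Kw` as targets. -/

/-- `T` is, up to its first three positions, the factorisation of `𝐰` into `f` and a cofactor,
receiving an arrow from `K_0^{p-1,J}`. -/
structure IsSink (D : ChainData) (T : GradedMF D.deg D.poly D.c) (κ : Fin T.rank) (f : PolyXY)
    (J : ℕ) : Prop where
  unique : ∀ a, a = κ
  bounds : D.q - D.ql ≤ J ∧ J ≤ D.q - 1
  d_in : T.d (-4) κ κ = -f
  eval_in : eval 0 f = 0
  eval_out : eval 0 (T.d (-3) κ κ) = 0
  s_eq : T.s (-3) κ = D.vec 0 (J + 1 - D.q)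
  ne_zero : f ≠ 0
  coprime : IsRelPrime f (X 0)
  -- These are the degrees of components of morphisms from the non-last summands of `K₀` in even
  -- positions.
  lift_middle : ∀ (M : ℤ) (p : PolyXY),
    IsWeightedHomogeneous D.deg p (D.vec 0 (J + 1 + D.ql + M * D.q)) →
    ∃ p', IsWeightedHomogeneous D.deg p' (D.vec (-D.pl) (J + 1 + D.ql + M * D.q)) ∧
      f ∣ p - X 0 ^ D.pl * p'
  -- This concerns the component at the first summand of `K₀` in odd positions; the cohomological
  -- degree of the morphism is 2μ, which is why μ = 0 is left out.
  lift_first : ∀ (i j : ℕ) (μ : ℤ) (p : PolyXY), i ≤ D.p → (D.q - D.ql ≤ j ∧ j ≤ D.q - 1) →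
    μ ≠ 0 → IsWeightedHomogeneous D.deg p (D.vec 0 (J - j + μ * D.q)) →
    ∃ p', IsWeightedHomogeneous D.deg p' (D.vec (-i) (J - j + μ * D.q)) ∧ f ∣ p - X 0 ^ i * p'
  -- This is the case μ = 0, where the morphisms given by paths live.
  span_first : ∀ (j : ℕ) (p : PolyXY), (D.q - D.ql ≤ j ∧ j ≤ D.q - 1) →
    IsWeightedHomogeneous D.deg p (D.vec 0 (J - j)) →
    f ∣ p ∨ (j ≤ J ∧ ∃ κ : ℂ, f ∣ p - C κ * X 1 ^ (J - j))

theorem mul_ql_le (D : ChainData) {m n : ℤ} (h : m ≤ n) : m * (D.ql : ℤ) ≤ n * D.ql :=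
  mul_le_mul_of_nonneg_right h (by positivity)

theorem mul_pl_le (D : ChainData) {m n : ℤ} (h : m ≤ n) : m * (D.pl : ℤ) ≤ n * D.pl :=
  mul_le_mul_of_nonneg_right h (by positivity)

theorem nonneg_of_mul_pl (D : ChainData) {a : ℕ} {t : ℤ} (h : (a : ℤ) = t * D.pl) : 0 ≤ t := by
  by_contra ht
  have h1 := D.mul_pl_le (show t ≤ -1 by omega)
  obtain ⟨e1, e2, e3, e4, e5⟩ := D.cast_eqs
  have : (0 : ℤ) ≤ a := a.cast_nonneg
  linarith

theorem isRelPrime_X_X : IsRelPrime (X 1 : PolyXY) (X 0) := by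
  refine ((X_prime (R := ℂ) (i := (1 : Fin 2))).irreducible.isRelPrime_iff_not_dvd).2 fun h => ?_
  exact X_not_dvd_X_pow (i := 1) (j := 0) (by decide) 1 (by rwa [pow_one])

theorem isRelPrime_wFactor_X_zero (D : ChainData) (r : ℕ) : IsRelPrime (D.wFactor r) (X 0) := by
  refine (((X_prime (R := ℂ) (i := (0 : Fin 2))).irreducible.isRelPrime_iff_not_dvd).2
    fun h => ?_).symm
  rw [wFactor, dvd_sub_right (dvd_pow_self _ D.pl_pos.ne')] at h
  have h0 : IsUnit (C (D.ζ r) : PolyXY) := (IsUnit.mk0 _ (D.ζ_ne_zero r)).map C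
  rw [h0.dvd_mul_left] at h
  exact X_not_dvd_X_pow (i := 0) (j := 1) (by decide) _ h

theorem isRelPrime_wFactor_X_one (D : ChainData) (r : ℕ) : IsRelPrime (D.wFactor r) (X 1) := by
  refine (((X_prime (R := ℂ) (i := (1 : Fin 2))).irreducible.isRelPrime_iff_not_dvd).2
    fun h => ?_).symm
  rw [wFactor, dvd_sub_left ((dvd_pow_self _ D.ql_pos.ne').mul_left _)] at h
  exact X_not_dvd_X_pow (i := 1) (j := 0) (by decide) _ h

/-- The two factors differ by a non-zero scalar multiple of y^ql, and w_r is coprime to y. -/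
theorem isRelPrime_wFactor_wFactor (D : ChainData) {r t : ℕ} (h : D.ζ r ≠ D.ζ t) :
    IsRelPrime (D.wFactor r) (D.wFactor t) := by
  have h1 : D.wFactor t = C (D.ζ r - D.ζ t) * X 1 ^ D.ql + D.wFactor r * 1 := by
    rw [wFactor, wFactor, map_sub]
    ring
  have h0 : IsUnit (C (D.ζ r - D.ζ t) : PolyXY) := (IsUnit.mk0 _ (sub_ne_zero.2 h)).map C
  rw [h1]
  refine IsRelPrime.add_mul_left_right ?_ 1
  exact IsRelPrime.mul_right h0.isRelPrime_right ((D.isRelPrime_wFactor_X_one r).pow_right)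

theorem ζ_injOn (D : ChainData) {r t : ℕ} (hr : r ∈ Finset.Icc 1 D.ℓ)
    (ht : t ∈ Finset.Icc 1 D.ℓ) (h : D.ζ r = D.ζ t) : r = t := by
  rw [Finset.mem_Icc] at hr ht
  have h1 := mul_left_cancel₀ (Complex.exp_ne_zero _) h
  obtain ⟨r, rfl⟩ : ∃ r', r = r' + 1 := ⟨r - 1, by omega⟩
  obtain ⟨t, rfl⟩ : ∃ t', t = t' + 1 := ⟨t - 1, by omega⟩
  rw [pow_succ, pow_succ] at h1
  have := D.isPrimitiveRoot.pow_inj (by omega) (by omega)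
    (mul_right_cancel₀ (D.isPrimitiveRoot.ne_zero D.ℓ_pos.ne') h1)
  omega

theorem wFactor_ne_zero (D : ChainData) (r : ℕ) : D.wFactor r ≠ 0 := fun h => by
  have h1 := D.isRelPrime_wFactor_X_zero r
  rw [h] at h1
  exact X_prime.not_isUnit (h1 (dvd_zero (X 0)) dvd_rfl)

theorem eval_wFactor (D : ChainData) (r : ℕ) : eval 0 (D.wFactor r) = 0 := by
  simp [wFactor, D.pl_pos.ne', D.ql_pos.ne']

/-- Modulo y a homogeneous element is a scalar multiple of a power x^a, and its degree forces a = t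
pl with t ≥ 0. The lifting properties are lower bounds for t. -/
theorem isSink_KyObj (D : ChainData) {j : ℕ} (hj : D.q - D.ql ≤ j ∧ j ≤ D.q - 1) :
    D.IsSink (D.KyObj j) (D.KyIdx j) (X 1) j := by
  have hd0 := D.KyObj_d_even j (-2) (D.KyIdx j) (D.KyIdx j)
  have hd1 := D.KyObj_d_odd j (-2) (D.KyIdx j) (D.KyIdx j)
  have hs := D.KyObj_s_odd j (-2) (D.KyIdx j)
  norm_num at hd0 hd1 hs
  obtain ⟨b1, b2, b3, b4⟩ := D.cast_bounds (i := 1) (by have := D.two_le_p; omega) hj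
  obtain ⟨e1, e2, e3, e4, e5⟩ := D.cast_eqs
  refine ⟨fun a => Subsingleton.elim (α := Fin 1) _ _, hj, hd0, by simp, ?_, ?_, X_ne_zero 1,
    isRelPrime_X_X, ?_, ?_, ?_⟩
  · have h1 : D.p ≠ 0 := by have := D.two_le_p; omega
    have h2 : D.q - 1 ≠ 0 := by have := D.two_le_q; omega
    rw [hd1, wProd_eq]
    simp [h1, h2]
  · rw [hs]
    exact D.vec_eq 0 (by ring) (by ring)
  · intro M p hp
    rcases D.X_dvd_sub hp with h | ⟨a, κ, ha, h⟩
    · exact ⟨0, isWeightedHomogeneous_zero ℂ _ _, by simpa using h⟩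
    obtain ⟨t, h1, h2⟩ := D.vec_eq_iff.1 ha
    rw [zero_add] at h1
    have ht := D.nonneg_of_mul_pl h1
    -- The degree is never 0: the integer j + 1 + ql + M q is positive for M ≥ -1 and negative for M
    -- ≤ -2. Hence t ≥ 1 and x^pl can be split off.
    have ht0 : t ≠ 0 := by
      rintro rfl
      rcases le_or_gt (-1) M with hM | hM
      · have := D.mul_q_le hM
        linarith
      · have := D.mul_q_le (show M ≤ -2 by omega)
        have := D.mul_ql_le e3
        linarith
    have hpa := D.mul_pl_le (show 1 ≤ t by omega)
    have hpa' : D.pl ≤ a := by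
      zify
      linarith
    refine ⟨C κ * X 0 ^ (a - D.pl), (D.x_homogeneous _ _ (D.vec_eq t ?_ ?_)).C_mul κ, ?_⟩
    · rw [Nat.cast_sub hpa']
      linarith
    · linarith
    · convert h using 2
      rw [mul_left_comm, ← pow_add, Nat.add_sub_of_le hpa']
  · intro i j' μ p hi hj' hμ hp
    obtain ⟨b1', b2', b3', b4'⟩ := D.cast_bounds (i := 1) (by have := D.two_le_p; omega) hj'
    rcases D.X_dvd_sub hp with h | ⟨a, κ, ha, h⟩
    · exact ⟨0, isWeightedHomogeneous_zero ℂ _ _, by simpa using h⟩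
    obtain ⟨t, h1, h2⟩ := D.vec_eq_iff.1 ha
    rw [zero_add] at h1
    have ht := D.mul_ql_le (D.nonneg_of_mul_pl h1)
    -- For μ < 0 the degree is negative, a contradiction. For μ ≥ 1 it exceeds (ℓ - 1) ql since the
    -- two rows differ by less than ql, so t ≥ ℓ and a ≥ p.
    have htl : (D.ℓ : ℤ) ≤ t := by
      rcases lt_or_gt_of_ne hμ with hμ | hμ
      · have := D.mul_q_le (show μ ≤ -1 by omega)
        linarith
      · have := D.mul_q_le (show 1 ≤ μ by omega)
        by_contra hlt
        have := D.mul_ql_le (show t ≤ D.ℓ - 1 by omega)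
        linarith
    have hpa := D.mul_pl_le htl
    have hia : i ≤ a := by
      zify at hi ⊢
      linarith
    refine ⟨C κ * X 0 ^ (a - i), (D.x_homogeneous _ _ (D.vec_eq t ?_ ?_)).C_mul κ, ?_⟩
    · rw [Nat.cast_sub hia]
      linarith
    · linarith
    · convert h using 2
      rw [mul_left_comm, ← pow_add, Nat.add_sub_of_le hia]
  · intro j' p hj' hp
    obtain ⟨b1', b2', b3', b4'⟩ := D.cast_bounds (i := 1) (by have := D.two_le_p; omega) hj'
    rcases D.X_dvd_sub hp with h | ⟨a, κ, ha, h⟩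
    · exact .inl h
    obtain ⟨t, h1, h2⟩ := D.vec_eq_iff.1 ha
    rw [zero_add] at h1
    have ht := D.nonneg_of_mul_pl h1
    obtain rfl : t = 0 := by
      by_contra ht0
      have := D.mul_ql_le (show 1 ≤ t by omega)
      linarith
    have hjj : j' = j := by
      zify
      linarith
    refine .inr ⟨hjj.le, κ, ?_⟩
    have ha0 : a = 0 := by
      zify
      linarith
    rw [ha0, pow_zero] at h
    rw [hjj, Nat.sub_self, pow_zero]
    exact h

/-- Modulo w_r every graded piece is spanned by any one of its monomials, so it suffices to exhibit
a monomial of the given degree with the required power of x. -/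
theorem isSink_KwObj (D : ChainData) {r : ℕ} (hr : r ∈ Finset.Icc 1 D.ℓ) :
    D.IsSink (D.KwObj r hr) (D.KwIdx r hr) (D.wFactor r) (D.q - 1) := by
  have hd0 := D.KwObj_d_even r hr (-2) (D.KwIdx r hr) (D.KwIdx r hr)
  have hd1 := D.KwObj_d_odd r hr (-2) (D.KwIdx r hr) (D.KwIdx r hr)
  have hs := D.KwObj_s_odd r hr (-2) (D.KwIdx r hr)
  norm_num at hd0 hd1 hs
  have hq2 := D.two_le_q
  have hql := D.ql_pos
  obtain ⟨e1, e2, e3, e4, e5⟩ := D.cast_eqs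
  have hqc : ((D.q - 1 : ℕ) : ℤ) = D.q - 1 := by
    rw [Nat.cast_sub (by omega), Nat.cast_one]
  refine ⟨fun a => Subsingleton.elim (α := Fin 1) _ _, by omega, hd0, D.eval_wFactor r, ?_, ?_,
    D.wFactor_ne_zero r, D.isRelPrime_wFactor_X_zero r, ?_, ?_, ?_⟩
  · rw [hd1, wCofactor]
    simp
  · rw [hs, hqc]
    exact D.vec_eq 0 (by ring) (by ring)
  · intro M p hp
    by_cases h0 : D.Pos (D.vec 0 ((D.q - 1 : ℕ) + 1 + D.ql + M * D.q))
    swap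
    · rw [D.eq_zero_of_not_pos hp h0]
      exact ⟨0, isWeightedHomogeneous_zero ℂ _ _, by simp⟩
    -- For smaller M there is no monomial of this degree; otherwise, with m = M + 1, the monomial
    -- x^pl y^(mq) has it.
    have hM : 0 ≤ M + 1 := by
      by_contra hM
      have := D.mul_q_le (show M + 1 ≤ -1 by omega)
      have := D.mul_ql_le (show (1 : ℤ) ≤ D.ℓ by omega)
      exact D.not_pos_vec (-1) (by linarith) (by linarith) h0
    obtain ⟨m, hm⟩ := Int.eq_ofNat_of_zero_le hM
    obtain rfl : M = m - 1 := by omega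
    obtain ⟨κ, h⟩ := D.wFactor_dvd_sub r (a := D.pl) (b := m * D.q)
      (D.vec_eq 1 (by ring) (by rw [hqc]; push_cast; ring)) hp
    refine ⟨C κ * X 1 ^ (m * D.q), (D.y_homogeneous _ _ (D.vec_eq 1 (by ring) ?_)).C_mul κ, ?_⟩
    · rw [hqc]
      push_cast
      ring
    · convert h using 2
      ring
  · intro i j μ p hi hj hμ hp
    obtain ⟨b1', b2', b3', b4'⟩ := D.cast_bounds (i := 1) (by have := D.two_le_p; omega) hj
    rcases lt_or_gt_of_ne hμ with hμ | hμ
    · have h1 := D.mul_q_le (show μ ≤ -1 by omega)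
      rw [D.eq_zero_of_not_pos hp (D.not_pos_vec (-1) (by linarith) (by rw [hqc]; linarith))]
      exact ⟨0, isWeightedHomogeneous_zero ℂ _ _, by simp⟩
    have h1 := D.mul_q_le (show 1 ≤ μ by omega)
    -- Since p x = (q - 1) y in L, the monomial x^p y^b with b = μq - j has the degree of p, and x^i
    -- divides x^p.
    obtain ⟨b, hb⟩ := Int.eq_ofNat_of_zero_le (show 0 ≤ μ * D.q - j by linarith)
    obtain ⟨κ, h⟩ := D.wFactor_dvd_sub r (a := D.p) (b := b)
      (D.vec_eq D.ℓ (by linarith) (by rw [hqc]; linarith)) hp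
    refine ⟨C κ * (X 0 ^ (D.p - i) * X 1 ^ b),
      (D.mono_homogeneous _ _ _ (D.vec_eq D.ℓ ?_ ?_)).C_mul κ, ?_⟩
    · rw [Nat.cast_sub hi]
      linarith
    · rw [hqc]
      linarith
    · convert h using 2
      rw [mul_left_comm, ← mul_assoc (X 0 ^ i), ← pow_add, Nat.add_sub_of_le hi]
  · intro j p hj hp
    obtain ⟨κ, h⟩ := D.wFactor_dvd_sub r (a := 0) (b := D.q - 1 - j)
      (D.vec_eq 0 (by ring) (by rw [Nat.cast_sub hj.2]; ring)) hp
    refine .inr ⟨hj.2, κ, ?_⟩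
    rwa [pow_zero, one_mul] at h

end ChainData

namespace ChainData

/-! ## Morphisms into `K_y` and `K_{w_r}` -/

theorem K₀_s_odd_of_lt (D : ChainData) {i j : ℕ} (hi : 1 ≤ i ∧ i ≤ D.p - 1)
    (hj : D.q - D.ql ≤ j ∧ j ≤ D.q - 1) (m : ℤ) {a : Fin (D.K₀ i j hi hj).rank}
    (ha : a ≠ D.lastIdx hi hj) :
    (D.K₀ i j hi hj).s (2 * m) a = D.vec 0 ((m + 2) * D.q - D.ql) := by
  rw [K₀_s_even_of_ne _ _ _ _ ha]
  exact D.vec_eq 0 (by ring) (by ring)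

namespace IsSink

variable {D : ChainData} {T : GradedMF D.deg D.poly D.c} {κ : Fin T.rank} {f : PolyXY} {J : ℕ}

theorem sum_eq (hT : D.IsSink T κ f J) (g : Fin T.rank → PolyXY) : ∑ t, g t = g κ :=
  Fintype.sum_eq_single κ fun t ht => absurd (hT.unique t) ht

theorem d_in' (hT : D.IsSink T κ f J) : T.d (-3 - 1) κ κ = -f := hT.d_in

theorem dvd_poly (hT : D.IsSink T κ f J) : f ∣ D.poly := by
  have h := congrFun (congrFun (T.d_mul_d (-4)) κ) κ
  rw [Matrix.mul_apply, hT.sum_eq, hT.d_in, Matrix.smul_apply, Matrix.one_apply_eq, smul_eq_mul,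
    mul_one] at h
  exact ⟨-T.d (-4 + 1) κ κ, by linear_combination -h⟩

/-- In rank one a syzygy of the single non-zero entry f is zero, so b = 0 works. -/
theorem resolves (hT : D.IsSink T κ f J) : T.Resolves (-3) κ := by
  refine .of_exact fun r hr => ⟨0, rfl, ?_⟩
  rw [hT.sum_eq, hT.d_in', mul_eq_zero, neg_eq_zero] at hr
  rw [Matrix.mulVec_zero]
  funext t
  rw [hT.unique t]
  exact (hr.resolve_left hT.ne_zero).symm

theorem homogeneous (hT : D.IsSink T κ f J) :
    IsWeightedHomogeneous D.deg f (T.s (-3) κ - T.s (-4) κ) := by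
  have h := (T.d_homogeneous (-4) κ κ).neg
  rwa [hT.d_in, neg_neg] at h

theorem imageMem (hT : D.IsSink T κ f J) {σ : D.L} {p : PolyXY}
    (hp : IsWeightedHomogeneous D.deg p (T.s (-3) κ - σ)) (h : f ∣ p) :
    T.ImageMem (-3) κ σ p := by
  obtain ⟨b, rfl⟩ := h
  refine ⟨fun _ => -b, fun t => ?_, ?_⟩
  · rw [hT.unique t]
    refine IsWeightedHomogeneous.neg ?_
    refine isWeightedHomogeneous_of_mul hT.ne_zero hT.homogeneous ?_
    rwa [show (-4 : ℤ) = -3 - 1 by norm_num, sub_add_sub_cancel]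
  · rw [hT.sum_eq, hT.d_in', neg_mul_neg]

/-- A closed morphism is exact as soon as its component in the critical position is, modulo `f`. -/
theorem isCoboundary (hT : D.IsSink T κ f J) {K : GradedMF D.deg D.poly D.c} {n i₀ : ℤ}
    (hi : i₀ + n = -3) {φ : ℤ → Matrix (Fin T.rank) (Fin K.rank) PolyXY}
    (hφ : K.IsCocycle T n φ) (g : Fin K.rank → PolyXY)
    (hg : ∀ a, IsWeightedHomogeneous D.deg (g a) (T.s (-3) κ - K.s (i₀ + 1) a))
    (hI : ∀ a, f ∣ φ i₀ κ a + Matrix.vecMul g (K.d i₀) a) : K.IsCoboundary T n φ :=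
  GradedMF.isCoboundary_of_imageMem D.poly_ne_zero hT.resolves hi hφ g hg fun a =>
    hT.imageMem ((GradedMF.Hom.homogeneous hφ.1 hi κ a).add
      (GradedMF.vecMul_d_homogeneous K i₀ hg a)) (hI a)

theorem exists_cocycle (hT : D.IsSink T κ f J) {K : GradedMF D.deg D.poly D.c} {n i₀ : ℤ}
    (hi : i₀ + n = -3) (g : Fin K.rank → PolyXY)
    (hg : ∀ a, IsWeightedHomogeneous D.deg (g a) (T.s (-3) κ - K.s i₀ a))
    (hI : ∀ a, f ∣ Matrix.vecMul g (K.d (i₀ - 1)) a) :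
    ∃ φ, K.IsCocycle T n φ ∧ ∀ a, φ i₀ κ a = g a :=
  GradedMF.exists_cocycle D.poly_ne_zero hT.resolves hi g hg fun a =>
    hT.imageMem (GradedMF.vecMul_d_homogeneous K (i₀ - 1)
      (fun a => by rw [sub_add_cancel]; exact hg a) a) (hI a)

theorem dvd_vecMul (hT : D.IsSink T κ f J) {K : GradedMF D.deg D.poly D.c} {n i₀ : ℤ}
    (hi : i₀ + n = -3) {φ : ℤ → Matrix (Fin T.rank) (Fin K.rank) PolyXY}
    (hφ : K.IsCocycle T n φ) (a : Fin K.rank) :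
    f ∣ Matrix.vecMul (φ i₀ κ) (K.d (i₀ - 1)) a := by
  rw [hφ.vecMul_mem hi κ a, hT.sum_eq, hT.d_in', smul_eq_C_mul]
  exact ⟨-(C ((-1) ^ n) * φ (i₀ - 1) κ a), by ring⟩

theorem dvd_of_dvd_X_pow_mul (hT : D.IsSink T κ f J) {n : ℕ} {p : PolyXY}
    (h : f ∣ X 0 ^ n * p) : f ∣ p :=
  hT.coprime.pow_right.dvd_of_dvd_mul_left h

/-- Solvability of `e · x^n ≡ p` modulo `f` in the degrees of interest. -/
theorem exists_lift (hT : D.IsSink T κ f J) {n : ℕ} (hn : n ≤ D.pl) (m : ℤ) {p : PolyXY}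
    {l l' : D.L} (hl : l = T.s (-3) κ - D.vec 0 ((m + 2) * D.q - D.ql))
    (hl' : l' = l - D.vec n 0) (hp : IsWeightedHomogeneous D.deg p l) :
    ∃ p', IsWeightedHomogeneous D.deg p' l' ∧ f ∣ p - X 0 ^ n * p' := by
  have hl2 : l = D.vec 0 (J + 1 + D.ql + (-(m + 3)) * D.q) := by
    rw [hl, hT.s_eq, vec_sub]
    exact D.vec_eq 0 (by ring) (by ring)
  obtain ⟨p', h1, h2⟩ := hT.lift_middle (-(m + 3)) p (hl2 ▸ hp)
  -- The available lift is divisible by x^pl; of this only x^n is needed and the rest is put into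
  -- p'.
  refine ⟨X 0 ^ (D.pl - n) * p', ?_, ?_⟩
  · have h3 := (D.x_homogeneous (D.pl - n) _ rfl).mul h1
    convert h3 using 1
    rw [hl', hl2, vec_sub, vec_add, Nat.cast_sub hn]
    exact D.vec_eq 0 (by ring) (by ring)
  · rwa [← mul_assoc, ← pow_add, Nat.add_sub_of_le hn]

end IsSink

/-! ### Solving congruences along the columns of d₀. -/

theorem vecMul_d₀ (D : ChainData) {i j : ℕ} (e : ℕ → PolyXY) {a : Fin (D.k i + 2)}
    (ha : (a : ℕ) ≤ D.k i) :
    Matrix.vecMul (fun t : Fin (D.k i + 2) => e t) (D.d₀ i j) a =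
      e a * D.diag i j a - e (a + 1) * D.subdiag i a := by
  rw [Matrix.vecMul, dotProduct, d₀_eq, sum_mul_cyclicMatrix, if_neg (by omega), mul_neg,
    sub_eq_add_neg]

theorem exists_subdiag_eq (D : ChainData) {i : ℕ} (hi : 1 ≤ i ∧ i ≤ D.p - 1) (t : ℕ) :
    ∃ n ≤ D.pl, D.subdiag i t = X 0 ^ n := by
  obtain ⟨k1, k2, k3⟩ := D.k_bounds hi
  unfold subdiag
  split_ifs
  · refine ⟨_, ?_, rfl⟩
    rw [add_mul, one_mul] at k3
    omega
  · exact ⟨_, le_rfl, rfl⟩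

/-- A sequence obtained by successive choices. -/
theorem exists_seq {α : Type*} (P : ℕ → α → Prop) (R : ℕ → α → α → Prop) {n : ℕ} {x : α}
    (hx : P 0 x) (h : ∀ t < n, ∀ a, P t a → ∃ b, P (t + 1) b ∧ R t a b) :
    ∃ e : ℕ → α, e 0 = x ∧ (∀ t ≤ n, P t (e t)) ∧ ∀ t < n, R t (e t) (e (t + 1)) := by
  induction n with
  | zero => exact ⟨fun _ => x, rfl, fun t ht => by obtain rfl : t = 0 := by omega
                                                   exact hx, fun t ht => by omega⟩
  | succ n ih =>
    obtain ⟨e, h1, h2, h3⟩ := ih fun t ht => h t (by omega)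
    obtain ⟨b, hb1, hb2⟩ := h n (by omega) (e n) (h2 n le_rfl)
    refine ⟨Function.update e (n + 1) b, ?_, fun t ht => ?_, fun t ht => ?_⟩
    · rw [Function.update_of_ne (by omega), h1]
    · by_cases htn : t = n + 1
      · rw [htn, Function.update_self]
        exact hb1
      · rw [Function.update_of_ne htn]
        exact h2 t (by omega)
    · rw [Function.update_of_ne (show t ≠ n + 1 by omega)]
      by_cases htn : t = n
      · rw [htn, Function.update_self]
        exact hb2
      · rw [Function.update_of_ne (by omega)]
        exact h3 t (by omega)

section

variable {D : ChainData} {T : GradedMF D.deg D.poly D.c} {κ : Fin T.rank} {f : PolyXY} {J : ℕ}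
  {i j : ℕ} (hi : 1 ≤ i ∧ i ≤ D.p - 1) (hj : D.q - D.ql ≤ j ∧ j ≤ D.q - 1)

/-- The relevant lifting property along `d₀`: given the first entry of a row `e` and a row `g`,
the other entries can be chosen such that `e · d₀ + g ≡ 0` in all columns but the last. -/
theorem IsSink.exists_row (hT : D.IsSink T κ f J) (m : ℤ)
    (g : Fin (D.K₀ i j hi hj).rank → PolyXY) (e₀ : PolyXY)
    (hg : ∀ a, IsWeightedHomogeneous D.deg (g a)
      (T.s (-3) κ - (D.K₀ i j hi hj).s (2 * m) a))
    (he₀ : IsWeightedHomogeneous D.deg e₀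
      (T.s (-3) κ - (D.K₀ i j hi hj).s (2 * m + 1) (D.firstIdx hi hj))) :
    ∃ e : Fin (D.K₀ i j hi hj).rank → PolyXY, e (D.firstIdx hi hj) = e₀ ∧
      (∀ a, IsWeightedHomogeneous D.deg (e a)
        (T.s (-3) κ - (D.K₀ i j hi hj).s (2 * m + 1) a)) ∧
      ∀ a ≠ D.lastIdx hi hj, f ∣ g a + Matrix.vecMul e ((D.K₀ i j hi hj).d (2 * m)) a := by
  have hd := (D.K₀ i j hi hj).d_homogeneous (2 * m)
  rw [K₀_d_even] at hd ⊢
  have hent : ∀ t, ∀ ht : t ≤ D.k i,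
      D.d₀ i j (⟨t, by omega⟩ : Fin (D.k i + 2)) ⟨t, by omega⟩ = D.diag i j t ∧
      D.d₀ i j (⟨t + 1, by omega⟩ : Fin (D.k i + 2)) ⟨t, by omega⟩ = -D.subdiag i t := by
    intro t ht
    rw [d₀_eq]
    simp [cyclicMatrix]
  -- Column t involves only the entries t and t + 1 of the row, so each entry is obtained from its
  -- predecessor by solving e_{t+1} x^n ≡ g_t + e_t diag_t modulo f.
  obtain ⟨e, h1, h2, h3⟩ := exists_seq (n := D.k i + 1) (x := e₀)
    (fun t b => ∀ ht : t < D.k i + 2, IsWeightedHomogeneous D.deg b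
      (T.s (-3) κ - (D.K₀ i j hi hj).s (2 * m + 1) (⟨t, ht⟩ : Fin (D.k i + 2))))
    (fun t b b' => ∀ ht : t < D.k i + 2,
      f ∣ g (⟨t, ht⟩ : Fin (D.k i + 2)) + (b * D.diag i j t - b' * D.subdiag i t))
    (fun _ => he₀) (by
      intro t ht b hb
      obtain ⟨n, hn, hs⟩ := D.exists_subdiag_eq hi t
      obtain ⟨hent1, hent2⟩ := hent t (by omega)
      have hlt : (⟨t, by omega⟩ : Fin (D.k i + 2)) ≠ D.lastIdx hi hj := fun h => by
        have := congrArg Fin.val h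
        simp [lastIdx] at this
        omega
      have hdd := hd (⟨t, by omega⟩ : Fin (D.k i + 2)) (⟨t, by omega⟩ : Fin (D.k i + 2))
      have hds := (hd (⟨t + 1, by omega⟩ : Fin (D.k i + 2)) (⟨t, by omega⟩ : Fin (D.k i + 2)))
      rw [hent1] at hdd
      rw [hent2, hs] at hds
      have h4 := (hb (by omega)).mul hdd
      rw [sub_add_sub_cancel] at h4
      have h5 := (hg (⟨t, by omega⟩ : Fin (D.k i + 2))).add h4
      have h6 : D.vec n 0 = (D.K₀ i j hi hj).s (2 * m + 1) (⟨t + 1, by omega⟩ : Fin (D.k i + 2)) -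
          (D.K₀ i j hi hj).s (2 * m) (⟨t, by omega⟩ : Fin (D.k i + 2)) := by
        have h7 := hds.neg
        rw [neg_neg] at h7
        exact IsWeightedHomogeneous.inj_right (pow_ne_zero n (X_ne_zero 0))
          (D.x_homogeneous n _ rfl) h7
      obtain ⟨b', hb', hbf⟩ := hT.exists_lift hn m
        (l' := T.s (-3) κ - (D.K₀ i j hi hj).s (2 * m + 1) (⟨t + 1, by omega⟩ : Fin (D.k i + 2)))
        (by rw [D.K₀_s_odd_of_lt hi hj m hlt]) (by rw [h6, sub_sub_sub_cancel_right]) h5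
      refine ⟨b', fun _ => hb', fun _ => ?_⟩
      rw [hs]
      convert hbf using 1
      ring)
  refine ⟨fun t => e (t : ℕ), h1, fun a => h2 a (by have := a.2; exact Nat.lt_succ_iff.1 this) a.2,
    fun a ha => ?_⟩
  have hlt : (a : ℕ) < D.k i + 1 := by
    refine lt_of_le_of_ne (Nat.lt_succ_iff.1 a.2) fun h => ha (Fin.ext h)
  have h4 := h3 a hlt a.2
  rwa [← D.vecMul_d₀ (a := a) (fun t => e t) (by omega)] at h4

end

end ChainData

/-! ### Morphisms from `K₀` into a sink. -/

namespace ChainData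

namespace IsSink

variable {D : ChainData} {T : GradedMF D.deg D.poly D.c} {κ : Fin T.rank} {f : PolyXY} {J : ℕ}
  {i j : ℕ} (hi : 1 ≤ i ∧ i ≤ D.p - 1) (hj : D.q - D.ql ≤ j ∧ j ≤ D.q - 1)

/-- A closed morphism `K_0 ⟶ T` is determined modulo `f` by its first component. -/
theorem dvd_mul_sub_mono_mul (hT : D.IsSink T κ f J) {n m : ℤ} (hn : 2 * m + 1 + n = -3)
    {φ : ℤ → Matrix (Fin T.rank) (Fin (D.K₀ i j hi hj).rank) PolyXY}
    (hφ : (D.K₀ i j hi hj).IsCocycle T n φ) (t : Fin (D.K₀ i j hi hj).rank) :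
    f ∣ X 0 ^ i * φ (2 * m + 1) κ t -
      D.mono i j (t : ℕ) * φ (2 * m + 1) κ (D.firstIdx hi hj) := by
  set e : ℕ → PolyXY := fun t => if h : t < D.k i + 2 then
    φ (2 * m + 1) κ (⟨t, h⟩ : Fin (D.k i + 2)) else 0 with he
  have heq : ∀ t : Fin (D.k i + 2), φ (2 * m + 1) κ t = e t := fun t => by simp [he]
  have hc : ∀ t, t ≤ D.k i → f ∣ e t * D.diag i j t - e (t + 1) * D.subdiag i t := by
    intro t ht
    have h := hT.dvd_vecMul hn hφ (⟨t, by omega⟩ : Fin (D.k i + 2))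
    rw [add_sub_cancel_right, K₀_d_even] at h
    rw [← D.vecMul_d₀ (a := ⟨t, by omega⟩) e ht]
    have h0 : (fun s : Fin (D.k i + 2) => e s) = φ (2 * m + 1) κ := funext fun s => (heq s).symm
    rw [h0]
    exact h
  suffices h : ∀ t, t ≤ D.k i + 1 → f ∣ X 0 ^ i * e t - D.mono i j t * e 0 by
    have h1 := h t (Nat.lt_succ_iff.1 t.2)
    rw [heq t, firstIdx, heq 0]
    exact h1
  intro t
  induction t with
  | zero => intro _; rw [D.mono_zero hj, sub_self]; exact dvd_zero _
  | succ t ih =>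
    intro ht
    obtain ⟨n, -, hn⟩ := D.exists_subdiag_eq hi t
    -- The congruence of column t determines e_{t+1} only after multiplication by the subdiagonal
    -- power of x, which may be cancelled because f is coprime to x.
    refine hT.dvd_of_dvd_X_pow_mul (n := n) ?_
    have h1 := D.mono_mul_diag hi hj (show t ≤ D.k i by omega)
    rw [← D.mono_succ_mul_subdiag hi (show t ≤ D.k i by omega)] at h1
    have h2 := ((ih (by omega)).mul_left (D.diag i j t)).sub
      ((hc t (by omega)).mul_left (X 0 ^ i))
    rw [← hn]
    convert h2 using 1
    linear_combination e 0 * h1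

/-- The non-last columns can be cleared with `exists_row`. The corrected row is still annihilated
modulo f by the preceding differential, whose last row begins with x^i; as the other entries vanish
modulo f, so does the last one. -/
theorem isCoboundary_of_even (hT : D.IsSink T κ f J) {n m : ℤ} (hn : 2 * m + n = -3)
    {φ : ℤ → Matrix (Fin T.rank) (Fin (D.K₀ i j hi hj).rank) PolyXY}
    (hφ : (D.K₀ i j hi hj).IsCocycle T n φ) : (D.K₀ i j hi hj).IsCoboundary T n φ := by
  obtain ⟨e, -, he, hd⟩ := hT.exists_row hi hj m (φ (2 * m) κ) 0
    (fun a => GradedMF.Hom.homogeneous hφ.1 hn κ a) (isWeightedHomogeneous_zero ℂ _ _)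
  refine hT.isCoboundary hn hφ e he fun a => ?_
  by_cases ha : a = D.lastIdx hi hj
  swap
  · exact hd a ha
  subst ha
  have h1 := hT.dvd_vecMul hn hφ (D.firstIdx hi hj)
  have h2 : f ∣ Matrix.vecMul (Matrix.vecMul e ((D.K₀ i j hi hj).d (2 * m)))
      ((D.K₀ i j hi hj).d (2 * m - 1)) (D.firstIdx hi hj) := by
    rw [Matrix.vecMul_vecMul, GradedMF.d_pred]
    have h3 := (D.K₀ i j hi hj).d_mul_d (2 * m - 1)
    rw [sub_add_cancel, GradedMF.d_pred] at h3
    rw [h3, Matrix.vecMul_smul, Matrix.vecMul_one, Pi.smul_apply, smul_eq_mul]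
    exact hT.dvd_poly.mul_right _
  have h3 := h1.add h2
  rw [← Pi.add_apply, ← Matrix.add_vecMul, Matrix.vecMul, dotProduct,
    ← Finset.add_sum_erase _ _ (Finset.mem_univ (D.lastIdx hi hj))] at h3
  have h4 := (dvd_add_left (Finset.dvd_sum fun s hs => ?_)).1 h3
  · rw [show 2 * m - 1 = 2 * (m - 1) + 1 by ring, K₀_d_odd_last, mul_comm] at h4
    rw [show D.mono i j (D.firstIdx hi hj : ℕ) = X 0 ^ i from D.mono_zero hj] at h4
    exact hT.dvd_of_dvd_X_pow_mul h4
  · exact (hd s (Finset.ne_of_mem_erase hs)).mul_right _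

/-- The homotopy with the single entry -h in the last place subtracts h times the row of generators.
The first entry then vanishes modulo f, and the others follow by `dvd_mul_sub_mono_mul`. -/
theorem isCoboundary_of_odd (hT : D.IsSink T κ f J) {n m : ℤ} (hn : 2 * m + 1 + n = -3)
    {φ : ℤ → Matrix (Fin T.rank) (Fin (D.K₀ i j hi hj).rank) PolyXY}
    (hφ : (D.K₀ i j hi hj).IsCocycle T n φ) {h : PolyXY}
    (hh : IsWeightedHomogeneous D.deg h
      (T.s (-3) κ - (D.K₀ i j hi hj).s (2 * m + 1 + 1) (D.lastIdx hi hj)))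
    (hd : f ∣ φ (2 * m + 1) κ (D.firstIdx hi hj) - X 0 ^ i * h) :
    (D.K₀ i j hi hj).IsCoboundary T n φ := by
  refine hT.isCoboundary hn hφ (Pi.single (D.lastIdx hi hj) (-h)) (fun a => ?_) fun a => ?_
  · by_cases ha : a = D.lastIdx hi hj
    · subst ha
      rw [Pi.single_eq_same]
      exact hh.neg
    · rw [Pi.single_eq_of_ne ha]
      exact isWeightedHomogeneous_zero ℂ _ _
  · rw [Matrix.single_vecMul, Pi.smul_apply, Matrix.row_apply, K₀_d_odd_last, smul_eq_mul]
    refine hT.dvd_of_dvd_X_pow_mul (n := i) ?_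
    convert (hT.dvd_mul_sub_mono_mul hi hj hn hφ a).add (hd.mul_left (D.mono i j a)) using 1
    ring

/-- If n is odd, the critical position is even and no obstruction exists. If n is even and non-zero,
`lift_first` makes the first entry divisible by x^i modulo f. For n = 0 divisibility of the first
entry by f itself is the hypothesis. -/
theorem K₀_isCoboundary (hT : D.IsSink T κ f J) {n : ℤ}
    {φ : ℤ → Matrix (Fin T.rank) (Fin (D.K₀ i j hi hj).rank) PolyXY}
    (hφ : (D.K₀ i j hi hj).IsCocycle T n φ)
    (h : n ≠ 0 ∨ f ∣ φ (-3) κ (D.firstIdx hi hj)) : (D.K₀ i j hi hj).IsCoboundary T n φ := by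
  rcases Int.even_or_odd' (-3 - n) with ⟨m, hm | hm⟩
  · exact hT.isCoboundary_of_even hi hj (m := m) (by omega) hφ
  have hn : 2 * m + 1 + n = -3 := by omega
  by_cases hn0 : n = 0
  · refine hT.isCoboundary_of_odd hi hj hn hφ (isWeightedHomogeneous_zero ℂ _ _) ?_
    rw [show 2 * m + 1 = -3 by omega, mul_zero, sub_zero]
    exact h.resolve_left (not_not.2 hn0)
  · have h1 := GradedMF.Hom.homogeneous hφ.1 hn κ (D.firstIdx hi hj)
    rw [K₀_s_odd_first, hT.s_eq, vec_sub] at h1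
    obtain ⟨p', h2, h3⟩ := hT.lift_first i j (-(m + 2)) _ (by omega) hj (by omega) (by
      convert h1 using 1
      exact D.vec_eq 0 (by ring) (by ring))
    refine hT.isCoboundary_of_odd hi hj hn hφ (h := p') ?_ h3
    rw [show 2 * m + 1 + 1 = 2 * (m + 1) by ring, K₀_s_even_last, hT.s_eq, vec_sub]
    convert h2 using 1
    exact D.vec_eq 0 (by ring) (by ring)

theorem first_homogeneous (hT : D.IsSink T κ f J)
    {φ : ℤ → Matrix (Fin T.rank) (Fin (D.K₀ i j hi hj).rank) PolyXY}
    (hφ : φ ∈ (D.K₀ i j hi hj).Hom T 0) :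
    IsWeightedHomogeneous D.deg (φ (-3) κ (D.firstIdx hi hj)) (D.vec 0 (J - j)) := by
  have h1 := GradedMF.Hom.homogeneous hφ (add_zero (-3)) κ (D.firstIdx hi hj)
  have h2 := D.K₀_s_odd_first hi hj (-2)
  norm_num at h2
  rw [h2, hT.s_eq, vec_sub] at h1
  convert h1 using 1
  exact D.vec_eq 0 (by ring) (by ring)

/-- In degree 0 the component of a homotopy starting from position -2 vanishes for degree reasons,
which leaves the multiple of f coming from the differential of T. -/
theorem dvd_first_of_isCoboundary (hT : D.IsSink T κ f J)
    {φ : ℤ → Matrix (Fin T.rank) (Fin (D.K₀ i j hi hj).rank) PolyXY}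
    (hφ : (D.K₀ i j hi hj).IsCoboundary T 0 φ) : f ∣ φ (-3) κ (D.firstIdx hi hj) := by
  obtain ⟨g, hg, rfl⟩ := hφ
  obtain ⟨b1, b2, b3, b4⟩ := D.cast_bounds hi hj
  obtain ⟨b1', b2', b3', b4'⟩ := D.cast_bounds hi hT.bounds
  obtain ⟨e1, e2, e3, e4, e5⟩ := D.cast_eqs
  have hql := D.mul_ql_le e3
  have hz : g (-2) κ = 0 := by
    funext s
    have h1 := GradedMF.Hom.homogeneous hg (show -2 + (0 - 1) = -3 by norm_num) κ s
    refine D.eq_zero_of_not_pos h1 ?_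
    by_cases hs : s = D.lastIdx hi hj
    · have h2 := D.K₀_s_even_last hi hj (-1)
      norm_num at h2
      rw [hs, h2, hT.s_eq, vec_sub]
      exact D.not_pos_vec 0 (by linarith) (by linarith)
    · have h2 := D.K₀_s_even_of_ne hi hj (-1) hs
      norm_num at h2
      rw [h2, hT.s_eq, vec_sub]
      exact D.not_pos_vec (-1) (by linarith) (by linarith)
  have h1 : GradedMF.dRaw (D.K₀ i j hi hj) T (0 - 1) g (-3) κ (D.firstIdx hi hj) =
      T.d (-4) κ κ * g (-3) κ (D.firstIdx hi hj) -
        (((-1 : ℂ) ^ ((0 : ℤ) - 1)) • (g (-2) * (D.K₀ i j hi hj).d (-3))) κ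
          (D.firstIdx hi hj) := by
    rw [← hT.sum_eq (fun t => T.d (-4) κ t * g (-3) t (D.firstIdx hi hj)), ← Matrix.mul_apply,
      ← Matrix.sub_apply]
    rfl
  rw [h1, hT.d_in, Matrix.smul_apply, Matrix.mul_apply_eq_vecMul, hz, Matrix.zero_vecMul,
    Pi.zero_apply, smul_zero, sub_zero]
  exact ⟨-g (-3) κ (D.firstIdx hi hj), by ring⟩

/-- Starting with e₀ the row is completed by `exists_row` so that the non-last columns are closed
modulo f. The last column is then automatic: composing with the next differential gives a multiple
of the potential, and x^i can be cancelled. -/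
theorem exists_cocycle_first (hT : D.IsSink T κ f J) {e₀ : PolyXY}
    (he₀ : IsWeightedHomogeneous D.deg e₀ (D.vec 0 (J - j))) :
    ∃ φ, (D.K₀ i j hi hj).IsCocycle T 0 φ ∧ φ (-3) κ (D.firstIdx hi hj) = e₀ := by
  have h2 := D.K₀_s_odd_first hi hj (-2)
  obtain ⟨e, h3, he, hd⟩ := hT.exists_row hi hj (-2) 0 e₀
    (fun a => isWeightedHomogeneous_zero ℂ _ _) (by
      rw [h2, hT.s_eq, vec_sub]
      convert he₀ using 1
      exact D.vec_eq 0 (by ring) (by ring))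
  norm_num at he hd
  obtain ⟨φ, hφ, hr⟩ := hT.exists_cocycle (K := D.K₀ i j hi hj) (add_zero (-3)) e he (by
    norm_num
    intro a
    by_cases ha : a = D.lastIdx hi hj
    swap
    · exact hd a ha
    subst ha
    have h4 : Matrix.vecMul (Matrix.vecMul e ((D.K₀ i j hi hj).d (-4)))
        ((D.K₀ i j hi hj).d (-3)) (D.firstIdx hi hj) = D.poly * e (D.firstIdx hi hj) := by
      have h5 := (D.K₀ i j hi hj).d_mul_d (-5)
      rw [← (D.K₀ i j hi hj).d_add_two (-5)] at h5
      norm_num at h5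
      rw [Matrix.vecMul_vecMul, h5, Matrix.vecMul_smul, Matrix.vecMul_one, Pi.smul_apply,
        smul_eq_mul]
    have h6 : f ∣ Matrix.vecMul (Matrix.vecMul e ((D.K₀ i j hi hj).d (-4)))
        ((D.K₀ i j hi hj).d (-3)) (D.firstIdx hi hj) := by
      rw [h4]
      exact hT.dvd_poly.mul_right _
    rw [Matrix.vecMul, dotProduct,
      ← Finset.add_sum_erase _ _ (Finset.mem_univ (D.lastIdx hi hj))] at h6
    have h7 := (dvd_add_left (Finset.dvd_sum fun s hs => ?_)).1 h6
    · have h8 := D.K₀_d_odd_last hi hj (-2) (D.firstIdx hi hj)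
      norm_num at h8
      rw [h8, mul_comm, show D.mono i j (D.firstIdx hi hj : ℕ) = X 0 ^ i from D.mono_zero hj] at h7
      exact hT.dvd_of_dvd_X_pow_mul h7
    · exact (hd s (Finset.ne_of_mem_erase hs)).mul_right _)
  exact ⟨φ, hφ, by rw [hr, h3]⟩

/-- The first component of a composition `K_0 ⟶ K_0 ⟶ T`. -/
theorem dvd_comp_first (hT : D.IsSink T κ f J) {i' j' : ℕ} (hi' : 1 ≤ i' ∧ i' ≤ D.p - 1)
    (hj' : D.q - D.ql ≤ j' ∧ j' ≤ D.q - 1)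
    {φ : ℤ → Matrix (Fin (D.K₀ i' j' hi' hj').rank) (Fin (D.K₀ i j hi hj).rank) PolyXY}
    {ψ : ℤ → Matrix (Fin T.rank) (Fin (D.K₀ i' j' hi' hj').rank) PolyXY}
    (hφ : (D.K₀ i j hi hj).IsCocycle (D.K₀ i' j' hi' hj') 0 φ)
    (hψ : (D.K₀ i' j' hi' hj').IsCocycle T 0 ψ) :
    f ∣ X 0 ^ i' * (ψ (-3) * φ (-3)) κ (D.firstIdx hi hj) -
      X 0 ^ i * (φ 0 (D.lastIdx hi' hj') (D.lastIdx hi hj) *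
        ψ (-3) κ (D.firstIdx hi' hj')) := by
  -- Closedness of φ at the critical row expresses the critical entry times x^i as the combination
  -- of the generators of the second ideal with coefficients from φ (-1). Combining this with the
  -- congruence for the row of ψ gives the claim termwise.
  have h1 := hφ.vecMul_mem (zero_add 0) (D.lastIdx hi' hj') (D.firstIdx hi hj)
  rw [zpow_zero, one_smul, Matrix.vecMul, dotProduct,
    Finset.sum_eq_single (D.lastIdx hi hj) (fun s _ hs => by
      rw [D.K₀_row_eq_zero hi hj hi' hj' hφ.1 hs, zero_mul]) (by simp)] at h1
  have h2 := D.K₀_d_odd_last hi hj (-1) (D.firstIdx hi hj)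
  have h3 := D.K₀_d_odd_last hi' hj' (-1)
  norm_num at h1 h2 h3
  have h4 : φ (-1) = φ (-3) := by
    have := hφ.1.1 (-3)
    norm_num at this
    exact this
  rw [h2, h4, show D.mono i j (D.firstIdx hi hj : ℕ) = X 0 ^ i from D.mono_zero hj] at h1
  simp only [h3] at h1
  rw [Matrix.mul_apply, Finset.mul_sum]
  have h5 : X 0 ^ i * (φ 0 (D.lastIdx hi' hj') (D.lastIdx hi hj) *
      ψ (-3) κ (D.firstIdx hi' hj')) = ∑ s : Fin (D.K₀ i' j' hi' hj').rank,
        D.mono i' j' (s : ℕ) * ψ (-3) κ (D.firstIdx hi' hj') *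
        φ (-3) s (D.firstIdx hi hj) := by
    rw [← mul_assoc, mul_comm (X 0 ^ i), h1, Finset.sum_mul]
    exact Finset.sum_congr rfl fun s _ => by ring
  rw [h5, ← Finset.sum_sub_distrib]
  refine Finset.dvd_sum fun s _ => ?_
  have h6 := hT.dvd_mul_sub_mono_mul hi' hj' (m := -2) (n := 0) (by norm_num) hψ s
  norm_num at h6
  convert h6.mul_right (φ (-3) s (D.firstIdx hi hj)) using 1
  ring

end IsSink

end ChainData

namespace ChainData

/-! ## Morphisms between `K_y` and `K_{w_r}` -/

/-- For a source of rank one the complex becomes multiplication by the two factors on S/f: an entry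
killed by one factor has to be a multiple of the other, with control of degrees. -/
theorem IsSink.isCoboundary_of_rank_one {D : ChainData} {T : GradedMF D.deg D.poly D.c}
    {κ : Fin T.rank} {f : PolyXY} {J : ℕ} (hT : D.IsSink T κ f J) {S : GradedMF D.deg D.poly D.c}
    {κ' : Fin S.rank} (hS : ∀ a, a = κ') {n i₀ : ℤ} (hi : i₀ + n = -3)
    {φ : ℤ → Matrix (Fin T.rank) (Fin S.rank) PolyXY} (hφ : S.IsCocycle T n φ)
    (h : ∀ p, IsWeightedHomogeneous D.deg p (T.s (-3) κ - S.s i₀ κ') →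
      f ∣ p * S.d (i₀ - 1) κ' κ' →
      ∃ g, IsWeightedHomogeneous D.deg g (T.s (-3) κ - S.s (i₀ + 1) κ') ∧
        f ∣ p + g * S.d i₀ κ' κ') : S.IsCoboundary T n φ := by
  have hsum : ∀ g : Fin S.rank → PolyXY, ∑ t, g t = g κ' := fun g =>
    Fintype.sum_eq_single κ' fun t ht => absurd (hS t) ht
  have h1 := hT.dvd_vecMul hi hφ κ'
  rw [Matrix.vecMul, dotProduct, hsum] at h1
  obtain ⟨g, hg, hd⟩ := h _ (GradedMF.Hom.homogeneous hφ.1 hi κ κ') h1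
  refine hT.isCoboundary hi hφ (fun _ => g) (fun a => by rw [hS a]; exact hg) fun a => ?_
  rw [hS a, Matrix.vecMul, dotProduct, hsum]
  exact hd

theorem isRelPrime_X_wFactor (D : ChainData) (r : ℕ) : IsRelPrime (X 1) (D.wFactor r) :=
  (D.isRelPrime_wFactor_X_one r).symm

theorem isRelPrime_X_wProd (D : ChainData) : IsRelPrime (X 1) D.wProd :=
  IsRelPrime.prod_right fun r _ => D.isRelPrime_X_wFactor r

theorem isRelPrime_wFactor_wCofactor (D : ChainData) {r : ℕ} (hr : r ∈ Finset.Icc 1 D.ℓ) :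
    IsRelPrime (D.wFactor r) (D.wCofactor r) := by
  refine (D.isRelPrime_wFactor_X_one r).mul_right (IsRelPrime.prod_right fun t ht => ?_)
  rw [Finset.mem_erase] at ht
  exact D.isRelPrime_wFactor_wFactor fun h => ht.1 (D.ζ_injOn hr ht.2 h).symm

/-- Modulo w_r the cofactor is a multiple of a pure power of y. The scalar is non-zero: otherwise
w_r would divide an element coprime to it and be a unit, although it vanishes at the origin. -/
theorem exists_wCofactor_eq (D : ChainData) {r : ℕ} (hr : r ∈ Finset.Icc 1 D.ℓ) :
    ∃ κ : ℂ, κ ≠ 0 ∧ D.wFactor r ∣ D.wCofactor r - C κ * X 1 ^ ((D.ℓ - 1) * D.ql + 1) := by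
  have hl := D.ℓ_pos
  obtain ⟨κ, h⟩ := D.wFactor_dvd_sub r (a := 0) (b := (D.ℓ - 1) * D.ql + 1) (D.vec_eq 1
    (m' := -D.pl) (n' := D.q) (by push_cast; ring) (by
      rw [D.q_eq]
      push_cast [Nat.cast_sub hl]
      ring)) (by
      have h := D.wCofactor_homogeneous r hr
      rw [c_eq, vec_sub] at h
      convert h using 1
      exact D.vec_eq 0 (by ring) (by ring))
  rw [pow_zero, one_mul] at h
  refine ⟨κ, fun h0 => ?_, h⟩
  rw [h0, map_zero, zero_mul, sub_zero] at h
  have h1 := (D.isRelPrime_wFactor_wCofactor hr dvd_rfl h).map (eval (0 : Fin 2 → ℂ))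
  rw [D.eval_wFactor] at h1
  exact not_isUnit_zero h1

section

variable (D : ChainData)

/-- In even critical positions the entry is killed modulo y by the product of the w_r, hence is
zero. In odd ones it is a multiple of a positive power of y in degree 0, as the rows differ; in the
other degrees it is ≡ x^p p', and x^p ≡ w_1 ⋯ w_ℓ modulo y. -/
theorem KyObj_KyObj_isCoboundary {j j' : ℕ} (hj : D.q - D.ql ≤ j ∧ j ≤ D.q - 1)
    (hj' : D.q - D.ql ≤ j' ∧ j' ≤ D.q - 1) {n : ℤ} (hn : n ≠ 0 ∨ j ≠ j')
    {φ : ℤ → Matrix (Fin (D.KyObj j').rank) (Fin (D.KyObj j).rank) PolyXY}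
    (hφ : (D.KyObj j).IsCocycle (D.KyObj j') n φ) :
    (D.KyObj j).IsCoboundary (D.KyObj j') n φ := by
  have hT := D.isSink_KyObj hj'
  rcases Int.even_or_odd' (-3 - n) with ⟨m, hm | hm⟩
  · refine hT.isCoboundary_of_rank_one (D.isSink_KyObj hj).unique (i₀ := 2 * m) (by omega) hφ
      fun p hp hd => ⟨0, isWeightedHomogeneous_zero ℂ _ _, ?_⟩
    rw [show 2 * m - 1 = 2 * (m - 1) + 1 by ring, KyObj_d_odd, mul_neg, dvd_neg] at hd
    rw [zero_mul, add_zero]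
    exact D.isRelPrime_X_wProd.dvd_of_dvd_mul_right hd
  · refine hT.isCoboundary_of_rank_one (D.isSink_KyObj hj).unique (i₀ := 2 * m + 1) (by omega) hφ
      fun p hp _ => ?_
    rw [hT.s_eq, KyObj_s_odd, vec_sub] at hp
    have hq := D.two_le_q
    by_cases hn0 : n = 0
    · obtain rfl : m = -2 := by omega
      refine ⟨0, isWeightedHomogeneous_zero ℂ _ _, ?_⟩
      rw [zero_mul, add_zero]
      rcases hT.span_first j p hj (by
        convert hp using 1
        exact D.vec_eq 0 (by ring) (by ring)) with h | ⟨hjj, κ, h⟩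
      · exact h
      · refine (dvd_sub_left ((dvd_pow_self _ ?_).mul_left _)).1 h
        omega
    · obtain ⟨p', h1, h2⟩ := hT.lift_first D.p j (-(m + 2)) p le_rfl hj (by omega) (by
        convert hp using 1
        exact D.vec_eq 0 (by ring) (by ring))
      refine ⟨p', ?_, ?_⟩
      · rw [show 2 * m + 1 + 1 = 2 * (m + 1) by ring, hT.s_eq, KyObj_s_even, vec_sub]
        convert h1 using 1
        have := D.cast_eqs
        exact D.vec_eq D.ℓ (by linarith) (by linarith)
      · rw [KyObj_d_odd, wProd_eq]
        convert h2.sub ((dvd_pow_self (X 1 : PolyXY)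
          (show D.q - 1 ≠ 0 by omega)).mul_left p') using 1
        ring

/-- Modulo w_r the entry is either killed by y, hence zero, or it is absent or a multiple of a
positive power of y, hence in the image of multiplication by y. -/
theorem KyObj_KwObj_isCoboundary {j r : ℕ} (hj : D.q - D.ql ≤ j ∧ j ≤ D.q - 1)
    (hr : r ∈ Finset.Icc 1 D.ℓ) {n : ℤ}
    {φ : ℤ → Matrix (Fin (D.KwObj r hr).rank) (Fin (D.KyObj j).rank) PolyXY}
    (hφ : (D.KyObj j).IsCocycle (D.KwObj r hr) n φ) :
    (D.KyObj j).IsCoboundary (D.KwObj r hr) n φ := by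
  have hT := D.isSink_KwObj hr
  have hq := D.two_le_q
  have hqc : ((D.q - 1 : ℕ) : ℤ) = D.q - 1 := by
    rw [Nat.cast_sub (by omega), Nat.cast_one]
  rcases Int.even_or_odd' (-3 - n) with ⟨m, hm | hm⟩
  · refine hT.isCoboundary_of_rank_one (D.isSink_KyObj hj).unique (i₀ := 2 * m) (by omega) hφ
      fun p hp _ => ?_
    obtain ⟨b1, b2, b3, b4⟩ := D.cast_bounds (i := 1) (by have := D.two_le_p; omega) hj
    obtain ⟨e1, e2, e3, e4, e5⟩ := D.cast_eqs
    rw [hT.s_eq, KyObj_s_even, vec_sub, hqc] at hp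
    rcases le_or_gt 0 (m + 1) with hm0 | hm0
    · have h1 := D.mul_q_le hm0
      have h2 := D.mul_ql_le e3
      rw [D.eq_zero_of_not_pos hp (D.not_pos_vec (-1) (by linarith) (by linarith))]
      exact ⟨0, isWeightedHomogeneous_zero ℂ _ _, by simp⟩
    · have h1 := D.mul_q_le (show m + 1 ≤ -1 by omega)
      obtain ⟨b, hb⟩ := Int.eq_ofNat_of_zero_le (show 0 ≤ -(m + 1) * D.q - j - 1 by linarith)
      obtain ⟨κ, h⟩ := D.wFactor_dvd_sub r (a := 0) (b := b + 1)
        (D.vec_eq 0 (by push_cast; ring) (by push_cast; linarith)) hp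
      refine ⟨C κ * X 1 ^ b, (D.y_homogeneous _ _ ?_).C_mul κ, ?_⟩
      · rw [hT.s_eq, KyObj_s_odd, vec_sub, hqc]
        exact D.vec_eq 0 (by ring) (by linarith)
      · rw [KyObj_d_even]
        convert h using 1
        ring
  · refine hT.isCoboundary_of_rank_one (D.isSink_KyObj hj).unique (i₀ := 2 * m + 1) (by omega) hφ
      fun p hp hd => ⟨0, isWeightedHomogeneous_zero ℂ _ _, ?_⟩
    rw [show 2 * m + 1 - 1 = 2 * m by ring, KyObj_d_even, mul_neg, dvd_neg] at hd
    rw [zero_mul, add_zero]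
    exact (D.isRelPrime_wFactor_X_one r).dvd_of_dvd_mul_right hd

/-- Modulo y the factor w_r becomes x^pl, which divides the entry by `lift_middle`; in the other
parity the entry is killed by w_r, which is coprime to y. -/
theorem KwObj_KyObj_isCoboundary {j r : ℕ} (hj : D.q - D.ql ≤ j ∧ j ≤ D.q - 1)
    (hr : r ∈ Finset.Icc 1 D.ℓ) {n : ℤ}
    {φ : ℤ → Matrix (Fin (D.KyObj j).rank) (Fin (D.KwObj r hr).rank) PolyXY}
    (hφ : (D.KwObj r hr).IsCocycle (D.KyObj j) n φ) :
    (D.KwObj r hr).IsCoboundary (D.KyObj j) n φ := by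
  have hT := D.isSink_KyObj hj
  rcases Int.even_or_odd' (-3 - n) with ⟨m, hm | hm⟩
  · refine hT.isCoboundary_of_rank_one (D.isSink_KwObj hr).unique (i₀ := 2 * m) (by omega) hφ
      fun p hp _ => ?_
    rw [hT.s_eq, KwObj_s_even, vec_sub] at hp
    obtain ⟨p', h1, h2⟩ := hT.lift_middle (-(m + 3)) p (by
      convert hp using 1
      exact D.vec_eq (-1) (by ring) (by ring))
    refine ⟨p', ?_, ?_⟩
    · rw [hT.s_eq, KwObj_s_odd, vec_sub]
      convert h1 using 1
      exact D.vec_eq 1 (by ring) (by ring)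
    · rw [KwObj_d_even, wFactor]
      convert h2.add ((dvd_pow_self (X 1 : PolyXY) D.ql_pos.ne').mul_left
        (p' * C (D.ζ r))) using 1
      ring
  · refine hT.isCoboundary_of_rank_one (D.isSink_KwObj hr).unique (i₀ := 2 * m + 1) (by omega) hφ
      fun p hp hd => ⟨0, isWeightedHomogeneous_zero ℂ _ _, ?_⟩
    rw [show 2 * m + 1 - 1 = 2 * m by ring, KwObj_d_even, mul_neg, dvd_neg] at hd
    rw [zero_mul, add_zero]
    exact (D.isRelPrime_X_wFactor r).dvd_of_dvd_mul_right hd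

/-- Modulo w_t the factor w_r is a non-zero scalar multiple of x^pl, so the argument for the target
`Ky` applies with a scalar inserted. -/
theorem KwObj_KwObj_isCoboundary_of_ne {r t : ℕ} (hr : r ∈ Finset.Icc 1 D.ℓ)
    (ht : t ∈ Finset.Icc 1 D.ℓ) (hrt : r ≠ t) {n : ℤ}
    {φ : ℤ → Matrix (Fin (D.KwObj t ht).rank) (Fin (D.KwObj r hr).rank) PolyXY}
    (hφ : (D.KwObj r hr).IsCocycle (D.KwObj t ht) n φ) :
    (D.KwObj r hr).IsCoboundary (D.KwObj t ht) n φ := by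
  have hT := D.isSink_KwObj ht
  have hq := D.two_le_q
  have hqc : ((D.q - 1 : ℕ) : ℤ) = D.q - 1 := by
    rw [Nat.cast_sub (by omega), Nat.cast_one]
  have hζ : D.ζ t - D.ζ r ≠ 0 := sub_ne_zero.2 fun h => hrt (D.ζ_injOn ht hr h).symm
  rcases Int.even_or_odd' (-3 - n) with ⟨m, hm | hm⟩
  · refine hT.isCoboundary_of_rank_one (D.isSink_KwObj hr).unique (i₀ := 2 * m) (by omega) hφ
      fun p hp _ => ?_
    rw [hT.s_eq, KwObj_s_even, vec_sub] at hp
    obtain ⟨p', h1, h2⟩ := hT.lift_middle (-(m + 3)) p (by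
      convert hp using 1
      exact D.vec_eq (-1) (by ring) (by ring))
    -- Modulo w_t one has ζ_t w_r ≡ (ζ_t - ζ_r) x^pl, whence this coefficient.
    refine ⟨C (D.ζ t * (D.ζ t - D.ζ r)⁻¹) * p', IsWeightedHomogeneous.C_mul ?_ _, ?_⟩
    · rw [hT.s_eq, KwObj_s_odd, vec_sub]
      convert h1 using 1
      exact D.vec_eq 1 (by ring) (by ring)
    · rw [KwObj_d_even]
      have h3 : C ((D.ζ t - D.ζ r)⁻¹) * (C (D.ζ t) - C (D.ζ r)) = (1 : PolyXY) := by
        rw [← map_sub, ← map_mul, inv_mul_cancel₀ hζ, map_one]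
      convert h2.add (dvd_mul_right (D.wFactor t) (p' - p' * C (D.ζ t) *
        C ((D.ζ t - D.ζ r)⁻¹))) using 1
      rw [wFactor, wFactor, map_mul]
      linear_combination (p' * X 1 ^ D.ql * -C (D.ζ t)) * h3
  · refine hT.isCoboundary_of_rank_one (D.isSink_KwObj hr).unique (i₀ := 2 * m + 1) (by omega) hφ
      fun p hp hd => ⟨0, isWeightedHomogeneous_zero ℂ _ _, ?_⟩
    rw [show 2 * m + 1 - 1 = 2 * m by ring, KwObj_d_even, mul_neg, dvd_neg] at hd
    rw [zero_mul, add_zero]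
    exact (D.isRelPrime_wFactor_wFactor
      fun h => hrt (D.ζ_injOn ht hr h).symm).dvd_of_dvd_mul_right hd

/-- In even critical positions coprimality with the cofactor forces zero. In odd ones the degree
excludes all monomials for m > -2, while for m < -2 the entry is a multiple of a power of y at least
as high as the one to which the cofactor reduces. -/
theorem KwObj_isCoboundary {r : ℕ} (hr : r ∈ Finset.Icc 1 D.ℓ) {n : ℤ} (hn : n ≠ 0)
    {φ : ℤ → Matrix (Fin (D.KwObj r hr).rank) (Fin (D.KwObj r hr).rank) PolyXY}
    (hφ : (D.KwObj r hr).IsCocycle (D.KwObj r hr) n φ) :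
    (D.KwObj r hr).IsCoboundary (D.KwObj r hr) n φ := by
  have hT := D.isSink_KwObj hr
  have hq := D.two_le_q
  have hl := D.ℓ_pos
  have hqc : ((D.q - 1 : ℕ) : ℤ) = D.q - 1 := by
    rw [Nat.cast_sub (by omega), Nat.cast_one]
  rcases Int.even_or_odd' (-3 - n) with ⟨m, hm | hm⟩
  · refine hT.isCoboundary_of_rank_one hT.unique (i₀ := 2 * m) (by omega) hφ
      fun p hp hd => ⟨0, isWeightedHomogeneous_zero ℂ _ _, ?_⟩
    rw [show 2 * m - 1 = 2 * (m - 1) + 1 by ring, KwObj_d_odd, mul_neg, dvd_neg] at hd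
    rw [zero_mul, add_zero]
    exact (D.isRelPrime_wFactor_wCofactor hr).dvd_of_dvd_mul_right hd
  · refine hT.isCoboundary_of_rank_one hT.unique (i₀ := 2 * m + 1) (by omega) hφ fun p hp _ => ?_
    obtain ⟨e1, e2, e3, e4, e5⟩ := D.cast_eqs
    rw [hT.s_eq, KwObj_s_odd, vec_sub, hqc] at hp
    rcases le_or_gt 0 (m + 2) with hm0 | hm0
    · have h1 := D.mul_q_le (show 1 ≤ m + 2 by omega)
      have h2 := D.mul_ql_le e3
      rw [D.eq_zero_of_not_pos hp (D.not_pos_vec (-1) (by linarith) (by linarith))]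
      exact ⟨0, isWeightedHomogeneous_zero ℂ _ _, by simp⟩
    · obtain ⟨k, hk⟩ := Int.eq_ofNat_of_zero_le (show 0 ≤ -(m + 3) by omega)
      obtain rfl : m = -k - 3 := by omega
      obtain ⟨κ', h0, h1⟩ := D.exists_wCofactor_eq hr
      obtain ⟨κ, h⟩ := D.wFactor_dvd_sub r (a := 0) (b := k * D.q + D.q)
        (D.vec_eq 0 (by push_cast; ring) (by push_cast; ring)) hp
      -- The exponent is what remains of kq + q after removing (ℓ - 1) ql + 1, the exponent of the
      -- cofactor modulo w_r.
      refine ⟨C (κ * κ'⁻¹) * X 1 ^ (k * D.q + D.ql), (D.y_homogeneous _ _ ?_).C_mul _, ?_⟩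
      · rw [show 2 * (-(k : ℤ) - 3) + 1 + 1 = 2 * (-k - 2) by ring, hT.s_eq, KwObj_s_even,
          vec_sub, hqc]
        exact D.vec_eq (-1) (by ring) (by push_cast; ring)
      · rw [KwObj_d_odd]
        have h3 : C κ'⁻¹ * C κ' = (1 : PolyXY) := by
          rw [← map_mul, inv_mul_cancel₀ h0, map_one]
        have h4 : (X 1 : PolyXY) ^ (k * D.q + D.q) =
            X 1 ^ (k * D.q + D.ql) * X 1 ^ ((D.ℓ - 1) * D.ql + 1) := by
          rw [← pow_add]
          congr 1
          have h5 : D.ql + (D.ℓ - 1) * D.ql = D.ℓ * D.ql := by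
            rw [Nat.sub_one_mul]
            have := Nat.le_mul_of_pos_left D.ql hl
            omega
          have := D.q_eq
          omega
        rw [h4] at h
        convert h.sub (h1.mul_left (C κ * C κ'⁻¹ * X 1 ^ (k * D.q + D.ql))) using 1
        rw [map_mul]
        linear_combination -(C κ * X 1 ^ (k * D.q + D.ql) *
          X 1 ^ ((D.ℓ - 1) * D.ql + 1)) * h3

end

/-! ### Endomorphisms of a sink. -/

namespace IsSink

variable {D : ChainData} {T : GradedMF D.deg D.poly D.c} {κ : Fin T.rank} {f : PolyXY} {J : ℕ}

/-- The component of degree 0 of S consists of the constants, so the critical entry is a scalar;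
subtracting this multiple of the identity makes it vanish. -/
theorem exists_sub_smul_id_isCoboundary (hT : D.IsSink T κ f J)
    {φ : ℤ → Matrix (Fin T.rank) (Fin T.rank) PolyXY} (hφ : T.IsCocycle T 0 φ) :
    ∃ r : ℂ, T.IsCoboundary T 0 (φ - r • (fun _ => 1 : ℤ → Matrix (Fin T.rank) (Fin T.rank) PolyXY)) := by
  have h1 := GradedMF.Hom.homogeneous hφ.1 (add_zero (-3)) κ κ
  rw [sub_self, zero_eq_vec] at h1
  obtain ⟨r, hr⟩ : ∃ r, φ (-3) κ κ = C r := by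
    refine D.homogeneous_induction (P := fun p => ∃ r, p = C r) ⟨0, (map_zero C).symm⟩ ?_ ?_ h1
    · rintro p q ⟨r, rfl⟩ ⟨r', rfl⟩
      exact ⟨r + r', (map_add C r r').symm⟩
    · intro a b s hab
      obtain ⟨t, h1, h2⟩ := D.vec_eq_iff.1 hab
      rw [zero_add] at h1
      have ht := D.nonneg_of_mul_pl h1
      have hb : (0 : ℤ) ≤ b := b.cast_nonneg
      obtain ⟨e1, e2, e3, e4, e5⟩ := D.cast_eqs
      obtain rfl : t = 0 := by
        by_contra ht0
        have := D.mul_ql_le (show 1 ≤ t by omega)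
        linarith
      obtain rfl : a = 0 := by zify; linarith
      obtain rfl : b = 0 := by zify; linarith
      exact ⟨s, by rw [smul_eq_C_mul, pow_zero, pow_zero, mul_one, mul_one]⟩
  refine ⟨r, hT.isCoboundary (add_zero (-3)) (hφ.sub ((GradedMF.isCocycle_id T).smul r)) 0
    (fun _ => isWeightedHomogeneous_zero ℂ _ _) fun a => ?_⟩
  rw [hT.unique a, Matrix.zero_vecMul, Pi.zero_apply, add_zero, Pi.sub_apply, Pi.smul_apply,
    Matrix.sub_apply, Matrix.smul_apply, Matrix.one_apply_eq, hr, smul_eq_C_mul, mul_one, sub_self]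
  exact dvd_zero _

/-- Both entries of the differential of T vanish at the origin, hence so does the critical entry of
every exact endomorphism, whereas the identity has entry 1. -/
theorem not_isCoboundary_id (hT : D.IsSink T κ f J) : ¬ T.IsCoboundary T 0 (fun _ => 1) := by
  rintro ⟨g, -, hg⟩
  have h1 := congrFun (congrFun (congrFun hg (-3)) κ) κ
  have h2 : GradedMF.dRaw T T (0 - 1) g (-3) κ κ = T.d (-4) κ κ * g (-3) κ κ -
      ((-1 : ℂ) ^ ((0 : ℤ) - 1)) • (g (-2) κ κ * T.d (-3) κ κ) := by
    rw [← hT.sum_eq (fun t => T.d (-4) κ t * g (-3) t κ), ← Matrix.mul_apply,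
      ← hT.sum_eq (fun t => g (-2) κ t * T.d (-3) t κ), ← Matrix.mul_apply, ← Matrix.smul_apply,
      ← Matrix.sub_apply]
    rfl
  rw [h2, hT.d_in, Matrix.one_apply_eq] at h1
  have h3 := congrArg (eval (0 : Fin 2 → ℂ)) h1
  rw [map_sub, smul_eval, map_mul, map_mul, map_neg, hT.eval_in, hT.eval_out, map_one] at h3
  simp at h3

end IsSink

end ChainData

namespace ChainData

/-! ## Paths in the quiver -/

/-- The exponent of `x` in the monomial of a label. -/
def Label.xdeg : Label → ℕ
  | .x => 1
  | _ => 0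

/-- The exponent of `y` in the monomial of a label. -/
def Label.ydeg : Label → ℕ
  | .y => 1
  | _ => 0

section

variable (D : ChainData)

/-- The number of arrows of a path that are labelled `x`. -/
def xCount {u v : D.Vertex} (P : Quiver.Path u v) : ℕ := ((D.labels P).map Label.xdeg).sum

/-- The number of arrows of a path that are labelled `y`. -/
def yCount {u v : D.Vertex} (P : Quiver.Path u v) : ℕ := ((D.labels P).map Label.ydeg).sum

theorem labels_comp {u v w : D.Vertex} (P : Quiver.Path u v) (Q : Quiver.Path v w) :
    D.labels (P.comp Q) = D.labels P ++ D.labels Q := by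
  induction Q with
  | nil => exact (List.append_nil _).symm
  | cons Q e ih => rw [Quiver.Path.comp_cons, labels, labels, ih, List.append_assoc]

theorem xCount_cons {u v w : D.Vertex} (P : Quiver.Path u v) (e : v ⟶ w) :
    D.xCount (P.cons e) = D.xCount P + e.1.xdeg := by
  simp [xCount, labels]

theorem yCount_cons {u v w : D.Vertex} (P : Quiver.Path u v) (e : v ⟶ w) :
    D.yCount (P.cons e) = D.yCount P + e.1.ydeg := by
  simp [yCount, labels]

theorem xCount_comp {u v w : D.Vertex} (P : Quiver.Path u v) (Q : Quiver.Path v w) :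
    D.xCount (P.comp Q) = D.xCount P + D.xCount Q := by
  simp [xCount, labels_comp]

theorem yCount_comp {u v w : D.Vertex} (P : Quiver.Path u v) (Q : Quiver.Path v w) :
    D.yCount (P.comp Q) = D.yCount P + D.yCount Q := by
  simp [yCount, labels_comp]

theorem xCount_of_labels {u v : D.Vertex} {P : Quiver.Path u v} {a b : ℕ}
    (h : D.labels P = List.replicate a .x ++ List.replicate b .y) : D.xCount P = a := by
  simp [xCount, h, Label.xdeg]

theorem yCount_of_labels {u v : D.Vertex} {P : Quiver.Path u v} {a b : ℕ}
    (h : D.labels P = List.replicate a .x ++ List.replicate b .y) : D.yCount P = b := by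
  simp [yCount, h, Label.ydeg]

/-- The vertices `K_0^{i,j}`. -/
def IsZero : D.Vertex → Prop
  | .zero _ _ _ _ => True
  | _ => False

/-- The degree of a vertex `K_0^{i,j}`. -/
def vdeg : D.Vertex → D.L
  | .zero i j _ _ => D.vec i j
  | _ => 0

theorem isZero_source {u v : D.Vertex} (e : u ⟶ v) : D.IsZero u := by
  obtain ⟨t, h⟩ := e
  cases u <;> cases v <;> cases t <;> trivial

theorem isZero_of_path {u v : D.Vertex} (P : Quiver.Path u v) (hv : D.IsZero v) : D.IsZero u := by
  induction P with
  | nil => exact hv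
  | cons P e ih => exact ih (D.isZero_source e)

theorem label_eq {u v : D.Vertex} (e : u ⟶ v) (hv : D.IsZero v) : e.1 = .x ∨ e.1 = .y := by
  obtain ⟨t, h⟩ := e
  cases u <;> cases v <;> cases t <;>
    first | exact .inl rfl | exact .inr rfl | exact False.elim hv | exact False.elim h

/-- A diagonal arrow moves by pl x + (1 - ql) y, which equals y in L; so it has the same degree as a
vertical one. -/
theorem vdeg_arrow {u v : D.Vertex} (e : u ⟶ v) (hv : D.IsZero v) :
    D.vec e.1.xdeg e.1.ydeg = D.vdeg v - D.vdeg u := by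
  have hq := D.two_le_q
  have hql := D.ql_pos
  have hqq := D.q_eq
  have h2 : D.ql ≤ D.ℓ * D.ql := Nat.le_mul_of_pos_left _ D.ℓ_pos
  rcases u with ⟨i, j, hi, hj⟩ | _ | _ <;> rcases v with ⟨i', j', hi', hj'⟩ | _ | _ <;>
    obtain ⟨t | t | t | t, h⟩ := e <;> try first | exact hv.elim | exact h.elim
  · obtain ⟨h1, h2⟩ := h
    refine D.vec_eq 0 ?_ ?_
    · show (1 : ℤ) = (i' : ℤ) - i + 0 * D.pl
      omega
    · show (0 : ℤ) = (j' : ℤ) - j - 0 * D.ql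
      omega
  · rcases h with ⟨h1, h2⟩ | ⟨h1, h2, h3⟩
    · refine D.vec_eq 0 ?_ ?_
      · show (0 : ℤ) = (i' : ℤ) - i + 0 * D.pl
        omega
      · show (1 : ℤ) = (j' : ℤ) - j - 0 * D.ql
        omega
    · refine D.vec_eq (-1) ?_ ?_
      · show (0 : ℤ) = (i' : ℤ) - i + -1 * D.pl
        omega
      · show (1 : ℤ) = (j' : ℤ) - j - -1 * D.ql
        omega

theorem vdeg_path {u v : D.Vertex} (P : Quiver.Path u v) (hv : D.IsZero v) :
    D.vec (D.xCount P) (D.yCount P) = D.vdeg v - D.vdeg u := by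
  induction P with
  | nil => rw [sub_self]; rfl
  | cons P e ih =>
    rw [xCount_cons, yCount_cons, Nat.cast_add, Nat.cast_add, ← vec_add,
      ih (D.isZero_source e), D.vdeg_arrow e hv]
    abel

/-- A vertical y-arrow never ends in the bottom row of a block and a diagonal one always does, so
the target decides between the two kinds. -/
theorem source_unique {t : Label} {u u' v : D.Vertex} (h : D.IsArrow t u v)
    (h' : D.IsArrow t u' v) : u = u' := by
  rcases u with ⟨i, j, hi, hj⟩ | _ | _ <;> rcases u' with ⟨i', j', hi', hj'⟩ | _ | _ <;>
    rcases v with ⟨k, l, hk, hl⟩ | _ | _ <;> cases t <;>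
    try first | exact h.elim | exact h'.elim
  all_goals
    simp only [IsArrow] at h h'
    obtain ⟨h1, h2⟩ : i = i' ∧ j = j' := by omega
    subst h1 h2
    rfl

/-- A path is determined by its labels. -/
theorem path_ext {u v : D.Vertex} {P Q : Quiver.Path u v} (h : D.labels P = D.labels Q) :
    P = Q := by
  induction P with
  | nil =>
    cases Q with
    | nil => rfl
    | cons Q e => simp [labels] at h
  | cons P e ih =>
    cases Q with
    | nil => simp [labels] at h
    | cons Q e' =>
      rw [labels, labels] at h
      obtain ⟨h1, h2⟩ := List.append_inj' h rfl
      rw [List.singleton_inj] at h2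
      obtain ⟨t, he⟩ := e
      obtain ⟨t', he'⟩ := e'
      simp only at h2
      subst h2
      obtain rfl := D.source_unique he he'
      rw [ih h1]

/-- The column of the corner i + 1 is admissible because it does not exceed that of the end point;
the y-arrow out of it is of the same kind as the given one. -/
theorem exists_square {u v w : D.Vertex} (f : u ⟶ v) (e : v ⟶ w) (hw : D.IsZero w)
    (hf : f.1 = .y) (he : e.1 = .x) :
    ∃ (v' : D.Vertex) (e' : u ⟶ v') (f' : v' ⟶ w), e'.1 = .x ∧ f'.1 = .y := by
  obtain ⟨t, hf'⟩ := f
  obtain ⟨t', he'⟩ := e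
  simp only at hf he
  subst hf he
  rcases u with ⟨i, j, hi, hj⟩ | _ | _ <;> rcases v with ⟨i', j', hi', hj'⟩ | _ | _ <;>
    rcases w with ⟨k, l, hk, hl⟩ | _ | _ <;>
    try first | exact hf'.elim | exact he'.elim | exact hw.elim
  simp only [IsArrow] at hf' he'
  exact ⟨.zero (i + 1) j (by omega) hj, ⟨.x, rfl, rfl⟩, ⟨.y, by simp only [IsArrow]; omega⟩,
    rfl, rfl⟩

/-! ### Existence of paths in normal form. -/

theorem exists_path_x {i j : ℕ} (hi : 1 ≤ i ∧ i ≤ D.p - 1) (hj : D.q - D.ql ≤ j ∧ j ≤ D.q - 1)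
    (a : ℕ) (hi' : 1 ≤ i + a ∧ i + a ≤ D.p - 1) :
    ∃ P : Quiver.Path (Vertex.zero i j hi hj) (Vertex.zero (i + a) j hi' hj),
      D.labels P = List.replicate a .x := by
  induction a with
  | zero => exact ⟨.nil, rfl⟩
  | succ a ih =>
    obtain ⟨P, hP⟩ := ih (by omega)
    refine ⟨P.cons ⟨.x, rfl, rfl⟩, ?_⟩
    rw [labels, hP, List.replicate_succ']

/-- The path is built backwards: the last y-arrow is vertical unless the end point is in the bottom
row, where it must be diagonal. The degree condition ensures that the preceding column is still
admissible. -/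
theorem exists_path_zero {i j i' j' : ℕ} (hi : 1 ≤ i ∧ i ≤ D.p - 1)
    (hj : D.q - D.ql ≤ j ∧ j ≤ D.q - 1) (hi' : 1 ≤ i' ∧ i' ≤ D.p - 1)
    (hj' : D.q - D.ql ≤ j' ∧ j' ≤ D.q - 1) (a b : ℕ)
    (h : D.vec a b = D.vec (i' - i) (j' - j)) :
    ∃ P : Quiver.Path (Vertex.zero i j hi hj) (Vertex.zero i' j' hi' hj'),
      D.labels P = List.replicate a .x ++ List.replicate b .y := by
  have hql := D.ql_pos
  have hqq := D.q_eq
  have hqlq : D.ql ≤ D.ℓ * D.ql := Nat.le_mul_of_pos_left _ D.ℓ_pos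
  induction b generalizing i' j' with
  | zero =>
    obtain ⟨t, h1, h2⟩ := D.vec_eq_iff.1 h
    obtain rfl : t = 0 := by
      by_contra ht
      rcases lt_or_gt_of_ne ht with ht | ht
      · have := D.mul_ql_le (show t ≤ -1 by omega)
        omega
      · have := D.mul_ql_le (show 1 ≤ t by omega)
        omega
    obtain rfl : j' = j := by omega
    obtain rfl : i' = i + a := by omega
    obtain ⟨P, hP⟩ := D.exists_path_x hi hj a hi'
    exact ⟨P, by rw [hP, List.replicate_zero, List.append_nil]⟩
  | succ b ih =>
    obtain ⟨t, h1, h2⟩ := D.vec_eq_iff.1 h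
    push_cast at h1 h2
    have ht : t ≤ 0 := by
      by_contra ht
      have := D.mul_ql_le (show 1 ≤ t by omega)
      omega
    by_cases hjj : D.q - D.ql < j'
    · obtain ⟨P, hP⟩ := ih (i' := i') (j' := j' - 1) hi' (by omega)
        (D.vec_eq t h1 (by rw [Nat.cast_sub (by omega)]; push_cast; linarith))
      refine ⟨P.cons ⟨.y, .inl ⟨rfl, by omega⟩⟩, ?_⟩
      rw [labels, hP, List.replicate_succ', List.append_assoc]
    -- In the bottom row j' ≤ j, so a positive number of y-steps requires at least one passage
    -- between blocks; this gives i' ≥ i + pl.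
    · have ht' : t ≤ -1 := by
        by_contra ht'
        obtain rfl : t = 0 := by omega
        omega
      have hpl := D.mul_pl_le ht'
      have hle : D.pl + 1 ≤ i' := by
        zify
        have := hi.1
        zify at this
        linarith [a.cast_nonneg (α := ℤ)]
      obtain ⟨P, hP⟩ := ih (i' := i' - D.pl) (j' := D.q - 1) (by omega) (by omega)
        (D.vec_eq (t + 1) (by rw [Nat.cast_sub (by omega)]; linarith) (by
          have : (j' : ℤ) = (D.q - 1 : ℕ) + 1 - D.ql := by omega
          linarith))
      refine ⟨P.cons ⟨.y, .inr ⟨by omega, rfl, by omega⟩⟩, ?_⟩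
      rw [labels, hP, List.replicate_succ', List.append_assoc]

/-- Paths between the vertices `K_0^{i,j}` exist in all possible degrees. -/
theorem exists_path {u v : D.Vertex} (hu : D.IsZero u) (hv : D.IsZero v) (a b : ℕ)
    (h : D.vec a b = D.vdeg v - D.vdeg u) :
    ∃ P : Quiver.Path u v, D.labels P = List.replicate a .x ++ List.replicate b .y := by
  rcases u with ⟨i, j, hi, hj⟩ | _ | _ <;> rcases v with ⟨i', j', hi', hj'⟩ | _ | _ <;>
    try first | exact hu.elim | exact hv.elim
  exact D.exists_path_zero hi hj hi' hj' a b h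

/-! ## The algebra of the quiver with relations -/

/-- Multiplication by a path on the right. -/
noncomputable def appendPath (u : D.Vertex) {v w : D.Vertex} (Q : Quiver.Path v w) :
    D.QuiverAlg u v →ₗ[ℂ] D.QuiverAlg u w :=
  Submodule.mapQ _ _ (Finsupp.lmapDomain ℂ ℂ fun P : Quiver.Path u v => P.comp Q) (by
    refine Submodule.span_le.2 ?_
    rintro _ ⟨u', v', P, ρ, R, hρ, rfl⟩
    refine Submodule.subset_span ⟨u', v', P, ρ, R.comp Q, hρ, ?_⟩
    rw [Finsupp.lmapDomain_apply, ← Finsupp.mapDomain_comp]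
    congr 1
    funext Z
    exact Quiver.Path.comp_assoc _ _ _)

theorem appendPath_pathClass {u v w : D.Vertex} (Q : Quiver.Path v w) (P : Quiver.Path u v) :
    D.appendPath u Q (D.pathClass P) = D.pathClass (P.comp Q) := by
  refine congrArg Submodule.Quotient.mk ?_
  rw [Finsupp.lmapDomain_apply, Finsupp.mapDomain_single]

theorem mapDomain_mem_relIdeal {u u' v : D.Vertex} (P : Quiver.Path u u')
    {ρ : Quiver.Path u' v →₀ ℂ} (hρ : D.Relation u' v ρ) :
    Finsupp.mapDomain (fun Z => P.comp Z) ρ ∈ D.relIdeal u v :=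
  Submodule.subset_span ⟨u', v, P, ρ, .nil, hρ, rfl⟩

theorem pathClass_square {u u' v : D.Vertex} (N : Quiver.Path u u') (P Q : Quiver.Path u' v)
    (hP : D.labels P = [.x, .y]) (hQ : D.labels Q = [.y, .x]) :
    D.pathClass (N.comp P) = D.pathClass (N.comp Q) := by
  have h := D.mapDomain_mem_relIdeal N (.comm _ _ P Q hP hQ)
  rw [sub_eq_add_neg, ← Finsupp.single_neg, Finsupp.mapDomain_add, Finsupp.mapDomain_single,
    Finsupp.mapDomain_single, Finsupp.single_neg, ← sub_eq_add_neg] at h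
  exact (Submodule.Quotient.eq _).2 h

/-- The new x-arrow is moved towards the start of the path, across one y-arrow at a time, by
commuting squares. -/
theorem exists_normal_cons {u v w : D.Vertex} (hw : D.IsZero w) {a b : ℕ} (N : Quiver.Path u v)
    (hN : D.labels N = List.replicate a .x ++ List.replicate b .y) (e : v ⟶ w) (he : e.1 = .x) :
    ∃ N' : Quiver.Path u w, D.labels N' = List.replicate (a + 1) .x ++ List.replicate b .y ∧
      D.pathClass (N.cons e) = D.pathClass N' := by
  induction b generalizing v w with
  | zero =>
    refine ⟨N.cons e, ?_, rfl⟩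
    rw [labels, hN, he, List.replicate_succ', List.replicate_zero, List.append_nil, List.append_nil]
  | succ b ih =>
    rw [List.replicate_succ', ← List.append_assoc] at hN
    cases N with
    | nil => simp [labels] at hN
    | cons N f =>
      rw [labels] at hN
      obtain ⟨h1, h2⟩ := List.append_inj' hN rfl
      rw [List.singleton_inj] at h2
      obtain ⟨v', e', f', h3, h4⟩ := D.exists_square f e hw h2 he
      obtain ⟨N', h5, h6⟩ := ih (D.isZero_source f') N h1 e' h3
      refine ⟨N'.cons f', ?_, ?_⟩
      · rw [labels, h5, h4, List.append_assoc, ← List.replicate_succ']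
      · have h7 := D.pathClass_square N (Quiver.Path.cons (.cons .nil e') f')
          (Quiver.Path.cons (.cons .nil f) e) (by simp [labels, h3, h4]) (by simp [labels, h2, he])
        have h8 := congrArg (D.appendPath u f'.toPath) h6
        rw [appendPath_pathClass, appendPath_pathClass] at h8
        exact h7.symm.trans h8

/-- Every path between vertices `K_0^{i,j}` is equivalent to one in normal form. -/
theorem exists_normal {u v : D.Vertex} (P : Quiver.Path u v) (hv : D.IsZero v) :
    ∃ N : Quiver.Path u v,
      D.labels N = List.replicate (D.xCount P) .x ++ List.replicate (D.yCount P) .y ∧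
      D.pathClass P = D.pathClass N := by
  induction P with
  | nil => exact ⟨.nil, rfl, rfl⟩
  | cons P e ih =>
    obtain ⟨N, h1, h2⟩ := ih (D.isZero_source e)
    have h3 := congrArg (D.appendPath u e.toPath) h2
    rw [appendPath_pathClass, appendPath_pathClass] at h3
    rw [xCount_cons, yCount_cons]
    rcases D.label_eq e hv with he | he
    · obtain ⟨N', h4, h5⟩ := D.exists_normal_cons hv N h1 e he
      refine ⟨N', ?_, h3.trans h5⟩
      rw [h4, he]
      rfl
    · refine ⟨N.cons e, ?_, h3⟩
      rw [labels, h1, he, List.append_assoc, ← List.replicate_succ']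
      rfl

/-- The class of a path between vertices `K_0^{i,j}` depends on its numbers of arrows only. -/
theorem pathClass_eq {u v : D.Vertex} (hv : D.IsZero v) (P Q : Quiver.Path u v)
    (hx : D.xCount P = D.xCount Q) (hy : D.yCount P = D.yCount Q) :
    D.pathClass P = D.pathClass Q := by
  obtain ⟨N, h1, h2⟩ := D.exists_normal P hv
  obtain ⟨N', h3, h4⟩ := D.exists_normal Q hv
  rw [h2, h4, D.path_ext (h1.trans (by rw [hx, hy, h3]))]

/-- The monomial of a path. -/
noncomputable def pathVal {u v : D.Vertex} (P : Quiver.Path u v) : PolyXY :=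
  X 0 ^ D.xCount P * X 1 ^ D.yCount P

open Classical in
/-- The class of the path of a given monomial, extended linearly to all polynomials. -/
noncomputable def monoClass (u v : D.Vertex) : PolyXY →ₗ[ℂ] D.QuiverAlg u v :=
  (basisMonomials (Fin 2) ℂ).constr ℂ fun d =>
    if h : ∃ P : Quiver.Path u v, D.xCount P = d 0 ∧ D.yCount P = d 1 then D.pathClass h.choose
    else 0

theorem monomial_eq_X_pow (d : Fin 2 →₀ ℕ) :
    basisMonomials (Fin 2) ℂ d = X 0 ^ d 0 * X 1 ^ d 1 := by
  rw [coe_basisMonomials]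
  show monomial d (1 : ℂ) = _
  rw [monomial_eq, Finsupp.prod_fintype _ _ (fun i => pow_zero _),
    Fin.prod_univ_two, C_1, one_mul]

theorem exists_exponent (a b : ℕ) : ∃ d : Fin 2 →₀ ℕ, d 0 = a ∧ d 1 = b :=
  ⟨Finsupp.equivFunOnFinite.symm ![a, b], rfl, rfl⟩

theorem monoClass_eq_of_path {u v : D.Vertex} (hv : D.IsZero v) (P : Quiver.Path u v) {a b : ℕ}
    (hx : D.xCount P = a) (hy : D.yCount P = b) :
    D.monoClass u v (X 0 ^ a * X 1 ^ b) = D.pathClass P := by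
  obtain ⟨d, rfl, rfl⟩ := exists_exponent a b
  have h : ∃ P : Quiver.Path u v, D.xCount P = d 0 ∧ D.yCount P = d 1 := ⟨P, hx, hy⟩
  rw [monoClass, ← monomial_eq_X_pow, Module.Basis.constr_basis, dif_pos h]
  exact D.pathClass_eq hv _ _ (h.choose_spec.1.trans hx.symm) (h.choose_spec.2.trans hy.symm)

theorem monoClass_eq_zero {u v : D.Vertex} {a b : ℕ}
    (h : ¬ ∃ P : Quiver.Path u v, D.xCount P = a ∧ D.yCount P = b) :
    D.monoClass u v (X 0 ^ a * X 1 ^ b) = 0 := by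
  obtain ⟨d, rfl, rfl⟩ := exists_exponent a b
  rw [monoClass, ← monomial_eq_X_pow, Module.Basis.constr_basis, dif_neg h]

/-- Between vertices `K₀` the polynomial of a combination of paths thus determines its class modulo
the relations. -/
theorem monoClass_linearCombination {u v : D.Vertex} (hv : D.IsZero v)
    (F : Quiver.Path u v →₀ ℂ) :
    D.monoClass u v (Finsupp.linearCombination ℂ D.pathVal F) = Submodule.Quotient.mk F := by
  have h : (D.monoClass u v).comp (Finsupp.linearCombination ℂ D.pathVal) =
      (D.relIdeal u v).mkQ := by
    refine Finsupp.lhom_ext' fun P => LinearMap.ext_ring ?_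
    rw [LinearMap.comp_apply, LinearMap.comp_apply, LinearMap.comp_apply, Finsupp.lsingle_apply,
      Finsupp.linearCombination_single, one_smul]
    exact D.monoClass_eq_of_path hv P rfl rfl
  exact LinearMap.congr_fun h F

/-- A relation `f` annihilated by an arrow into a sink. -/
theorem appendPath_monoClass_eq_zero {u v t : D.Vertex} {f : PolyXY} (e : v ⟶ t)
    (h : ∀ a b : ℕ, D.appendPath u e.toPath (D.monoClass u v (f * (X 0 ^ a * X 1 ^ b))) = 0)
    (g : PolyXY) : D.appendPath u e.toPath (D.monoClass u v (f * g)) = 0 := by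
  have h1 : (D.appendPath u e.toPath).comp ((D.monoClass u v).comp (LinearMap.mulLeft ℂ f)) = 0 := by
    refine (basisMonomials (Fin 2) ℂ).ext fun d => ?_
    rw [monomial_eq_X_pow]
    exact h _ _
  exact LinearMap.congr_fun h1 g

/-- A monomial divisible by y has a normal form ending with a y-arrow, and then the relation ay = 0
applies. -/
theorem appendPath_a_eq_zero {u v t : D.Vertex} (e : v ⟶ t) (he : e.1 = .a) (hv : D.IsZero v)
    (g : PolyXY) : D.appendPath u e.toPath (D.monoClass u v (X 1 * g)) = 0 := by
  refine D.appendPath_monoClass_eq_zero e (fun a b => ?_) g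
  rw [mul_left_comm, ← pow_succ']
  by_cases h : ∃ P : Quiver.Path u v, D.xCount P = a ∧ D.yCount P = b + 1
  swap
  · rw [D.monoClass_eq_zero h, map_zero]
  obtain ⟨P, rfl, hy⟩ := h
  rw [D.monoClass_eq_of_path hv P rfl hy]
  obtain ⟨N, h1, h2⟩ := D.exists_normal P hv
  rw [h2, appendPath_pathClass]
  rw [hy, List.replicate_succ', ← List.append_assoc] at h1
  cases N with
  | nil => simp [labels] at h1
  | cons N k =>
    rw [labels] at h1
    have h3 := (List.append_inj' h1 rfl).2
    rw [List.singleton_inj] at h3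
    have h4 := D.mapDomain_mem_relIdeal N
      (.ay _ _ (Quiver.Path.cons (.cons .nil k) e) (by simp [labels, h3, he]))
    rw [Finsupp.mapDomain_single] at h4
    exact (Submodule.Quotient.mk_eq_zero _).2 h4

/-- The two terms of w_r times a monomial have equal degree, so both or neither are represented by
paths. If they are, both can be taken to begin with a common path R and to continue with x^pl and
y^ql respectively, which exhibits the relation for c_r. -/
theorem appendPath_c_eq_zero {u v : D.Vertex} {r : ℕ} {hr : r ∈ Finset.Icc 1 D.ℓ}
    (e : v ⟶ Vertex.w r hr) (g : PolyXY) :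
    D.appendPath u e.toPath (D.monoClass u v (D.wFactor r * g)) = 0 := by
  have hv := D.isZero_source e
  refine D.appendPath_monoClass_eq_zero e (fun a b => ?_) g
  have h0 : D.wFactor r * (X 0 ^ a * X 1 ^ b) =
      X 0 ^ (a + D.pl) * X 1 ^ b - D.ζ r • (X 0 ^ a * X 1 ^ (b + D.ql)) := by
    rw [wFactor, smul_eq_C_mul]
    ring
  rw [h0, map_sub, map_smul]
  have hvec : D.vec (a + D.pl : ℕ) b = D.vec a (b + D.ql : ℕ) :=
    D.vec_eq 1 (by push_cast; ring) (by push_cast; ring)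
  by_cases h : ∃ P : Quiver.Path u v, D.xCount P = a + D.pl ∧ D.yCount P = b
  swap
  -- A path for one of the two monomials would yield one for the other, by `exists_path` in the
  -- common degree.
  · have h' : ¬ ∃ P : Quiver.Path u v, D.xCount P = a ∧ D.yCount P = b + D.ql := by
      rintro ⟨P, hx, hy⟩
      have h1 := D.vdeg_path P hv
      rw [hx, hy, ← hvec] at h1
      obtain ⟨Q, hQ⟩ := D.exists_path (D.isZero_of_path P hv) hv _ _ h1
      exact h ⟨Q, D.xCount_of_labels hQ, D.yCount_of_labels hQ⟩
    rw [D.monoClass_eq_zero h, D.monoClass_eq_zero h', smul_zero, sub_zero, map_zero]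
  obtain ⟨P, hx, hy⟩ := h
  have hu := D.isZero_of_path P hv
  have h1 := D.vdeg_path P hv
  rw [hx, hy] at h1
  rcases u with ⟨i, j, hi, hj⟩ | _ | _ <;> try exact hu.elim
  obtain ⟨t, he⟩ := e
  rcases v with ⟨i', j', hi', hj'⟩ | _ | _ <;> try exact hv.elim
  cases t <;> try exact he.elim
  obtain ⟨rfl, rfl⟩ : i' = D.p - 1 ∧ j' = D.q - 1 := he
  obtain ⟨t, h2, h3⟩ := D.vec_eq_iff.1 h1
  have hql := D.ql_pos
  have hqq := D.q_eq
  have hqlq : D.ql ≤ D.ℓ * D.ql := Nat.le_mul_of_pos_left _ D.ℓ_pos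
  have ht : t ≤ 0 := by
    by_contra ht
    have := D.mul_ql_le (show 1 ≤ t by omega)
    omega
  have hpl := D.mul_pl_le ht
  -- The column p - 1 - pl equals a + i - t pl with t ≤ 0, so the source v' of the relation is a
  -- vertex.
  have hle : 1 ≤ D.p - 1 - D.pl := by omega
  let v' : D.Vertex := .zero (D.p - 1 - D.pl) (D.q - 1) (by omega) hj'
  obtain ⟨R, hR⟩ := D.exists_path (u := .zero i j hi hj) (v := v') trivial trivial a b
    (D.vec_eq t (by rw [Nat.cast_sub (by omega)]; push_cast at h2; linarith) h3)
  obtain ⟨A, hA⟩ := D.exists_path (u := v') (v := .zero (D.p - 1) (D.q - 1) hi' hj')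
    trivial trivial D.pl 0
    (D.vec_eq 0 (by rw [Nat.cast_sub (by omega : D.pl ≤ D.p - 1)]; ring) (by push_cast; ring))
  obtain ⟨B, hB⟩ := D.exists_path (u := v') (v := .zero (D.p - 1) (D.q - 1) hi' hj')
    trivial trivial 0 D.ql
    (D.vec_eq (-1) (by rw [Nat.cast_sub (by omega : D.pl ≤ D.p - 1)]; push_cast; ring)
      (by push_cast; ring))
  rw [D.monoClass_eq_of_path hv (R.comp A)
      (by rw [xCount_comp, D.xCount_of_labels hR, D.xCount_of_labels hA])
      (by rw [yCount_comp, D.yCount_of_labels hR, D.yCount_of_labels hA]; rfl),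
    D.monoClass_eq_of_path hv (R.comp B)
      (by rw [xCount_comp, D.xCount_of_labels hR, D.xCount_of_labels hB]; rfl)
      (by rw [yCount_comp, D.yCount_of_labels hR, D.yCount_of_labels hB]),
    map_sub, map_smul, appendPath_pathClass, appendPath_pathClass]
  have h4 := D.mapDomain_mem_relIdeal R (.cr v' r hr
    (A.cons ⟨.c, rfl, rfl⟩) (B.cons ⟨.c, rfl, rfl⟩)
    (by rw [labels, hA, List.replicate_zero, List.append_nil])
    (by rw [labels, hB, List.replicate_zero, List.nil_append]))
  rw [Finsupp.smul_single, smul_eq_mul, mul_one, sub_eq_add_neg, ← Finsupp.single_neg,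
    Finsupp.mapDomain_add, Finsupp.mapDomain_single, Finsupp.mapDomain_single,
    Finsupp.single_neg, ← sub_eq_add_neg, ← mul_one (D.ζ r), ← smul_eq_mul,
    ← Finsupp.smul_single] at h4
  exact (Submodule.Quotient.mk_eq_zero _).2 h4

end

end ChainData

namespace ChainData

/-! ## Uniform description of the morphisms between the objects -/

section

variable (D : ChainData)

/-- The number `i` of a vertex `K_0^{i,j}`. -/
def vcol : D.Vertex → ℕ
  | .zero i _ _ _ => i
  | _ => 0

/-- The number `j` of `K_0^{i,j}`, or of the vertices `K_0^{p-1,j}` with an arrow to the given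
vertex. -/
def vrow : D.Vertex → ℕ
  | .zero _ j _ _ => j
  | .y j _ => j
  | .w _ _ => D.q - 1

/-- The index of the summand of an object that controls the morphisms in even degrees. -/
def vlast : ∀ v : D.Vertex, Fin (D.obj v).rank
  | .zero _ _ hi hj => D.lastIdx hi hj
  | .y j _ => D.KyIdx j
  | .w r hr => D.KwIdx r hr

/-- The index of the summand of an object that controls the morphisms in odd degrees. -/
def vfirst : ∀ v : D.Vertex, Fin (D.obj v).rank
  | .zero _ _ hi hj => D.firstIdx hi hj
  | .y j _ => D.KyIdx j
  | .w r hr => D.KwIdx r hr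

/-- The polynomial modulo which the components of morphisms into an object are considered. -/
noncomputable def modulus : D.Vertex → PolyXY
  | .zero _ _ _ _ => 0
  | .y _ _ => X 1
  | .w r _ => D.wFactor r

/-- Families of matrices between the objects at two vertices. -/
abbrev Family (u v : D.Vertex) : Type :=
  ℤ → Matrix (Fin (D.obj v).rank) (Fin (D.obj u).rank) PolyXY

theorem isSink_obj {t : D.Vertex} (ht : ¬ D.IsZero t) :
    D.IsSink (D.obj t) (D.vlast t) (D.modulus t) (D.vrow t) := by
  rcases t with _ | ⟨j, hj⟩ | ⟨r, hr⟩
  · exact absurd trivial ht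
  · exact D.isSink_KyObj hj
  · exact D.isSink_KwObj hr

theorem modulus_eq_zero {v : D.Vertex} (hv : D.IsZero v) : D.modulus v = 0 := by
  cases v <;> first | rfl | exact False.elim hv

theorem vlast_comp {u v w : D.Vertex} (hv : D.IsZero v) (hw : D.IsZero w)
    {ψ : D.Family v w} (hψ : ψ ∈ (D.obj v).Hom (D.obj w) 0) (φ : D.Family u v) :
    (ψ 0 * φ 0) (D.vlast w) (D.vlast u) =
      ψ 0 (D.vlast w) (D.vlast v) * φ 0 (D.vlast v) (D.vlast u) := by
  rcases v with ⟨i, j, hi, hj⟩ | _ | _ <;> rcases w with ⟨i', j', hi', hj'⟩ | _ | _ <;>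
    try first | exact hv.elim | exact hw.elim
  exact D.K₀_comp_last hi hj hi' hj' hψ _ _

theorem vlast_homogeneous {u v : D.Vertex} (hu : D.IsZero u) (hv : D.IsZero v) {φ : D.Family u v}
    (hφ : φ ∈ (D.obj u).Hom (D.obj v) 0) :
    IsWeightedHomogeneous D.deg (φ 0 (D.vlast v) (D.vlast u)) (D.vdeg v - D.vdeg u) := by
  rcases u with ⟨i, j, hi, hj⟩ | _ | _ <;> rcases v with ⟨i', j', hi', hj'⟩ | _ | _ <;>
    try first | exact hu.elim | exact hv.elim
  have h := GradedMF.Hom.homogeneous hφ (zero_add 0) (D.lastIdx hi' hj') (D.lastIdx hi hj)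
  have h1 : (D.obj (.zero i j hi hj)).s 0 (D.lastIdx hi hj) = D.vec i (j + 1) :=
    D.K₀_s_zero_last hi hj
  have h2 : (D.obj (.zero i' j' hi' hj')).s 0 (D.lastIdx hi' hj') = D.vec i' (j' + 1) :=
    D.K₀_s_zero_last hi' hj'
  rw [h1, h2, vec_sub, add_sub_add_right_eq_sub] at h
  exact h

theorem isCoboundary_of_vlast {u v : D.Vertex} (hu : D.IsZero u) (hv : D.IsZero v)
    {φ : D.Family u v} (hφ : (D.obj u).IsCocycle (D.obj v) 0 φ)
    (h : φ 0 (D.vlast v) (D.vlast u) = 0) : (D.obj u).IsCoboundary (D.obj v) 0 φ := by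
  rcases u with ⟨i, j, hi, hj⟩ | _ | _ <;> rcases v with ⟨i', j', hi', hj'⟩ | _ | _ <;>
    try first | exact hu.elim | exact hv.elim
  exact D.K₀_isCoboundary hi hj hi' hj' hφ (.inr h)

theorem vlast_eq_zero_of_isCoboundary {u v : D.Vertex} (hu : D.IsZero u) (hv : D.IsZero v)
    {φ : D.Family u v} (hφ : (D.obj u).IsCoboundary (D.obj v) 0 φ) :
    φ 0 (D.vlast v) (D.vlast u) = 0 := by
  rcases u with ⟨i, j, hi, hj⟩ | _ | _ <;> rcases v with ⟨i', j', hi', hj'⟩ | _ | _ <;>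
    try first | exact hu.elim | exact hv.elim
  exact D.K₀_eq_zero_of_isCoboundary hi hj hi' hj' hφ

theorem exists_cocycle_vlast {u v : D.Vertex} (hu : D.IsZero u) (hv : D.IsZero v) {h : PolyXY}
    (hh : IsWeightedHomogeneous D.deg h (D.vdeg v - D.vdeg u)) :
    ∃ φ : D.Family u v, (D.obj u).IsCocycle (D.obj v) 0 φ ∧
      φ 0 (D.vlast v) (D.vlast u) = h := by
  rcases u with ⟨i, j, hi, hj⟩ | _ | _ <;> rcases v with ⟨i', j', hi', hj'⟩ | _ | _ <;>
    try first | exact hu.elim | exact hv.elim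
  exact D.K₀_exists_cocycle hi hj hi' hj' hh

theorem vrow_bounds (v : D.Vertex) : D.q - D.ql ≤ D.vrow v ∧ D.vrow v ≤ D.q - 1 := by
  have := D.ql_pos
  rcases v with ⟨i, j, hi, hj⟩ | ⟨j, hj⟩ | _
  · exact hj
  · exact hj
  · simp only [vrow]
    omega

theorem vfirst_homogeneous {u t : D.Vertex} (hu : D.IsZero u) (ht : ¬ D.IsZero t)
    {φ : D.Family u t} (hφ : φ ∈ (D.obj u).Hom (D.obj t) 0) :
    IsWeightedHomogeneous D.deg (φ (-3) (D.vlast t) (D.vfirst u))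
      (D.vec 0 (D.vrow t - D.vrow u)) := by
  rcases u with ⟨i, j, hi, hj⟩ | _ | _ <;> try exact hu.elim
  exact (D.isSink_obj ht).first_homogeneous hi hj hφ

theorem isCoboundary_of_vfirst {u t : D.Vertex} (hu : D.IsZero u) (ht : ¬ D.IsZero t)
    {φ : D.Family u t} (hφ : (D.obj u).IsCocycle (D.obj t) 0 φ)
    (h : D.modulus t ∣ φ (-3) (D.vlast t) (D.vfirst u)) :
    (D.obj u).IsCoboundary (D.obj t) 0 φ := by
  rcases u with ⟨i, j, hi, hj⟩ | _ | _ <;> try exact hu.elim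
  exact (D.isSink_obj ht).K₀_isCoboundary hi hj hφ (.inr h)

theorem dvd_vfirst_of_isCoboundary {u t : D.Vertex} (hu : D.IsZero u) (ht : ¬ D.IsZero t)
    {φ : D.Family u t} (hφ : (D.obj u).IsCoboundary (D.obj t) 0 φ) :
    D.modulus t ∣ φ (-3) (D.vlast t) (D.vfirst u) := by
  rcases u with ⟨i, j, hi, hj⟩ | _ | _ <;> try exact hu.elim
  exact (D.isSink_obj ht).dvd_first_of_isCoboundary hi hj hφ

theorem exists_cocycle_vfirst {u t : D.Vertex} (hu : D.IsZero u) (ht : ¬ D.IsZero t)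
    (h : D.vrow u = D.vrow t) :
    ∃ φ : D.Family u t, (D.obj u).IsCocycle (D.obj t) 0 φ ∧
      φ (-3) (D.vlast t) (D.vfirst u) = 1 := by
  rcases u with ⟨i, j, hi, hj⟩ | _ | _ <;> try exact hu.elim
  refine (D.isSink_obj ht).exists_cocycle_first hi hj ?_
  have h1 : j = D.vrow t := h
  rw [← h1, sub_self, ← zero_eq_vec]
  exact isWeightedHomogeneous_one ℂ D.deg

theorem dvd_vfirst_comp {u v t : D.Vertex} (hu : D.IsZero u) (hv : D.IsZero v)
    (ht : ¬ D.IsZero t) {φ : D.Family u v} {ψ : D.Family v t}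
    (hφ : (D.obj u).IsCocycle (D.obj v) 0 φ) (hψ : (D.obj v).IsCocycle (D.obj t) 0 ψ) :
    D.modulus t ∣ X 0 ^ D.vcol v * (ψ (-3) * φ (-3)) (D.vlast t) (D.vfirst u) -
      X 0 ^ D.vcol u * (φ 0 (D.vlast v) (D.vlast u) * ψ (-3) (D.vlast t) (D.vfirst v)) := by
  rcases u with ⟨i, j, hi, hj⟩ | _ | _ <;> rcases v with ⟨i', j', hi', hj'⟩ | _ | _ <;>
    try first | exact hu.elim | exact hv.elim
  exact (D.isSink_obj ht).dvd_comp_first hi hj hi' hj' hφ hψ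

theorem vrow_arrow {v t : D.Vertex} (e : v ⟶ t) (ht : ¬ D.IsZero t) :
    D.vcol v = D.p - 1 ∧ D.vrow v = D.vrow t := by
  obtain ⟨l, h⟩ := e
  rcases v with ⟨i, j, hi, hj⟩ | _ | _ <;> rcases t with _ | _ | _ <;> cases l <;>
    first | exact False.elim h | exact absurd trivial ht | exact ⟨h.1, h.2.symm⟩ | exact h

theorem degrees_arrow {v t : D.Vertex} (e : v ⟶ t) (ht : ¬ D.IsZero t) :
    e.1.xdeg = 0 ∧ e.1.ydeg = 0 := by
  obtain ⟨l, h⟩ := e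
  rcases v with ⟨i, j, hi, hj⟩ | _ | _ <;> rcases t with _ | _ | _ <;> cases l <;>
    first | exact False.elim h | exact absurd trivial ht | exact ⟨rfl, rfl⟩

/-! ## The functor from the quiver -/

theorem exists_arrowMap {u v : D.Vertex} (e : u ⟶ v) :
    ∃ φ : MFCat.closed (D.obj u) (D.obj v),
      (D.IsZero v → φ.1 0 (D.vlast v) (D.vlast u) = X 0 ^ e.1.xdeg * X 1 ^ e.1.ydeg) ∧
      (¬ D.IsZero v → φ.1 (-3) (D.vlast v) (D.vfirst u) = 1) := by
  have hu := D.isZero_source e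
  by_cases hv : D.IsZero v
  · obtain ⟨φ, h1, h2⟩ := D.exists_cocycle_vlast hu hv
      (D.mono_homogeneous e.1.xdeg e.1.ydeg _ (D.vdeg_arrow e hv))
    exact ⟨⟨φ, h1⟩, fun _ => h2, fun h => absurd hv h⟩
  · obtain ⟨φ, h1, h2⟩ := D.exists_cocycle_vfirst hu hv (D.vrow_arrow e hv).2
    exact ⟨⟨φ, h1⟩, fun h => absurd h hv, fun _ => h2⟩

/-- A closed morphism representing an arrow of the quiver. -/
noncomputable def arrowMap {u v : D.Vertex} (e : u ⟶ v) : MFCat.closed (D.obj u) (D.obj v) :=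
  (D.exists_arrowMap e).choose

/-- The composition of the closed morphisms representing the arrows of a path. -/
noncomputable def pathMap {u : D.Vertex} :
    {v : D.Vertex} → Quiver.Path u v → MFCat.closed (D.obj u) (D.obj v)
  | _, .nil => ⟨fun _ => 1, GradedMF.isCocycle_id _⟩
  | _, .cons P e => ⟨fun i => (D.arrowMap e).1 i * (pathMap P).1 i,
      GradedMF.IsCocycle.comp (pathMap P).2 (D.arrowMap e).2⟩

theorem pathMap_comp {u v w : D.Vertex} (P : Quiver.Path u v) (Q : Quiver.Path v w) (i : ℤ) :
    (D.pathMap (P.comp Q)).1 i = (D.pathMap Q).1 i * (D.pathMap P).1 i := by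
  induction Q with
  | nil => exact (Matrix.one_mul _).symm
  | cons Q e ih =>
    show (D.arrowMap e).1 i * (D.pathMap (P.comp Q)).1 i = _
    rw [ih, ← Matrix.mul_assoc]
    rfl

theorem pathMap_vlast {u v : D.Vertex} (P : Quiver.Path u v) (hv : D.IsZero v) :
    (D.pathMap P).1 0 (D.vlast v) (D.vlast u) = D.pathVal P := by
  induction P with
  | nil =>
    refine (Matrix.one_apply_eq _).trans ?_
    simp [pathVal, xCount, yCount, labels]
  | cons P e ih =>
    have h := D.isZero_source e
    refine (D.vlast_comp h hv (D.arrowMap e).2.1 _).trans ?_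
    rw [ih h, show (D.arrowMap e).1 0 _ _ = _ from (D.exists_arrowMap e).choose_spec.1 hv,
      pathVal, pathVal, xCount_cons, yCount_cons, pow_add, pow_add]
    ring

/-- The powers of x come from the comparison of the ideals at the two ends of the path before the
final arrow, whose source is in column p - 1 and whose first entry is 1. They are harmless, since x
is invertible for divisibility by the modulus. -/
theorem dvd_pathMap_vfirst {u t : D.Vertex} (P : Quiver.Path u t) (hu : D.IsZero u)
    (ht : ¬ D.IsZero t) :
    D.modulus t ∣ X 0 ^ (D.p - 1) * (D.pathMap P).1 (-3) (D.vlast t) (D.vfirst u) -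
      X 0 ^ D.vcol u * D.pathVal P := by
  cases P with
  | nil => exact absurd hu ht
  | cons P e =>
    have hv := D.isZero_source e
    have h := D.dvd_vfirst_comp hu hv ht (D.pathMap P).2 (D.arrowMap e).2
    rw [(D.vrow_arrow e ht).1, D.pathMap_vlast P hv,
      show (D.arrowMap e).1 (-3) _ _ = _ from (D.exists_arrowMap e).choose_spec.2 ht, mul_one] at h
    rw [pathVal, xCount_cons, yCount_cons, (D.degrees_arrow e ht).1, (D.degrees_arrow e ht).2]
    exact h

/-- The closed morphism given by a linear combination of paths. -/
noncomputable def pathsMap (u v : D.Vertex) :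
    (Quiver.Path u v →₀ ℂ) →ₗ[ℂ] MFCat.closed (D.obj u) (D.obj v) :=
  Finsupp.linearCombination ℂ D.pathMap

/-- The polynomial of a linear combination of paths. -/
noncomputable def pathsVal (u v : D.Vertex) : (Quiver.Path u v →₀ ℂ) →ₗ[ℂ] PolyXY :=
  Finsupp.linearCombination ℂ D.pathVal

theorem pathsMap_vlast {u v : D.Vertex} (F : Quiver.Path u v →₀ ℂ) (hv : D.IsZero v) :
    (D.pathsMap u v F).1 0 (D.vlast v) (D.vlast u) = D.pathsVal u v F := by
  induction F using Finsupp.induction_linear with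
  | zero => rw [map_zero, map_zero]; rfl
  | add F G hF hG =>
    rw [map_add, map_add, ← hF, ← hG]
    rfl
  | single P r =>
    rw [pathsMap, pathsVal, Finsupp.linearCombination_single, Finsupp.linearCombination_single,
      ← D.pathMap_vlast P hv]
    rfl

theorem dvd_pathsMap_vfirst {u t : D.Vertex} (F : Quiver.Path u t →₀ ℂ) (hu : D.IsZero u)
    (ht : ¬ D.IsZero t) :
    D.modulus t ∣ X 0 ^ (D.p - 1) * (D.pathsMap u t F).1 (-3) (D.vlast t) (D.vfirst u) -
      X 0 ^ D.vcol u * D.pathsVal u t F := by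
  induction F using Finsupp.induction_linear with
  | zero =>
    rw [map_zero, map_zero, mul_zero, sub_zero]
    exact (dvd_zero _).mul_left _
  | add F G hF hG =>
    rw [map_add, map_add]
    convert hF.add hG using 1
    show X 0 ^ (D.p - 1) * (_ + _) - _ = _
    ring
  | single P r =>
    rw [pathsMap, pathsVal, Finsupp.linearCombination_single, Finsupp.linearCombination_single,
      smul_eq_C_mul]
    convert (D.dvd_pathMap_vfirst P hu ht).mul_left (C r) using 1
    show X 0 ^ (D.p - 1) * (r • _) - _ = _
    rw [smul_eq_C_mul]
    ring

/-- Between vertices `K₀` the polynomial is the critical entry itself and the modulus is 0. For a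
sink it agrees modulo f, up to powers of x coprime to f, with the first entry that decides
exactness. -/
theorem isCoboundary_pathsMap_iff {u v : D.Vertex} (hu : D.IsZero u) (F : Quiver.Path u v →₀ ℂ) :
    (D.obj u).IsCoboundary (D.obj v) 0 (D.pathsMap u v F).1 ↔ D.modulus v ∣ D.pathsVal u v F := by
  by_cases hv : D.IsZero v
  · rw [D.modulus_eq_zero hv, zero_dvd_iff, ← D.pathsMap_vlast F hv]
    exact ⟨D.vlast_eq_zero_of_isCoboundary hu hv, D.isCoboundary_of_vlast hu hv (D.pathsMap u v F).2⟩
  · have hT := D.isSink_obj hv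
    have h := D.dvd_pathsMap_vfirst F hu hv
    constructor
    · intro h1
      exact hT.dvd_of_dvd_X_pow_mul
        ((dvd_sub_right ((D.dvd_vfirst_of_isCoboundary hu hv h1).mul_left _)).1 h)
    · intro h1
      exact D.isCoboundary_of_vfirst hu hv (D.pathsMap u v F).2
        (hT.dvd_of_dvd_X_pow_mul ((dvd_sub_left (h1.mul_left _)).1 h))

/-! ## The relations -/

theorem eq_of_path {u v : D.Vertex} (P : Quiver.Path u v) (hu : ¬ D.IsZero u) : u = v := by
  induction P with
  | nil => rfl
  | cons P e ih => exact absurd (ih ▸ D.isZero_source e) hu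

theorem labels_eq_nil {u v : D.Vertex} (P : Quiver.Path u v) (hu : ¬ D.IsZero u) :
    D.labels P = [] := by
  cases P with
  | nil => rfl
  | cons P e => exact absurd (D.eq_of_path P hu ▸ D.isZero_source e) hu

theorem isZero_of_relation {u v : D.Vertex} {ρ : Quiver.Path u v →₀ ℂ} (h : D.Relation u v ρ) :
    D.IsZero u := by
  by_contra hu
  cases h with
  | comm _ P Q hP hQ | ay _ P hP | cr r hr P Q hP hQ =>
    rw [D.labels_eq_nil P hu] at hP
    simp at hP

theorem modulus_dvd_of_relation {u v : D.Vertex} {ρ : Quiver.Path u v →₀ ℂ}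
    (h : D.Relation u v ρ) : D.modulus v ∣ D.pathsVal u v ρ := by
  cases h with
  | comm _ P Q hP hQ =>
    rw [map_sub, pathsVal, Finsupp.linearCombination_single, Finsupp.linearCombination_single,
      pathVal, pathVal, xCount, yCount, xCount, yCount, hP, hQ]
    simp [Label.xdeg, Label.ydeg]
  | ay _ P hP =>
    have hv : D.modulus v = X 1 := by
      cases P with
      | nil => simp [labels] at hP
      | cons P e =>
        rw [labels] at hP
        have h1 : D.labels P ++ [e.1] = [Label.y] ++ [Label.a] := hP
        replace h1 := (List.append_inj' h1 rfl).2
        rw [List.singleton_inj] at h1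
        obtain ⟨l, h⟩ := e
        simp only at h1
        subst h1
        rename_i w
        rcases w with _ | _ | _ <;> rcases v with _ | _ | _ <;>
          first | rfl | exact False.elim h
    rw [hv, pathsVal, Finsupp.linearCombination_single, pathVal, xCount, yCount, hP]
    simp [Label.xdeg, Label.ydeg]
  | cr r hr P Q hP hQ =>
    rw [map_sub, map_smul, pathsVal, Finsupp.linearCombination_single,
      Finsupp.linearCombination_single, pathVal, pathVal, xCount, yCount, xCount, yCount, hP, hQ,
      modulus, wFactor]
    simp [Label.xdeg, Label.ydeg, smul_eq_C_mul]

theorem pathVal_comp {u v w : D.Vertex} (P : Quiver.Path u v) (Q : Quiver.Path v w) :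
    D.pathVal (P.comp Q) = D.pathVal P * D.pathVal Q := by
  rw [pathVal, pathVal, pathVal, xCount_comp, yCount_comp, pow_add, pow_add]
  ring

theorem pathsVal_mapDomain {u u' v v' : D.Vertex} (P : Quiver.Path u u') (Q : Quiver.Path v' v)
    (ρ : Quiver.Path u' v' →₀ ℂ) :
    D.pathsVal u v (Finsupp.mapDomain (fun Z => (P.comp Z).comp Q) ρ) =
      D.pathVal P * D.pathsVal u' v' ρ * D.pathVal Q := by
  rw [pathsVal, pathsVal, Finsupp.linearCombination_mapDomain, Finsupp.linearCombination_apply,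
    Finsupp.linearCombination_apply, Finsupp.sum, Finsupp.sum, Finset.mul_sum, Finset.sum_mul]
  refine Finset.sum_congr rfl fun Z _ => ?_
  rw [Function.comp_apply, pathVal_comp, pathVal_comp, mul_smul_comm, smul_mul_assoc]

/-- A relation ending in a vertex `K₀` has polynomial 0, so its multiples vanish. One ending in a
sink cannot be prolonged there, so the modulus at its end is the modulus at v. -/
theorem modulus_dvd_of_mem_relIdeal {u v : D.Vertex} {F : Quiver.Path u v →₀ ℂ}
    (hF : F ∈ D.relIdeal u v) : D.modulus v ∣ D.pathsVal u v F := by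
  suffices h : D.relIdeal u v ≤
      ((Ideal.span {D.modulus v}).restrictScalars ℂ).comap (D.pathsVal u v) from
    Ideal.mem_span_singleton.1 (h hF)
  refine Submodule.span_le.2 ?_
  rintro _ ⟨u', v', P, ρ, Q, hρ, rfl⟩
  refine Ideal.mem_span_singleton.2 ?_
  have h1 := D.modulus_dvd_of_relation hρ
  rw [pathsVal_mapDomain]
  by_cases hv : D.IsZero v'
  · rw [D.modulus_eq_zero hv, zero_dvd_iff] at h1
    rw [h1, mul_zero, zero_mul]
    exact dvd_zero _
  · obtain rfl := D.eq_of_path Q hv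
    exact (h1.mul_left _).mul_right _

theorem relIdeal_eq_bot {u v : D.Vertex} (hu : ¬ D.IsZero u) : D.relIdeal u v = ⊥ := by
  refine Submodule.span_eq_bot.2 ?_
  rintro _ ⟨u', v', P, ρ, Q, hρ, rfl⟩
  obtain rfl := D.eq_of_path P hu
  exact absurd (D.isZero_of_relation hρ) hu

/-- Every sink has a unique predecessor and a unique arrow from it. -/
theorem exists_pred {t : D.Vertex} (ht : ¬ D.IsZero t) :
    ∃ (z : D.Vertex) (e : z ⟶ t), D.IsZero z ∧
      (∀ u, D.IsZero u → ∀ P : Quiver.Path u t, ∃ P' : Quiver.Path u z, P = P'.cons e) ∧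
      ∀ u g, D.appendPath u e.toPath (D.monoClass u z (D.modulus t * g)) = 0 := by
  have hp := D.two_le_p
  have hb := D.vrow_bounds t
  have key : ∀ e : Vertex.zero (D := D) (D.p - 1) (D.vrow t) (by omega) hb ⟶ t,
      (∀ (v : D.Vertex) (f : v ⟶ t), f.1 = e.1) → ∀ u, D.IsZero u → ∀ P : Quiver.Path u t,
      ∃ P' : Quiver.Path u _, P = P'.cons e := by
    intro e he u hu P
    cases P with
    | nil => exact absurd hu ht
    | cons P f =>
      have h1 := he _ f
      obtain ⟨l, hf⟩ := f
      obtain ⟨l', hl'⟩ := e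
      simp only at h1
      subst h1
      obtain rfl := D.source_unique hf hl'
      exact ⟨P, rfl⟩
  rcases t with _ | ⟨j, hj⟩ | ⟨r, hr⟩
  · exact absurd trivial ht
  · refine ⟨.zero (D.p - 1) j (by omega) hj, ⟨.a, rfl, rfl⟩, trivial, key _ ?_,
      fun u g => D.appendPath_a_eq_zero (v := .zero (D.p - 1) j (by omega) hj) _ rfl trivial g⟩
    rintro v ⟨l, hl⟩
    rcases v with _ | _ | _ <;> cases l <;> first | rfl | exact False.elim hl
  · refine ⟨.zero (D.p - 1) (D.q - 1) (by omega) hb, ⟨.c, rfl, rfl⟩, trivial, key _ ?_,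
      fun u g => D.appendPath_c_eq_zero _ g⟩
    rintro v ⟨l, hl⟩
    rcases v with _ | _ | _ <;> cases l <;> first | rfl | exact False.elim hl

/-- For a sink every path factors through its unique incoming arrow, so the combination is the image
of one ending at a vertex `K₀`. There it is represented by its polynomial, a multiple of the
modulus, and these are annihilated by the arrow. -/
theorem mem_relIdeal_of_modulus_dvd {u v : D.Vertex} (hu : D.IsZero u) {F : Quiver.Path u v →₀ ℂ}
    (h : D.modulus v ∣ D.pathsVal u v F) : F ∈ D.relIdeal u v := by
  rw [← Submodule.Quotient.mk_eq_zero]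
  by_cases hv : D.IsZero v
  · rw [D.modulus_eq_zero hv, zero_dvd_iff] at h
    rw [← D.monoClass_linearCombination hv F, show Finsupp.linearCombination ℂ D.pathVal F = 0 from h,
      map_zero]
  · obtain ⟨z, e, hz, hP, he⟩ := D.exists_pred hv
    have h1 : ∃ G : Quiver.Path u z →₀ ℂ,
        F = Finsupp.mapDomain (fun P : Quiver.Path u z => P.cons e) G := by
      clear h
      induction F using Finsupp.induction_linear with
      | zero => exact ⟨0, Finsupp.mapDomain_zero.symm⟩
      | add F F' hF hF' =>
        obtain ⟨G, rfl⟩ := hF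
        obtain ⟨G', rfl⟩ := hF'
        exact ⟨G + G', Finsupp.mapDomain_add.symm⟩
      | single P r =>
        obtain ⟨P', rfl⟩ := hP u hu P
        exact ⟨Finsupp.single P' r, (Finsupp.mapDomain_single (f := fun P : Quiver.Path u z => P.cons e)).symm⟩
    obtain ⟨G, rfl⟩ := h1
    have h2 : D.pathsVal u v (Finsupp.mapDomain (fun P : Quiver.Path u z => P.cons e) G) =
        D.pathsVal u z G := by
      rw [pathsVal, pathsVal, Finsupp.linearCombination_mapDomain]
      congr 2
      funext P
      rw [Function.comp_apply, pathVal, pathVal, xCount_cons, yCount_cons,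
        (D.degrees_arrow e hv).1, (D.degrees_arrow e hv).2, add_zero, add_zero]
    rw [h2] at h
    obtain ⟨g, hg⟩ := h
    have h3 := he u g
    rw [← hg, show D.monoClass u z (D.pathsVal u z G) = _ from
      D.monoClass_linearCombination hz G] at h3
    exact h3

end

end ChainData

namespace ChainData

/-! ## The comparison isomorphism -/

section

variable (D : ChainData)

theorem exists_pathsVal_eq {u v : D.Vertex} (hu : D.IsZero u) (hv : D.IsZero v) {h : PolyXY}
    (hh : IsWeightedHomogeneous D.deg h (D.vdeg v - D.vdeg u)) :
    ∃ F : Quiver.Path u v →₀ ℂ, D.pathsVal u v F = h := by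
  refine D.homogeneous_induction (P := fun h => ∃ F, D.pathsVal u v F = h) ⟨0, map_zero _⟩ ?_ ?_ hh
  · rintro _ _ ⟨F, rfl⟩ ⟨G, rfl⟩
    exact ⟨F + G, map_add _ _ _⟩
  · intro a b r hab
    obtain ⟨P, hP⟩ := D.exists_path hu hv a b hab
    refine ⟨Finsupp.single P r, ?_⟩
    rw [pathsVal, Finsupp.linearCombination_single, pathVal, D.xCount_of_labels hP,
      D.yCount_of_labels hP]

theorem vdeg_eq {v : D.Vertex} (hv : D.IsZero v) : D.vdeg v = D.vec (D.vcol v) (D.vrow v) := by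
  cases v <;> first | rfl | exact False.elim hv

theorem vcol_le (v : D.Vertex) : D.vcol v ≤ D.p - 1 := by
  rcases v with ⟨i, j, hi, hj⟩ | _ | _
  · exact hi.2
  · exact Nat.zero_le _
  · exact Nat.zero_le _

/-- The paths span the cohomology classes of degree zero. -/
theorem exists_sub_pathsMap_isCoboundary {u v : D.Vertex} (hu : D.IsZero u)
    (φ : MFCat.closed (D.obj u) (D.obj v)) :
    ∃ F, (D.obj u).IsCoboundary (D.obj v) 0 (φ - D.pathsMap u v F).1 := by
  by_cases hv : D.IsZero v
  · obtain ⟨F, hF⟩ := D.exists_pathsVal_eq hu hv (D.vlast_homogeneous hu hv φ.2.1)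
    refine ⟨F, D.isCoboundary_of_vlast hu hv (φ - D.pathsMap u v F).2 ?_⟩
    rw [← D.pathsMap_vlast F hv] at hF
    exact sub_eq_zero.2 hF.symm
  have hT := D.isSink_obj hv
  have hφ := D.vfirst_homogeneous hu hv φ.2.1
  rcases hT.span_first _ _ (D.vrow_bounds u) hφ with h | ⟨hle, κ, h⟩
  · refine ⟨0, ?_⟩
    rw [map_zero, sub_zero]
    exact D.isCoboundary_of_vfirst hu hv φ.2 h
  obtain ⟨z, e, hz, -, -⟩ := D.exists_pred hv
  obtain ⟨hc, hr⟩ := D.vrow_arrow e hv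
  -- The path x^(p-1-i) y^(J-j) followed by the arrow into the sink has first entry y^(J-j) modulo
  -- f, the generator to which φ reduces.
  obtain ⟨P, hP⟩ := D.exists_path hu hz (D.p - 1 - D.vcol u) (D.vrow v - D.vrow u) (by
    rw [D.vdeg_eq hu, D.vdeg_eq hz, hc, hr, vec_sub, Nat.cast_sub hle, Nat.cast_sub (D.vcol_le u)])
  have hval : D.pathVal (P.cons e) =
      X 0 ^ (D.p - 1 - D.vcol u) * X 1 ^ (D.vrow v - D.vrow u) := by
    rw [pathVal, xCount_cons, yCount_cons, (D.degrees_arrow e hv).1, (D.degrees_arrow e hv).2,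
      add_zero, add_zero, D.xCount_of_labels hP, D.yCount_of_labels hP]
  have h1 := D.dvd_pathMap_vfirst (P.cons e) hu hv
  rw [hval, ← mul_assoc, ← pow_add, Nat.add_sub_of_le (D.vcol_le u), ← mul_sub] at h1
  have h2 := hT.dvd_of_dvd_X_pow_mul h1
  refine ⟨Finsupp.single (P.cons e) κ, D.isCoboundary_of_vfirst hu hv (φ - _).2 ?_⟩
  rw [pathsMap, Finsupp.linearCombination_single]
  convert h.sub (h2.mul_left (C κ)) using 1
  show φ.1 (-3) (D.vlast v) (D.vfirst u) -
    κ • (D.pathMap (P.cons e)).1 (-3) (D.vlast v) (D.vfirst u) = _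
  rw [smul_eq_C_mul]
  ring

theorem coh_subsingleton_of_isCoboundary {u v : D.Vertex} {n : ℤ}
    (h : ∀ φ : D.Family u v, (D.obj u).IsCocycle (D.obj v) n φ →
      (D.obj u).IsCoboundary (D.obj v) n φ) : Subsingleton (D.B.Coh u v n) :=
  MFCat.coh_subsingleton D.obj h

/-- The vanishing of cohomology. -/
theorem isCoboundary_of_isCocycle {u v : D.Vertex} {n : ℤ}
    (h : n ≠ 0 ∨ (¬ D.IsZero u ∧ u ≠ v)) {φ : D.Family u v}
    (hφ : (D.obj u).IsCocycle (D.obj v) n φ) : (D.obj u).IsCoboundary (D.obj v) n φ := by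
  rcases u with ⟨i, j, hi, hj⟩ | ⟨j, hj⟩ | ⟨r, hr⟩
  · have hn : n ≠ 0 := h.resolve_right fun h => h.1 trivial
    by_cases hv : D.IsZero v
    · rcases v with ⟨i', j', hi', hj'⟩ | _ | _ <;> try exact hv.elim
      exact D.K₀_isCoboundary hi hj hi' hj' hφ (.inl hn)
    · exact (D.isSink_obj hv).K₀_isCoboundary hi hj hφ (.inl hn)
  · rcases v with ⟨i', j', hi', hj'⟩ | ⟨j', hj'⟩ | ⟨r', hr'⟩
    · exact D.isCoboundary_of_neg hi' hj' hφ fun a => .inr (D.KyObj_neg hj hi' hj' _ a)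
    · refine D.KyObj_KyObj_isCoboundary hj hj' (h.imp_right ?_) hφ
      rintro ⟨-, h⟩ rfl
      exact h rfl
    · exact D.KyObj_KwObj_isCoboundary hj hr' hφ
  · rcases v with ⟨i', j', hi', hj'⟩ | ⟨j', hj'⟩ | ⟨r', hr'⟩
    · exact D.isCoboundary_of_neg hi' hj' hφ fun a => .inr (D.KwObj_neg hr hi' hj' _ a)
    · exact D.KwObj_KyObj_isCoboundary hj' hr hφ
    · by_cases hrr : r = r'
      · subst hrr
        exact D.KwObj_isCoboundary hr (h.resolve_right fun h => h.2 rfl) hφ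
      · exact D.KwObj_KwObj_isCoboundary_of_ne hr hr' hrr hφ

/-- For a vertex `K₀` as source both conditions mean divisibility by the modulus. Out of a sink only
the trivial path exists, the ideal is zero, and the identity is not exact. -/
theorem mem_relIdeal_iff {u v : D.Vertex} (F : Quiver.Path u v →₀ ℂ) :
    F ∈ D.relIdeal u v ↔ (D.obj u).IsCoboundary (D.obj v) 0 (D.pathsMap u v F).1 := by
  by_cases hu : D.IsZero u
  · rw [D.isCoboundary_pathsMap_iff hu]
    exact ⟨D.modulus_dvd_of_mem_relIdeal, D.mem_relIdeal_of_modulus_dvd hu⟩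
  rw [D.relIdeal_eq_bot hu, Submodule.mem_bot]
  refine ⟨fun h => ?_, fun h => ?_⟩
  · rw [h, map_zero, ← MFCat.cls_eq_zero_iff, map_zero]
  by_cases huv : u = v
  swap
  · exact Finsupp.ext fun P => absurd (D.eq_of_path P hu) huv
  subst huv
  have hP : ∀ P : Quiver.Path u u, P = .nil := fun P => by
    refine D.path_ext ?_
    rw [D.labels_eq_nil P hu]
    rfl
  obtain ⟨r, rfl⟩ : ∃ r, F = Finsupp.single .nil r :=
    ⟨F .nil, Finsupp.ext fun P => by rw [hP P, Finsupp.single_eq_same]⟩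
  rw [← MFCat.cls_eq_zero_iff, pathsMap, Finsupp.linearCombination_single, map_smul,
    smul_eq_zero] at h
  rcases h with h | h
  · rw [h, Finsupp.single_zero]
  · exact absurd ((MFCat.cls_eq_zero_iff D.obj _).1 h) (D.isSink_obj hu).not_isCoboundary_id

/-- The comparison map from the algebra of the quiver to the cohomology of the category. -/
noncomputable def comparison (u v : D.Vertex) : D.QuiverAlg u v →ₗ[ℂ] D.B.Coh u v 0 :=
  (D.relIdeal u v).liftQ ((MFCat.cls D.obj u v).comp (D.pathsMap u v)) fun F hF =>
    (MFCat.cls_eq_zero_iff D.obj _).2 ((D.mem_relIdeal_iff F).1 hF)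

theorem comparison_mk {u v : D.Vertex} (F : Quiver.Path u v →₀ ℂ) :
    D.comparison u v (Submodule.Quotient.mk F) = MFCat.cls D.obj u v (D.pathsMap u v F) := rfl

theorem comparison_pathClass {u v : D.Vertex} (P : Quiver.Path u v) :
    D.comparison u v (D.pathClass P) = MFCat.cls D.obj u v (D.pathMap P) := by
  refine (D.comparison_mk _).trans ?_
  rw [pathsMap, Finsupp.linearCombination_single, one_smul]

theorem comparison_injective (u v : D.Vertex) : Function.Injective (D.comparison u v) := by
  refine (injective_iff_map_eq_zero _).2 fun x hx => ?_
  obtain ⟨F, rfl⟩ := Submodule.Quotient.mk_surjective _ x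
  rw [Submodule.Quotient.mk_eq_zero, mem_relIdeal_iff]
  exact (MFCat.cls_eq_zero_iff D.obj _).1 hx

theorem comparison_surjective (u v : D.Vertex) : Function.Surjective (D.comparison u v) := by
  intro y
  obtain ⟨φ, rfl⟩ := MFCat.cls_surjective D.obj u v y
  suffices h : ∃ F, (D.obj u).IsCoboundary (D.obj v) 0 (φ - D.pathsMap u v F).1 by
    obtain ⟨F, hF⟩ := h
    refine ⟨Submodule.Quotient.mk F, ?_⟩
    rw [← MFCat.cls_eq_zero_iff, map_sub, sub_eq_zero] at hF
    exact hF.symm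
  by_cases hu : D.IsZero u
  · exact D.exists_sub_pathsMap_isCoboundary hu φ
  by_cases huv : u = v
  · subst huv
    obtain ⟨r, hr⟩ := (D.isSink_obj hu).exists_sub_smul_id_isCoboundary φ.2
    refine ⟨Finsupp.single .nil r, ?_⟩
    rw [pathsMap, Finsupp.linearCombination_single]
    exact hr
  · exact ⟨0, D.isCoboundary_of_isCocycle (.inr ⟨hu, huv⟩) (φ - D.pathsMap u v 0).2⟩

theorem comparison_comp {u v t : D.Vertex} (P : Quiver.Path u v) (Q : Quiver.Path v t) :
    D.comparison u t (D.pathClass (P.comp Q)) =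
      D.B.comp (add_zero (0 : ℤ)) (D.comparison u v (D.pathClass P))
        (D.comparison v t (D.pathClass Q)) := by
  rw [comparison_pathClass, comparison_pathClass, comparison_pathClass]
  refine Eq.trans ?_ (MFCat.comp_cls D.obj _ _).symm
  exact congrArg _ (Subtype.ext (funext fun i => D.pathMap_comp P Q i))

/-! ## The number of objects -/

/-- The vertices as triples of ranges. -/
def vertexEquiv : D.Vertex ≃
    (Finset.Icc 1 (D.p - 1) × Finset.Icc (D.q - D.ql) (D.q - 1)) ⊕
      Finset.Icc (D.q - D.ql) (D.q - 1) ⊕ Finset.Icc 1 D.ℓ where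
  toFun
    | .zero i j hi hj => .inl (⟨i, Finset.mem_Icc.2 hi⟩, ⟨j, Finset.mem_Icc.2 hj⟩)
    | .y j hj => .inr (.inl ⟨j, Finset.mem_Icc.2 hj⟩)
    | .w r hr => .inr (.inr ⟨r, hr⟩)
  invFun
    | .inl (i, j) => .zero i j (Finset.mem_Icc.1 i.2) (Finset.mem_Icc.1 j.2)
    | .inr (.inl j) => .y j (Finset.mem_Icc.1 j.2)
    | .inr (.inr r) => .w r r.2
  left_inv v := by cases v <;> rfl
  right_inv
    | .inl _ => rfl
    | .inr (.inl _) => rfl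
    | .inr (.inr _) => rfl

/-- The objects `K₀` contribute (p - 1) ql, the objects `Ky` another ql, which makes p ql = p(q -
1)/ℓ, and the objects `Kw` contribute ℓ. -/
theorem card_vertex : Nat.card D.Vertex = D.p * (D.q - 1) / D.ℓ + D.ℓ := by
  have hp := D.two_le_p
  have hq := D.q_eq
  have hle : D.ql ≤ D.ℓ * D.ql := Nat.le_mul_of_pos_left _ D.ℓ_pos
  have h1 : D.p * (D.q - 1) / D.ℓ = D.p * D.ql := by
    rw [hq, Nat.add_sub_cancel, mul_left_comm, Nat.mul_div_cancel_left _ D.ℓ_pos]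
  have h2 : D.q - 1 + 1 - (D.q - D.ql) = D.ql := by omega
  obtain ⟨k, hk⟩ := Nat.exists_eq_add_of_le hp
  have h3 : D.p - 1 + 1 - 1 = k + 1 := by omega
  rw [h1, Nat.card_congr D.vertexEquiv, Nat.card_eq_fintype_card, Fintype.card_sum,
    Fintype.card_sum, Fintype.card_prod, Fintype.card_coe, Fintype.card_coe, Fintype.card_coe,
    Nat.card_Icc, Nat.card_Icc, Nat.card_Icc, h2, h3, hk, Nat.add_sub_cancel]
  ring

end

end ChainData

/-! ### The main theorem. -/

theorem mainTheorem5 (D : ChainData) :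
    -- the number of objects
    Nat.card D.Vertex = D.p * (D.q - 1) / D.ℓ + D.ℓ ∧
    -- the cohomology of the category is concentrated in degree zero
    (∀ (u v : D.Vertex) (n : ℤ), n ≠ 0 → Subsingleton (D.B.Coh u v n)) ∧
    -- in degree zero it is the algebra of the quiver with relations
    (∃ Φ : ∀ u v : D.Vertex, D.QuiverAlg u v ≃ₗ[ℂ] D.B.Coh u v 0,
      ∀ (u v t : D.Vertex) (P : Quiver.Path u v) (Q : Quiver.Path v t),
        Φ u t (D.pathClass (P.comp Q)) =
          D.B.comp (add_zero (0 : ℤ)) (Φ u v (D.pathClass P)) (Φ v t (D.pathClass Q))) ∧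
    -- the category is intrinsically formal
    IntrinsicallyFormal.{u, 0} D.B := by
  have h : ∀ (u v : D.Vertex) (n : ℤ), n ≠ 0 → Subsingleton (D.B.Coh u v n) :=
    fun u v n hn => D.coh_subsingleton_of_isCoboundary fun φ hφ =>
      D.isCoboundary_of_isCocycle (.inl hn) hφ
  exact ⟨D.card_vertex, h,
    ⟨fun u v => .ofBijective (D.comparison u v)
      ⟨D.comparison_injective u v, D.comparison_surjective u v⟩,
      fun _ _ _ P Q => D.comparison_comp P Q⟩,
    AInfCat.intrinsicallyFormal_of_subsingleton D.B h⟩
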